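/- Let $n\ge 2$ be an integer, $N\ge n$, $\varepsilon>0$ and $\eta\le 1$ real. Let $X$ be the metric horn: $\mathbb R^n$ in polar coordinates $(r,\theta)$, with tip $o=0$, metric $g=dr^2+(\tfrac12 r^{1+\varepsilon})^2g_{S^{n-1}}$ and measure $d\mathfrak m=r^{(N-n)(1-\eta)}\,d\mathrm{vol}_g$. (1) The function $$p(x,o,t)=Z^{-1}\,t^{-\frac12(N+(n-1)\varepsilon-(N-n)\eta)}\,e^{-r(x)^2/4t},\qquad Z=\int_X e^{-r^2/4}\,d\mathfrak m,\quad t>0,$$ is the heat kernel of $X$ with pole at the tip: it is continuous and nonnegative, has $\int_X p(\cdot,o,t)\,d\mathfrak m=1$, is a heat flow, converges to $\delta_o$ as $t\downarrow0$ (tested against bounded continuous functions), and for every $L^2$ heat flow $v$ on $X\times[0,\infty)$ and every $t>0$ for which $v(\cdot,t)$ is continuous at $o$, $v(o,t)=\int_X p(x,o,t)\,v(x,0)\,d\mathfrak m(x)$. (2) Let $G(x,t)=p(x,o,-t)$ for $t<0$ and let $R_0>0$. Let $u\in W^{1,2}_{loc}(X\times[-R_0^2,0])$ be a weak solution of $\Delta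 u=\partial_tu$ on $X\times[-R_0^2,0]$, not a.e. zero, with $$\int_{-R_0^2}^0\!\int_X\big(u^2+|\nabla u|^2+(\partial_tu)^2\big)\,e^{-a r^2}\,d\mathfrak m\,dt<\infty\quad\text{for some } a<\frac1{4R_0^2}$$ (for instance $u\in W^{1,2}(X\times[-R_0^2,0])$, where $a=0$); $u$ is identified with its representative for which $t\mapsto u(\cdot,t)\in L^2_{loc}(X)$ is continuous. For $0<R\le R_0$ put $$I(R)=R^2\int_{t=-R^2}|\nabla u|^2G\,d\mathfrak m,\qquad D(R)=\int_{t=-R^2}u^2G\,d\mathfrak m,\qquad N(R)=\frac{I(R)}{D(R)}.$$ Then $u(\cdot,-R^2)$ has a weak gradient, both integrals converge, and $D(R)>0$, for every $R\in(0,R_0]$; the function $N(\cdot)$ is differentiable on $(0,R_0)$ and $$(\log N)'(R)\ge-\frac{2\varepsilon}{R}\qquad\text{for every } R\in(0,R_0)\text{ with } N(R)>0;$$ and there are constants $C>0$ independent of $R$ (possibly different in the two estimates) with $$N(R)\le C R^{-2\varepsilon},\qquad D(R)\ge C e^{-CR^{-2\varepsilon}}\qquad\text{for all } R\in(0,R_0].$$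 In particular, if $u$ is as above, except that it may be zero, and if for every $C>0$ there is $R\in(0,R_0]$ with $D(R)<Ce^{-CR^{-2\varepsilon}}$, then $u=0$ almost everywhere. -/

import Mathlib

open Set Filter Topology MeasureTheory
open scoped ContDiff

noncomputable section

/-- The underlying space `ℝⁿ` of the metric horn. The point `x = r θ` (`r > 0`, `θ ∈ S^{n-1}`) has
polar coordinates `(r, θ)`, the origin is the tip of the horn, and `r = ‖x‖` is the horn distance
to the tip. -/
abbrev HornSpace (n : ℕ) : Type := EuclideanSpace ℝ (Fin n)

/-- The component `⟨v, ∂_r⟩` of a vector `v` at `x` in the radial direction `∂_r = x / ‖x‖`. -/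
def radialPart {n : ℕ} (x v : HornSpace n) : ℝ := inner ℝ v x / ‖x‖

/-- The Riemannian metric `g = dr² + (r^{1+ε} / 2)² g_{S^{n-1}}` at `x ≠ 0`, in the Cartesian
coordinates of `ℝⁿ`: the pullback of `g_{S^{n-1}}` under `x ↦ x / ‖x‖` is
`r⁻² (⟨v, w⟩ - ⟨v, ∂_r⟩ ⟨w, ∂_r⟩)`. -/
def hornMetric {n : ℕ} (ε : ℝ) (x v w : HornSpace n) : ℝ :=
  radialPart x v * radialPart x w +
    (‖x‖ ^ (1 + ε) / 2) ^ 2 *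
      ((inner ℝ v w - radialPart x v * radialPart x w) / ‖x‖ ^ 2)

/-- The horn gradient at `x` of a function whose Cartesian gradient at `x` is `V`. -/
def hornSharp {n : ℕ} (ε : ℝ) (x V : HornSpace n) : HornSpace n :=
  (radialPart x V / ‖x‖) • x +
    (4 * ‖x‖ ^ (-(2 * ε))) • (V - (radialPart x V / ‖x‖) • x)

/-- The scalar product `⟨∇f, ∇h⟩_g` at `x` of the horn gradients of two functions whose Cartesian
gradients at `x` are `V` and `W`: `∂_r f ∂_r h + 4 r^{-2-2ε} ⟨∇_S f, ∇_S h⟩`. -/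
def hornInner {n : ℕ} (ε : ℝ) (x V W : HornSpace n) : ℝ :=
  radialPart x V * radialPart x W +
    4 * ‖x‖ ^ (-(2 * ε)) * (inner ℝ V W - radialPart x V * radialPart x W)

/-- `hornSharp ε x V` is the gradient with respect to the horn metric: its metric product with `w`
is the directional derivative `⟨V, w⟩`. -/
theorem hornMetric_hornSharp {n : ℕ} (ε : ℝ) {x : HornSpace n} (hx : x ≠ 0)
    (V w : HornSpace n) : hornMetric ε x (hornSharp ε x V) w = inner ℝ V w := by
  have h0 : 0 < ‖x‖ := norm_pos_iff.mpr hx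
  have h1 : (‖x‖ ^ (1 + ε)) ^ 2 * ‖x‖ ^ (-(2 * ε)) = ‖x‖ ^ 2 := by
    rw [← Real.rpow_natCast (‖x‖ ^ (1 + ε)), ← Real.rpow_mul h0.le, ← Real.rpow_add h0,
      ← Real.rpow_natCast ‖x‖]
    congr 1
    push_cast
    ring
  have h2 : inner ℝ x x = ‖x‖ ^ 2 := real_inner_self_eq_norm_sq x
  have hr : radialPart x (hornSharp ε x V) = radialPart x V := by
    simp only [radialPart, hornSharp, inner_add_left, inner_smul_left, inner_sub_left, h2,
      RCLike.conj_to_real]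
    field_simp
    ring
  have hi : inner ℝ (hornSharp ε x V) w - radialPart x V * radialPart x w =
      4 * ‖x‖ ^ (-(2 * ε)) * (inner ℝ V w - radialPart x V * radialPart x w) := by
    simp only [radialPart, hornSharp, inner_add_left, inner_smul_left, inner_sub_left,
      RCLike.conj_to_real, real_inner_comm w x]
    field_simp
    ring
  rw [hornMetric, hr, hi]
  have h3 : (‖x‖ ^ (1 + ε) / 2) ^ 2 *
      (4 * ‖x‖ ^ (-(2 * ε)) * (inner ℝ V w - radialPart x V * radialPart x w) / ‖x‖ ^ 2) =
      ((‖x‖ ^ (1 + ε)) ^ 2 * ‖x‖ ^ (-(2 * ε))) / ‖x‖ ^ 2 *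
        (inner ℝ V w - radialPart x V * radialPart x w) := by ring
  rw [h3, h1, div_self (by positivity)]
  ring

/-- `hornInner` is the metric product of horn gradients. -/
theorem hornInner_eq {n : ℕ} (ε : ℝ) {x : HornSpace n} (hx : x ≠ 0) (V W : HornSpace n) :
    hornInner ε x V W = hornMetric ε x (hornSharp ε x V) (hornSharp ε x W) := by
  have h0 : 0 < ‖x‖ := norm_pos_iff.mpr hx
  rw [hornMetric_hornSharp ε hx]
  simp only [hornInner, radialPart, hornSharp, inner_add_right, inner_smul_right, inner_sub_right]
  field_simp

/-- The weighted measure `dm = e^{(N-n)(1-η) log r} dvol_g` of the metric horn. The Riemannian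
volume of `g` has density `(r^ε / 2)^{n-1}` with respect to Lebesgue measure. -/
def hornMeasure (n : ℕ) (N ε η : ℝ) : Measure (HornSpace n) :=
  volume.withDensity fun x =>
    ENNReal.ofReal ((‖x‖ ^ ε / 2) ^ (n - 1) * ‖x‖ ^ ((N - n) * (1 - η)))

/-- The product of Lebesgue measure in time and the horn measure in space. -/
def hornSpaceTime (n : ℕ) (N ε η : ℝ) : Measure (ℝ × HornSpace n) :=
  (volume : Measure ℝ).prod (hornMeasure n N ε η)

/-- `V` is the (Cartesian) weak gradient of `f` on the horn without its tip. -/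
structure IsHornWeakGrad {n : ℕ} (f : HornSpace n → ℝ) (V : HornSpace n → HornSpace n) :
    Prop where
  locInt : LocallyIntegrableOn f {0}ᶜ
  locInt_grad : LocallyIntegrableOn V {0}ᶜ
  by_parts : ∀ φ : HornSpace n → ℝ, ContDiff ℝ ∞ φ → HasCompactSupport φ → tsupport φ ⊆ {0}ᶜ →
    ∀ v : HornSpace n, ∫ x, f x * fderiv ℝ φ x v = -∫ x, inner ℝ (V x) v * φ x

open Classical in
/-- The (Cartesian) weak gradient of `f`, unique up to null sets; `0` if there is none. -/
def hornWeakGrad {n : ℕ} (f : HornSpace n → ℝ) : HornSpace n → HornSpace n :=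
  if h : ∃ V, IsHornWeakGrad f V then h.choose else 0

/-- `u`, with spatial weak gradient `V` (in Cartesian coordinates) and weak time derivative `w`, is
a weak solution of the heat equation `Δu - ∂_t u = 0` on `X × [t₀, t₁]`: it lies in
`W^{1,2}_loc (X × [t₀, t₁])` (with the tip included in `X`), and
`∫∫ ⟨∇u, ∇φ⟩ + φ ∂_t u dm dt = 0` for all test functions `φ`. The function `u` is its representative
for which `t ↦ u t` is continuous from `[t₀, t₁]` to `L²_loc(X)`, so that `u t` makes sense for
every `t`. -/
structure IsHornSolution (n : ℕ) (N ε η t₀ t₁ : ℝ) (u : ℝ → HornSpace n → ℝ)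
    (V : ℝ → HornSpace n → HornSpace n) (w : ℝ → HornSpace n → ℝ) : Prop where
  locInt : LocallyIntegrableOn (fun z : ℝ × HornSpace n => u z.1 z.2) (Ioo t₀ t₁ ×ˢ {0}ᶜ)
  locInt_grad : LocallyIntegrableOn (fun z : ℝ × HornSpace n => V z.1 z.2) (Ioo t₀ t₁ ×ˢ {0}ᶜ)
  locInt_dt : LocallyIntegrableOn (fun z : ℝ × HornSpace n => w z.1 z.2) (Ioo t₀ t₁ ×ˢ {0}ᶜ)
  weak_grad : ∀ φ : ℝ × HornSpace n → ℝ, ContDiff ℝ ∞ φ → HasCompactSupport φ →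
    tsupport φ ⊆ Ioo t₀ t₁ ×ˢ {0}ᶜ → ∀ v : HornSpace n,
      ∫ z, u z.1 z.2 * fderiv ℝ φ z (0, v) = -∫ z, inner ℝ (V z.1 z.2) v * φ z
  weak_dt : ∀ φ : ℝ × HornSpace n → ℝ, ContDiff ℝ ∞ φ → HasCompactSupport φ →
    tsupport φ ⊆ Ioo t₀ t₁ ×ˢ {0}ᶜ →
      ∫ z, u z.1 z.2 * fderiv ℝ φ z (1, 0) = -∫ z, w z.1 z.2 * φ z
  loc_energy : ∀ ρ : ℝ, IntegrableOn
    (fun z : ℝ × HornSpace n => u z.1 z.2 ^ 2 + hornInner ε z.2 (V z.1 z.2) (V z.1 z.2) +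
      w z.1 z.2 ^ 2) (Ioo t₀ t₁ ×ˢ Metric.ball 0 ρ) (hornSpaceTime n N ε η)
  heat_eq : ∀ φ : ℝ × HornSpace n → ℝ, ContDiff ℝ ∞ φ → HasCompactSupport φ →
    tsupport φ ⊆ Ioo t₀ t₁ ×ˢ {0}ᶜ →
      ∫ z, (hornInner ε z.2 (V z.1 z.2) (gradient (fun y => φ (z.1, y)) z.2) +
        φ z * w z.1 z.2) ∂(hornSpaceTime n N ε η) = 0
  slice_meas : ∀ t ∈ Icc t₀ t₁, AEStronglyMeasurable (u t) (hornMeasure n N ε η)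
  slice_cont : ∀ s ∈ Icc t₀ t₁, ∀ ρ : ℝ,
    Tendsto (fun t => eLpNorm (fun x => u t x - u s x) 2
      ((hornMeasure n N ε η).restrict (Metric.ball 0 ρ))) (𝓝[Icc t₀ t₁] s) (𝓝 0)

/-- `v` is the heat flow on `X × [0, ∞)` starting from the function `v 0 ∈ L²(X)`. -/
structure IsHornHeatFlow (n : ℕ) (N ε η : ℝ) (v : ℝ → HornSpace n → ℝ)
    (V : ℝ → HornSpace n → HornSpace n) (w : ℝ → HornSpace n → ℝ) : Prop where
  memLp : ∀ t, 0 ≤ t → MemLp (v t) 2 (hornMeasure n N ε η)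
  solution : ∀ s T, 0 < s → s < T → IsHornSolution n N ε η s T v V w
  energy : ∀ s T, 0 < s → s < T → IntegrableOn
    (fun z : ℝ × HornSpace n => v z.1 z.2 ^ 2 + hornInner ε z.2 (V z.1 z.2) (V z.1 z.2) +
      w z.1 z.2 ^ 2) (Ioo s T ×ˢ univ) (hornSpaceTime n N ε η)
  initial : Tendsto (fun t => eLpNorm (fun x => v t x - v 0 x) 2 (hornMeasure n N ε η))
    (𝓝[>] 0) (𝓝 0)

/-- `K t x = p(x, o, t)` is the heat kernel of the horn with pole at the tip `o`: a continuous
nonnegative function on `(0, ∞) × X` which is itself a heat flow, starts from the Dirac measure at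
`o`, and is the integral kernel of `f ↦ (P_t f)(o)`, where `P_t f` is the heat flow of `f ∈ L²(X)`
(evaluated at `o` through its representative that is continuous there). -/
structure IsTipHeatKernel (n : ℕ) (N ε η : ℝ) (K : ℝ → HornSpace n → ℝ) : Prop where
  continuousOn : ContinuousOn (fun z : ℝ × HornSpace n => K z.1 z.2) (Ioi 0 ×ˢ univ)
  nonneg : ∀ t x, 0 < t → 0 ≤ K t x
  heat_flow : ∀ s, 0 < s → ∃ V w, IsHornHeatFlow n N ε η (fun t => K (s + t)) V w
  mass_one : ∀ t, 0 < t → Integrable (K t) (hornMeasure n N ε η) ∧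
    ∫ x, K t x ∂(hornMeasure n N ε η) = 1
  dirac : ∀ f : HornSpace n → ℝ, Continuous f → (∃ B, ∀ x, |f x| ≤ B) →
    Tendsto (fun t => ∫ x, K t x * f x ∂(hornMeasure n N ε η)) (𝓝[>] 0) (𝓝 (f 0))
  reproducing : ∀ v V w, IsHornHeatFlow n N ε η v V w → ∀ t, 0 < t → ContinuousAt (v t) 0 →
    Integrable (fun x => K t x * v 0 x) (hornMeasure n N ε η) ∧
      v t 0 = ∫ x, K t x * v 0 x ∂(hornMeasure n N ε η)

/-- The function `Z⁻¹ t^{-(N + (n-1)ε - (N-n)η)/2} e^{-r²/(4t)}`, with `Z` such that its integral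
is one. -/
def tipHeatKernel (n : ℕ) (N ε η : ℝ) (t : ℝ) (x : HornSpace n) : ℝ :=
  (∫ y, Real.exp (-‖y‖ ^ 2 / 4) ∂(hornMeasure n N ε η))⁻¹ *
    t ^ (-(N + (n - 1) * ε - (N - n) * η) / 2) * Real.exp (-‖x‖ ^ 2 / (4 * t))

/-- The backward heat kernel `G(x, t) = p(x, o, -t)`, `t < 0`, centred at the tip. -/
def backwardKernel (n : ℕ) (N ε η : ℝ) (x : HornSpace n) (t : ℝ) : ℝ :=
  tipHeatKernel n N ε η (-t) x

/-- `|∇f|²` with respect to the horn metric, for the weak gradient of `f`. -/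
def hornGradSq {n : ℕ} (ε : ℝ) (f : HornSpace n → ℝ) (x : HornSpace n) : ℝ :=
  hornInner ε x (hornWeakGrad f x) (hornWeakGrad f x)

/-- `I(R) = R² ∫_{t = -R²} |∇u|² G dm`. -/
def freqI (n : ℕ) (N ε η : ℝ) (u : ℝ → HornSpace n → ℝ) (R : ℝ) : ℝ :=
  R ^ 2 * ∫ x, hornGradSq ε (u (-R ^ 2)) x * backwardKernel n N ε η x (-R ^ 2)
    ∂(hornMeasure n N ε η)

/-- `D(R) = ∫_{t = -R²} u² G dm`. -/
def freqD (n : ℕ) (N ε η : ℝ) (u : ℝ → HornSpace n → ℝ) (R : ℝ) : ℝ :=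
  ∫ x, u (-R ^ 2) x ^ 2 * backwardKernel n N ε η x (-R ^ 2) ∂(hornMeasure n N ε η)

/-- The frequency `N(R) = I(R) / D(R)`. -/
def freqN (n : ℕ) (N ε η : ℝ) (u : ℝ → HornSpace n → ℝ) (R : ℝ) : ℝ :=
  freqI n N ε η u R / freqD n N ε η u R

end

/-!
With `β = ε (n - 1) + (N - n) (1 - η) > 0` the measure of the horn is `2^{1-n} r^β dx`, homogeneous of
degree `d = n + β > 2` under the dilations `x ↦ l x` of `ℝⁿ`, while the metric is not: under a
dilation radial and tangential derivatives scale with powers that differ by `ε`. All functions are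
taken in the spaces `L²(e^{-b r²} dm)`, where `b` is allowed to increase a little from one estimate to
the next; this loss absorbs the unbounded factor `r` in the scaling field `r ∂_r`.

*The tip.* Weak gradients and test functions live away from the tip. Since `d > 2`, Hardy's
inequality holds near the tip and the tip has zero capacity, so functions with a square integrable
weak gradient form the closure `Gam` of the test functions (`IsHornWeakGrad.mem_Gam`), and the weak
equation `div F = g` (`Lap`) may be tested with all of them.

*Regularity.* A solution of less than the critical Gaussian growth is mollified in time. Energy
estimates on smaller time intervals and for larger `b` (`exists_interior_estimate`) show that it is
a continuously differentiable curve `f` in a weighted `L²` space whose gradients `F` depend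
continuously on time and which solves the equation at every time (`exists_isRegSol`).

*Frequency.* Let `B = 1 / (4τ)`, `τ = -t = R²`. With the backward kernel as weight, put
`D = c τ^{-d/2} ∫ f² e^{-B r²} dm` and `E = c τ^{-d/2} ∫ |F|² e^{-B r²} dm`, so that `N = τ E / D`. With
`P = ∂_t f - 2 B r ∂_r f` the equation gives `D' = -2 E` and `E = -⟨P, f⟩`, and
`E' = -2 ‖P‖² + (E + ε E_tan) / τ`, where `E_tan ≤ E` is the tangential part of the energy. The last
formula rests on the Pohozaev identity for the field `r ∂_r` (`pohozaev`), which is the first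
variation of the energy under dilations. By the Cauchy–Schwarz inequality `N' ≤ ε N / τ` in the
variable `t`, which is `(log N)'(R) ≥ -2 ε / R` in the variable `R`. Hence `N R^{2ε}` is nondecreasing
in `R`, `N ≤ C R^{-2ε}`, and integrating `(log D)' = -2 N / τ` in `t` gives the lower bound for `D`,
in particular its positivity (`IsFreqPair`).

*The kernel.* The Gaussian `kern` solves the equation, because its gradient is radial. Pairing a heat
flow with the backward kernel gives a function of time that is constant: this is the equation
tested with the function `1`, whose gradient vanishes. Letting the pole time tend to the final time
gives the reproducing property (`isTipHeatKernel_kern`).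
-/

set_option linter.unusedSectionVars false

noncomputable section

namespace Horn

/-! ### Weighted measures -/

/-- The density `2^{1-n} ‖x‖^β e^{-b‖x‖²}`. For the horn, `β = ε(n-1) + (N-n)(1-η)`. -/
def dens (n : ℕ) (β b : ℝ) (x : HornSpace n) : ℝ :=
  (1 / 2) ^ (n - 1) * ‖x‖ ^ β * Real.exp (-b * ‖x‖ ^ 2)

/-- The horn measure with the Gaussian weight `e^{-b‖x‖²}`. -/
def wm (n : ℕ) (β b : ℝ) : Measure (HornSpace n) :=
  volume.withDensity fun x => ENNReal.ofReal (dens n β b x)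

variable {n : ℕ} {β : ℝ}

theorem dens_nonneg (b : ℝ) (x : HornSpace n) : 0 ≤ dens n β b x := by
  unfold dens; positivity

theorem dens_pos (b : ℝ) {x : HornSpace n} (hx : x ≠ 0) : 0 < dens n β b x := by
  have := norm_pos_iff.mpr hx
  unfold dens; positivity

theorem dens_mul_exp (b c : ℝ) (x : HornSpace n) :
    dens n β b x * Real.exp (-c * ‖x‖ ^ 2) = dens n β (b + c) x := by
  unfold dens; rw [mul_assoc, ← Real.exp_add]; ring_nf

theorem continuous_dens [hβ : Fact (0 < β)] (b : ℝ) : Continuous (dens n β b) := by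
  unfold dens
  have : Continuous fun x : HornSpace n => ‖x‖ ^ β :=
    continuous_norm.rpow_const fun _ => Or.inr hβ.out.le
  fun_prop

theorem measurable_dens (b : ℝ) : Measurable (dens n β b) := by
  unfold dens
  have : Measurable fun x : HornSpace n => ‖x‖ ^ β := measurable_norm.pow_const β
  fun_prop

theorem contDiffOn_dens (b : ℝ) {x : HornSpace n} (hx : x ≠ 0) :
    ContDiffAt ℝ ∞ (dens n β b) x := by
  unfold dens
  have h1 : ContDiffAt ℝ ∞ (fun x : HornSpace n => ‖x‖) x := contDiffAt_norm ℝ hx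
  have h2 : ContDiffAt ℝ ∞ (fun x : HornSpace n => ‖x‖ ^ β) x :=
    h1.rpow_const_of_ne (norm_ne_zero_iff.mpr hx)
  have h3 : ContDiffAt ℝ ∞ (fun x : HornSpace n => ‖x‖ ^ 2) x := (contDiff_norm_sq ℝ).contDiffAt
  exact (contDiffAt_const.mul h2).mul ((contDiffAt_const.mul h3).exp)

theorem integral_wm {E : Type*} [NormedAddCommGroup E] [NormedSpace ℝ E] (b : ℝ)
    (f : HornSpace n → E) : ∫ x, f x ∂(wm n β b) = ∫ x, dens n β b x • f x := by
  unfold wm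
  rw [integral_withDensity_eq_integral_toReal_smul (measurable_dens b).ennreal_ofReal (by simp)]
  simp_rw [ENNReal.toReal_ofReal (dens_nonneg b _)]

theorem integrable_wm {E : Type*} [NormedAddCommGroup E] [NormedSpace ℝ E] (b : ℝ)
    {f : HornSpace n → E} :
    Integrable f (wm n β b) ↔ Integrable fun x => dens n β b x • f x := by
  unfold wm
  rw [integrable_withDensity_iff_integrable_smul' (measurable_dens b).ennreal_ofReal (by simp)]
  simp_rw [ENNReal.toReal_ofReal (dens_nonneg b _)]

theorem lintegral_wm (b : ℝ) (f : HornSpace n → ENNReal) :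
    ∫⁻ x, f x ∂(wm n β b) = ∫⁻ x, ENNReal.ofReal (dens n β b x) * f x := by
  unfold wm
  rw [lintegral_withDensity_eq_lintegral_mul_non_measurable _ (measurable_dens b).ennreal_ofReal
    (by simp)]
  rfl

instance instSFiniteWm (b : ℝ) : SFinite (wm n β b) := by unfold wm; infer_instance

theorem integral_wm_add {E : Type*} [NormedAddCommGroup E] [NormedSpace ℝ E] (b c : ℝ)
    (f : HornSpace n → E) :
    ∫ x, f x ∂(wm n β (b + c)) = ∫ x, Real.exp (-c * ‖x‖ ^ 2) • f x ∂(wm n β b) := by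
  rw [integral_wm, integral_wm]
  congr 1; ext x; rw [smul_smul, dens_mul_exp]

theorem integrable_wm_add {E : Type*} [NormedAddCommGroup E] [NormedSpace ℝ E] (b c : ℝ)
    {f : HornSpace n → E} :
    Integrable f (wm n β (b + c)) ↔
      Integrable (fun x => Real.exp (-c * ‖x‖ ^ 2) • f x) (wm n β b) := by
  rw [integrable_wm, integrable_wm]
  simp_rw [smul_smul, dens_mul_exp]

section

variable [hn : Fact (2 ≤ n)]

instance instNontrivialHornSpace : Nontrivial (HornSpace n) := by
  have : NeZero n := ⟨by have := hn.out; omega⟩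
  infer_instance

theorem ae_ne_zero : ∀ᵐ x : HornSpace n, x ≠ 0 := by
  simp [ae_iff]

theorem ae_wm (b : ℝ) : ae (wm n β b) = ae (volume : Measure (HornSpace n)) := by
  apply le_antisymm
  · exact (withDensity_absolutelyContinuous _ _).ae_le
  · refine (withDensity_absolutelyContinuous' (measurable_dens b).ennreal_ofReal.aemeasurable
      ?_).ae_le
    filter_upwards [ae_ne_zero] with x hx
    simpa using dens_pos b hx

theorem ae_wm_iff {b : ℝ} {p : HornSpace n → Prop} :
    (∀ᵐ x ∂(wm n β b), p x) ↔ ∀ᵐ x : HornSpace n, p x := by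
  simp only [Filter.Eventually, ae_wm]

theorem ae_eq_wm {b : ℝ} {F : Type*} {f g : HornSpace n → F} :
    f =ᵐ[wm n β b] g ↔ f =ᵐ[volume] g :=
  ae_wm_iff

theorem ae_ne_zero_wm (b : ℝ) : ∀ᵐ x ∂(wm n β b), x ≠ 0 := by
  rw [ae_wm]; exact ae_ne_zero

theorem aestronglyMeasurable_wm {E : Type*} [TopologicalSpace E] {b : ℝ} {f : HornSpace n → E} :
    AEStronglyMeasurable f (wm n β b) ↔
      AEStronglyMeasurable f (volume : Measure (HornSpace n)) :=
  ⟨fun h => h.mono_ac (withDensity_absolutelyContinuous'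
      (measurable_dens b).ennreal_ofReal.aemeasurable (by
        filter_upwards [ae_ne_zero] with x hx
        simpa using dens_pos b hx)),
    fun h => h.mono_ac (withDensity_absolutelyContinuous _ _)⟩

end

/-! ### Gaussian bounds -/

theorem exists_pow_mul_exp_le (k : ℕ) {c : ℝ} (hc : 0 < c) :
    ∃ C : ℝ, 0 < C ∧ ∀ r : ℝ, 0 ≤ r → r ^ k * Real.exp (-c * r ^ 2) ≤ C := by
  refine ⟨((k.factorial : ℝ) / c ^ k) + 1 + 1, by positivity, fun r hr => ?_⟩
  have h1 : (c * r ^ 2) ^ k / k.factorial ≤ Real.exp (c * r ^ 2) :=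
    Real.pow_div_factorial_le_exp _ (by positivity) k
  have h2 : Real.exp (-c * r ^ 2) = (Real.exp (c * r ^ 2))⁻¹ := by
    rw [← Real.exp_neg]; ring_nf
  have he : 0 < Real.exp (c * r ^ 2) := Real.exp_pos _
  have he1 : 1 ≤ Real.exp (c * r ^ 2) := Real.one_le_exp (by positivity)
  have h3 : r ^ k ≤ 1 + (r ^ 2) ^ k := by
    rw [← pow_mul, mul_comm, pow_mul]
    nlinarith [sq_nonneg (r ^ k - 1), pow_nonneg hr k]
  rw [h2, ← div_eq_mul_inv, div_le_iff₀ he]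
  have h4 : (r ^ 2) ^ k ≤ (k.factorial : ℝ) / c ^ k * Real.exp (c * r ^ 2) := by
    rw [mul_pow, div_le_iff₀ (by positivity)] at h1
    rw [div_mul_eq_mul_div, le_div_iff₀ (by positivity)]
    linarith
  have : (0:ℝ) ≤ (k.factorial : ℝ) / c ^ k := by positivity
  nlinarith

/-- Finiteness for every positive Gaussian weight; near the tip the density is bounded because
`β > 0`. -/
theorem isFiniteMeasure_wm [hβ : Fact (0 < β)] {b : ℝ} (hb : 0 < b) :
    IsFiniteMeasure (wm n β b) := by
  obtain ⟨k, hk⟩ := exists_nat_gt (β + n + 1)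
  obtain ⟨C, hC, hCb⟩ := exists_pow_mul_exp_le k hb
  have h1 : Integrable fun x : HornSpace n => (1 + ‖x‖) ^ (-(n + 1 : ℝ)) :=
    integrable_one_add_norm (by simp)
  obtain ⟨C0, hC0, hCb0⟩ := exists_pow_mul_exp_le 0 hb
  have h2 : Integrable fun x : HornSpace n => dens n β b x := by
    refine Integrable.mono' (h1.const_mul ((1 / 2) ^ (n - 1) * (2 ^ k * (C0 + C))))
      (measurable_dens b).aestronglyMeasurable (Eventually.of_forall fun x => ?_)
    rw [Real.norm_of_nonneg (dens_nonneg b x)]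
    unfold dens
    have hx := norm_nonneg x
    set r := ‖x‖
    have hr : (0 : ℝ) < 1 + r := by positivity
    have key : r ^ β * Real.exp (-b * r ^ 2) * (1 + r) ^ (n + 1 : ℝ) ≤ 2 ^ k * (C0 + C) := by
      have e1 : r ^ β * (1 + r) ^ (n + 1 : ℝ) ≤ (1 + r) ^ k := by
        calc r ^ β * (1 + r) ^ (n + 1 : ℝ) ≤ (1 + r) ^ β * (1 + r) ^ (n + 1 : ℝ) := by
              gcongr
              · exact hβ.out.le
              · linarith
          _ = (1 + r) ^ (β + (n + 1)) := by rw [← Real.rpow_add hr]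
          _ ≤ (1 + r) ^ (k : ℝ) := Real.rpow_le_rpow_of_exponent_le (by linarith) (by linarith)
          _ = _ := Real.rpow_natCast _ _
      have e2 : (1 + r) ^ k ≤ 2 ^ k * (1 + r ^ k) := by
        rcases le_total r 1 with h | h
        · calc (1 + r) ^ k ≤ 2 ^ k := by gcongr; linarith
            _ ≤ _ := by nlinarith [pow_nonneg hx k, pow_pos (two_pos : (0:ℝ) < 2) k]
        · calc (1 + r) ^ k ≤ (2 * r) ^ k := by gcongr; linarith
            _ = 2 ^ k * r ^ k := mul_pow _ _ _
            _ ≤ _ := by nlinarith [pow_nonneg hx k, pow_pos (two_pos : (0:ℝ) < 2) k]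
      have e3 := hCb r hx
      have e4 := hCb0 r hx
      have hE := Real.exp_pos (-b * r ^ 2)
      calc r ^ β * Real.exp (-b * r ^ 2) * (1 + r) ^ (n + 1 : ℝ)
          = r ^ β * (1 + r) ^ (n + 1 : ℝ) * Real.exp (-b * r ^ 2) := by ring
        _ ≤ 2 ^ k * (1 + r ^ k) * Real.exp (-b * r ^ 2) :=
              mul_le_mul_of_nonneg_right (e1.trans e2) hE.le
        _ = 2 ^ k * (r ^ 0 * Real.exp (-b * r ^ 2) + r ^ k * Real.exp (-b * r ^ 2)) := by ring
        _ ≤ _ := by gcongr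
    rw [Real.rpow_neg hr.le, ← div_eq_mul_inv, le_div_iff₀ (by positivity)]
    calc (1 / 2 : ℝ) ^ (n - 1) * r ^ β * Real.exp (-b * r ^ 2) * (1 + r) ^ (n + 1 : ℝ)
        = (1 / 2) ^ (n - 1) * (r ^ β * Real.exp (-b * r ^ 2) * (1 + r) ^ (n + 1 : ℝ)) := by ring
      _ ≤ _ := by gcongr
  exact ⟨by
    unfold wm
    rw [withDensity_apply _ MeasurableSet.univ, Measure.restrict_univ]
    exact h2.lintegral_lt_top⟩

/-! ### Dilations -/

/-- The dimension `d = n + β` of the horn measure: it is homogeneous of degree `d`. -/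
def hdim (n : ℕ) (β : ℝ) : ℝ := n + β

theorem dens_smul (b : ℝ) {l : ℝ} (hl : 0 < l) (x : HornSpace n) :
    dens n β b (l • x) = l ^ β * dens n β (b * l ^ 2) x := by
  unfold dens
  rw [norm_smul, Real.norm_of_nonneg hl.le, Real.mul_rpow hl.le (norm_nonneg x)]
  ring_nf

theorem lintegral_wm_smul (b : ℝ) {l : ℝ} (hl : 0 < l) (f : HornSpace n → ENNReal) :
    ∫⁻ x, f (l • x) ∂(wm n β (b * l ^ 2)) =
      ENNReal.ofReal (l ^ (-hdim n β)) * ∫⁻ x, f x ∂(wm n β b) := by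
  rw [lintegral_wm, lintegral_wm]
  have e : ∀ x : HornSpace n, ENNReal.ofReal (dens n β (b * l ^ 2) x) * f (l • x) =
      ENNReal.ofReal (l ^ (-β)) * (ENNReal.ofReal (dens n β b (l • x)) * f (l • x)) := by
    intro x
    rw [dens_smul b hl, ← mul_assoc, ← ENNReal.ofReal_mul (by positivity), ← mul_assoc,
      ← Real.rpow_add hl]
    simp
  simp_rw [e]
  rw [lintegral_const_mul' _ _ (by simp)]
  have h1 : ∫⁻ x : HornSpace n, ENNReal.ofReal (dens n β b (l • x)) * f (l • x) =
      ∫⁻ y, ENNReal.ofReal (dens n β b y) * f y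
        ∂(Measure.map (fun x : HornSpace n => l • x) volume) := by
    have hm : MeasurableEmbedding (fun x : HornSpace n => l • x) :=
      (Homeomorph.smulOfNeZero l hl.ne').measurableEmbedding
    rw [hm.lintegral_map]
  rw [h1, Measure.map_addHaar_smul _ hl.ne', lintegral_smul_measure, smul_eq_mul, ← mul_assoc,
    ← ENNReal.ofReal_mul (by positivity)]
  congr 2
  rw [abs_of_pos (by positivity), hdim, finrank_euclideanSpace_fin, neg_add, Real.rpow_add hl,
    Real.rpow_neg hl.le (n : ℝ), Real.rpow_natCast, mul_comm]

theorem integral_wm_smul {E : Type*} [NormedAddCommGroup E] [NormedSpace ℝ E] (b : ℝ) {l : ℝ}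
    (hl : 0 < l) (f : HornSpace n → E) :
    ∫ x, f (l • x) ∂(wm n β (b * l ^ 2)) = l ^ (-hdim n β) • ∫ x, f x ∂(wm n β b) := by
  rw [integral_wm, integral_wm]
  have e : ∀ x : HornSpace n, dens n β (b * l ^ 2) x • f (l • x) =
      l ^ (-β) • (dens n β b (l • x) • f (l • x)) := by
    intro x
    rw [dens_smul b hl, smul_smul, ← mul_assoc, ← Real.rpow_add hl]
    simp
  simp_rw [e]
  rw [integral_smul, Measure.integral_comp_smul volume (fun y => dens n β b y • f y), smul_smul]
  congr 1
  rw [abs_of_pos (by positivity), hdim, finrank_euclideanSpace_fin, neg_add, Real.rpow_add hl,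
    Real.rpow_neg hl.le (n : ℝ), Real.rpow_natCast, mul_comm]

/-! ### Operators on weighted `L²` spaces -/

section

variable {n : ℕ} {β : ℝ}

theorem eLpNorm_two_sq {α E : Type*} [MeasurableSpace α] [NormedAddCommGroup E] (f : α → E)
    (μ : Measure α) : eLpNorm f 2 μ ^ 2 = ∫⁻ x, ‖f x‖ₑ ^ 2 ∂μ := by
  have h := eLpNorm_nnreal_pow_eq_lintegral (p := 2) (μ := μ) (f := f) (by norm_num)
  simpa using h

theorem eLpNorm_two_le {α α' E E' : Type*} [MeasurableSpace α] [MeasurableSpace α']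
    [NormedAddCommGroup E] [NormedAddCommGroup E'] {f : α → E} {g : α' → E'}
    {μ : Measure α} {ν : Measure α'} {C : ENNReal}
    (h : ∫⁻ x, ‖f x‖ₑ ^ 2 ∂μ ≤ C ^ 2 * ∫⁻ x, ‖g x‖ₑ ^ 2 ∂ν) :
    eLpNorm f 2 μ ≤ C * eLpNorm g 2 ν := by
  rw [← ENNReal.pow_le_pow_left_iff two_ne_zero, mul_pow, eLpNorm_two_sq, eLpNorm_two_sq]
  exact h

section LpMap

variable {α E E' : Type*} [MeasurableSpace α] [NormedAddCommGroup E] [NormedSpace ℝ E]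
  [NormedAddCommGroup E'] [NormedSpace ℝ E'] {μ ν : Measure α}

theorem memLp_of_bound (T : (α → E) →ₗ[ℝ] (α → E'))
    (hC : ∃ C : NNReal, ∀ f, MemLp f 2 μ →
      AEStronglyMeasurable (T f) ν ∧ eLpNorm (T f) 2 ν ≤ C * eLpNorm f 2 μ) (f : Lp E 2 μ) :
    MemLp (T f) 2 ν := by
  obtain ⟨C, hC⟩ := hC
  obtain ⟨h1, h2⟩ := hC f (Lp.memLp f)
  exact ⟨h1, h2.trans_lt (ENNReal.mul_lt_top ENNReal.coe_lt_top (Lp.memLp f).2)⟩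

/-- The bounded operator between `L²` spaces induced by a linear map on functions. -/
def lpMap (T : (α → E) →ₗ[ℝ] (α → E')) (hT : ∀ f g : α → E, f =ᵐ[μ] g → T f =ᵐ[ν] T g)
    (hC : ∃ C : NNReal, ∀ f, MemLp f 2 μ →
      AEStronglyMeasurable (T f) ν ∧ eLpNorm (T f) 2 ν ≤ C * eLpNorm f 2 μ) :
    Lp E 2 μ →L[ℝ] Lp E' 2 ν :=
  have hm : ∀ f : Lp E 2 μ, MemLp (T f) 2 ν := memLp_of_bound T hC
  LinearMap.mkContinuousOfExistsBound
    { toFun := fun f => (hm f).toLp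
      map_add' := fun f g => by
        rw [← MemLp.toLp_add]
        refine MemLp.toLp_congr _ _ ?_
        rw [← map_add]
        exact hT _ _ (Lp.coeFn_add f g)
      map_smul' := fun c f => by
        simp only [RingHom.id_apply]
        rw [← MemLp.toLp_const_smul]
        refine MemLp.toLp_congr _ _ ?_
        rw [← map_smul]
        exact hT _ _ (Lp.coeFn_smul c f) }
    (by
      obtain ⟨C, hC⟩ := hC
      refine ⟨C, fun f => ?_⟩
      obtain ⟨h1, h2⟩ := hC f (Lp.memLp f)
      simp only [LinearMap.coe_mk, AddHom.coe_mk, Lp.norm_toLp]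
      rw [Lp.norm_def, ← ENNReal.coe_toReal, ← ENNReal.toReal_mul]
      exact ENNReal.toReal_mono (ENNReal.mul_ne_top ENNReal.coe_ne_top (Lp.memLp f).2.ne) h2)

theorem coeFn_lpMap (T : (α → E) →ₗ[ℝ] (α → E')) (hT) (hC) (f : Lp E 2 μ) :
    lpMap (μ := μ) (ν := ν) T hT hC f =ᵐ[ν] T f :=
  MemLp.coeFn_toLp (memLp_of_bound T hC f)

end LpMap

theorem quasiMeasurePreserving_smul {l : ℝ} (hl : 0 < l) :
    Measure.QuasiMeasurePreserving (fun x : HornSpace n => l • x) volume volume :=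
  ⟨measurable_const_smul l, by
    rw [Measure.map_addHaar_smul _ hl.ne']
    exact Measure.smul_absolutelyContinuous⟩

section Fiber

variable [hn : Fact (2 ≤ n)] {E E' : Type*} [NormedAddCommGroup E] [NormedSpace ℝ E]
  [NormedAddCommGroup E'] [NormedSpace ℝ E']

/-- The linear map `f ↦ (x ↦ L x (f (l x)))` on functions. -/
def fiberFun (l : ℝ) (L : HornSpace n → E →L[ℝ] E') :
    (HornSpace n → E) →ₗ[ℝ] (HornSpace n → E') where
  toFun := fun f x => L x (f (l • x))
  map_add' := fun f g => by ext x; simp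
  map_smul' := fun c f => by ext x; simp

theorem fiberFun_apply (l : ℝ) (L : HornSpace n → E →L[ℝ] E') (f : HornSpace n → E)
    (x : HornSpace n) : fiberFun l L f x = L x (f (l • x)) := rfl

theorem fiberFun_congr (b b' : ℝ) {l : ℝ} (hl : 0 < l) (L : HornSpace n → E →L[ℝ] E')
    (f g : HornSpace n → E) (h : f =ᵐ[wm n β b] g) :
    fiberFun l L f =ᵐ[wm n β b'] fiberFun l L g := by
  rw [ae_eq_wm] at h ⊢
  filter_upwards [(quasiMeasurePreserving_smul hl).ae h] with x hx
  simp [fiberFun_apply, hx]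

/-- The growth of `L` may use up half of the gain between the dilated weight `b l²` and `b'`, since
it enters the norm squared. -/
theorem fiberFun_bound {b b' : ℝ} {l : ℝ} (hl : 0 < l) {L : HornSpace n → E →L[ℝ] E'}
    (hL : StronglyMeasurable L)
    (hC : ∃ C : ℝ, ∀ x, ‖L x‖ ≤ C * Real.exp ((b' - b * l ^ 2) / 2 * ‖x‖ ^ 2)) :
    ∃ C : NNReal, ∀ f, MemLp f 2 (wm n β b) → AEStronglyMeasurable (fiberFun l L f) (wm n β b') ∧
      eLpNorm (fiberFun l L f) 2 (wm n β b') ≤ C * eLpNorm f 2 (wm n β b) := by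
  obtain ⟨C, hC⟩ := hC
  refine ⟨Real.toNNReal (C * l ^ (-hdim n β / 2)), fun f hf => ⟨?_, ?_⟩⟩
  · rw [aestronglyMeasurable_wm]
    have h1 : AEStronglyMeasurable (fun x => f (l • x)) volume :=
      (aestronglyMeasurable_wm.mp hf.1).comp_quasiMeasurePreserving
        (quasiMeasurePreserving_smul hl)
    exact ContinuousLinearMap.aestronglyMeasurable_comp₂
      (ContinuousLinearMap.id ℝ (E →L[ℝ] E')) hL.aestronglyMeasurable h1
  · apply eLpNorm_two_le
    have hC0 : 0 ≤ C := by
      have := (norm_nonneg _).trans (hC 0)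
      simpa using this
    have e1 : ∀ x : HornSpace n, ENNReal.ofReal (dens n β b' x) * ‖L x (f (l • x))‖ₑ ^ 2 ≤
        ENNReal.ofReal (C ^ 2) *
          (ENNReal.ofReal (dens n β (b * l ^ 2) x) * ‖f (l • x)‖ₑ ^ 2) := by
      intro x
      have h2 : ‖L x (f (l • x))‖ ≤ C * Real.exp ((b' - b * l ^ 2) / 2 * ‖x‖ ^ 2) *
          ‖f (l • x)‖ :=
        ((L x).le_opNorm _).trans (mul_le_mul_of_nonneg_right (hC x) (norm_nonneg _))
      have hexp : Real.exp ((b' - b * l ^ 2) / 2 * ‖x‖ ^ 2) ^ 2 =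
          Real.exp (-(b * l ^ 2 - b') * ‖x‖ ^ 2) := by
        rw [← Real.exp_nat_mul]; congr 1; push_cast; ring
      rw [← ofReal_norm, ← ofReal_norm, ← ENNReal.ofReal_pow (norm_nonneg _),
        ← ENNReal.ofReal_pow (norm_nonneg _), ← ENNReal.ofReal_mul (dens_nonneg _ _),
        ← ENNReal.ofReal_mul (dens_nonneg _ _), ← ENNReal.ofReal_mul (by positivity)]
      apply ENNReal.ofReal_le_ofReal
      calc dens n β b' x * ‖L x (f (l • x))‖ ^ 2
          ≤ dens n β b' x * (C * Real.exp ((b' - b * l ^ 2) / 2 * ‖x‖ ^ 2) *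
            ‖f (l • x)‖) ^ 2 := by
            gcongr
            exact dens_nonneg _ _
        _ = C ^ 2 * ((dens n β b' x * Real.exp (-(b * l ^ 2 - b') * ‖x‖ ^ 2)) *
            ‖f (l • x)‖ ^ 2) := by rw [mul_pow, mul_pow, hexp]; ring
        _ = _ := by rw [dens_mul_exp]; ring_nf
    calc ∫⁻ x, ‖L x (f (l • x))‖ₑ ^ 2 ∂(wm n β b')
        = ∫⁻ x, ENNReal.ofReal (dens n β b' x) * ‖L x (f (l • x))‖ₑ ^ 2 := lintegral_wm _ _
      _ ≤ ∫⁻ x, ENNReal.ofReal (C ^ 2) *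
          (ENNReal.ofReal (dens n β (b * l ^ 2) x) * ‖f (l • x)‖ₑ ^ 2) :=
          lintegral_mono e1
      _ = ENNReal.ofReal (C ^ 2) * ∫⁻ x, ‖f (l • x)‖ₑ ^ 2 ∂(wm n β (b * l ^ 2)) := by
          rw [lintegral_const_mul' _ _ (by simp), ← lintegral_wm]
      _ = ENNReal.ofReal (C ^ 2) * (ENNReal.ofReal (l ^ (-hdim n β)) *
          ∫⁻ x, ‖f x‖ₑ ^ 2 ∂(wm n β b)) := by
          rw [lintegral_wm_smul b hl (fun y => ‖f y‖ₑ ^ 2)]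
      _ ≤ _ := by
          rw [← mul_assoc, ← ENNReal.ofReal_mul (by positivity)]
          gcongr
          change _ ≤ (ENNReal.ofReal _) ^ 2
          rw [← ENNReal.ofReal_pow (by positivity)]
          apply ENNReal.ofReal_le_ofReal
          rw [mul_pow, ← Real.rpow_natCast (l ^ _), ← Real.rpow_mul hl.le]
          apply le_of_eq
          congr 2
          push_cast
          ring

/-- The operator `f ↦ (x ↦ L x (f (l x)))` from `L²` with weight `b` to `L²` with weight `b'`. -/
def fiberMap (b b' : ℝ) {l : ℝ} (hl : 0 < l) (L : HornSpace n → E →L[ℝ] E')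
    (hL : StronglyMeasurable L)
    (hC : ∃ C : ℝ, ∀ x, ‖L x‖ ≤ C * Real.exp ((b' - b * l ^ 2) / 2 * ‖x‖ ^ 2)) :
    Lp E 2 (wm n β b) →L[ℝ] Lp E' 2 (wm n β b') :=
  lpMap (fiberFun l L) (fiberFun_congr b b' hl L) (fiberFun_bound hl hL hC)

theorem coeFn_fiberMap {b b' l : ℝ} (hl : 0 < l) (L : HornSpace n → E →L[ℝ] E') (hL) (hC)
    (f : Lp E 2 (wm n β b)) :
    fiberMap b b' hl L hL hC f =ᵐ[volume] fun x => L x (f (l • x)) :=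
  ae_eq_wm.mp (coeFn_lpMap (fiberFun l L) (fiberFun_congr b b' hl L) (fiberFun_bound hl hL hC) f)

end Fiber

end

/-! ### The orthonormal frame of the horn metric -/

section

variable {n : ℕ} {β : ℝ}

/-- The orthogonal projection to the radial direction at `x`. -/
def radProj (x : HornSpace n) : HornSpace n →L[ℝ] HornSpace n :=
  (‖x‖ ^ 2)⁻¹ • (innerSL ℝ x).smulRight x

theorem radProj_apply (x v : HornSpace n) : radProj x v = ((‖x‖ ^ 2)⁻¹ * inner ℝ x v) • x := by
  simp [radProj, smul_smul]

/-- The linear map taking a Cartesian gradient `V` at `x` to the components of the horn gradient in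
an orthonormal frame: its square norm is `hornInner ε x V V`. -/
def frame (ε : ℝ) (x : HornSpace n) : HornSpace n →L[ℝ] HornSpace n :=
  radProj x + (2 * ‖x‖ ^ (-ε)) • (1 - radProj x)

/-- The inverse of `frame ε x`. -/
def frameInv (ε : ℝ) (x : HornSpace n) : HornSpace n →L[ℝ] HornSpace n :=
  radProj x + (‖x‖ ^ ε / 2) • (1 - radProj x)

theorem frame_apply (ε : ℝ) (x v : HornSpace n) :
    frame ε x v = radProj x v + (2 * ‖x‖ ^ (-ε)) • (v - radProj x v) := by
  simp [frame]

theorem frameInv_apply (ε : ℝ) (x v : HornSpace n) :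
    frameInv ε x v = radProj x v + (‖x‖ ^ ε / 2) • (v - radProj x v) := by
  simp [frameInv]

theorem inner_radProj (x v w : HornSpace n) :
    inner ℝ (radProj x v) w = (‖x‖ ^ 2)⁻¹ * inner ℝ x v * inner ℝ x w := by
  rw [radProj_apply, inner_smul_left]; simp

theorem inner_radProj_right (x v w : HornSpace n) :
    inner ℝ v (radProj x w) = inner ℝ (radProj x v) w := by
  rw [real_inner_comm, inner_radProj, inner_radProj]; ring

theorem radProj_radProj (x v : HornSpace n) : radProj x (radProj x v) = radProj x v := by
  rcases eq_or_ne x 0 with rfl | hx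
  · simp [radProj_apply]
  have h0 := norm_ne_zero_iff.mpr hx
  rw [radProj_apply x (radProj x v), real_inner_comm, inner_radProj, real_inner_self_eq_norm_sq,
    radProj_apply]
  congr 1; field_simp

theorem radProj_self (x : HornSpace n) : radProj x x = x := by
  rcases eq_or_ne x 0 with rfl | hx
  · simp
  have h0 := norm_ne_zero_iff.mpr hx
  rw [radProj_apply, real_inner_self_eq_norm_sq, inv_mul_cancel₀ (by positivity), one_smul]

theorem frame_self (ε : ℝ) (x : HornSpace n) : frame ε x x = x := by
  simp [frame_apply, radProj_self]

theorem inner_self_frame (ε : ℝ) (x v : HornSpace n) :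
    inner ℝ x (frame ε x v) = inner ℝ x v := by
  have h : inner ℝ x (radProj x v) = inner ℝ x v := by
    rw [inner_radProj_right, radProj_self]
  rw [frame_apply, inner_add_right, inner_smul_right, inner_sub_right, h]; simp

theorem inner_frame_frame (ε : ℝ) {x : HornSpace n} (hx : x ≠ 0) (v w : HornSpace n) :
    inner ℝ (frame ε x v) (frame ε x w) = hornInner ε x v w := by
  have h0 : 0 < ‖x‖ := norm_pos_iff.mpr hx
  have hp : (2 * ‖x‖ ^ (-ε)) * (2 * ‖x‖ ^ (-ε)) = 4 * ‖x‖ ^ (-(2 * ε)) := by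
    rw [mul_mul_mul_comm, ← Real.rpow_add h0]; ring_nf
  have hrp : ∀ v w : HornSpace n, inner ℝ (radProj x v) w = radialPart x v * radialPart x w := by
    intro v w
    rw [inner_radProj, radialPart, radialPart, real_inner_comm v x, real_inner_comm w x]
    field_simp
  rw [frame_apply, frame_apply, hornInner, ← hp]
  simp only [inner_add_left, inner_add_right, inner_smul_left, inner_smul_right, inner_sub_left,
    inner_sub_right, inner_radProj_right, radProj_radProj, RCLike.conj_to_real]
  simp only [hrp]
  ring

theorem frameInv_frame (ε : ℝ) {x : HornSpace n} (hx : x ≠ 0) (v : HornSpace n) :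
    frameInv ε x (frame ε x v) = v := by
  have h0 : 0 < ‖x‖ := norm_pos_iff.mpr hx
  have hp : ‖x‖ ^ ε * ‖x‖ ^ (-ε) = 1 := by rw [← Real.rpow_add h0]; simp
  have hr : radProj x (frame ε x v) = radProj x v := by
    simp [frame_apply, radProj_radProj]
  rw [frameInv_apply, hr, frame_apply, add_sub_cancel_left, smul_smul]
  rw [show ‖x‖ ^ ε / 2 * (2 * ‖x‖ ^ (-ε)) = ‖x‖ ^ ε * ‖x‖ ^ (-ε) by ring, hp]
  simp

theorem frame_frameInv (ε : ℝ) {x : HornSpace n} (hx : x ≠ 0) (v : HornSpace n) :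
    frame ε x (frameInv ε x v) = v := by
  have h0 : 0 < ‖x‖ := norm_pos_iff.mpr hx
  have hp : ‖x‖ ^ ε * ‖x‖ ^ (-ε) = 1 := by rw [← Real.rpow_add h0]; simp
  have hr : radProj x (frameInv ε x v) = radProj x v := by
    simp [frameInv_apply, radProj_radProj]
  rw [frame_apply, hr, frameInv_apply, add_sub_cancel_left, smul_smul]
  rw [show 2 * ‖x‖ ^ (-ε) * (‖x‖ ^ ε / 2) = ‖x‖ ^ ε * ‖x‖ ^ (-ε) by ring, hp]
  simp

theorem stronglyMeasurable_radProj : StronglyMeasurable (radProj : HornSpace n → _) := by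
  have h1 : Continuous fun x : HornSpace n => (innerSL ℝ x).smulRight x :=
    ((ContinuousLinearMap.smulRightL ℝ (HornSpace n) (HornSpace n)).continuous₂).comp
      (((innerSL ℝ).continuous).prodMk continuous_id)
  have h2 : StronglyMeasurable fun x : HornSpace n => (‖x‖ ^ 2)⁻¹ :=
    (by fun_prop : Measurable fun x : HornSpace n => (‖x‖ ^ 2)⁻¹).stronglyMeasurable
  exact h2.smul h1.stronglyMeasurable

theorem continuousOn_radProj : ContinuousOn (radProj : HornSpace n → _) {0}ᶜ := by
  have h1 : Continuous fun x : HornSpace n => (innerSL ℝ x).smulRight x :=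
    ((ContinuousLinearMap.smulRightL ℝ (HornSpace n) (HornSpace n)).continuous₂).comp
      (((innerSL ℝ).continuous).prodMk continuous_id)
  refine ContinuousOn.smul (ContinuousOn.inv₀ (f := fun x : HornSpace n => ‖x‖ ^ 2)
    (by fun_prop) fun x hx => ?_) h1.continuousOn
  have := norm_ne_zero_iff.mpr (mem_compl_singleton_iff.mp hx)
  positivity

theorem continuousOn_norm_rpow (a : ℝ) :
    ContinuousOn (fun x : HornSpace n => ‖x‖ ^ a) {0}ᶜ :=
  continuous_norm.continuousOn.rpow_const fun _ hx =>
    Or.inl (norm_ne_zero_iff.mpr (mem_compl_singleton_iff.mp hx))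

theorem continuousOn_frame (ε : ℝ) : ContinuousOn (frame ε : HornSpace n → _) {0}ᶜ :=
  continuousOn_radProj.add ((continuousOn_const.mul (continuousOn_norm_rpow _)).smul
    (continuousOn_const.sub continuousOn_radProj))

theorem continuousOn_frameInv (ε : ℝ) : ContinuousOn (frameInv ε : HornSpace n → _) {0}ᶜ :=
  continuousOn_radProj.add (((continuousOn_norm_rpow _).div_const 2).smul
    (continuousOn_const.sub continuousOn_radProj))

theorem stronglyMeasurable_frame (ε : ℝ) : StronglyMeasurable (frame ε : HornSpace n → _) := by
  have h2 : StronglyMeasurable fun x : HornSpace n => 2 * ‖x‖ ^ (-ε) :=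
    (by fun_prop : Measurable fun x : HornSpace n => 2 * ‖x‖ ^ (-ε)).stronglyMeasurable
  exact stronglyMeasurable_radProj.add
    (h2.smul (stronglyMeasurable_const.sub stronglyMeasurable_radProj))

theorem stronglyMeasurable_frameInv (ε : ℝ) :
    StronglyMeasurable (frameInv ε : HornSpace n → _) := by
  have h2 : StronglyMeasurable fun x : HornSpace n => ‖x‖ ^ ε / 2 :=
    (by fun_prop : Measurable fun x : HornSpace n => ‖x‖ ^ ε / 2).stronglyMeasurable
  exact stronglyMeasurable_radProj.add
    (h2.smul (stronglyMeasurable_const.sub stronglyMeasurable_radProj))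

theorem norm_sq_radProj_add (x v : HornSpace n) :
    ‖radProj x v‖ ^ 2 + ‖v - radProj x v‖ ^ 2 = ‖v‖ ^ 2 := by
  simp only [← real_inner_self_eq_norm_sq, inner_sub_left, inner_sub_right, inner_radProj_right,
    radProj_radProj]
  ring

theorem norm_radProj_le (x : HornSpace n) : ‖radProj x‖ ≤ 1 := by
  refine ContinuousLinearMap.opNorm_le_bound _ zero_le_one fun v => ?_
  rw [one_mul]
  have := norm_sq_radProj_add x v
  exact le_of_sq_le_sq (by nlinarith [sq_nonneg ‖v - radProj x v‖]) (norm_nonneg _)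

theorem norm_one_sub_radProj_le (x : HornSpace n) :
    ‖(1 - radProj x : HornSpace n →L[ℝ] HornSpace n)‖ ≤ 1 := by
  refine ContinuousLinearMap.opNorm_le_bound _ zero_le_one fun v => ?_
  rw [one_mul]
  have := norm_sq_radProj_add x v
  have h : (1 - radProj x : HornSpace n →L[ℝ] HornSpace n) v = v - radProj x v := by simp
  rw [h]
  exact le_of_sq_le_sq (by nlinarith [sq_nonneg ‖radProj x v‖]) (norm_nonneg _)

/-! ### Particular operators -/

section Ops

variable [hn : Fact (2 ≤ n)] {E : Type*} [NormedAddCommGroup E] [NormedSpace ℝ E]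

/-- The inclusion of the `L²` space with weight `b` into the one with the smaller weight. -/
def incl (E : Type*) [NormedAddCommGroup E] [NormedSpace ℝ E] {b b' : ℝ} (h : b ≤ b') :
    Lp E 2 (wm n β b) →L[ℝ] Lp E 2 (wm n β b') :=
  fiberMap b b' one_pos (fun _ => ContinuousLinearMap.id ℝ E) stronglyMeasurable_const
    ⟨1, fun x => ContinuousLinearMap.norm_id_le.trans (by
      rw [one_mul]; exact Real.one_le_exp (by have : 0 ≤ b' - b := by linarith
                                              simp; positivity))⟩

theorem coeFn_incl {b b' : ℝ} (h : b ≤ b') (f : Lp E 2 (wm n β b)) :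
    incl E h f =ᵐ[volume] f := by
  exact (coeFn_fiberMap one_pos _ _ _ _).trans (ae_of_all _ fun x => by simp)

/-- Multiplication by a bounded measurable function. -/
def mulOp (E : Type*) [NormedAddCommGroup E] [NormedSpace ℝ E] (b : ℝ) (c : HornSpace n → ℝ)
    (hc : Measurable c) (hC : ∃ C : ℝ, ∀ x, |c x| ≤ C) :
    Lp E 2 (wm n β b) →L[ℝ] Lp E 2 (wm n β b) :=
  fiberMap b b one_pos (fun x => c x • ContinuousLinearMap.id ℝ E)
    (hc.stronglyMeasurable.smul stronglyMeasurable_const)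
    (by
      obtain ⟨C, hC⟩ := hC
      refine ⟨C, fun x => ?_⟩
      rw [norm_smul]
      simp only [one_pow, mul_one, sub_self, zero_div, zero_mul, Real.exp_zero]
      calc ‖c x‖ * _ ≤ ‖c x‖ * 1 := by gcongr; exact ContinuousLinearMap.norm_id_le
        _ ≤ C := by rw [mul_one]; exact hC x)

theorem coeFn_mulOp (b : ℝ) (c : HornSpace n → ℝ) (hc hC) (f : Lp E 2 (wm n β b)) :
    mulOp E b c hc hC f =ᵐ[volume] fun x => c x • f x := by
  exact (coeFn_fiberMap one_pos _ _ _ _).trans (ae_of_all _ fun x => by simp)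

theorem exists_norm_le_mul_exp {c : ℝ} (hc : 0 < c) :
    ∃ C : ℝ, ∀ x : HornSpace n, ‖x‖ ≤ C * Real.exp (c / 2 * ‖x‖ ^ 2) := by
  obtain ⟨C, -, h⟩ := exists_pow_mul_exp_le 1 (half_pos hc)
  refine ⟨C, fun x => ?_⟩
  have := h ‖x‖ (norm_nonneg x)
  rw [pow_one] at this
  rwa [← div_le_iff₀ (Real.exp_pos _), div_eq_mul_inv, ← Real.exp_neg, ← neg_mul]

/-- The operator `F ↦ ⟨x, F⟩`; it takes a gradient field to the radial derivative `r ∂_r`. -/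
def radOp {b b' : ℝ} (h : b < b') : Lp (HornSpace n) 2 (wm n β b) →L[ℝ] Lp ℝ 2 (wm n β b') :=
  fiberMap b b' one_pos (fun x => innerSL ℝ x) (innerSL ℝ).continuous.stronglyMeasurable
    (by
      obtain ⟨C, hC⟩ := exists_norm_le_mul_exp (n := n) (sub_pos.mpr h)
      exact ⟨C, fun x => by simpa using hC x⟩)

theorem coeFn_radOp {b b' : ℝ} (h : b < b') (F : Lp (HornSpace n) 2 (wm n β b)) :
    radOp h F =ᵐ[volume] fun x => inner ℝ x (F x) := by
  exact (coeFn_fiberMap one_pos _ _ _ _).trans (ae_of_all _ fun x => by simp)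

/-- The operator `f ↦ f x`. -/
def posOp {b b' : ℝ} (h : b < b') : Lp ℝ 2 (wm n β b) →L[ℝ] Lp (HornSpace n) 2 (wm n β b') :=
  fiberMap b b' one_pos (fun x => ContinuousLinearMap.toSpanSingleton ℝ x)
    (by
      have : Continuous fun x : HornSpace n => ContinuousLinearMap.toSpanSingleton ℝ x :=
        (ContinuousLinearMap.toSpanSingletonLIE ℝ (HornSpace n)).continuous
      exact this.stronglyMeasurable)
    (by
      obtain ⟨C, hC⟩ := exists_norm_le_mul_exp (n := n) (sub_pos.mpr h)
      exact ⟨C, fun x => by simpa using hC x⟩)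

theorem coeFn_posOp {b b' : ℝ} (h : b < b') (f : Lp ℝ 2 (wm n β b)) :
    posOp h f =ᵐ[volume] fun x => f x • x := by
  exact (coeFn_fiberMap one_pos _ _ _ _).trans (ae_of_all _ fun x => by simp)

/-- The radial part of a vector field. -/
def radPartOp (b : ℝ) : Lp (HornSpace n) 2 (wm n β b) →L[ℝ] Lp (HornSpace n) 2 (wm n β b) :=
  fiberMap b b one_pos radProj stronglyMeasurable_radProj
    ⟨1, fun x => by simpa using norm_radProj_le x⟩

theorem coeFn_radPartOp (b : ℝ) (F : Lp (HornSpace n) 2 (wm n β b)) :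
    radPartOp b F =ᵐ[volume] fun x => radProj x (F x) := by
  exact (coeFn_fiberMap one_pos _ _ _ _).trans (ae_of_all _ fun x => by simp)

end Ops

end

/-! ### Test functions on the punctured horn -/

section

variable {n : ℕ} {β : ℝ}

/-- Smooth functions with compact support away from the tip. -/
structure IsTest (φ : HornSpace n → ℝ) : Prop where
  smooth : ContDiff ℝ ∞ φ
  compact : HasCompactSupport φ
  supp : tsupport φ ⊆ {0}ᶜ

theorem inner_gradient_apply (φ : HornSpace n → ℝ) (x v : HornSpace n) :
    inner ℝ (gradient φ x) v = fderiv ℝ φ x v := by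
  simp [gradient]

theorem eventually_eq_zero_of_notMem_tsupport {E F : Type*} [TopologicalSpace E] [Zero F]
    {f : E → F} {x : E} (hx : x ∉ tsupport f) : f =ᶠ[𝓝 x] 0 :=
  notMem_tsupport_iff_eventuallyEq.mp hx

namespace IsTest

variable {φ ψ : HornSpace n → ℝ}

theorem differentiableAt (h : IsTest φ) (x : HornSpace n) : DifferentiableAt ℝ φ x :=
  (h.smooth.differentiable (by simp)) x

theorem zero_notMem (h : IsTest φ) : (0 : HornSpace n) ∉ tsupport φ := fun h0 => h.supp h0 rfl

theorem mul_contDiffAt (h : IsTest φ) {c : HornSpace n → ℝ}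
    (hc : ∀ x ≠ 0, ContDiffAt ℝ ∞ c x) : IsTest fun x => φ x * c x where
  smooth := by
    rw [contDiff_iff_contDiffAt]
    intro x
    by_cases hx : x ∈ tsupport φ
    · exact h.smooth.contDiffAt.mul (hc x (h.supp hx))
    · have : (fun x => φ x * c x) =ᶠ[𝓝 x] fun _ => 0 := by
        filter_upwards [eventually_eq_zero_of_notMem_tsupport hx] with y hy
        simp [hy]
      exact contDiffAt_const.congr_of_eventuallyEq this
  compact := h.compact.mul_right
  supp := (tsupport_mul_subset_left).trans h.supp

theorem mul (h : IsTest φ) (h' : IsTest ψ) : IsTest fun x => φ x * ψ x :=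
  h.mul_contDiffAt fun _ _ => h'.smooth.contDiffAt

theorem add (h : IsTest φ) (h' : IsTest ψ) : IsTest fun x => φ x + ψ x where
  smooth := h.smooth.add h'.smooth
  compact := h.compact.add h'.compact
  supp := (tsupport_add φ ψ).trans (union_subset h.supp h'.supp)

theorem const_mul (h : IsTest φ) (c : ℝ) : IsTest fun x => c * φ x where
  smooth := contDiff_const.mul h.smooth
  compact := h.compact.mul_left
  supp := (tsupport_mul_subset_right).trans h.supp

theorem zero : IsTest fun _ : HornSpace n => (0 : ℝ) where
  smooth := contDiff_const
  compact := HasCompactSupport.zero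
  supp := by
    have : tsupport (fun _ : HornSpace n => (0 : ℝ)) = ∅ := by simp
    simp [this]

theorem comp_smul (h : IsTest φ) {l : ℝ} (hl : 0 < l) : IsTest fun x => φ (l • x) where
  smooth := h.smooth.comp (contDiff_const_smul l)
  compact := h.compact.comp_homeomorph (Homeomorph.smulOfNeZero l hl.ne')
  supp := by
    intro x hx hx0
    rw [mem_singleton_iff] at hx0
    subst hx0
    refine (notMem_tsupport_iff_eventuallyEq.mpr ?_) hx
    have h1 : Tendsto (fun x : HornSpace n => l • x) (𝓝 0) (𝓝 0) := by
      have := (continuous_const_smul l : Continuous fun x : HornSpace n => l • x).tendsto 0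
      simpa using this
    exact h1.eventually (eventually_eq_zero_of_notMem_tsupport h.zero_notMem)

theorem continuous_gradient (h : IsTest φ) : Continuous (gradient φ) :=
  (InnerProductSpace.toDual ℝ (HornSpace n)).symm.continuous.comp
    (h.smooth.continuous_fderiv (by simp))

theorem tsupport_gradient : tsupport (gradient φ) ⊆ tsupport φ := by
  refine (closure_mono fun x hx => ?_).trans (tsupport_fderiv_subset ℝ (f := φ))
  intro h0
  exact hx (by simp [gradient, h0])

theorem gradient_eq_zero {x : HornSpace n} (hx : x ∉ tsupport φ) : gradient φ x = 0 :=
  image_eq_zero_of_notMem_tsupport fun h => hx (tsupport_gradient h)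

theorem hasCompactSupport_gradient (h : IsTest φ) : HasCompactSupport (gradient φ) :=
  h.compact.mono' (subset_tsupport _ |>.trans tsupport_gradient)

theorem hasGradientAt_add (h : IsTest φ) (h' : IsTest ψ) (x : HornSpace n) :
    gradient (fun x => φ x + ψ x) x = gradient φ x + gradient ψ x := by
  simp [gradient, fderiv_fun_add (h.differentiableAt x) (h'.differentiableAt x)]

theorem gradient_const_mul (h : IsTest φ) (c : ℝ) (x : HornSpace n) :
    gradient (fun x => c * φ x) x = c • gradient φ x := by
  simp [gradient, fderiv_const_mul (h.differentiableAt x)]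

theorem gradient_mul {c : HornSpace n → ℝ} (h : IsTest φ) {x : HornSpace n}
    (hc : DifferentiableAt ℝ c x) :
    gradient (fun x => φ x * c x) x = φ x • gradient c x + c x • gradient φ x := by
  simp [gradient, fderiv_fun_mul (h.differentiableAt x) hc]

theorem gradient_comp_smul (h : IsTest φ) (l : ℝ) (x : HornSpace n) :
    gradient (fun x => φ (l • x)) x = l • gradient φ (l • x) := by
  refine ext_inner_right ℝ fun v => ?_
  rw [inner_gradient_apply, inner_smul_left, inner_gradient_apply]
  have h1 : HasFDerivAt (fun x : HornSpace n => l • x) (l • ContinuousLinearMap.id ℝ _) x :=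
    (hasFDerivAt_id x).const_smul l
  have h2 := ((h.differentiableAt (l • x)).hasFDerivAt.comp x h1).fderiv
  change fderiv ℝ (φ ∘ fun x => l • x) x v = _
  rw [h2]; simp

end IsTest

theorem gradient_exp_neg (B : ℝ) (x : HornSpace n) :
    gradient (fun x : HornSpace n => Real.exp (-B * ‖x‖ ^ 2)) x =
      (-(2 * B) * Real.exp (-B * ‖x‖ ^ 2)) • x := by
  refine ext_inner_right ℝ fun v => ?_
  rw [inner_gradient_apply]
  have h1 : HasFDerivAt (fun x : HornSpace n => ‖x‖ ^ 2) (2 • innerSL ℝ x) x :=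
    (hasStrictFDerivAt_norm_sq x).hasFDerivAt
  rw [((h1.const_mul (-B)).exp).fderiv, inner_smul_left]
  simp; ring

theorem contDiff_exp_neg (B : ℝ) :
    ContDiff ℝ ∞ fun x : HornSpace n => Real.exp (-B * ‖x‖ ^ 2) :=
  (contDiff_const.mul (contDiff_norm_sq ℝ)).exp

/-! ### The closure of the test functions -/

section

variable [hn : Fact (2 ≤ n)] [hβ : Fact (0 < β)]

instance instIsLocallyFiniteMeasureWm (b : ℝ) : IsLocallyFiniteMeasure (wm n β b) :=
  IsLocallyFiniteMeasure.withDensity_ofReal (continuous_dens b)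

theorem memLp_of_hasCompactSupport {E : Type*} [NormedAddCommGroup E] (b : ℝ)
    {g : HornSpace n → E} (hg : Continuous g) (hc : HasCompactSupport g) :
    MemLp g 2 (wm n β b) :=
  hg.memLp_of_hasCompactSupport hc

theorem continuous_fiber {E E' : Type*} [NormedAddCommGroup E] [NormedSpace ℝ E]
    [NormedAddCommGroup E'] [NormedSpace ℝ E'] {L : HornSpace n → E →L[ℝ] E'}
    (hL : ContinuousOn L {0}ᶜ) {g : HornSpace n → E} (hg : Continuous g)
    (hs : tsupport g ⊆ {0}ᶜ) : Continuous fun x => L x (g x) := by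
  refine ContinuousOn.continuous_of_tsupport_subset (s := {0}ᶜ)
    (hL.clm_apply hg.continuousOn) isOpen_compl_singleton ?_
  refine (closure_mono fun x hx h0 => ?_).trans hs
  simp only [Function.mem_support] at hx
  exact hx (by simp [h0])

theorem hasCompactSupport_fiber {E E' : Type*} [NormedAddCommGroup E] [NormedSpace ℝ E]
    [NormedAddCommGroup E'] [NormedSpace ℝ E'] (L : HornSpace n → E →L[ℝ] E')
    {g : HornSpace n → E} (hc : HasCompactSupport g) : HasCompactSupport fun x => L x (g x) :=
  hc.mono fun x hx h0 => by
    simp only [Function.mem_support] at hx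
    exact hx (by simp [h0])

namespace IsTest

variable {φ ψ : HornSpace n → ℝ}

theorem memLp (h : IsTest φ) (b : ℝ) : MemLp φ 2 (wm n β b) :=
  memLp_of_hasCompactSupport b h.smooth.continuous h.compact

theorem continuous_frame_gradient (h : IsTest φ) (ε : ℝ) :
    Continuous fun x => frame ε x (gradient φ x) :=
  continuous_fiber (continuousOn_frame ε) h.continuous_gradient
    (tsupport_gradient.trans h.supp)

theorem memLp_grad (h : IsTest φ) (ε b : ℝ) :
    MemLp (fun x => frame ε x (gradient φ x)) 2 (wm n β b) :=
  memLp_of_hasCompactSupport b (h.continuous_frame_gradient ε)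
    (hasCompactSupport_fiber _ h.hasCompactSupport_gradient)

/-- A test function as an element of a weighted `L²` space. -/
def lp (h : IsTest φ) (β b : ℝ) [Fact (0 < β)] : Lp ℝ 2 (wm n β b) := (h.memLp b).toLp

/-- The horn gradient of a test function, in the orthonormal frame, as an element of a weighted
`L²` space. -/
def lpGrad (h : IsTest φ) (β ε b : ℝ) [Fact (0 < β)] : Lp (HornSpace n) 2 (wm n β b) :=
  (h.memLp_grad ε b).toLp

theorem coeFn_lp (h : IsTest φ) (b : ℝ) : h.lp β b =ᵐ[volume] φ :=
  ae_eq_wm.mp (h.memLp b).coeFn_toLp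

theorem coeFn_lpGrad (h : IsTest φ) (ε b : ℝ) :
    h.lpGrad β ε b =ᵐ[volume] fun x => frame ε x (gradient φ x) :=
  ae_eq_wm.mp (h.memLp_grad ε b).coeFn_toLp

end IsTest

variable (n β) in
/-- The pairs `(φ, ∇φ)` for test functions `φ`. -/
def testPairs (ε b : ℝ) :
    Submodule ℝ (Lp ℝ 2 (wm n β b) × Lp (HornSpace n) 2 (wm n β b)) where
  carrier := {p | ∃ (φ : HornSpace n → ℝ) (h : IsTest φ), p = (h.lp β b, h.lpGrad β ε b)}
  add_mem' := by
    rintro _ _ ⟨φ, hφ, rfl⟩ ⟨ψ, hψ, rfl⟩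
    refine ⟨_, hφ.add hψ, Prod.ext ?_ ?_⟩
    · exact (MemLp.toLp_add (hφ.memLp b) (hψ.memLp b)).symm
    · refine ((MemLp.toLp_add (hφ.memLp_grad ε b) (hψ.memLp_grad ε b)).symm.trans
        (MemLp.toLp_congr _ ((hφ.add hψ).memLp_grad ε b) (ae_of_all _ fun x => ?_)))
      simp [IsTest.hasGradientAt_add hφ hψ]
  zero_mem' := by
    refine ⟨_, IsTest.zero, Prod.ext ?_ ?_⟩
    · exact (MemLp.toLp_zero (MemLp.zero' : MemLp (fun _ => (0 : ℝ)) 2 (wm n β b))).symm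
    · refine (MemLp.toLp_zero (MemLp.zero' : MemLp (fun _ => (0 : HornSpace n)) 2
        (wm n β b))).symm.trans (MemLp.toLp_congr _ (IsTest.zero.memLp_grad ε b) (ae_of_all _ fun x => ?_))
      simp [gradient]
  smul_mem' := by
    rintro c _ ⟨φ, hφ, rfl⟩
    refine ⟨_, hφ.const_mul c, Prod.ext ?_ ?_⟩
    · exact (MemLp.toLp_const_smul c (hφ.memLp b)).symm
    · refine ((MemLp.toLp_const_smul c (hφ.memLp_grad ε b)).symm.trans
        (MemLp.toLp_congr _ ((hφ.const_mul c).memLp_grad ε b) (ae_of_all _ fun x => ?_)))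
      simp [IsTest.gradient_const_mul hφ]

variable (n β) in
/-- The weighted Sobolev space: the closure of the pairs `(φ, ∇φ)`, `φ` a test function, in the
`L²` space with weight `b`. -/
def Gam (ε b : ℝ) : Submodule ℝ (Lp ℝ 2 (wm n β b) × Lp (HornSpace n) 2 (wm n β b)) :=
  (testPairs n β ε b).topologicalClosure

theorem isClosed_Gam (ε b : ℝ) :
    IsClosed (Gam n β ε b : Set (Lp ℝ 2 (wm n β b) × Lp (HornSpace n) 2 (wm n β b))) :=
  Submodule.isClosed_topologicalClosure _

theorem IsTest.mem_Gam {φ : HornSpace n → ℝ} (h : IsTest φ) (ε b : ℝ) :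
    (h.lp β b, h.lpGrad β ε b) ∈ Gam n β ε b :=
  Submodule.le_topologicalClosure _ ⟨φ, h, rfl⟩

theorem Gam_induction {ε b : ℝ}
    {S : Set (Lp ℝ 2 (wm n β b) × Lp (HornSpace n) 2 (wm n β b))} (hS : IsClosed S)
    (h : ∀ (φ : HornSpace n → ℝ) (hφ : IsTest φ), (hφ.lp β b, hφ.lpGrad β ε b) ∈ S) :
    ∀ p ∈ Gam n β ε b, p ∈ S := by
  intro p hp
  refine closure_minimal ?_ hS hp
  rintro _ ⟨φ, hφ, rfl⟩
  exact h φ hφ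

/-! ### Integration by parts for the radial field -/

theorem integral_fderiv_self_add {Ψ : HornSpace n → ℝ} (h : ContDiff ℝ 1 Ψ)
    (hc : HasCompactSupport Ψ) :
    ∫ x, fderiv ℝ Ψ x x = -(n * ∫ x, Ψ x) := by
  have hd : Continuous (fderiv ℝ Ψ) := h.continuous_fderiv (by simp)
  have hdc : HasCompactSupport (fderiv ℝ Ψ) := hc.fderiv ℝ
  let e : Fin n → HornSpace n := fun i => EuclideanSpace.single i 1
  have hcoord : ∀ (i : Fin n) (x : HornSpace n),
      HasFDerivAt (fun y : HornSpace n => y i) (EuclideanSpace.proj i : HornSpace n →L[ℝ] ℝ) x :=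
    fun i x => (EuclideanSpace.proj i : HornSpace n →L[ℝ] ℝ).hasFDerivAt
  have hint : ∀ i, Integrable fun x : HornSpace n => fderiv ℝ Ψ x (e i) * x i := fun i =>
    Continuous.integrable_of_hasCompactSupport (by fun_prop)
      ((hdc.mono (fun x hx h0 => by simp at hx; exact hx.1 (by simp [h0]))))
  have h1 : ∀ i, ∫ x, Ψ x = -∫ x, fderiv ℝ Ψ x (e i) * x i := by
    intro i
    have := integral_mul_fderiv_eq_neg_fderiv_mul_of_integrable (μ := volume) (f := Ψ)
      (g := fun x : HornSpace n => x i) (v := e i) (hint i)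
      (Continuous.integrable_of_hasCompactSupport (by
        simp_rw [(hcoord i _).fderiv]
        exact h.continuous.mul continuous_const) hc.mul_right)
      (Continuous.integrable_of_hasCompactSupport (h.continuous.mul (by fun_prop)) hc.mul_right)
      (fun x _ => h.differentiable (by simp) x) (fun x _ => (hcoord i x).differentiableAt)
    rw [← this]
    congr 1; ext x
    rw [(hcoord i x).fderiv]
    simp [e]
  have h2 : ∀ x : HornSpace n, fderiv ℝ Ψ x x = ∑ i, fderiv ℝ Ψ x (e i) * x i := by
    intro x
    have hx : x = ∑ i, x i • e i := by
      ext j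
      simp [e, Finset.sum_apply, Pi.single_apply]
    have := congrArg (fderiv ℝ Ψ x) hx
    rw [map_sum] at this
    simpa [mul_comm] using this
  simp_rw [h2]
  rw [integral_finsetSum _ fun i _ => hint i]
  have : ∀ i, ∫ x, fderiv ℝ Ψ x (e i) * x i = -∫ x, Ψ x := fun i => by rw [h1 i, neg_neg]
  simp [this]

theorem fderiv_dens_self (b : ℝ) {x : HornSpace n} (hx : x ≠ 0) :
    fderiv ℝ (dens n β b) x x = (β - 2 * b * ‖x‖ ^ 2) * dens n β b x := by
  have h0 : HasFDerivAt (dens n β b) (fderiv ℝ (dens n β b) x) ((1 : ℝ) • x) := by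
    rw [one_smul]
    exact ((contDiffOn_dens b hx).differentiableAt (by simp)).hasFDerivAt
  have h1 : HasDerivAt (fun s : ℝ => s • x) x 1 := by
    simpa using (hasDerivAt_id (1 : ℝ)).smul_const x
  have h2 := h0.comp_hasDerivAt (1 : ℝ) h1
  have h3 : HasDerivAt (fun s : ℝ => (1 / 2 : ℝ) ^ (n - 1) * ‖x‖ ^ β *
      (s ^ β * Real.exp (-b * ‖x‖ ^ 2 * s ^ 2)))
      ((1 / 2 : ℝ) ^ (n - 1) * ‖x‖ ^ β * ((β * 1 ^ (β - 1)) * Real.exp (-b * ‖x‖ ^ 2 * 1 ^ 2) +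
        1 ^ β * (Real.exp (-b * ‖x‖ ^ 2 * 1 ^ 2) * (-b * ‖x‖ ^ 2 * (2 * 1))))) 1 := by
    refine ((Real.hasDerivAt_rpow_const (Or.inl one_ne_zero)).mul
      (((hasDerivAt_pow 2 (1 : ℝ)).const_mul (-b * ‖x‖ ^ 2)).exp.congr_deriv ?_)).const_mul _
    norm_num
  have h4 : (dens n β b ∘ fun s : ℝ => s • x) =ᶠ[𝓝 1] fun s : ℝ =>
      (1 / 2 : ℝ) ^ (n - 1) * ‖x‖ ^ β * (s ^ β * Real.exp (-b * ‖x‖ ^ 2 * s ^ 2)) := by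
    filter_upwards [lt_mem_nhds (zero_lt_one' ℝ)] with s hs
    simp only [Function.comp, dens, norm_smul, Real.norm_of_nonneg hs.le]
    rw [Real.mul_rpow hs.le (norm_nonneg x)]
    ring_nf
  rw [h2.unique (h3.congr_of_eventuallyEq h4)]
  simp only [Real.one_rpow, dens]
  ring_nf

/-- The radial field `x` has divergence `d - 2b‖x‖²` with respect to the weighted measure. -/
theorem IsTest.integral_fderiv_self {φ : HornSpace n → ℝ} (h : IsTest φ) (b : ℝ) :
    ∫ x, fderiv ℝ φ x x ∂(wm n β b) =
      -∫ x, φ x * (hdim n β - 2 * b * ‖x‖ ^ 2) ∂(wm n β b) := by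
  have hΨ := h.mul_contDiffAt (c := dens n β b) fun x hx => contDiffOn_dens b hx
  have h1 := integral_fderiv_self_add (hΨ.smooth.of_le (by simp)) hΨ.compact
  have hd : Continuous (fderiv ℝ φ) := h.smooth.continuous_fderiv (by simp)
  have h2 : ∀ x : HornSpace n, fderiv ℝ (fun x => φ x * dens n β b x) x x =
      dens n β b x * fderiv ℝ φ x x + (β - 2 * b * ‖x‖ ^ 2) * (φ x * dens n β b x) := by
    intro x
    by_cases hx : x = 0
    · subst hx
      simp [image_eq_zero_of_notMem_tsupport h.zero_notMem]
    · rw [fderiv_fun_mul (h.differentiableAt x)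
        ((contDiffOn_dens b hx).differentiableAt (by simp))]
      simp only [_root_.add_apply, _root_.smul_apply, smul_eq_mul,
        fderiv_dens_self b hx]
      ring
  simp_rw [h2] at h1
  have hcd := continuous_dens (n := n) (β := β) b
  have hφ := h.smooth.continuous
  have i1 : Integrable fun x => (β - 2 * b * ‖x‖ ^ 2) * (φ x * dens n β b x) :=
    Continuous.integrable_of_hasCompactSupport (by fun_prop)
      (h.compact.mono fun x hx h0 => by simp at hx; exact hx.2.1 h0)
  have i2 : Integrable fun x => φ x * dens n β b x :=
    Continuous.integrable_of_hasCompactSupport (by fun_prop) h.compact.mul_right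
  rw [integral_add (Continuous.integrable_of_hasCompactSupport (by fun_prop)
    ((h.compact.fderiv ℝ).mono fun x hx h0 => by
      simp at hx; exact hx.2 (by simp [h0]))) i1] at h1
  have h3 : ∫ x, dens n β b x * (φ x * (hdim n β - 2 * b * ‖x‖ ^ 2)) =
      (∫ x, (β - 2 * b * ‖x‖ ^ 2) * (φ x * dens n β b x)) + n * ∫ x, φ x * dens n β b x := by
    rw [← integral_const_mul, ← integral_add i1 (i2.const_mul _)]
    congr 1; ext x
    rw [hdim]; ring
  rw [integral_wm, integral_wm]
  simp only [smul_eq_mul]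
  rw [h3]
  linarith

end

end

/-! ### Averages in `L²` and mollification -/

theorem enorm_integral_sq_le {α E : Type*} [MeasurableSpace α] [NormedAddCommGroup E]
    [NormedSpace ℝ E] {ν : Measure α} {g : α → E} (hg : AEStronglyMeasurable g ν) :
    ‖∫ y, g y ∂ν‖ₑ ^ 2 ≤ ν univ * ∫⁻ y, ‖g y‖ₑ ^ 2 ∂ν := by
  have h1 := eLpNorm_le_eLpNorm_mul_rpow_measure_univ (p := 1) (q := 2) (by norm_num) hg
  rw [eLpNorm_one_eq_lintegral_enorm] at h1
  have h2 := (enorm_integral_le_lintegral_enorm (μ := ν) g).trans h1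
  calc ‖∫ y, g y ∂ν‖ₑ ^ 2 ≤ (eLpNorm g 2 ν * ν univ ^ (1 / ENNReal.toReal 1 -
      1 / ENNReal.toReal 2)) ^ 2 := by gcongr
    _ = _ := by
      rw [mul_pow, eLpNorm_two_sq, mul_comm, ← ENNReal.rpow_natCast (ν univ ^ _),
        ← ENNReal.rpow_mul]
      norm_num

/-- The `L²` norm of an average is bounded by the average of the `L²` norms. -/
theorem lintegral_enorm_integral_sq_le {Y X E : Type*} [MeasurableSpace Y] [MeasurableSpace X]
    [NormedAddCommGroup E] [NormedSpace ℝ E] {ν : Measure Y} {μ : Measure X} [SFinite ν]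
    [SFinite μ] {g : Y → X → E} (hg : AEStronglyMeasurable (Function.uncurry g) (ν.prod μ)) :
    ∫⁻ x, ‖∫ y, g y x ∂ν‖ₑ ^ 2 ∂μ ≤ ν univ * ∫⁻ y, ∫⁻ x, ‖g y x‖ₑ ^ 2 ∂μ ∂ν := by
  have hs : AEStronglyMeasurable (fun z : X × Y => g z.2 z.1) (μ.prod ν) := hg.prod_swap
  calc ∫⁻ x, ‖∫ y, g y x ∂ν‖ₑ ^ 2 ∂μ ≤ ∫⁻ x, ν univ * ∫⁻ y, ‖g y x‖ₑ ^ 2 ∂ν ∂μ := by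
        refine lintegral_mono_ae ?_
        filter_upwards [hs.prodMk_left] with x hx
        exact enorm_integral_sq_le hx
    _ = ν univ * ∫⁻ x, ∫⁻ y, ‖g y x‖ₑ ^ 2 ∂ν ∂μ := by
        refine lintegral_const_mul'' _ ?_
        exact ((hs.enorm.pow_const 2).lintegral_prod_right')
    _ = _ := by
        congr 1
        exact lintegral_lintegral_swap (hs.enorm.pow_const 2)

variable {n : ℕ}

theorem tendsto_eLpNorm_translate {E : Type*} [NormedAddCommGroup E] {g : HornSpace n → E}
    (hg : MemLp g 2) :
    Tendsto (fun y : HornSpace n => eLpNorm (fun x => g (x - y) - g x) 2 volume) (𝓝 0) (𝓝 0) := by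
  have : Fact ((2 : ENNReal) ≠ ⊤) := ⟨by norm_num⟩
  have h1 : Continuous fun y : HornSpace n =>
      (DomAddAct.mk (-y) +ᵥ hg.toLp g : Lp E 2 (volume : Measure (HornSpace n))) := by
    have c1 : Continuous fun y : HornSpace n => DomAddAct.mk (-y) :=
      DomAddAct.continuous_mk.comp continuous_neg
    exact c1.vadd continuous_const
  have h2 : Tendsto (fun y : HornSpace n => edist ((DomAddAct.mk (-y)) +ᵥ hg.toLp) hg.toLp)
      (𝓝 0) (𝓝 0) := by
    have := (h1.edist (continuous_const (y := hg.toLp))).tendsto 0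
    simpa using this
  refine h2.congr fun y => ?_
  rw [DomAddAct.mk_vadd_toLp, Lp.edist_toLp_toLp]
  congr 1; ext x
  simp only [Pi.sub_apply, vadd_eq_add]
  congr 2; abel

/-- The convolution of `g` with `η`. -/
def moll {E : Type*} [NormedAddCommGroup E] [NormedSpace ℝ E] (η : HornSpace n → ℝ)
    (g : HornSpace n → E) (x : HornSpace n) : E := ∫ y, η (x - y) • g y

theorem moll_eq {E : Type*} [NormedAddCommGroup E] [NormedSpace ℝ E] (η : HornSpace n → ℝ)
    (g : HornSpace n → E) (x : HornSpace n) : moll η g x = ∫ y, η y • g (x - y) := by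
  rw [moll, ← integral_sub_left_eq_self (fun y => η (x - y) • g y) volume x]
  simp

theorem integrable_moll {E : Type*} [NormedAddCommGroup E] [NormedSpace ℝ E]
    {η : HornSpace n → ℝ} (hη : Continuous η) (hc : HasCompactSupport η) {g : HornSpace n → E}
    (hg : LocallyIntegrable g) (x : HornSpace n) : Integrable fun y => η (x - y) • g y := by
  have h1 : Continuous fun y => η (x - y) := by fun_prop
  have h2 : HasCompactSupport fun y => η (x - y) :=
    hc.comp_homeomorph (Homeomorph.subLeft x)
  exact hg.integrable_smul_left_of_hasCompactSupport h1 h2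

theorem tendsto_eLpNorm_moll {E : Type*} [NormedAddCommGroup E] [NormedSpace ℝ E]
    [CompleteSpace E]
    {φ : ℕ → ContDiffBump (0 : HornSpace n)} (hφ : Tendsto (fun k => (φ k).rOut) atTop (𝓝 0))
    {g : HornSpace n → E} (hg : MemLp g 2) :
    Tendsto (fun k => eLpNorm (fun x => moll ((φ k).normed volume) g x - g x) 2 volume)
      atTop (𝓝 0) := by
  have hgl : LocallyIntegrable g := hg.locallyIntegrable (by norm_num)
  rw [ENNReal.tendsto_nhds_zero]
  intro δ hδ
  obtain ⟨r, hr, hball⟩ := Metric.eventually_nhds_iff.mp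
    ((ENNReal.tendsto_nhds_zero.mp (tendsto_eLpNorm_translate hg)) δ hδ)
  filter_upwards [hφ.eventually (gt_mem_nhds hr)] with k hk
  set η := (φ k).normed volume with hη
  have hη0 : ∀ y, 0 ≤ η y := (φ k).nonneg_normed
  have hηc : Continuous η := (φ k).continuous_normed
  have hηm : Measurable fun y => ENNReal.ofReal (η y) := hηc.measurable.ennreal_ofReal
  set ν : Measure (HornSpace n) := volume.withDensity fun y => ENNReal.ofReal (η y) with hν
  have hν1 : ν univ = 1 := by
    rw [hν, withDensity_apply _ MeasurableSet.univ, Measure.restrict_univ,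
      ← ofReal_integral_eq_lintegral_ofReal (φ k).integrable_normed (ae_of_all _ hη0),
      (φ k).integral_normed, ENNReal.ofReal_one]
  have : IsProbabilityMeasure ν := ⟨hν1⟩
  have hνi : ∀ f : HornSpace n → E, ∫ y, f y ∂ν = ∫ y, η y • f y := by
    intro f
    rw [hν, integral_withDensity_eq_integral_toReal_smul hηm (by simp)]
    simp_rw [ENNReal.toReal_ofReal (hη0 _)]
  have hνI : ∀ f : HornSpace n → E, Integrable (fun y => η y • f y) → Integrable f ν := by
    intro f hf
    rw [hν, integrable_withDensity_iff_integrable_smul' hηm (by simp)]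
    simpa only [ENNReal.toReal_ofReal (hη0 _)] using hf
  have e1 : ∀ x, moll η g x - g x = ∫ y, (g (x - y) - g x) ∂ν := by
    intro x
    rw [integral_sub, integral_const, hνi, moll_eq]
    · simp [hν1, Measure.real]
    · refine hνI _ ?_
      have := (integrable_moll hηc (φ k).hasCompactSupport_normed hgl x).comp_sub_left x
      simpa using this
    · exact integrable_const _
  have hmeas : AEStronglyMeasurable
      (Function.uncurry fun y x : HornSpace n => g (x - y) - g x) (ν.prod volume) := by
    have hac : ν.prod (volume : Measure (HornSpace n)) ≪
        (volume : Measure (HornSpace n)).prod volume :=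
      (withDensity_absolutelyContinuous _ _).prod Measure.AbsolutelyContinuous.rfl
    refine AEStronglyMeasurable.mono_ac hac ?_
    refine AEStronglyMeasurable.sub ?_ ?_
    · have := hg.1.comp_quasiMeasurePreserving
        (quasiMeasurePreserving_sub_of_right_invariant (volume : Measure (HornSpace n)) volume)
      exact this.prod_swap
    · exact hg.1.comp_quasiMeasurePreserving Measure.quasiMeasurePreserving_snd
  rw [← ENNReal.pow_le_pow_left_iff two_ne_zero, eLpNorm_two_sq]
  simp_rw [e1]
  refine (lintegral_enorm_integral_sq_le hmeas).trans ?_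
  rw [hν1, one_mul]
  calc ∫⁻ y, (∫⁻ x, ‖g (x - y) - g x‖ₑ ^ 2) ∂ν ≤ ∫⁻ _, δ ^ 2 ∂ν := by
        refine lintegral_mono_ae ?_
        have : ∀ᵐ y ∂ν, y ∈ Metric.ball (0 : HornSpace n) r := by
          rw [hν, ae_withDensity_iff hηm]
          refine ae_of_all _ fun y hy => ?_
          have : y ∈ Function.support η := fun h0 => hy (by simp [h0])
          rw [hη, (φ k).support_normed_eq] at this
          exact Metric.ball_subset_ball hk.le this
        filter_upwards [this] with y hy
        rw [← eLpNorm_two_sq]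
        gcongr
        exact hball (by simpa using hy)
    _ = δ ^ 2 := by simp [hν1]

/-- A compactly supported `L²` function with an `L²` weak gradient is mollified: the convolution is
smooth, and its gradient is the convolution of the gradient. -/
theorem moll_smooth (φ : ContDiffBump (0 : HornSpace n)) {f : HornSpace n → ℝ}
    {V : HornSpace n → HornSpace n} (hf : LocallyIntegrable f) (hV : LocallyIntegrable V)
    (h : ∀ ψ : HornSpace n → ℝ, ContDiff ℝ ∞ ψ → HasCompactSupport ψ → ∀ v : HornSpace n,
      ∫ x, f x * fderiv ℝ ψ x v = -∫ x, inner ℝ (V x) v * ψ x) :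
    ContDiff ℝ ∞ (moll (φ.normed volume) f) ∧
      ∀ x, gradient (moll (φ.normed volume) f) x = moll (φ.normed volume) V x := by
  set η := φ.normed volume
  have hη : ContDiff ℝ ∞ η := φ.contDiff_normed
  have hηc : HasCompactSupport η := φ.hasCompactSupport_normed
  have e : moll η f = convolution f η (ContinuousLinearMap.mul ℝ ℝ) volume := by
    ext x
    simp [moll, convolution_def, mul_comm]
  refine ⟨?_, fun x => ?_⟩
  · rw [e]
    exact hηc.contDiff_convolution_right _ hf hη
  · refine ext_inner_right ℝ fun v => ?_
    rw [inner_gradient_apply, e]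
    rw [(hηc.hasFDerivAt_convolution_right (ContinuousLinearMap.mul ℝ ℝ) hf
      (hη.of_le (by simp)) x).fderiv, convolution_precompR_apply _ hf (hηc.fderiv ℝ)
      (hη.continuous_fderiv (by simp))]
    have h1 := h (fun y => η (x - y)) (hη.comp (contDiff_const.sub contDiff_id))
      (hηc.comp_homeomorph (Homeomorph.subLeft x)) v
    have h2 : ∀ y, fderiv ℝ (fun y => η (x - y)) y v = -(fderiv ℝ η (x - y) v) := by
      intro y
      have h3 : HasFDerivAt (fun y : HornSpace n => x - y) (-ContinuousLinearMap.id ℝ _) y :=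
        (hasFDerivAt_id y).const_sub x
      have h4 := ((hη.differentiable (by simp) (x - y)).hasFDerivAt.comp y h3).fderiv
      change fderiv ℝ (η ∘ fun y => x - y) y v = _
      rw [h4]; simp
    simp_rw [h2, mul_neg, integral_neg, neg_inj] at h1
    rw [convolution_def]
    simp only [ContinuousLinearMap.mul_apply']
    rw [h1, moll, real_inner_comm,
      ← integral_inner (integrable_moll hη.continuous hηc hV x)]
    simp only [inner_smul_right]
    congr 1; ext y
    rw [real_inner_comm, mul_comm]

section

variable {n : ℕ} {β : ℝ}

section

variable [hn : Fact (2 ≤ n)] [hβ : Fact (0 < β)]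

/-! ### Weak gradients -/

theorem integrableOn_of_memLp {E : Type*} [NormedAddCommGroup E] [NormedSpace ℝ E] {b : ℝ}
    {f : HornSpace n → E} (hf : MemLp f 2 (wm n β b)) {K : Set (HornSpace n)} (hK : IsCompact K)
    (hK0 : K ⊆ {0}ᶜ) : IntegrableOn f K := by
  have h1 : IntegrableOn f K (wm n β b) := by
    have : IsFiniteMeasure ((wm n β b).restrict K) := ⟨by
      rw [Measure.restrict_apply_univ]; exact hK.measure_lt_top⟩
    exact (hf.restrict K).integrable (by norm_num)
  have h2 : IntegrableOn (fun x => dens n β b x • f x) K := by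
    have h3 : (wm n β b).restrict K = (volume.restrict K).withDensity
        fun x => ENNReal.ofReal (dens n β b x) := by
      unfold wm; rw [restrict_withDensity hK.measurableSet]
    rw [IntegrableOn, h3, integrable_withDensity_iff_integrable_smul'
      (measurable_dens b).ennreal_ofReal (by simp)] at h1
    rw [IntegrableOn]
    simpa only [ENNReal.toReal_ofReal (dens_nonneg b _)] using h1
  have h4 : ContinuousOn (fun x => (dens n β b x)⁻¹) K :=
    (continuous_dens b).continuousOn.inv₀ fun x hx => (dens_pos b (hK0 hx)).ne'
  refine (h2.continuousOn_smul h4 hK).congr_fun (fun x hx => ?_) hK.measurableSet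
  simp [smul_smul, inv_mul_cancel₀ (dens_pos b (hK0 hx)).ne']

theorem locallyIntegrableOn_of_memLp {E : Type*} [NormedAddCommGroup E] [NormedSpace ℝ E] {b : ℝ}
    {f : HornSpace n → E} (hf : MemLp f 2 (wm n β b)) : LocallyIntegrableOn f {0}ᶜ :=
  (locallyIntegrableOn_iff isOpen_compl_singleton.isLocallyClosed).mpr fun _ hK0 hK =>
    integrableOn_of_memLp hf hK hK0

theorem locallyIntegrableOn_fiber {E E' : Type*} [NormedAddCommGroup E] [NormedSpace ℝ E]
    [NormedAddCommGroup E'] [NormedSpace ℝ E'] {L : HornSpace n → E →L[ℝ] E'}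
    (hL : ContinuousOn L {0}ᶜ) (hLm : StronglyMeasurable L) {f : HornSpace n → E}
    (hf : LocallyIntegrableOn f {0}ᶜ) : LocallyIntegrableOn (fun x => L x (f x)) {0}ᶜ := by
  rw [locallyIntegrableOn_iff isOpen_compl_singleton.isLocallyClosed] at hf ⊢
  intro K hK0 hK
  obtain ⟨C, hC⟩ := hK.exists_bound_of_continuousOn (hL.mono hK0)
  refine Integrable.mono' ((hf K hK0 hK).norm.const_mul C)
    (ContinuousLinearMap.aestronglyMeasurable_comp₂
      (ContinuousLinearMap.id ℝ (E →L[ℝ] E')) hLm.aestronglyMeasurable (hf K hK0 hK).1) ?_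
  filter_upwards [ae_restrict_mem hK.measurableSet] with x hx
  exact ((L x).le_opNorm _).trans (mul_le_mul_of_nonneg_right (hC x hx) (norm_nonneg _))

/-- Pairing with a continuous function supported away from the tip is a bounded functional on every
weighted `L²` space. -/
theorem exists_inner_eq_integral {E : Type*} [NormedAddCommGroup E] [InnerProductSpace ℝ E]
    (b : ℝ) {g : HornSpace n → E} (hg : Continuous g) (hc : HasCompactSupport g)
    (hs : tsupport g ⊆ {0}ᶜ) :
    ∃ G : Lp E 2 (wm n β b), ∀ f : Lp E 2 (wm n β b),
      Integrable (fun x => inner ℝ (f x) (g x)) ∧ inner ℝ f G = ∫ x, inner ℝ (f x) (g x) := by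
  have h1 : ContinuousOn (fun x => (dens n β b x)⁻¹ • ContinuousLinearMap.id ℝ E) {0}ᶜ :=
    ((continuous_dens b).continuousOn.inv₀ fun x hx => (dens_pos b hx).ne').smul
      continuousOn_const
  have h2 := continuous_fiber h1 hg hs
  have h3 := hasCompactSupport_fiber
    (fun x => (dens n β b x)⁻¹ • ContinuousLinearMap.id ℝ E) hc
  have h4 := memLp_of_hasCompactSupport (β := β) b h2 h3
  refine ⟨h4.toLp, fun f => ?_⟩
  have e : (fun x => dens n β b x • inner ℝ (f x) (h4.toLp _ x)) =ᵐ[volume]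
      fun x => inner ℝ (f x) (g x) := by
    filter_upwards [ae_eq_wm.mp h4.coeFn_toLp, ae_ne_zero] with x hx hx0
    rw [hx]
    simp [inner_smul_right, mul_inv_cancel_left₀ (dens_pos b hx0).ne']
  constructor
  · exact (integrable_congr e).mp (integrable_wm b |>.mp (L2.integrable_inner f _))
  · rw [L2.inner_def, integral_wm, integral_congr_ae e]

theorem inner_frameInv (ε : ℝ) (x v w : HornSpace n) :
    inner ℝ (frameInv ε x v) w = inner ℝ v (frameInv ε x w) := by
  simp only [frameInv_apply, inner_add_left, inner_add_right, inner_smul_left, inner_smul_right,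
    inner_sub_left, inner_sub_right, inner_radProj_right, RCLike.conj_to_real]

theorem tsupport_fderiv_apply_subset (φ : HornSpace n → ℝ) (v : HornSpace n) :
    tsupport (fun x => fderiv ℝ φ x v) ⊆ tsupport φ := by
  refine (closure_mono fun x hx h0 => ?_).trans (tsupport_fderiv_subset ℝ (f := φ))
  simp only [Function.mem_support] at hx
  exact hx (by simp [h0])

/-- The elements of the weighted Sobolev space are weakly differentiable. -/
theorem isHornWeakGrad_of_mem_Gam {ε b : ℝ}
    {p : Lp ℝ 2 (wm n β b) × Lp (HornSpace n) 2 (wm n β b)} (hp : p ∈ Gam n β ε b) :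
    IsHornWeakGrad (p.1 : HornSpace n → ℝ) (fun x => frameInv ε x (p.2 x)) where
  locInt := locallyIntegrableOn_of_memLp (Lp.memLp p.1)
  locInt_grad := locallyIntegrableOn_fiber (continuousOn_frameInv ε)
    (stronglyMeasurable_frameInv ε) (locallyIntegrableOn_of_memLp (Lp.memLp p.2))
  by_parts := by
    intro φ hφ hφc hφs v
    have hT : IsTest φ := ⟨hφ, hφc, hφs⟩
    have hd : Continuous fun x => fderiv ℝ φ x v := by
      have := hφ.continuous_fderiv (by simp); fun_prop
    obtain ⟨G, hG⟩ := exists_inner_eq_integral (β := β) b hd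
      ((hφc.fderiv ℝ).mono fun x hx h0 => by
        simp only [Function.mem_support] at hx; exact hx (by simp [h0]))
      ((tsupport_fderiv_apply_subset φ v).trans hφs)
    have hc0 : Continuous fun x => φ x • v := hφ.continuous.smul continuous_const
    have hs0 : tsupport (fun x => φ x • v) ⊆ {0}ᶜ :=
      (tsupport_smul_subset_left φ _).trans hφs
    have hc1 : Continuous fun x => frameInv ε x (φ x • v) :=
      continuous_fiber (continuousOn_frameInv ε) hc0 hs0
    obtain ⟨G', hG'⟩ := exists_inner_eq_integral (β := β) b hc1
      (hasCompactSupport_fiber _ hφc.smul_right)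
      ((closure_mono fun x hx h0 => by
        simp only [Function.mem_support] at hx; exact hx (by simp [h0])).trans hφs)
    have key : p ∈ {q : Lp ℝ 2 (wm n β b) × Lp (HornSpace n) 2 (wm n β b) |
        inner ℝ q.1 G = -inner ℝ q.2 G'} := by
      refine Gam_induction (isClosed_eq (by fun_prop) (by fun_prop)) (fun ψ hψ => ?_) p hp
      simp only [mem_ofPred_eq]
      rw [(hG _).2, (hG' _).2]
      have e1 : ∫ x, inner ℝ (hψ.lp β b x) (fderiv ℝ φ x v) = ∫ x, ψ x * fderiv ℝ φ x v := by
        refine integral_congr_ae ?_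
        filter_upwards [hψ.coeFn_lp (β := β) b] with x hx
        rw [hx]; simp [mul_comm]
      have e2 : ∫ x, inner ℝ (hψ.lpGrad β ε b x) (frameInv ε x (φ x • v)) =
          ∫ x, fderiv ℝ ψ x v * φ x := by
        refine integral_congr_ae ?_
        filter_upwards [hψ.coeFn_lpGrad (β := β) ε b, ae_ne_zero] with x hx hx0
        rw [hx, ← inner_frameInv, frameInv_frame ε hx0, inner_smul_right, inner_gradient_apply,
          mul_comm]
      rw [e1, e2]
      have c1 := hψ.smooth.continuous
      have c2 := hφ.continuous
      have c3 : Continuous fun x => fderiv ℝ ψ x v := by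
        have := hψ.smooth.continuous_fderiv (by simp); fun_prop
      exact integral_mul_fderiv_eq_neg_fderiv_mul_of_integrable
        ((c3.mul c2).integrable_of_hasCompactSupport hφc.mul_left)
        ((c1.mul hd).integrable_of_hasCompactSupport hψ.compact.mul_right)
        ((c1.mul c2).integrable_of_hasCompactSupport hφc.mul_left)
        (fun x _ => hψ.differentiableAt x) (fun x _ => hT.differentiableAt x)
    simp only [mem_ofPred_eq] at key
    rw [(hG _).2, (hG' _).2] at key
    convert key using 1
    · congr 1; ext x; simp [mul_comm]
    · congr 2; ext x; rw [map_smul, inner_smul_right, inner_frameInv, mul_comm]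

theorem _root_.IsHornWeakGrad.ae_eq {f f' : HornSpace n → ℝ} {V V' : HornSpace n → HornSpace n}
    (h : IsHornWeakGrad f V) (h' : IsHornWeakGrad f' V') (hff : f =ᵐ[volume] f') :
    V =ᵐ[volume] V' := by
  have key : ∀ᵐ x : HornSpace n, x ∈ ({0}ᶜ : Set (HornSpace n)) → V x - V' x = 0 := by
    refine isOpen_compl_singleton.ae_eq_zero_of_integral_contDiff_smul_eq_zero
      (h.locInt_grad.sub h'.locInt_grad) fun φ hφ hφc hφs => ?_
    have hi : ∀ {W : HornSpace n → HornSpace n}, LocallyIntegrableOn W {0}ᶜ →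
        Integrable fun x => φ x • W x := by
      intro W hW
      have h1 : IntegrableOn (fun x => φ x • W x) (tsupport φ) :=
        ((locallyIntegrableOn_iff isOpen_compl_singleton.isLocallyClosed).mp hW _ hφs
          hφc).continuousOn_smul hφ.continuous.continuousOn hφc
      refine (integrableOn_iff_integrable_of_support_subset fun x hx => ?_).mp h1
      exact subset_tsupport φ fun h0 => hx (by simp [h0])
    refine ext_inner_right ℝ fun v => ?_
    have i1 := hi h.locInt_grad
    have i2 := hi h'.locInt_grad
    simp_rw [smul_sub]
    rw [integral_sub i1 i2, inner_sub_left, real_inner_comm, ← integral_inner i1,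
      real_inner_comm v, ← integral_inner i2]
    have e1 := h.by_parts φ hφ hφc hφs v
    have e2 := h'.by_parts φ hφ hφc hφs v
    have e3 : ∫ x, f x * fderiv ℝ φ x v = ∫ x, f' x * fderiv ℝ φ x v :=
      integral_congr_ae (by filter_upwards [hff] with x hx; rw [hx])
    simp only [inner_smul_right, inner_zero_left]
    simp only [mul_comm (inner ℝ _ _)] at e1 e2
    simp only [real_inner_comm] at e1 e2
    linarith
  filter_upwards [key, ae_ne_zero] with x hx hx0
  exact sub_eq_zero.mp (hx hx0)

theorem _root_.IsHornWeakGrad.congr {f f' : HornSpace n → ℝ} {V : HornSpace n → HornSpace n}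
    (h : IsHornWeakGrad f V) (hff : f =ᵐ[volume] f') : IsHornWeakGrad f' V where
  locInt := h.locInt.congr (ae_restrict_of_ae hff)
  locInt_grad := h.locInt_grad
  by_parts φ hφ hφc hφs v := by
    rw [← h.by_parts φ hφ hφc hφs v]
    exact integral_congr_ae (by filter_upwards [hff] with x hx; rw [hx])

end

end

section

variable {n : ℕ} {β : ℝ}

section

variable [hn : Fact (2 ≤ n)] [hβ : Fact (0 < β)]

/-! ### Approximation of compactly supported functions -/

theorem memLp_volume_of_fiber {E E' : Type*} [NormedAddCommGroup E] [NormedSpace ℝ E]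
    [NormedAddCommGroup E'] [NormedSpace ℝ E'] {b : ℝ} {g : HornSpace n → E →L[ℝ] E'}
    (hg : Continuous g) (hc : HasCompactSupport g) (hs : tsupport g ⊆ {0}ᶜ)
    {f : HornSpace n → E} (hf : MemLp f 2 (wm n β b)) :
    MemLp (fun x => g x (f x)) 2 volume := by
  have h1 : ContinuousOn (fun x => (dens n β b x)⁻¹ • ContinuousLinearMap.id ℝ ℝ) {0}ᶜ :=
    ((continuous_dens b).continuousOn.inv₀ fun x hx => (dens_pos b hx).ne').smul
      continuousOn_const
  have hn2 : Continuous fun x => ‖g x‖ ^ 2 := by fun_prop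
  have hs2 : tsupport (fun x => ‖g x‖ ^ 2) ⊆ tsupport g := closure_mono fun x hx h0 => by
    simp only [Function.mem_support] at hx; exact hx (by simp [h0])
  have h2 := continuous_fiber h1 hn2 (hs2.trans hs)
  have hc2 : HasCompactSupport fun x => ‖g x‖ ^ 2 := hc.mono fun x hx h0 => by
    simp only [Function.mem_support] at hx; exact hx (by simp [h0])
  obtain ⟨C, hC⟩ := h2.bounded_above_of_compact_support (hasCompactSupport_fiber _ hc2)
  have hC' : ∀ x, ‖g x‖ ^ 2 ≤ C * dens n β b x := by
    intro x
    by_cases hx : x = 0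
    · have : g x = 0 := image_eq_zero_of_notMem_tsupport fun h => hs h hx
      rw [this]
      have h0 : 0 ≤ C := (norm_nonneg _).trans (hC 0)
      have := mul_nonneg h0 (dens_nonneg (n := n) (β := β) b x)
      simpa using this
    · have h3 := hC x
      have hp := dens_pos (n := n) (β := β) b hx
      simp only [_root_.smul_apply, ContinuousLinearMap.id_apply, smul_eq_mul, norm_mul,
        norm_inv, norm_pow, norm_norm] at h3
      rw [Real.norm_of_nonneg hp.le, inv_mul_le_iff₀ hp] at h3
      linarith
  have hC0 : 0 ≤ C := (norm_nonneg _).trans (hC 0)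
  have hm : AEStronglyMeasurable (fun x => g x (f x)) volume :=
    ContinuousLinearMap.aestronglyMeasurable_comp₂
      (ContinuousLinearMap.id ℝ (E →L[ℝ] E')) hg.aestronglyMeasurable
      (aestronglyMeasurable_wm.mp hf.1)
  refine ⟨hm, ?_⟩
  have h4 : eLpNorm (fun x => g x (f x)) 2 volume ^ 2 < ⊤ := by
    rw [eLpNorm_two_sq]
    calc ∫⁻ x, ‖g x (f x)‖ₑ ^ 2 ≤ ∫⁻ x, ENNReal.ofReal C *
          (ENNReal.ofReal (dens n β b x) * ‖f x‖ₑ ^ 2) := by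
          refine lintegral_mono fun x => ?_
          rw [← ofReal_norm, ← ofReal_norm, ← ENNReal.ofReal_pow (norm_nonneg _),
            ← ENNReal.ofReal_pow (norm_nonneg _), ← ENNReal.ofReal_mul (dens_nonneg _ _),
            ← ENNReal.ofReal_mul hC0]
          apply ENNReal.ofReal_le_ofReal
          calc ‖g x (f x)‖ ^ 2 ≤ (‖g x‖ * ‖f x‖) ^ 2 := by gcongr; exact (g x).le_opNorm _
            _ = ‖g x‖ ^ 2 * ‖f x‖ ^ 2 := mul_pow _ _ _
            _ ≤ C * dens n β b x * ‖f x‖ ^ 2 := by gcongr; exact hC' x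
            _ = _ := by ring
      _ = ENNReal.ofReal C * eLpNorm f 2 (wm n β b) ^ 2 := by
          rw [lintegral_const_mul' _ _ (by simp), ← lintegral_wm, eLpNorm_two_sq]
      _ < ⊤ := ENNReal.mul_lt_top (by simp) (ENNReal.pow_lt_top hf.2)
  simpa using h4

theorem exists_eLpNorm_fiber_le {E E' : Type*} [NormedAddCommGroup E] [NormedSpace ℝ E]
    [NormedAddCommGroup E'] [NormedSpace ℝ E'] (b : ℝ) {L : HornSpace n → E →L[ℝ] E'}
    (hL : ContinuousOn L {0}ᶜ) {K : Set (HornSpace n)} (hK : IsCompact K) (hK0 : K ⊆ {0}ᶜ) :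
    ∃ C : NNReal, ∀ f : HornSpace n → E, (∀ x ∉ K, f x = 0) →
      eLpNorm (fun x => L x (f x)) 2 (wm n β b) ≤ C * eLpNorm f 2 volume := by
  obtain ⟨M, hM⟩ := hK.exists_bound_of_continuousOn (hL.mono hK0)
  obtain ⟨M', hM'⟩ := hK.exists_bound_of_continuousOn
    (continuous_dens (n := n) (β := β) b).continuousOn
  set C := (max M' 0) * (max M 0) ^ 2
  have hC0 : 0 ≤ C := by positivity
  refine ⟨Real.toNNReal (√C), fun f hf => eLpNorm_two_le ?_⟩
  rw [lintegral_wm]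
  change _ ≤ (ENNReal.ofReal _) ^ 2 * _
  rw [← ENNReal.ofReal_pow (Real.sqrt_nonneg _), Real.sq_sqrt hC0,
    ← lintegral_const_mul' _ _ (by simp)]
  refine lintegral_mono fun x => ?_
  by_cases hx : x ∈ K
  · rw [← ofReal_norm, ← ofReal_norm, ← ENNReal.ofReal_pow (norm_nonneg _),
      ← ENNReal.ofReal_pow (norm_nonneg _), ← ENNReal.ofReal_mul (dens_nonneg _ _),
      ← ENNReal.ofReal_mul hC0]
    apply ENNReal.ofReal_le_ofReal
    have h1 : dens n β b x ≤ max M' 0 := (le_abs_self _).trans ((hM' x hx).trans (le_max_left _ _))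
    have h2 : ‖L x (f x)‖ ≤ max M 0 * ‖f x‖ :=
      ((L x).le_opNorm _).trans (mul_le_mul_of_nonneg_right ((hM x hx).trans (le_max_left _ _))
        (norm_nonneg _))
    calc dens n β b x * ‖L x (f x)‖ ^ 2 ≤ max M' 0 * (max M 0 * ‖f x‖) ^ 2 := by
          gcongr
      _ = _ := by ring
  · simp [hf x hx]

/-- The product with a cutoff vanishing near the tip has a weak gradient on all of `ℝⁿ`, so that it
can be mollified. -/
theorem _root_.IsHornWeakGrad.by_parts_mul {f : HornSpace n → ℝ} {V : HornSpace n → HornSpace n}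
    (h : IsHornWeakGrad f V) {χ : HornSpace n → ℝ} (hχ : IsTest χ) {φ : HornSpace n → ℝ}
    (hφ : ContDiff ℝ ∞ φ) (v : HornSpace n) :
    ∫ x, χ x * f x * fderiv ℝ φ x v =
      -∫ x, inner ℝ (χ x • V x + f x • gradient χ x) v * φ x := by
  have hT : IsTest fun x => χ x * φ x := hχ.mul_contDiffAt fun _ _ => hφ.contDiffAt
  have h1 := h.by_parts _ hT.smooth hT.compact hT.supp v
  have hloc : ∀ {g : HornSpace n → ℝ}, Continuous g → tsupport g ⊆ tsupport χ →
      Integrable fun x => f x * g x := by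
    intro g hg hgs
    have h1 : IntegrableOn (fun x => f x * g x) (tsupport χ) :=
      ((locallyIntegrableOn_iff isOpen_compl_singleton.isLocallyClosed).mp h.locInt _ hχ.supp
        hχ.compact).mul_continuousOn hg.continuousOn hχ.compact
    refine (integrableOn_iff_integrable_of_support_subset fun x hx => hgs ?_).mp h1
    exact subset_tsupport g fun h0 => hx (by simp [h0])
  have hlocV : Integrable fun x => inner ℝ (V x) v * (χ x * φ x) := by
    have h0 : LocallyIntegrableOn (fun x => innerSL ℝ v (V x)) {0}ᶜ :=
      locallyIntegrableOn_fiber (L := fun _ => innerSL ℝ v) continuousOn_const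
        stronglyMeasurable_const h.locInt_grad
    have h1 : IntegrableOn (fun x => innerSL ℝ v (V x) * (χ x * φ x)) (tsupport χ) :=
      ((locallyIntegrableOn_iff isOpen_compl_singleton.isLocallyClosed).mp h0 _ hχ.supp
        hχ.compact).mul_continuousOn (hT.smooth.continuous.continuousOn) hχ.compact
    have h2 := (integrableOn_iff_integrable_of_support_subset fun x hx => ?_).mp h1
    · refine h2.congr (ae_of_all _ fun x => ?_)
      simp [real_inner_comm]
    · exact subset_tsupport χ fun h0 => hx (by simp [h0])
  have c1 := hχ.smooth.continuous
  have c2 := hφ.continuous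
  have c3 : Continuous fun x => fderiv ℝ χ x v := by
    have := hχ.smooth.continuous_fderiv (by simp); fun_prop
  have c4 : Continuous fun x => fderiv ℝ φ x v := by
    have := hφ.continuous_fderiv (by simp); fun_prop
  have i1 : Integrable fun x => f x * (χ x * fderiv ℝ φ x v) :=
    hloc (c1.mul c4) tsupport_mul_subset_left
  have i2 : Integrable fun x => f x * (fderiv ℝ χ x v * φ x) :=
    hloc (c3.mul c2) (tsupport_mul_subset_left.trans (tsupport_fderiv_apply_subset χ v))
  have e1 : ∀ x, f x * fderiv ℝ (fun x => χ x * φ x) x v =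
      f x * (χ x * fderiv ℝ φ x v) + f x * (fderiv ℝ χ x v * φ x) := by
    intro x
    rw [fderiv_fun_mul (hχ.differentiableAt x) (hφ.differentiable (by simp) x)]
    simp; ring
  simp_rw [e1] at h1
  rw [integral_add i1 i2] at h1
  have e2 : ∫ x, inner ℝ (χ x • V x + f x • gradient χ x) v * φ x =
      (∫ x, inner ℝ (V x) v * (χ x * φ x)) + ∫ x, f x * (fderiv ℝ χ x v * φ x) := by
    rw [← integral_add hlocV i2]
    congr 1; ext x
    rw [inner_add_left, inner_smul_left, inner_smul_left, inner_gradient_apply]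
    simp; ring
  have e3 : ∫ x, χ x * f x * fderiv ℝ φ x v = ∫ x, f x * (χ x * fderiv ℝ φ x v) := by
    congr 1; ext x; ring
  rw [e2, e3]; linarith

theorem memLp_volume_cut {ε b : ℝ} {f : HornSpace n → ℝ} {V : HornSpace n → HornSpace n}
    (hf : MemLp f 2 (wm n β b)) (hV : MemLp (fun x => frame ε x (V x)) 2 (wm n β b))
    {χ : HornSpace n → ℝ} (hχ : IsTest χ) :
    MemLp (fun x => χ x • V x + f x • gradient χ x) 2 volume := by
  have h1 : MemLp (fun x => χ x • V x) 2 volume := by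
    have hsup : Function.support (fun x : HornSpace n => χ x • frameInv ε x) ⊆ Function.support χ := by
      intro x hx h0
      rw [Function.mem_support, h0] at hx
      exact hx (zero_smul ℝ (frameInv ε x))
    have hgs : tsupport (fun x : HornSpace n => χ x • frameInv ε x) ⊆ {0}ᶜ := (closure_mono hsup).trans hχ.supp
    have hgo : ContinuousOn (fun x : HornSpace n => χ x • frameInv ε x) {0}ᶜ :=
      ContinuousOn.smul hχ.smooth.continuous.continuousOn (continuousOn_frameInv ε)
    have hgc : Continuous fun x : HornSpace n => χ x • frameInv ε x :=
      hgo.continuous_of_tsupport_subset isOpen_compl_singleton hgs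
    have h0 : MemLp (fun x => (χ x • frameInv ε x) (frame ε x (V x))) 2 volume :=
      memLp_volume_of_fiber hgc (hχ.compact.mono hsup) hgs hV
    refine (memLp_congr_ae ?_).mp h0
    filter_upwards [ae_ne_zero] with x hx
    rw [_root_.smul_apply, frameInv_frame ε hx]
  have h2 : MemLp (fun x => f x • gradient χ x) 2 volume := by
    have hc : Continuous fun x =>
        ContinuousLinearMap.toSpanSingleton ℝ (gradient χ x) :=
      (ContinuousLinearMap.toSpanSingletonLIE ℝ (HornSpace n)).continuous.comp
        hχ.continuous_gradient
    have hsup : tsupport (fun x => ContinuousLinearMap.toSpanSingleton ℝ (gradient χ x)) ⊆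
        tsupport χ := by
      refine (closure_mono fun x hx h0 => ?_).trans IsTest.tsupport_gradient
      simp only [Function.mem_support] at hx
      exact hx (by simp [h0])
    exact memLp_volume_of_fiber hc
      (hχ.compact.mono' ((subset_tsupport _).trans hsup)) (hsup.trans hχ.supp) hf
  exact h1.add h2

/-- Multiplication by a test function maps weakly differentiable functions into the closure of the
test functions; this is proved by mollification. -/
theorem _root_.IsHornWeakGrad.cut_mem_Gam {ε b : ℝ} {f : HornSpace n → ℝ}
    {V : HornSpace n → HornSpace n}
    (h : IsHornWeakGrad f V) (hf : MemLp f 2 (wm n β b))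
    (hV : MemLp (fun x => frame ε x (V x)) 2 (wm n β b))
    {χ : HornSpace n → ℝ} (hχ : IsTest χ) :
    ∃ p ∈ Gam n β ε b, p.1 =ᵐ[volume] (fun x => χ x * f x) ∧
      p.2 =ᵐ[volume] fun x => frame ε x (χ x • V x + f x • gradient χ x) := by
  set f1 : HornSpace n → ℝ := fun x => χ x * f x with hf1
  set W : HornSpace n → HornSpace n := fun x => χ x • V x + f x • gradient χ x with hW
  have hf1L : MemLp f1 2 volume := by
    have := memLp_volume_of_fiber (g := fun x => χ x • ContinuousLinearMap.id ℝ ℝ)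
      (hχ.smooth.continuous.smul continuous_const) hχ.compact.smul_right
      ((tsupport_smul_subset_left _ _).trans hχ.supp) hf
    simpa [hf1] using this
  have hWL : MemLp W 2 volume := memLp_volume_cut hf hV hχ
  obtain ⟨δ, hδ, hδK⟩ := hχ.compact.isCompact.exists_cthickening_subset_open
    isOpen_compl_singleton hχ.supp
  set K := Metric.cthickening δ (tsupport χ) with hKdef
  have hK : IsCompact K := hχ.compact.isCompact.cthickening
  have hoff1 : ∀ x ∉ tsupport χ, f1 x = 0 := fun x hx => by
    simp [hf1, image_eq_zero_of_notMem_tsupport hx]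
  have hoffW : ∀ x ∉ tsupport χ, W x = 0 := fun x hx => by
    simp [hW, image_eq_zero_of_notMem_tsupport hx, IsTest.gradient_eq_zero hx]
  have hKs : tsupport χ ⊆ K := Metric.self_subset_cthickening _
  let φ : ℕ → ContDiffBump (0 : HornSpace n) := fun k =>
    ⟨δ / (k + 1) / 2, δ / (k + 1), by positivity, half_lt_self (by positivity)⟩
  have hφ : Tendsto (fun k => (φ k).rOut) atTop (𝓝 0) := by
    change Tendsto (fun k : ℕ => δ / ((k : ℝ) + 1)) atTop (𝓝 0)
    exact tendsto_const_nhds.div_atTop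
      (tendsto_atTop_add_const_right _ _ tendsto_natCast_atTop_atTop)
  have hmoff : ∀ {E : Type} [NormedAddCommGroup E] [NormedSpace ℝ E] {g : HornSpace n → E},
      (∀ x ∉ tsupport χ, g x = 0) → ∀ k, ∀ x ∉ K, moll ((φ k).normed volume) g x = 0 := by
    intro E _ _ g hg k x hx
    rw [moll]
    refine integral_eq_zero_of_ae (ae_of_all _ fun y => ?_)
    by_cases hy : y ∈ tsupport χ
    · have : (φ k).normed volume (x - y) = 0 := by
        by_contra hne
        have h1 : x - y ∈ Function.support ((φ k).normed volume) := hne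
        rw [(φ k).support_normed_eq, mem_ball_zero_iff] at h1
        have h2 : (φ k).rOut ≤ δ := by
          change δ / (k + 1) ≤ δ
          exact div_le_self hδ.le (by linarith [(Nat.cast_nonneg k : (0 : ℝ) ≤ k)])
        refine hx (Metric.mem_cthickening_of_dist_le x y δ _ hy ?_)
        rw [dist_eq_norm]; linarith
      simp [this]
    · simp [hg y hy]
  have hsm := fun k => moll_smooth (φ k) (hf1L.locallyIntegrable (by norm_num))
    (hWL.locallyIntegrable (by norm_num)) fun ψ hψ _ v => h.by_parts_mul hχ hψ v
  have hT : ∀ k, IsTest (moll ((φ k).normed volume) f1) := fun k =>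
    have hsub : tsupport (moll ((φ k).normed volume) f1) ⊆ K :=
      closure_minimal (fun x hx => by
        by_contra hxK; exact hx (hmoff hoff1 k x hxK)) Metric.isClosed_cthickening
    ⟨(hsm k).1, hK.of_isClosed_subset (isClosed_tsupport _) hsub, hsub.trans hδK⟩
  obtain ⟨C1, hC1⟩ := exists_eLpNorm_fiber_le (β := β) b
    (L := fun _ : HornSpace n => ContinuousLinearMap.id ℝ ℝ) continuousOn_const hK hδK
  obtain ⟨C2, hC2⟩ := exists_eLpNorm_fiber_le (β := β) b (continuousOn_frame (n := n) ε) hK hδK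
  have m1 : MemLp f1 2 (wm n β b) := by
    refine ⟨aestronglyMeasurable_wm.mpr hf1L.1, ?_⟩
    refine (hC1 f1 fun x hx => hoff1 x fun h' => hx (hKs h')).trans_lt ?_
    exact ENNReal.mul_lt_top ENNReal.coe_lt_top hf1L.2
  have m2 : MemLp (fun x => frame ε x (W x)) 2 (wm n β b) := by
    refine ⟨aestronglyMeasurable_wm.mpr (ContinuousLinearMap.aestronglyMeasurable_comp₂
      (ContinuousLinearMap.id ℝ (HornSpace n →L[ℝ] HornSpace n))
      (stronglyMeasurable_frame ε).aestronglyMeasurable hWL.1), ?_⟩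
    refine (hC2 W fun x hx => hoffW x fun h' => hx (hKs h')).trans_lt ?_
    exact ENNReal.mul_lt_top ENNReal.coe_lt_top hWL.2
  refine ⟨(m1.toLp, m2.toLp), ?_, ae_eq_wm.mp m1.coeFn_toLp, ae_eq_wm.mp m2.coeFn_toLp⟩
  refine (isClosed_Gam ε b).mem_of_tendsto (b := atTop)
    (f := fun k => ((hT k).lp β b, (hT k).lpGrad β ε b)) ?_
    (Eventually.of_forall fun k => (hT k).mem_Gam ε b)
  refine Tendsto.prodMk_nhds ?_ ?_
  · refine (Lp.tendsto_Lp_iff_tendsto_eLpNorm'' _ (fun k => (hT k).memLp b) f1 m1).mpr ?_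
    have t1 := ENNReal.Tendsto.const_mul (a := (C1 : ENNReal)) (tendsto_eLpNorm_moll hφ hf1L)
      (Or.inr ENNReal.coe_ne_top)
    rw [mul_zero] at t1
    refine tendsto_of_tendsto_of_tendsto_of_le_of_le tendsto_const_nhds t1 (fun _ => zero_le)
      fun k => ?_
    exact hC1 _ fun x hx => by
      rw [hmoff hoff1 k x hx, hoff1 x fun h' => hx (hKs h'), sub_zero]
  · refine (Lp.tendsto_Lp_iff_tendsto_eLpNorm'' _ (fun k => (hT k).memLp_grad ε b) _ m2).mpr ?_
    have t1 := ENNReal.Tendsto.const_mul (a := (C2 : ENNReal)) (tendsto_eLpNorm_moll hφ hWL)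
      (Or.inr ENNReal.coe_ne_top)
    rw [mul_zero] at t1
    refine tendsto_of_tendsto_of_tendsto_of_le_of_le tendsto_const_nhds t1 (fun _ => zero_le)
      fun k => ?_
    have e := hC2 (fun x => moll ((φ k).normed volume) W x - W x) fun x hx => by
      rw [hmoff hoffW k x hx, hoffW x fun h' => hx (hKs h'), sub_zero]
    refine le_trans (le_of_eq ?_) e
    congr 1; ext1 x
    simp only [Pi.sub_apply]
    rw [(hsm k).2 x, map_sub]

end

end

/-! ### Hardy's inequality and density of the test functions -/

section

variable {n : ℕ} {β : ℝ}

theorem deriv_smoothTransition_eq_zero {x : ℝ} (hx : x < 0 ∨ 1 < x) :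
    deriv Real.smoothTransition x = 0 := by
  rcases hx with hx | hx
  · have : Real.smoothTransition =ᶠ[𝓝 x] fun _ => 0 := by
      filter_upwards [gt_mem_nhds hx] with y hy
      exact Real.smoothTransition.zero_of_nonpos hy.le
    rw [this.deriv_eq]; simp
  · have : Real.smoothTransition =ᶠ[𝓝 x] fun _ => 1 := by
      filter_upwards [lt_mem_nhds hx] with y hy
      exact Real.smoothTransition.one_of_one_le hy.le
    rw [this.deriv_eq]; simp

theorem exists_deriv_smoothTransition_le :
    ∃ M : ℝ, 0 ≤ M ∧ ∀ x, deriv Real.smoothTransition x ≤ M := by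
  have hc : Continuous (deriv Real.smoothTransition) :=
    (Real.smoothTransition.contDiff (n := 1)).continuous_deriv (by simp)
  obtain ⟨C, hC⟩ := (isCompact_Icc (a := (0 : ℝ)) (b := 1)).exists_bound_of_continuousOn
    hc.continuousOn
  refine ⟨max C 0, le_max_right _ _, fun x => ?_⟩
  by_cases hx : x ∈ Icc (0 : ℝ) 1
  · exact (le_abs_self _).trans ((hC x hx).trans (le_max_left _ _))
  · rw [deriv_smoothTransition_eq_zero]
    · exact le_max_right _ _
    · by_contra h
      push Not at h
      exact hx h

theorem deriv_smoothTransition_nonneg (x : ℝ) : 0 ≤ deriv Real.smoothTransition x :=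
  Real.smoothTransition.monotone.deriv_nonneg

/-- A cutoff between `s = 1/k` and `s = 2m`; it is increasing near `1/k`. -/
def cut (k m s : ℝ) : ℝ := Real.smoothTransition (k * s - 1) * Real.smoothTransition (2 - s / m)

theorem cut_nonneg (k m s : ℝ) : 0 ≤ cut k m s :=
  mul_nonneg (Real.smoothTransition.nonneg _) (Real.smoothTransition.nonneg _)

theorem cut_le_one (k m s : ℝ) : cut k m s ≤ 1 :=
  mul_le_one₀ (Real.smoothTransition.le_one _) (Real.smoothTransition.nonneg _)
    (Real.smoothTransition.le_one _)

/-- The derivative of the cutoff. -/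
def cutDeriv (k m s : ℝ) : ℝ :=
  k * deriv Real.smoothTransition (k * s - 1) * Real.smoothTransition (2 - s / m) -
    Real.smoothTransition (k * s - 1) * (deriv Real.smoothTransition (2 - s / m) / m)

theorem contDiff_cut (k m : ℝ) : ContDiff ℝ ∞ (cut k m) := by
  unfold cut
  have h := Real.smoothTransition.contDiff (n := ⊤)
  exact (h.comp ((contDiff_const.mul contDiff_id).sub contDiff_const)).mul
    (h.comp (contDiff_const.sub (contDiff_id.div_const m)))

theorem hasDerivAt_cut (k m s : ℝ) : HasDerivAt (cut k m) (cutDeriv k m s) s := by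
  have hS : ∀ y, HasDerivAt Real.smoothTransition (deriv Real.smoothTransition y) y := fun y =>
    ((Real.smoothTransition.contDiff (n := 1)).differentiable (by simp) y).hasDerivAt
  have h1 : HasDerivAt (fun s => k * s - 1) k s := by
    simpa using ((hasDerivAt_id s).const_mul k).sub_const 1
  have h2 : HasDerivAt (fun s => 2 - s / m) (-(1 / m)) s := by
    simpa using ((hasDerivAt_id s).div_const m).const_sub 2
  refine (((hS _).comp s h1).mul ((hS _).comp s h2)).congr_deriv ?_
  simp only [cutDeriv, Function.comp]; ring

theorem gradient_cut (k m : ℝ) (x : HornSpace n) :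
    gradient (fun x : HornSpace n => cut k m (‖x‖ ^ 2)) x = (2 * cutDeriv k m (‖x‖ ^ 2)) • x := by
  refine ext_inner_right ℝ fun v => ?_
  rw [inner_gradient_apply]
  have h1 : HasFDerivAt (fun x : HornSpace n => ‖x‖ ^ 2) (2 • innerSL ℝ x) x :=
    (hasStrictFDerivAt_norm_sq x).hasFDerivAt
  have h2 := ((hasDerivAt_cut k m (‖x‖ ^ 2)).comp_hasFDerivAt x h1).fderiv
  change fderiv ℝ (cut k m ∘ fun x : HornSpace n => ‖x‖ ^ 2) x v = _
  rw [h2, inner_smul_left]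
  simp; ring

theorem isTest_cut (k : ℝ) {m : ℝ} (hm : 0 < m) :
    IsTest fun x : HornSpace n => cut k m (‖x‖ ^ 2) := by
  have hsub : tsupport (fun x : HornSpace n => cut k m (‖x‖ ^ 2)) ⊆
      {x | 1 ≤ k * ‖x‖ ^ 2} ∩ {x | ‖x‖ ^ 2 ≤ 2 * m} := by
    refine closure_minimal (fun x hx => ?_) ((isClosed_le (by fun_prop) (by fun_prop)).inter
      (isClosed_le (by fun_prop) (by fun_prop)))
    simp only [Function.mem_support, cut, mul_ne_zero_iff] at hx
    constructor
    · by_contra h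
      exact hx.1 (Real.smoothTransition.zero_of_nonpos (by simp at h; linarith))
    · by_contra h
      refine hx.2 (Real.smoothTransition.zero_of_nonpos ?_)
      simp only [mem_ofPred_eq, not_le] at h
      rw [sub_nonpos, le_div_iff₀ hm]; exact h.le
  refine ⟨(contDiff_cut k m).comp (contDiff_norm_sq ℝ), ?_, fun x hx h0 => ?_⟩
  · refine (isCompact_closedBall (0 : HornSpace n) (√(2 * m))).of_isClosed_subset
      (isClosed_tsupport _) fun x hx => ?_
    rw [mem_closedBall_zero_iff]
    exact Real.le_sqrt_of_sq_le (hsub hx).2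
  · have h1 := (hsub hx).1
    rw [mem_singleton_iff] at h0
    subst h0
    simp at h1
    linarith

theorem tendsto_eLpNorm_of_dominated {α E : Type*} [MeasurableSpace α] [NormedAddCommGroup E]
    {μ : Measure α} {F : ℕ → α → E} {f : α → E} {g : α → ℝ}
    (hF : ∀ k, AEStronglyMeasurable (F k) μ) (hg : MemLp g 2 μ)
    (hb : ∀ k, ∀ᵐ x ∂μ, ‖F k x‖ ≤ g x)
    (hlim : ∀ᵐ x ∂μ, Tendsto (fun k => F k x) atTop (𝓝 (f x))) :
    Tendsto (fun k => eLpNorm (F k - f) 2 μ) atTop (𝓝 0) := by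
  have hf : AEStronglyMeasurable f μ := aestronglyMeasurable_of_tendsto_ae atTop hF hlim
  have h1 : Tendsto (fun k => ∫⁻ x, ‖F k x - f x‖ₑ ^ 2 ∂μ) atTop (𝓝 (∫⁻ _, 0 ∂μ)) := by
    refine tendsto_lintegral_of_dominated_convergence' (fun x => ‖2 * g x‖ₑ ^ 2)
      (fun k => (((hF k).sub hf).enorm).pow_const 2) (fun k => ?_) ?_ ?_
    · filter_upwards [ae_all_iff.mpr hb, hlim] with x hx hl
      have hfx : ‖f x‖ ≤ g x := le_of_tendsto hl.norm (Eventually.of_forall hx)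
      gcongr
      rw [enorm_le_iff_norm_le]
      have h0 : 0 ≤ g x := (norm_nonneg _).trans hfx
      rw [Real.norm_of_nonneg (by positivity)]
      linarith [norm_sub_le (F k x) (f x), hx k]
    · rw [← eLpNorm_two_sq]
      exact (ENNReal.pow_lt_top (hg.const_mul 2).2).ne
    · filter_upwards [hlim] with x hl
      have h2 : Tendsto (fun k => ‖F k x - f x‖ₑ) atTop (𝓝 0) := by
        have := ((hl.sub_const (f x))).enorm
        simpa using this
      simpa using ENNReal.Tendsto.pow (n := 2) h2
  have h3 := (ENNReal.continuous_rpow_const (y := 1 / 2)).tendsto 0 |>.comp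
    (by simpa using h1 : Tendsto (fun k => ∫⁻ x, ‖F k x - f x‖ₑ ^ 2 ∂μ) atTop (𝓝 0))
  rw [ENNReal.zero_rpow_of_pos (by norm_num)] at h3
  refine h3.congr fun k => ?_
  have h4 := eLpNorm_two_sq (F k - f) μ
  simp only [Function.comp]
  simp only [Pi.sub_apply] at h4
  rw [← h4, ← ENNReal.rpow_natCast, ← ENNReal.rpow_mul]
  norm_num

section

variable [hn : Fact (2 ≤ n)] [hβ : Fact (0 < β)]

theorem IsTest.exists_abs_le {c : HornSpace n → ℝ} (h : IsTest c) : ∃ C : ℝ, ∀ x, |c x| ≤ C :=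
  h.compact.exists_bound_of_continuous h.smooth.continuous

/-- The identity `∫ f² div(c x) = -2 ∫ f ⟨x, ∇f⟩ c`, for a cutoff `c`. -/
theorem integral_sq_mul_div_eq {ε b : ℝ}
    {p : Lp ℝ 2 (wm n β b) × Lp (HornSpace n) 2 (wm n β b)} (hp : p ∈ Gam n β ε b)
    {c : HornSpace n → ℝ} (hc : IsTest c) :
    Integrable (fun x => p.1 x ^ 2 * ((hdim n β - 2 * b * ‖x‖ ^ 2) * c x + fderiv ℝ c x x))
        (wm n β b) ∧
      Integrable (fun x => p.1 x * inner ℝ x (p.2 x) * c x) (wm n β b) ∧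
      ∫ x, p.1 x ^ 2 * ((hdim n β - 2 * b * ‖x‖ ^ 2) * c x + fderiv ℝ c x x) ∂(wm n β b) =
        -2 * ∫ x, p.1 x * inner ℝ x (p.2 x) * c x ∂(wm n β b) := by
  set w : HornSpace n → ℝ := fun x => (hdim n β - 2 * b * ‖x‖ ^ 2) * c x + fderiv ℝ c x x
  have hcc := hc.smooth.continuous
  have hcd : Continuous fun x => fderiv ℝ c x x := by
    have := hc.smooth.continuous_fderiv (by simp); fun_prop
  have hw : Continuous w := by fun_prop
  have hwc : HasCompactSupport w :=
    hc.compact.mul_left.add ((hc.compact.fderiv ℝ).mono fun x hx h0 => by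
      simp only [Function.mem_support] at hx; exact hx (by simp [h0]))
  obtain ⟨C, hC⟩ := hwc.exists_bound_of_continuous hw
  let A : Lp ℝ 2 (wm n β b) →L[ℝ] Lp ℝ 2 (wm n β b) := mulOp ℝ b w hw.measurable ⟨C, hC⟩
  have hLc : Continuous fun x : HornSpace n => c x • innerSL ℝ x :=
    hcc.smul (innerSL ℝ).continuous
  have hLs : HasCompactSupport fun x : HornSpace n => c x • innerSL ℝ x :=
    hc.compact.mono fun x hx h0 => by
      simp only [Function.mem_support] at hx; exact hx (by simp [h0])
  obtain ⟨C', hC'⟩ := hLs.exists_bound_of_continuous hLc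
  let B : Lp (HornSpace n) 2 (wm n β b) →L[ℝ] Lp ℝ 2 (wm n β b) :=
    fiberMap b b one_pos (fun x => c x • innerSL ℝ x) hLc.stronglyMeasurable
      ⟨C', fun x => by simpa using hC' x⟩
  have hA : ∀ f, A f =ᵐ[volume] fun x => w x * f x := fun f => coeFn_mulOp b w _ _ f
  have hB : ∀ F, B F =ᵐ[volume] fun x => c x * inner ℝ x (F x) := fun F =>
    (coeFn_fiberMap one_pos _ _ _ F).trans (ae_of_all _ fun x => by simp)
  have eA : ∀ f : Lp ℝ 2 (wm n β b), (fun x => inner ℝ (f x) (A f x)) =ᵐ[wm n β b]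
      fun x => f x ^ 2 * w x := fun f => by
    filter_upwards [ae_eq_wm.mpr (hA f)] with x hx
    rw [hx]; simp; ring
  have eB : ∀ (f : Lp ℝ 2 (wm n β b)) (F), (fun x => inner ℝ (f x) (B F x)) =ᵐ[wm n β b]
      fun x => f x * inner ℝ x (F x) * c x := fun f F => by
    filter_upwards [ae_eq_wm.mpr (hB F)] with x hx
    rw [hx]; simp; ring
  refine ⟨(L2.integrable_inner _ _).congr (eA p.1),
    (L2.integrable_inner _ _).congr (eB p.1 p.2), ?_⟩
  rw [← integral_congr_ae (eA p.1), ← integral_congr_ae (eB p.1 p.2), ← L2.inner_def,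
    ← L2.inner_def]
  have key : p ∈ {q : Lp ℝ 2 (wm n β b) × Lp (HornSpace n) 2 (wm n β b) |
      inner ℝ q.1 (A q.1) = -2 * inner ℝ q.1 (B q.2)} := by
    refine Gam_induction (isClosed_eq (by fun_prop) (by fun_prop)) (fun φ hφ => ?_) p hp
    simp only [mem_ofPred_eq]
    rw [L2.inner_def, L2.inner_def, integral_congr_ae (eA _), integral_congr_ae (eB _ _)]
    have hT : IsTest fun x => φ x * φ x * c x := (hφ.mul hφ).mul hc
    have h1 := hT.integral_fderiv_self (β := β) b
    have h2 : ∀ x, fderiv ℝ (fun x => φ x * φ x * c x) x x =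
        2 * (φ x * fderiv ℝ φ x x * c x) + φ x ^ 2 * fderiv ℝ c x x := by
      intro x
      rw [fderiv_fun_mul ((hφ.differentiableAt x).fun_mul (hφ.differentiableAt x))
        (hc.differentiableAt x), fderiv_fun_mul (hφ.differentiableAt x) (hφ.differentiableAt x)]
      simp; ring
    simp_rw [h2] at h1
    have c1 := hφ.smooth.continuous
    have c2 : Continuous fun x => fderiv ℝ φ x x := by
      have := hφ.smooth.continuous_fderiv (by simp); fun_prop
    have ci : ∀ {g : HornSpace n → ℝ}, Continuous g → (∀ x, φ x = 0 → g x = 0) →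
        Integrable g (wm n β b) := fun hg h0 =>
      hg.integrable_of_hasCompactSupport (hφ.compact.mono fun x hx h => hx (h0 x h))
    rw [integral_add (ci (by fun_prop) fun x h => by simp [h])
      (ci (by fun_prop) fun x h => by simp [h]), integral_const_mul] at h1
    have e1 : ∫ x, hφ.lp β b x ^ 2 * w x ∂(wm n β b) =
        ∫ x, (φ x * φ x * c x * (hdim n β - 2 * b * ‖x‖ ^ 2) + φ x ^ 2 * fderiv ℝ c x x)
          ∂(wm n β b) := by
      refine integral_congr_ae ?_
      filter_upwards [ae_eq_wm.mpr (hφ.coeFn_lp (β := β) b)] with x hx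
      rw [hx]; simp only [w]; ring
    have e2 : ∫ x, hφ.lp β b x * inner ℝ x (hφ.lpGrad β ε b x) * c x ∂(wm n β b) =
        ∫ x, φ x * fderiv ℝ φ x x * c x ∂(wm n β b) := by
      refine integral_congr_ae ?_
      filter_upwards [ae_eq_wm.mpr (hφ.coeFn_lp (β := β) b),
        ae_eq_wm.mpr (hφ.coeFn_lpGrad (β := β) ε b)] with x hx hx'
      rw [hx, hx', inner_self_frame, real_inner_comm, inner_gradient_apply]
    rw [e1, e2, integral_add (ci (by fun_prop) fun x h => by simp [h])
      (ci (by fun_prop) fun x h => by simp [h])]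
    linarith
  exact key

/-- Hardy's inequality near the tip, for a function with a weak gradient away from the tip: the field
`x / ‖x‖²` has divergence `(d - 2) / ‖x‖²` up to bounded terms, and `d > 2`. Nothing is assumed on the
behaviour at the tip; cutoffs that increase with `‖x‖` near the tip contribute with a good sign. -/
theorem _root_.IsHornWeakGrad.memLp_hardy {ε b : ℝ} {f : HornSpace n → ℝ}
    {V : HornSpace n → HornSpace n}
    (h : IsHornWeakGrad f V) (hf : MemLp f 2 (wm n β b))
    (hV : MemLp (fun x => frame ε x (V x)) 2 (wm n β b)) :
    MemLp (fun x => Real.smoothTransition (2 - ‖x‖ ^ 2) ^ 2 * f x * ‖x‖⁻¹) 2 (wm n β b) := by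
  obtain ⟨M, hM0, hM⟩ := exists_deriv_smoothTransition_le
  have hd : 0 < hdim n β - 2 := by
    have h1 : (2 : ℝ) ≤ n := by exact_mod_cast hn.out
    have := hβ.out
    unfold hdim; linarith
  set δ := hdim n β - 2 with hδ
  have hfi : Integrable (fun x => f x ^ 2) (wm n β b) := hf.integrable_sq
  have hVi : Integrable (fun x => ‖frame ε x (V x)‖ ^ 2) (wm n β b) :=
    (memLp_two_iff_integrable_sq_norm hV.1).mp hV
  set R : ℝ := ∫ x, ((2 * |b| + 8 * M) * f x ^ 2 + 2 / δ * ‖frame ε x (V x)‖ ^ 2) ∂(wm n β b)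
  have hRi : Integrable (fun x => (2 * |b| + 8 * M) * f x ^ 2 +
      2 / δ * ‖frame ε x (V x)‖ ^ 2) (wm n β b) := (hfi.const_mul _).add (hVi.const_mul _)
  -- the bound for the cutoff at `‖x‖² = 1 / k`
  have key : ∀ k : ℕ, 2 ≤ k →
      ∫⁻ x, ENNReal.ofReal (cut k 1 (‖x‖ ^ 2) ^ 4 * f x ^ 2 * (‖x‖ ^ 2)⁻¹) ∂(wm n β b) ≤
        ENNReal.ofReal (2 / δ * R) := by
    intro k hk
    have hk' : (2 : ℝ) ≤ k := by exact_mod_cast hk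
    have hχ : IsTest fun x : HornSpace n => cut k 1 (‖x‖ ^ 2) := isTest_cut _ one_pos
    set χ : HornSpace n → ℝ := fun x => cut k 1 (‖x‖ ^ 2) with hχdef
    have hinv : ∀ x : HornSpace n, x ≠ 0 → ContDiffAt ℝ ∞ (fun x : HornSpace n => (‖x‖ ^ 2)⁻¹) x :=
      fun x hx => (contDiff_norm_sq ℝ).contDiffAt.inv
        (pow_ne_zero 2 (norm_ne_zero_iff.mpr hx))
    have hc : IsTest fun x : HornSpace n => χ x * χ x * (‖x‖ ^ 2)⁻¹ :=
      (hχ.mul hχ).mul_contDiffAt hinv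
    obtain ⟨p, hp, hp1, hp2⟩ := h.cut_mem_Gam hf hV hχ
    obtain ⟨i1, i2, e⟩ := integral_sq_mul_div_eq hp hc
    have hDχ : ∀ x : HornSpace n, fderiv ℝ χ x x = 2 * cutDeriv k 1 (‖x‖ ^ 2) * ‖x‖ ^ 2 := by
      intro x
      rw [← inner_gradient_apply, gradient_cut, inner_smul_left, real_inner_self_eq_norm_sq]
      simp
    have hDc : ∀ x : HornSpace n, x ≠ 0 →
        fderiv ℝ (fun x : HornSpace n => χ x * χ x * (‖x‖ ^ 2)⁻¹) x x =
          4 * χ x * cutDeriv k 1 (‖x‖ ^ 2) - 2 * χ x ^ 2 * (‖x‖ ^ 2)⁻¹ := by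
      intro x hx
      have hx0 := norm_ne_zero_iff.mpr hx
      have h1 : HasFDerivAt (fun x : HornSpace n => ‖x‖ ^ 2) (2 • innerSL ℝ x) x :=
        (hasStrictFDerivAt_norm_sq x).hasFDerivAt
      have h2 := ((hasDerivAt_inv (by positivity : ‖x‖ ^ 2 ≠ 0)).comp_hasFDerivAt x h1).fderiv
      have h3 := fderiv_fun_mul ((hχ.differentiableAt x).fun_mul (hχ.differentiableAt x))
        ((hinv x hx).differentiableAt (by simp))
      rw [h3, fderiv_fun_mul (hχ.differentiableAt x) (hχ.differentiableAt x)]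
      have h2' : fderiv ℝ (fun x : HornSpace n => (‖x‖ ^ 2)⁻¹) x x = -2 * (‖x‖ ^ 2)⁻¹ := by
        change fderiv ℝ ((fun y : ℝ => y⁻¹) ∘ fun x : HornSpace n => ‖x‖ ^ 2) x x = _
        rw [h2]
        simp
        field_simp
      simp only [_root_.add_apply, _root_.smul_apply, smul_eq_mul, hDχ, h2']
      field_simp
      ring
    have hpt : ∀ᵐ x ∂(wm n β b), δ / 2 * (χ x ^ 4 * f x ^ 2 * (‖x‖ ^ 2)⁻¹) -
        ((2 * |b| + 8 * M) * f x ^ 2 + 2 / δ * ‖frame ε x (V x)‖ ^ 2) ≤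
        p.1 x ^ 2 * ((hdim n β - 2 * b * ‖x‖ ^ 2) * (χ x * χ x * (‖x‖ ^ 2)⁻¹) +
          fderiv ℝ (fun x : HornSpace n => χ x * χ x * (‖x‖ ^ 2)⁻¹) x x) +
        2 * (p.1 x * inner ℝ x (p.2 x) * (χ x * χ x * (‖x‖ ^ 2)⁻¹)) := by
      filter_upwards [ae_eq_wm.mpr hp1, ae_eq_wm.mpr hp2, ae_ne_zero_wm b] with x h1 h2 hx
      have hx0 : 0 < ‖x‖ := norm_pos_iff.mpr hx
      rw [hDc x hx, h1, h2, inner_self_frame, inner_add_right, inner_smul_right, inner_smul_right,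
        real_inner_comm, real_inner_comm (gradient χ x), inner_gradient_apply, hDχ]
      have hs0 : 0 ≤ χ x := cut_nonneg _ _ _
      have hs1 : χ x ≤ 1 := cut_le_one _ _ _
      -- only the decreasing part of the cutoff, away from the tip, contributes to the lower bound
      have hD : -M ≤ cutDeriv k 1 (‖x‖ ^ 2) := by
        unfold cutDeriv
        have a1 : 0 ≤ k * deriv Real.smoothTransition (k * ‖x‖ ^ 2 - 1) *
            Real.smoothTransition (2 - ‖x‖ ^ 2 / 1) :=
          mul_nonneg (mul_nonneg (by linarith) (deriv_smoothTransition_nonneg _))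
            (Real.smoothTransition.nonneg _)
        have a2 : Real.smoothTransition (k * ‖x‖ ^ 2 - 1) *
            (deriv Real.smoothTransition (2 - ‖x‖ ^ 2 / 1) / 1) ≤ 1 * M := by
          rw [div_one (deriv _ _)]
          exact mul_le_mul (Real.smoothTransition.le_one _) (hM _)
            (deriv_smoothTransition_nonneg _) zero_le_one
        linarith
      set D := cutDeriv k 1 (‖x‖ ^ 2)
      set s := χ x
      set q := inner ℝ x (V x) with hq
      rw [real_inner_comm] at hq
      have hqV : (q * ‖x‖⁻¹) ^ 2 ≤ ‖frame ε x (V x)‖ ^ 2 := by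
        have := abs_real_inner_le_norm x (frame ε x (V x))
        rw [inner_self_frame, real_inner_comm, ← hq] at this
        rw [← sq_abs, abs_mul, abs_inv, abs_norm]
        gcongr
        rw [← div_eq_mul_inv, div_le_iff₀ hx0]; linarith
      have hs4 : s ^ 4 ≤ 1 := pow_le_one₀ hs0 hs1
      have hs3 : s ^ 3 ≤ 1 := pow_le_one₀ hs0 hs1
      have hb1 : s ^ 4 * b ≤ |b| := by
        calc s ^ 4 * b ≤ s ^ 4 * |b| := by gcongr; exact le_abs_self b
          _ ≤ 1 * |b| := by gcongr
          _ = _ := one_mul _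
      have hD1 : -M ≤ s ^ 3 * D := by
        rcases le_total 0 D with h0 | h0
        · have : 0 ≤ s ^ 3 * D := by positivity
          linarith
        · nlinarith [pow_nonneg hs0 3]
      have hr : ‖x‖ ^ 2 * (‖x‖ ^ 2)⁻¹ = 1 := mul_inv_cancel₀ (by positivity)
      have hr2 : (‖x‖ ^ 2)⁻¹ = ‖x‖⁻¹ ^ 2 := by rw [inv_pow]
      -- complete the square in `f / ‖x‖` and the radial derivative
      have hsq : -(δ / 2 * (s ^ 4 * f x ^ 2 * (‖x‖ ^ 2)⁻¹) + 2 / δ * ‖frame ε x (V x)‖ ^ 2) ≤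
          2 * s ^ 4 * f x * q * (‖x‖ ^ 2)⁻¹ := by
        have a1 : 2 / δ * (s ^ 4 * (q * ‖x‖⁻¹) ^ 2) ≤ 2 / δ * ‖frame ε x (V x)‖ ^ 2 := by
          gcongr
          calc s ^ 4 * (q * ‖x‖⁻¹) ^ 2 ≤ 1 * (q * ‖x‖⁻¹) ^ 2 := by gcongr
            _ ≤ _ := by rw [one_mul]; exact hqV
        have a2 : 0 ≤ s ^ 4 * (δ / 2) * (f x * ‖x‖⁻¹ + 2 / δ * (q * ‖x‖⁻¹)) ^ 2 := by positivity
        have a3 : s ^ 4 * (δ / 2) * (f x * ‖x‖⁻¹ + 2 / δ * (q * ‖x‖⁻¹)) ^ 2 =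
            δ / 2 * (s ^ 4 * f x ^ 2 * ‖x‖⁻¹ ^ 2) + 2 * s ^ 4 * f x * q * ‖x‖⁻¹ ^ 2 +
              2 / δ * (s ^ 4 * (q * ‖x‖⁻¹) ^ 2) := by
          field_simp; ring
        rw [hr2]; linarith
      have hid : (s * f x) ^ 2 * ((hdim n β - 2 * b * ‖x‖ ^ 2) * (s * s * (‖x‖ ^ 2)⁻¹) +
            (4 * s * D - 2 * s ^ 2 * (‖x‖ ^ 2)⁻¹)) +
          2 * (s * f x * (s * q + f x * (2 * D * ‖x‖ ^ 2)) * (s * s * (‖x‖ ^ 2)⁻¹)) =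
          δ * (s ^ 4 * f x ^ 2 * (‖x‖ ^ 2)⁻¹) + 2 * s ^ 4 * f x * q * (‖x‖ ^ 2)⁻¹
            - 2 * (s ^ 4 * b) * f x ^ 2 + 8 * (s ^ 3 * D) * f x ^ 2 := by
        rw [hδ]; field_simp; ring
      rw [← hq, hid]
      have hb2 := mul_le_mul_of_nonneg_right hb1 (sq_nonneg (f x))
      have hD2 := mul_le_mul_of_nonneg_right hD1 (sq_nonneg (f x))
      linarith
    have hχi : Integrable (fun x => χ x ^ 4 * f x ^ 2 * (‖x‖ ^ 2)⁻¹) (wm n β b) := by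
      obtain ⟨C, hC⟩ := ((hχ.mul hχ).mul hc).exists_abs_le
      refine Integrable.congr (f := fun x =>
        (χ x * χ x * (χ x * χ x * (‖x‖ ^ 2)⁻¹)) * f x ^ 2) ?_ (ae_of_all _ fun x => by ring)
      exact hfi.bdd_mul ((hχ.mul hχ).mul hc).smooth.continuous.aestronglyMeasurable
        (ae_of_all _ hC)
    have hint := integral_mono_ae ((hχi.const_mul _).sub hRi) (i1.add (i2.const_mul 2)) hpt
    rw [integral_add' i1 (i2.const_mul 2), integral_const_mul, e,
      integral_sub' (hχi.const_mul _) hRi, integral_const_mul] at hint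
    rw [← ofReal_integral_eq_lintegral_ofReal hχi (ae_of_all _ fun x => by
      have : 0 ≤ χ x := cut_nonneg _ _ _
      positivity)]
    apply ENNReal.ofReal_le_ofReal
    have hfin : δ / 2 * ∫ x, χ x ^ 4 * f x ^ 2 * (‖x‖ ^ 2)⁻¹ ∂(wm n β b) ≤ R := by linarith
    rw [div_mul_eq_mul_div, le_div_iff₀ hd]
    linarith
  have hm : AEStronglyMeasurable
      (fun x : HornSpace n => Real.smoothTransition (2 - ‖x‖ ^ 2) ^ 2 * f x * ‖x‖⁻¹)
      (wm n β b) := by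
    refine (AEStronglyMeasurable.mul ?_ hf.1).mul ?_
    · have : Continuous fun x : HornSpace n => Real.smoothTransition (2 - ‖x‖ ^ 2) ^ 2 := by
        have := Real.smoothTransition.continuous; fun_prop
      exact this.aestronglyMeasurable
    · exact (measurable_norm.inv).aestronglyMeasurable
  refine ⟨hm, ?_⟩
  have hfin : eLpNorm (fun x : HornSpace n =>
      Real.smoothTransition (2 - ‖x‖ ^ 2) ^ 2 * f x * ‖x‖⁻¹) 2 (wm n β b) ^ 2 < ⊤ := by
    rw [eLpNorm_two_sq]
    refine lt_of_le_of_lt ?_ (ENNReal.ofReal_lt_top (r := 2 / δ * R))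
    have hlim : ∀ᵐ x ∂(wm n β b), ‖Real.smoothTransition (2 - ‖x‖ ^ 2) ^ 2 * f x * ‖x‖⁻¹‖ₑ ^ 2 ≤
        liminf (fun k : ℕ => ENNReal.ofReal
          (cut k 1 (‖x‖ ^ 2) ^ 4 * f x ^ 2 * (‖x‖ ^ 2)⁻¹)) atTop := by
      filter_upwards [ae_ne_zero_wm b] with x hx
      have hx0 : 0 < ‖x‖ ^ 2 := by have := norm_pos_iff.mpr hx; positivity
      refine le_liminf_of_le (by isBoundedDefault) ?_
      obtain ⟨k0, hk0⟩ := exists_nat_gt (2 / ‖x‖ ^ 2)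
      filter_upwards [eventually_ge_atTop k0] with k hk
      have hk1 : 2 / ‖x‖ ^ 2 ≤ k := hk0.le.trans (by exact_mod_cast hk)
      rw [div_le_iff₀ hx0] at hk1
      rw [cut, Real.smoothTransition.one_of_one_le (by linarith : (1 : ℝ) ≤ k * ‖x‖ ^ 2 - 1), ← ofReal_norm,
        ← ENNReal.ofReal_pow (norm_nonneg _), Real.norm_eq_abs, sq_abs]
      apply ENNReal.ofReal_le_ofReal
      rw [div_one]
      apply le_of_eq; ring
    refine (lintegral_mono_ae hlim).trans ?_
    refine (lintegral_liminf_le' fun k => ?_).trans ?_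
    · refine AEMeasurable.ennreal_ofReal ?_
      refine ((AEMeasurable.pow_const ?_ 4).mul (hf.1.aemeasurable.pow_const 2)).mul ?_
      · exact ((contDiff_cut k 1).continuous.comp (by fun_prop)).measurable.aemeasurable
      · exact (measurable_norm.pow_const 2).inv.aemeasurable
    · refine liminf_le_of_le (by isBoundedDefault) fun a ha => ?_
      obtain ⟨k, h1, h2⟩ := (ha.and (eventually_ge_atTop 2)).exists
      exact h1.trans (key k h2)
  simpa using hfin

/-- Functions with a weak gradient away from the tip are approximated by test functions: the tip has
zero capacity, because the dimension of the measure is more than two. -/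
theorem _root_.IsHornWeakGrad.mem_Gam {ε b : ℝ} {f : HornSpace n → ℝ}
    {V : HornSpace n → HornSpace n}
    (h : IsHornWeakGrad f V) (hf : MemLp f 2 (wm n β b))
    (hV : MemLp (fun x => frame ε x (V x)) 2 (wm n β b)) :
    (hf.toLp, hV.toLp) ∈ Gam n β ε b := by
  obtain ⟨M, hM0, hM⟩ := exists_deriv_smoothTransition_le
  have hχ : ∀ k : ℕ, IsTest fun x : HornSpace n => cut (k + 2) (k + 2) (‖x‖ ^ 2) := fun k =>
    isTest_cut _ (by positivity)
  choose p hp hp1 hp2 using fun k : ℕ => h.cut_mem_Gam hf hV (hχ k)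
  refine (isClosed_Gam ε b).mem_of_tendsto (b := atTop) (f := p) ?_ (Eventually.of_forall hp)
  have hev : ∀ x : HornSpace n, x ≠ 0 → ∀ᶠ k : ℕ in atTop,
      1 < ((k : ℝ) + 2) * ‖x‖ ^ 2 - 1 ∧ 1 < 2 - ‖x‖ ^ 2 / ((k : ℝ) + 2) := by
    intro x hx
    have hx0 : 0 < ‖x‖ ^ 2 := by have := norm_pos_iff.mpr hx; positivity
    have t : Tendsto (fun k : ℕ => (k : ℝ) + 2) atTop atTop :=
      tendsto_atTop_add_const_right _ _ tendsto_natCast_atTop_atTop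
    filter_upwards [t.eventually_gt_atTop (2 / ‖x‖ ^ 2), t.eventually_gt_atTop (‖x‖ ^ 2)]
      with k h1 h2
    rw [div_lt_iff₀ hx0] at h1
    have h3 : ‖x‖ ^ 2 / ((k : ℝ) + 2) < 1 := by rw [div_lt_one (by positivity)]; exact h2
    constructor <;> linarith
  have hcut1 : ∀ x : HornSpace n, x ≠ 0 → ∀ᶠ k : ℕ in atTop,
      cut (k + 2) (k + 2) (‖x‖ ^ 2) = 1 ∧ cutDeriv (k + 2) (k + 2) (‖x‖ ^ 2) = 0 := by
    intro x hx
    filter_upwards [hev x hx] with k hk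
    constructor
    · rw [cut, Real.smoothTransition.one_of_one_le hk.1.le,
        Real.smoothTransition.one_of_one_le hk.2.le, one_mul]
    · rw [cutDeriv, deriv_smoothTransition_eq_zero (Or.inr hk.1),
        deriv_smoothTransition_eq_zero (Or.inr hk.2)]
      simp
  have hfr : ∀ (k : ℕ) (x : HornSpace n), frame ε x (cut (k + 2) (k + 2) (‖x‖ ^ 2) • V x +
      f x • gradient (fun x : HornSpace n => cut (k + 2) (k + 2) (‖x‖ ^ 2)) x) =
      cut (k + 2) (k + 2) (‖x‖ ^ 2) • frame ε x (V x) +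
        (f x * (2 * cutDeriv (k + 2) (k + 2) (‖x‖ ^ 2))) • x := by
    intro k x
    rw [gradient_cut, map_add, map_smul, map_smul, map_smul, frame_self, smul_smul]
  refine Tendsto.prodMk_nhds ?_ ?_
  · rw [Lp.tendsto_Lp_iff_tendsto_eLpNorm']
    have t := tendsto_eLpNorm_of_dominated (μ := wm n β b) (F := fun k => (p k).1)
      (f := f) (g := fun x => ‖f x‖) (fun k => (Lp.aestronglyMeasurable _)) hf.norm
      (fun k => by
        filter_upwards [ae_eq_wm.mpr (hp1 k)] with x hx
        rw [hx, norm_mul, Real.norm_of_nonneg (cut_nonneg _ _ _)]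
        exact mul_le_of_le_one_left (norm_nonneg _) (cut_le_one _ _ _))
      (by
        filter_upwards [ae_all_iff.mpr fun k => ae_eq_wm.mpr (hp1 k), ae_ne_zero_wm b]
          with x hx hx0
        refine tendsto_const_nhds.congr' ?_
        filter_upwards [hcut1 x hx0] with k hk
        rw [hx k, hk.1, one_mul])
    refine t.congr fun k => eLpNorm_congr_ae ?_
    filter_upwards [hf.coeFn_toLp] with x hx
    simp [hx]
  · rw [Lp.tendsto_Lp_iff_tendsto_eLpNorm']
    have hH := h.memLp_hardy hf hV
    have t := tendsto_eLpNorm_of_dominated (μ := wm n β b) (F := fun k => (p k).2)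
      (f := fun x => frame ε x (V x)) (g := fun x => ‖frame ε x (V x)‖ + (4 * M) *
        (‖Real.smoothTransition (2 - ‖x‖ ^ 2) ^ 2 * f x * ‖x‖⁻¹‖ + ‖f x‖))
      (fun k => (Lp.aestronglyMeasurable _))
      (hV.norm.add ((hH.norm.add hf.norm).const_mul _))
      (fun k => by
        filter_upwards [ae_eq_wm.mpr (hp2 k), ae_ne_zero_wm b] with x hx hx0
        have hr : 0 < ‖x‖ := norm_pos_iff.mpr hx0
        rw [hx, hfr]
        refine (norm_add_le _ _).trans (add_le_add ?_ ?_)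
        · rw [norm_smul, Real.norm_of_nonneg (cut_nonneg _ _ _)]
          exact mul_le_of_le_one_left (norm_nonneg _) (cut_le_one _ _ _)
        · rw [norm_smul, norm_mul, norm_mul, norm_mul _ ‖x‖⁻¹, norm_mul _ (f x), norm_pow, norm_inv,
            norm_norm, Real.norm_of_nonneg (Real.smoothTransition.nonneg _), Real.norm_two]
          set m : ℝ := (k : ℝ) + 2
          have hm2 : 2 ≤ m := by
            have : (0 : ℝ) ≤ k := Nat.cast_nonneg k
            simp only [m]; linarith
          set s := ‖x‖ ^ 2 with hs
          have hs0 : 0 < s := by positivity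
          -- the inner part of the derivative of the cutoff is absorbed by Hardy's inequality, the
          -- outer part is bounded
          have hb1 : m * deriv Real.smoothTransition (m * s - 1) * Real.smoothTransition (2 - s / m)
              * ‖x‖ ≤ 2 * M * (Real.smoothTransition (2 - s) ^ 2 * ‖x‖⁻¹) := by
            by_cases hc : m * s - 1 ≤ 1
            · have hs1 : s ≤ 1 := by nlinarith
              rw [Real.smoothTransition.one_of_one_le (by linarith : (1 : ℝ) ≤ 2 - s), one_pow,
                one_mul, ← div_eq_mul_inv, le_div_iff₀ hr]
              calc m * deriv Real.smoothTransition (m * s - 1) *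
                    Real.smoothTransition (2 - s / m) * ‖x‖ * ‖x‖
                  = (m * s) * deriv Real.smoothTransition (m * s - 1) *
                    Real.smoothTransition (2 - s / m) := by rw [hs]; ring
                _ ≤ 2 * M * 1 := by
                    gcongr
                    · exact Real.smoothTransition.nonneg _
                    · exact deriv_smoothTransition_nonneg _
                    · linarith
                    · exact hM _
                    · exact Real.smoothTransition.le_one _
                _ = 2 * M := mul_one _
            · rw [deriv_smoothTransition_eq_zero (Or.inr (by linarith))]
              simp; positivity
          have hb2 : Real.smoothTransition (m * s - 1) *
              (deriv Real.smoothTransition (2 - s / m) / m) * ‖x‖ ≤ 2 * M := by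
            by_cases hc : 0 ≤ 2 - s / m
            · have h1 : s ≤ 2 * m := by
                rw [sub_nonneg, div_le_iff₀ (by linarith)] at hc; exact hc
              have h2 : ‖x‖ ≤ 2 * m := by nlinarith
              calc _ ≤ 1 * (M / m) * (2 * m) := by
                    gcongr
                    · exact div_nonneg (deriv_smoothTransition_nonneg _) (by linarith)
                    · exact Real.smoothTransition.le_one _
                    · exact hM _
                _ = 2 * M := by field_simp
            · rw [deriv_smoothTransition_eq_zero (Or.inl (by linarith))]
              simp; positivity
          have hb3 : 0 ≤ m * deriv Real.smoothTransition (m * s - 1) *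
              Real.smoothTransition (2 - s / m) * ‖x‖ :=
            mul_nonneg (mul_nonneg (mul_nonneg (by linarith) (deriv_smoothTransition_nonneg _))
              (Real.smoothTransition.nonneg _)) hr.le
          have hb4 : 0 ≤ Real.smoothTransition (m * s - 1) *
              (deriv Real.smoothTransition (2 - s / m) / m) * ‖x‖ :=
            mul_nonneg (mul_nonneg (Real.smoothTransition.nonneg _)
              (div_nonneg (deriv_smoothTransition_nonneg _) (by linarith))) hr.le
          have hb5 : ‖cutDeriv m m s‖ * ‖x‖ ≤
              2 * M * (Real.smoothTransition (2 - s) ^ 2 * ‖x‖⁻¹) + 2 * M := by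
            rw [← norm_norm x, ← norm_mul, norm_norm, cutDeriv, sub_mul, Real.norm_eq_abs,
              abs_le]
            constructor <;> linarith
          have := mul_le_mul_of_nonneg_left hb5 (by positivity : 0 ≤ 2 * ‖f x‖)
          linarith)
      (by
        filter_upwards [ae_all_iff.mpr fun k => ae_eq_wm.mpr (hp2 k), ae_ne_zero_wm b]
          with x hx hx0
        refine tendsto_const_nhds.congr' ?_
        filter_upwards [hcut1 x hx0] with k hk
        rw [hx k, hfr, hk.1, hk.2]; simp)
    refine t.congr fun k => eLpNorm_congr_ae ?_
    filter_upwards [hV.coeFn_toLp] with x hx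
    simp [hx]

end

end

/-! ### Changing the weight, and the weak equation -/

section

variable {n : ℕ} {β : ℝ}

/-- The functions that are square integrable with respect to the Gaussian weight `e^{-b r²}`. -/
abbrev HFun (n : ℕ) (β b : ℝ) := Lp ℝ 2 (wm n β b)

/-- The vector fields that are square integrable with respect to the Gaussian weight
`e^{-b r²}`. -/
abbrev HVec (n : ℕ) (β b : ℝ) := Lp (HornSpace n) 2 (wm n β b)

section

variable [hn : Fact (2 ≤ n)] [hβ : Fact (0 < β)]

section

variable {E : Type*} [NormedAddCommGroup E] [NormedSpace ℝ E]

theorem lp_ext {b : ℝ} {f g : Lp E 2 (wm n β b)} (h : f =ᵐ[volume] g) : f = g :=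
  Lp.ext (ae_eq_wm.mpr h)

@[simp] theorem incl_incl {b b' b'' : ℝ} (h : b ≤ b') (h' : b' ≤ b'') (f : Lp E 2 (wm n β b)) :
    incl E h' (incl E h f) = incl E (h.trans h') f :=
  lp_ext ((coeFn_incl _ _).trans ((coeFn_incl _ _).trans (coeFn_incl _ _).symm))

@[simp] theorem incl_radOp {b b' b'' : ℝ} (h : b < b') (h' : b' ≤ b'') (F : HVec n β b) :
    incl _ h' (radOp h F) = radOp (h.trans_le h') F :=
  lp_ext ((coeFn_incl _ _).trans ((coeFn_radOp _ _).trans (coeFn_radOp _ _).symm))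

theorem incl_injective {b b' : ℝ} (h : b ≤ b') :
    Function.Injective (incl (n := n) (β := β) E h) := fun f g hfg =>
  lp_ext ((coeFn_incl h f).symm.trans ((by rw [hfg] : (incl E h f : HornSpace n → E) =ᵐ[volume]
    incl E h g).trans (coeFn_incl h g)))

end

/-- The product of `L²` functions is computed from any functions that agree with them almost
everywhere. -/
theorem inner_eq_integral {E : Type*} [NormedAddCommGroup E] [InnerProductSpace ℝ E] {b : ℝ}
    {f g : Lp E 2 (wm n β b)} {f' g' : HornSpace n → E} (hf : f =ᵐ[volume] f')
    (hg : g =ᵐ[volume] g') : inner ℝ f g = ∫ x, inner ℝ (f' x) (g' x) ∂(wm n β b) := by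
  rw [L2.inner_def]
  refine integral_congr_ae ?_
  filter_upwards [ae_eq_wm.mpr hf, ae_eq_wm.mpr hg] with x h1 h2
  rw [h1, h2]

theorem inner_radOp_left {b B : ℝ} (hb : b < B) (F : HVec n β b) (h : HFun n β b) :
    inner ℝ (radOp hb F) (incl ℝ hb.le h) = inner ℝ (incl _ hb.le F) (posOp hb h) := by
  rw [inner_eq_integral (coeFn_radOp hb F) (coeFn_incl hb.le h),
    inner_eq_integral (coeFn_incl hb.le F) (coeFn_posOp hb h)]
  refine integral_congr_ae (ae_of_all _ fun x => ?_)
  simp [inner_smul_right, real_inner_comm]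

theorem inner_posOp {b B : ℝ} (hb : b < B) (f h : HFun n β b) :
    inner ℝ (posOp hb f) (posOp hb h) = ∫ x, ‖x‖ ^ 2 * (f x * h x) ∂(wm n β B) := by
  rw [inner_eq_integral (coeFn_posOp hb f) (coeFn_posOp hb h)]
  refine integral_congr_ae (ae_of_all _ fun x => ?_)
  simp only [inner_smul_left, inner_smul_right, real_inner_self_eq_norm_sq, RCLike.conj_to_real]
  ring

theorem IsTest.incl_lp {φ : HornSpace n → ℝ} (h : IsTest φ) {b b' : ℝ} (hb : b ≤ b') :
    incl ℝ hb (h.lp β b) = h.lp β b' :=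
  lp_ext ((coeFn_incl _ _).trans ((h.coeFn_lp b).trans (h.coeFn_lp b').symm))

theorem IsTest.incl_lpGrad {φ : HornSpace n → ℝ} (h : IsTest φ) (ε : ℝ) {b b' : ℝ} (hb : b ≤ b') :
    incl _ hb (h.lpGrad β ε b) = h.lpGrad β ε b' :=
  lp_ext ((coeFn_incl _ _).trans ((h.coeFn_lpGrad ε b).trans (h.coeFn_lpGrad ε b').symm))

theorem incl_mem_Gam {ε b b' : ℝ} (hb : b ≤ b') {p : HFun n β b × HVec n β b}
    (hp : p ∈ Gam n β ε b) : (incl ℝ hb p.1, incl _ hb p.2) ∈ Gam n β ε b' := by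
  obtain ⟨T, hT⟩ : ∃ T : (HFun n β b × HVec n β b) →L[ℝ] HFun n β b' × HVec n β b',
      ∀ f F, T (f, F) = (incl ℝ hb f, incl _ hb F) :=
    ⟨(incl ℝ hb).prodMap (incl _ hb), fun f F => by rw [ContinuousLinearMap.coe_prodMap']; rfl⟩
  have key := Gam_induction ((isClosed_Gam ε b').preimage T.continuous) (fun φ hφ => by
    rw [mem_preimage, hT, hφ.incl_lp hb, hφ.incl_lpGrad ε hb]
    exact hφ.mem_Gam ε b') p hp
  rwa [mem_preimage, ← Prod.mk.eta (p := p), hT] at key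

theorem IsTest.radOp_lpGrad {φ : HornSpace n → ℝ} (h : IsTest φ) (ε : ℝ) {b b' : ℝ} (hb : b < b') :
    radOp hb (h.lpGrad β ε b) =ᵐ[volume] fun x => fderiv ℝ φ x x := by
  filter_upwards [coeFn_radOp hb (h.lpGrad β ε b), h.coeFn_lpGrad (β := β) ε b] with x h1 h2
  rw [h1, h2, inner_self_frame, real_inner_comm, inner_gradient_apply]

/-- The divergence of the radial field `x` with weight `e^{-B r²}` is `d - 2 B r²`; this is the
resulting identity for `∫ f r ∂_r f`. -/
theorem two_inner_radOp_self {ε b B : ℝ} (hb : b < B) {p : HFun n β b × HVec n β b}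
    (hp : p ∈ Gam n β ε b) :
    2 * inner ℝ (radOp hb p.2) (incl ℝ hb.le p.1) =
      -hdim n β * inner ℝ (incl ℝ hb.le p.1) (incl ℝ hb.le p.1) +
        2 * B * inner ℝ (posOp hb p.1) (posOp hb p.1) := by
  have key : p ∈ {p : HFun n β b × HVec n β b |
      2 * inner ℝ (radOp hb p.2) (incl ℝ hb.le p.1) =
      -hdim n β * inner ℝ (incl ℝ hb.le p.1) (incl ℝ hb.le p.1) +
        2 * B * inner ℝ (posOp hb p.1) (posOp hb p.1)} := by
    refine Gam_induction (isClosed_eq (by fun_prop) (by fun_prop)) (fun φ hφ => ?_) p hp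
    simp only [mem_ofPred_eq, hφ.incl_lp]
    rw [inner_eq_integral (hφ.radOp_lpGrad ε hb) (hφ.coeFn_lp B),
      inner_eq_integral (hφ.coeFn_lp B) (hφ.coeFn_lp B), inner_posOp]
    have e1 : ∫ x, ‖x‖ ^ 2 * (hφ.lp β b x * hφ.lp β b x) ∂(wm n β B) =
        ∫ x, ‖x‖ ^ 2 * (φ x * φ x) ∂(wm n β B) := by
      refine integral_congr_ae ?_
      filter_upwards [ae_eq_wm.mpr (hφ.coeFn_lp (β := β) b)] with x hx
      rw [hx]
    rw [e1]
    have h1 := (hφ.mul hφ).integral_fderiv_self (β := β) B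
    have c1 := hφ.smooth.continuous
    have c2 : Continuous fun x => fderiv ℝ φ x x := by
      have := hφ.smooth.continuous_fderiv (by simp); fun_prop
    have ci : ∀ {g : HornSpace n → ℝ}, Continuous g → (∀ x, φ x = 0 → g x = 0) →
        Integrable g (wm n β B) := fun hg h0 =>
      hg.integrable_of_hasCompactSupport (hφ.compact.mono fun x hx h => hx (h0 x h))
    have h2 : ∀ x, fderiv ℝ (fun x => φ x * φ x) x x = 2 * inner ℝ (fderiv ℝ φ x x) (φ x) := by
      intro x
      rw [fderiv_fun_mul (hφ.differentiableAt x) (hφ.differentiableAt x)]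
      simp; ring
    simp_rw [h2] at h1
    rw [integral_const_mul] at h1
    rw [h1, ← integral_const_mul, ← integral_const_mul, ← integral_neg, ← integral_add]
    · refine integral_congr_ae (ae_of_all _ fun x => ?_)
      simp; ring
    · exact ci (by fun_prop) fun x h => by simp [h]
    · exact ci (by fun_prop) fun x h => by simp [h]
  exact key

/-- The integration by parts
`∫ (r ∂_r f) h + ∫ f (r ∂_r h) = -d ∫ f h + 2 B ∫ r² f h` with respect to the weight
`e^{-B r²}`. -/
theorem inner_radOp_add {ε b B : ℝ} (hb : b < B) {p q : HFun n β b × HVec n β b}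
    (hp : p ∈ Gam n β ε b) (hq : q ∈ Gam n β ε b) :
    inner ℝ (radOp hb p.2) (incl ℝ hb.le q.1) + inner ℝ (radOp hb q.2) (incl ℝ hb.le p.1) =
      -hdim n β * inner ℝ (incl ℝ hb.le p.1) (incl ℝ hb.le q.1) +
        2 * B * inner ℝ (posOp hb p.1) (posOp hb q.1) := by
  have h1 := two_inner_radOp_self hb (add_mem hp hq)
  have h2 := two_inner_radOp_self hb hp
  have h3 := two_inner_radOp_self hb hq
  simp only [Prod.fst_add, Prod.snd_add, map_add, inner_add_left, inner_add_right] at h1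
  have h4 := real_inner_comm (incl ℝ hb.le p.1) (incl ℝ hb.le q.1)
  have h5 := real_inner_comm (posOp hb p.1) (posOp hb q.1)
  rw [h4, h5] at h1
  linarith

/-- The functional `(F, g) ↦ ∫ ⟨F, ∇ψ⟩ + ∫ g ψ`. -/
theorem exists_lapFunctional {ψ : HornSpace n → ℝ} (hψ : IsTest ψ) (β ε b : ℝ)
    [Fact (0 < β)] : ∃ ℓ : (HVec n β b × HFun n β b) →L[ℝ] ℝ, ∀ p,
      ℓ p = ∫ x, inner ℝ (p.1 x) (frame ε x (gradient ψ x)) ∂(wm n β 0) +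
        ∫ x, p.2 x * ψ x ∂(wm n β 0) := by
  have h1 : Continuous fun x => dens n β 0 x • frame ε x (gradient ψ x) :=
    (continuous_dens 0).smul (hψ.continuous_frame_gradient ε)
  have t1 : tsupport (fun x => dens n β 0 x • frame ε x (gradient ψ x)) ⊆ tsupport ψ := by
    refine (closure_mono fun x hx h0 => ?_).trans (IsTest.tsupport_gradient (φ := ψ))
    simp only [Function.mem_support] at hx
    exact hx (by simp [h0])
  have h2 : Continuous fun x => dens n β 0 x * ψ x :=
    (continuous_dens 0).mul hψ.smooth.continuous
  have t2 : tsupport (fun x => dens n β 0 x * ψ x) ⊆ tsupport ψ := by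
    refine closure_mono fun x hx h0 => ?_
    simp only [Function.mem_support] at hx
    exact hx (by simp [h0])
  obtain ⟨G, hG⟩ := exists_inner_eq_integral (β := β) b h1
    (hψ.compact.of_isClosed_subset (isClosed_tsupport _) t1) (t1.trans hψ.supp)
  obtain ⟨K, hK⟩ := exists_inner_eq_integral (β := β) b h2
    (hψ.compact.of_isClosed_subset (isClosed_tsupport _) t2) (t2.trans hψ.supp)
  refine ⟨(innerSL ℝ G).coprod (innerSL ℝ K), fun p => ?_⟩
  rw [ContinuousLinearMap.coprod_apply, innerSL_apply_apply, innerSL_apply_apply, real_inner_comm,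
    real_inner_comm p.2, (hG p.1).2, (hK p.2).2, integral_wm, integral_wm]
  congr 1
  · simp [inner_smul_right]
  · refine integral_congr_ae (ae_of_all _ fun x => ?_)
    simp; ring

variable (n β) in
/-- The pairs `(F, g)` such that `div F = g` weakly, where `F` is written in the orthonormal
frame. -/
def Lap (ε b : ℝ) : Submodule ℝ (HVec n β b × HFun n β b) :=
  ⨅ (ψ : HornSpace n → ℝ) (hψ : IsTest ψ),
    LinearMap.ker (exists_lapFunctional hψ β ε b).choose.toLinearMap

theorem mem_Lap {ε b : ℝ} {p : HVec n β b × HFun n β b} :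
    p ∈ Lap n β ε b ↔ ∀ ψ : HornSpace n → ℝ, IsTest ψ →
      ∫ x, inner ℝ (p.1 x) (frame ε x (gradient ψ x)) ∂(wm n β 0) +
        ∫ x, p.2 x * ψ x ∂(wm n β 0) = 0 := by
  simp only [Lap, Submodule.mem_iInf, LinearMap.mem_ker]
  refine forall_congr' fun ψ => forall_congr' fun hψ => ?_
  rw [← (exists_lapFunctional hψ β ε b).choose_spec p]
  rfl

theorem isClosed_Lap (ε b : ℝ) : IsClosed (Lap n β ε b : Set (HVec n β b × HFun n β b)) := by
  simp only [Lap, Submodule.coe_iInf]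
  exact isClosed_iInter fun ψ => isClosed_iInter fun hψ =>
    (exists_lapFunctional hψ β ε b).choose.isClosed_ker

theorem incl_mem_Lap {ε b b' : ℝ} (hb : b ≤ b') {p : HVec n β b × HFun n β b}
    (hp : p ∈ Lap n β ε b) : (incl _ hb p.1, incl ℝ hb p.2) ∈ Lap n β ε b' := by
  rw [mem_Lap] at hp ⊢
  intro ψ hψ
  refine Eq.trans ?_ (hp ψ hψ)
  congr 1
  · refine integral_congr_ae ?_
    filter_upwards [ae_eq_wm.mpr (coeFn_incl hb p.1)] with x hx
    rw [hx]
  · refine integral_congr_ae ?_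
    filter_upwards [ae_eq_wm.mpr (coeFn_incl hb p.2)] with x hx
    rw [hx]

/-- The weak equation `div F = g`, tested with `h e^{-B r²}`. -/
theorem inner_incl_of_mem_Lap {ε b B : ℝ} (hb : b < B) {p : HVec n β b × HFun n β b}
    (hp : p ∈ Lap n β ε b) {q : HFun n β b × HVec n β b} (hq : q ∈ Gam n β ε b) :
    inner ℝ (incl _ hb.le p.1) (incl _ hb.le q.2) =
      -inner ℝ (incl ℝ hb.le p.2 - (2 * B) • radOp hb p.1) (incl ℝ hb.le q.1) := by
  have key : q ∈ {q : HFun n β b × HVec n β b |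
      inner ℝ (incl _ hb.le p.1) (incl _ hb.le q.2) =
        -inner ℝ (incl ℝ hb.le p.2 - (2 * B) • radOp hb p.1) (incl ℝ hb.le q.1)} := by
    refine Gam_induction (isClosed_eq (by fun_prop) (by fun_prop)) (fun φ hφ => ?_) q hq
    simp only [mem_ofPred_eq, hφ.incl_lp, hφ.incl_lpGrad]
    have hexp : ∀ x : HornSpace n, ContDiffAt ℝ ∞ (fun x : HornSpace n =>
        Real.exp (-B * ‖x‖ ^ 2)) x := fun x => (contDiff_exp_neg B).contDiffAt
    have h1 := mem_Lap.mp hp _ (hφ.mul_contDiffAt fun x _ => hexp x)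
    have hg : ∀ x : HornSpace n, frame ε x (gradient (fun x => φ x * Real.exp (-B * ‖x‖ ^ 2)) x) =
        Real.exp (-B * ‖x‖ ^ 2) • (frame ε x (gradient φ x) - (2 * B * φ x) • x) := by
      intro x
      rw [hφ.gradient_mul ((hexp x).differentiableAt (by simp)), gradient_exp_neg, map_add,
        map_smul, map_smul, map_smul, frame_self]
      module
    simp_rw [hg, inner_smul_right] at h1
    have e1 : ∫ x, Real.exp (-B * ‖x‖ ^ 2) *
        inner ℝ (p.1 x) (frame ε x (gradient φ x) - (2 * B * φ x) • x) ∂(wm n β 0) =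
        inner ℝ (incl _ hb.le p.1) (hφ.lpGrad β ε B) -
          2 * B * inner ℝ (radOp hb p.1) (hφ.lp β B) := by
      rw [← hφ.incl_lp hb.le, inner_radOp_left, ← inner_smul_right, ← inner_sub_right,
        inner_eq_integral (f' := p.1)
          (g' := fun x => frame ε x (gradient φ x) - (2 * B * φ x) • x) (coeFn_incl _ _)]
      · have := integral_wm_add (n := n) (β := β) 0 B fun x =>
          inner ℝ (p.1 x) (frame ε x (gradient φ x) - (2 * B * φ x) • x)
        rw [zero_add] at this
        rw [this]; rfl
      · filter_upwards [ae_eq_wm.mp (Lp.coeFn_sub (hφ.lpGrad β ε B) ((2 * B) • posOp hb (hφ.lp β b))),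
          ae_eq_wm.mp (Lp.coeFn_smul (2 * B) (posOp hb (hφ.lp β b))), hφ.coeFn_lpGrad (β := β) ε B,
          coeFn_posOp hb (hφ.lp β b), hφ.coeFn_lp (β := β) b] with x h1 h2 h3 h4 h5
        rw [h1, Pi.sub_apply, h2, Pi.smul_apply, h3, h4, h5, smul_smul]
    have e2 : ∫ x, p.2 x * (φ x * Real.exp (-B * ‖x‖ ^ 2)) ∂(wm n β 0) =
        inner ℝ (incl ℝ hb.le p.2) (hφ.lp β B) := by
      rw [inner_eq_integral (coeFn_incl hb.le p.2) (hφ.coeFn_lp B)]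
      have := integral_wm_add (n := n) (β := β) 0 B fun x => inner ℝ (p.2 x) (φ x)
      rw [zero_add] at this
      rw [this]
      refine integral_congr_ae (ae_of_all _ fun x => ?_)
      simp; ring
    rw [e1, e2] at h1
    rw [inner_sub_left, inner_smul_left, RCLike.conj_to_real]
    linarith
  exact key

/-- The constant functions have gradient zero. -/
theorem exists_one_mem_Gam (ε : ℝ) {b : ℝ} (hb : 0 < b) :
    ∃ e : HFun n β b, e =ᵐ[volume] (fun _ => (1 : ℝ)) ∧ (e, 0) ∈ Gam n β ε b := by
  have := isFiniteMeasure_wm (n := n) (β := β) hb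
  have h : IsHornWeakGrad (fun _ : HornSpace n => (1 : ℝ)) fun _ => 0 := by
    refine ⟨(continuous_const.locallyIntegrable).locallyIntegrableOn _,
      (continuous_const.locallyIntegrable).locallyIntegrableOn _, fun φ hφ hc _ v => ?_⟩
    simp only [one_mul, inner_zero_left, zero_mul, integral_zero, neg_zero]
    have := integral_mul_fderiv_eq_neg_fderiv_mul_of_integrable (𝕜 := ℝ) (μ := volume)
      (f := fun _ : HornSpace n => (1 : ℝ)) (g := φ) (v := v) (by simp)
      (by
        simp only [one_mul]
        exact ((hφ.continuous_fderiv (by simp)).clm_apply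
          continuous_const).integrable_of_hasCompactSupport
          ((hc.fderiv ℝ).mono fun x hx h0 => hx (by simp [h0])))
      (by simpa using hφ.continuous.integrable_of_hasCompactSupport hc)
      (fun _ _ => differentiableAt_const _) (fun _ _ => hφ.differentiable (by simp) _)
    simpa using this
  have h1 : MemLp (fun _ : HornSpace n => (1 : ℝ)) 2 (wm n β b) := memLp_const 1
  have h2 : MemLp (fun x : HornSpace n => frame ε x 0) 2 (wm n β b) := by simp
  refine ⟨h1.toLp, ae_eq_wm.mp h1.coeFn_toLp, ?_⟩
  have h3 := h.mem_Gam h1 h2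
  convert h3
  refine lp_ext (ae_eq_wm.mp ((Lp.coeFn_zero _ _ _).trans ?_))
  filter_upwards [h2.coeFn_toLp] with x hx
  rw [hx]; simp

end

end

/-! ### Interior energy estimates -/

section

variable {n : ℕ} {β : ℝ}

/-- If `y' ≤ -z + K x` and `0 ≤ y ≤ K₀ x`, then `y` at later times, and the integral of `z`, are
controlled by the integral of `x`: integrate the derivative of `(t - s) y`. -/
theorem energy_le {y y' x z : ℝ → ℝ} {s s₁ T K K₀ : ℝ} (hs : s ≤ s₁) (hK₀ : 0 ≤ K₀) (hK : 0 ≤ K)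
    (hy : ∀ t ∈ Icc s T, HasDerivAt y (y' t) t) (hy' : ContinuousOn y' (Icc s T))
    (hx : ContinuousOn x (Icc s T)) (hz : ContinuousOn z (Icc s T))
    (hy0 : ∀ t ∈ Icc s T, 0 ≤ y t) (hx0 : ∀ t ∈ Icc s T, 0 ≤ x t) (hz0 : ∀ t ∈ Icc s T, 0 ≤ z t)
    (hyx : ∀ t ∈ Icc s T, y t ≤ K₀ * x t)
    (h : ∀ t ∈ Icc s T, y' t ≤ -z t + K * x t) {t : ℝ} (ht : t ∈ Icc s₁ T) :
    (s₁ - s) * (y t + ∫ r in s₁..t, z r) ≤ (K₀ + K * (T - s)) * ∫ r in s..T, x r := by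
  have hst : s ≤ t := hs.trans ht.1
  have hsub : Icc s t ⊆ Icc s T := Icc_subset_Icc_right ht.2
  have hyc : ContinuousOn y (Icc s T) := fun r hr => (hy r hr).continuousAt.continuousWithinAt
  have hI : ∀ {f : ℝ → ℝ} {a b : ℝ}, ContinuousOn f (Icc s T) → a ≤ b → s ≤ a → b ≤ T →
      IntervalIntegrable f volume a b := fun hf hab ha hb =>
    (hf.mono (Icc_subset_Icc ha hb)).intervalIntegrable_of_Icc hab
  have hw : ContinuousOn (fun r => y r + (r - s) * y' r) (Icc s T) := by fun_prop
  have hw2 : ContinuousOn (fun r => (r - s) * z r) (Icc s T) := by fun_prop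
  have e1 : ∫ r in s..t, (y r + (r - s) * y' r) = (t - s) * y t := by
    rw [intervalIntegral.integral_eq_sub_of_hasDerivAt (f := fun r => (r - s) * y r)
      (fun r hr => ?_) (hI hw hst le_rfl ht.2)]
    · simp
    · rw [uIcc_of_le hst] at hr
      refine (((hasDerivAt_id r).sub_const s).mul (hy r (hsub hr))).congr_deriv ?_
      simp
  have e2 : ∫ r in s..t, (y r + (r - s) * y' r) ≤
      ∫ r in s..t, ((K₀ + K * (T - s)) * x r - (r - s) * z r) := by
    refine intervalIntegral.integral_mono_on hst (hI hw hst le_rfl ht.2)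
      ((hI (hx.const_mul _) hst le_rfl ht.2).sub (hI hw2 hst le_rfl ht.2)) fun r hr => ?_
    have hr' := hsub hr
    have h1 := mul_le_mul_of_nonneg_left (h r hr') (sub_nonneg.mpr hr.1)
    have h2 := hyx r hr'
    have h3 : (r - s) * (K * x r) ≤ (T - s) * (K * x r) := by
      have := mul_nonneg hK (hx0 r hr')
      gcongr
      exact hr'.2
    linarith
  rw [e1, intervalIntegral.integral_sub (hI (hx.const_mul _) hst le_rfl ht.2)
    (hI hw2 hst le_rfl ht.2), intervalIntegral.integral_const_mul] at e2
  have hmono : ∫ r in s..t, x r ≤ ∫ r in s..T, x r := by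
    rw [← intervalIntegral.integral_add_adjacent_intervals (hI hx hst le_rfl ht.2)
      (hI hx ht.2 hst le_rfl)]
    have : 0 ≤ ∫ r in t..T, x r := intervalIntegral.integral_nonneg ht.2 fun r hr =>
      hx0 r ⟨hst.trans hr.1, hr.2⟩
    linarith
  have hz1 : (s₁ - s) * ∫ r in s₁..t, z r ≤ ∫ r in s..t, (r - s) * z r := by
    rw [← intervalIntegral.integral_add_adjacent_intervals (hI hw2 hs le_rfl (ht.1.trans ht.2))
      (hI hw2 ht.1 hs ht.2), ← intervalIntegral.integral_const_mul]
    have h1 : 0 ≤ ∫ r in s..s₁, (r - s) * z r := intervalIntegral.integral_nonneg hs fun r hr =>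
      mul_nonneg (sub_nonneg.mpr hr.1) (hz0 r ⟨hr.1, hr.2.trans (ht.1.trans ht.2)⟩)
    have h2 : ∫ r in s₁..t, (s₁ - s) * z r ≤ ∫ r in s₁..t, (r - s) * z r := by
      refine intervalIntegral.integral_mono_on ht.1 (hI (hz.const_mul _) ht.1 hs ht.2)
        (hI hw2 ht.1 hs ht.2) fun r hr => ?_
      have := hz0 r ⟨hs.trans hr.1, hr.2.trans ht.2⟩
      gcongr
      exact hr.1
    linarith
  have hy1 : (s₁ - s) * y t ≤ (t - s) * y t := by
    have := hy0 t ⟨hst, ht.2⟩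
    gcongr
    exact ht.1
  have hC : 0 ≤ K₀ + K * (T - s) := by
    have : 0 ≤ T - s := by linarith [ht.2]
    positivity
  have := mul_le_mul_of_nonneg_left hmono hC
  linarith

section

variable [hn : Fact (2 ≤ n)] [hβ : Fact (0 < β)]

/-- A twice differentiable curve of solutions `f` of the heat equation, with gradients `F`. -/
structure SolCurve (n : ℕ) (β ε b : ℝ) [Fact (2 ≤ n)] [Fact (0 < β)] (I : Set ℝ)
    (f f' f'' : ℝ → HFun n β b) (F F' : ℝ → HVec n β b) : Prop where
  deriv : ∀ t ∈ I, HasDerivAt f (f' t) t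
  deriv' : ∀ t ∈ I, HasDerivAt f' (f'' t) t
  deriv_grad : ∀ t ∈ I, HasDerivAt F (F' t) t
  cont : ContinuousOn f'' I
  cont_grad : ContinuousOn F' I
  mem_Gam : ∀ t ∈ I, (f t, F t) ∈ Gam n β ε b
  mem_Gam' : ∀ t ∈ I, (f' t, F' t) ∈ Gam n β ε b
  mem_Lap : ∀ t ∈ I, (F t, f' t) ∈ Lap n β ε b
  mem_Lap' : ∀ t ∈ I, (F' t, f'' t) ∈ Lap n β ε b

theorem SolCurve.sub {ε b : ℝ} {I : Set ℝ} {f f' f'' g g' g'' : ℝ → HFun n β b}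
    {F F' G G' : ℝ → HVec n β b} (h : SolCurve n β ε b I f f' f'' F F')
    (k : SolCurve n β ε b I g g' g'' G G') :
    SolCurve n β ε b I (f - g) (f' - g') (f'' - g'') (F - G) (F' - G') where
  deriv t ht := (h.deriv t ht).sub (k.deriv t ht)
  deriv' t ht := (h.deriv' t ht).sub (k.deriv' t ht)
  deriv_grad t ht := (h.deriv_grad t ht).sub (k.deriv_grad t ht)
  cont := h.cont.sub k.cont
  cont_grad := h.cont_grad.sub k.cont_grad
  mem_Gam t ht := sub_mem (h.mem_Gam t ht) (k.mem_Gam t ht)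
  mem_Gam' t ht := sub_mem (h.mem_Gam' t ht) (k.mem_Gam' t ht)
  mem_Lap t ht := sub_mem (h.mem_Lap t ht) (k.mem_Lap t ht)
  mem_Lap' t ht := sub_mem (h.mem_Lap' t ht) (k.mem_Lap' t ht)

theorem hasDerivAt_incl {E : Type*} [NormedAddCommGroup E] [NormedSpace ℝ E] {b B : ℝ} (hb : b ≤ B)
    {f : ℝ → Lp E 2 (wm n β b)} {f' : Lp E 2 (wm n β b)} {t : ℝ} (h : HasDerivAt f f' t) :
    HasDerivAt (fun t => incl E hb (f t)) (incl E hb f') t :=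
  (incl E hb).hasFDerivAt.comp_hasDerivAt t h

/-- Caccioppoli's inequality. -/
theorem exists_caccioppoli {b B : ℝ} (hB : 0 ≤ B) (hb : b < B) {s s₁ T : ℝ} (hs : s < s₁)
    (hT : s₁ ≤ T) :
    ∃ C : ℝ, 0 ≤ C ∧ ∀ (ε : ℝ) (f f' : ℝ → HFun n β b) (F : ℝ → HVec n β b),
      (∀ t ∈ Icc s T, HasDerivAt f (f' t) t) → ContinuousOn f' (Icc s T) →
      ContinuousOn F (Icc s T) → (∀ t ∈ Icc s T, (f t, F t) ∈ Gam n β ε b) →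
      (∀ t ∈ Icc s T, (F t, f' t) ∈ Lap n β ε b) → ∀ t ∈ Icc s₁ T,
      ‖incl ℝ hb.le (f t)‖ ^ 2 + ∫ r in s₁..t, ‖incl _ hb.le (F r)‖ ^ 2 ≤
        C * ∫ r in s..T, ‖f r‖ ^ 2 := by
  set K₀ := ‖(incl ℝ hb.le : HFun n β b →L[ℝ] HFun n β B)‖ ^ 2
  set K := 4 * B ^ 2 * ‖(posOp hb : HFun n β b →L[ℝ] HVec n β B)‖ ^ 2
  refine ⟨(K₀ + K * (T - s)) / (s₁ - s), div_nonneg (add_nonneg (by positivity)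
    (mul_nonneg (by positivity) (by linarith))) (by linarith), fun ε f f' F hf hf' hF hG hL t ht => ?_⟩
  have hfc : ContinuousOn f (Icc s T) := fun r hr => (hf r hr).continuousAt.continuousWithinAt
  have key := energy_le (y := fun t => ‖incl ℝ hb.le (f t)‖ ^ 2)
    (y' := fun t => 2 * inner ℝ (incl ℝ hb.le (f t)) (incl ℝ hb.le (f' t)))
    (x := fun t => ‖f t‖ ^ 2) (z := fun t => ‖incl _ hb.le (F t)‖ ^ 2) (K := K) (K₀ := K₀)
    hs.le (by positivity) (by positivity) (fun t ht => (hasDerivAt_incl hb.le (hf t ht)).norm_sq)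
    (by fun_prop) (by fun_prop) (by fun_prop) (fun _ _ => by positivity)
    (fun _ _ => by positivity) (fun _ _ => by positivity) (fun t _ => ?_) (fun t ht => ?_) ht
  · rw [div_mul_eq_mul_div, le_div_iff₀ (by linarith), mul_comm]
    exact key
  · rw [← mul_pow]
    gcongr
    exact ContinuousLinearMap.le_opNorm _ _
  · have h1 := inner_incl_of_mem_Lap hb (hL t ht) (hG t ht)
    simp only [inner_sub_left, inner_smul_left, RCLike.conj_to_real, inner_radOp_left,
      real_inner_self_eq_norm_sq] at h1
    have h2 : ‖posOp hb (f t)‖ ^ 2 ≤ ‖(posOp hb : HFun n β b →L[ℝ] HVec n β B)‖ ^ 2 * ‖f t‖ ^ 2 := by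
      rw [← mul_pow]
      gcongr
      exact ContinuousLinearMap.le_opNorm _ _
    have h3 := real_inner_le_norm (incl _ hb.le (F t)) (posOp hb (f t))
    have h4 := real_inner_comm (incl ℝ hb.le (f t)) (incl ℝ hb.le (f' t))
    have h5 := mul_le_mul_of_nonneg_left h2 (by positivity : 0 ≤ 4 * B ^ 2)
    have h6 := mul_le_mul_of_nonneg_left h3 (by positivity : 0 ≤ 4 * B)
    nlinarith [sq_nonneg (‖incl _ hb.le (F t)‖ - 2 * B * ‖posOp hb (f t)‖)]

/-- The energy inequality for the gradient. -/
theorem exists_energy_grad {b B : ℝ} (hB : 0 ≤ B) (hb : b < B) {s s₁ T : ℝ} (hs : s < s₁)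
    (hT : s₁ ≤ T) :
    ∃ C : ℝ, 0 ≤ C ∧ ∀ (ε : ℝ) (f' : ℝ → HFun n β b) (F F' : ℝ → HVec n β b),
      (∀ t ∈ Icc s T, HasDerivAt F (F' t) t) → ContinuousOn F' (Icc s T) →
      ContinuousOn f' (Icc s T) → (∀ t ∈ Icc s T, (f' t, F' t) ∈ Gam n β ε b) →
      (∀ t ∈ Icc s T, (F t, f' t) ∈ Lap n β ε b) → ∀ t ∈ Icc s₁ T,
      ‖incl _ hb.le (F t)‖ ^ 2 + ∫ r in s₁..t, ‖incl ℝ hb.le (f' r)‖ ^ 2 ≤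
        C * ∫ r in s..T, ‖F r‖ ^ 2 := by
  set K₀ := ‖(incl _ hb.le : HVec n β b →L[ℝ] HVec n β B)‖ ^ 2
  set K := 4 * B ^ 2 * ‖(radOp hb : HVec n β b →L[ℝ] HFun n β B)‖ ^ 2
  refine ⟨(K₀ + K * (T - s)) / (s₁ - s), div_nonneg (add_nonneg (by positivity)
    (mul_nonneg (by positivity) (by linarith))) (by linarith), fun ε f' F F' hF hF' hf' hG hL t ht => ?_⟩
  have hFc : ContinuousOn F (Icc s T) := fun r hr => (hF r hr).continuousAt.continuousWithinAt
  have key := energy_le (y := fun t => ‖incl _ hb.le (F t)‖ ^ 2)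
    (y' := fun t => 2 * inner ℝ (incl _ hb.le (F t)) (incl _ hb.le (F' t)))
    (x := fun t => ‖F t‖ ^ 2) (z := fun t => ‖incl ℝ hb.le (f' t)‖ ^ 2) (K := K) (K₀ := K₀)
    hs.le (by positivity) (by positivity) (fun t ht => (hasDerivAt_incl hb.le (hF t ht)).norm_sq)
    (by fun_prop) (by fun_prop) (by fun_prop) (fun _ _ => by positivity)
    (fun _ _ => by positivity) (fun _ _ => by positivity) (fun t _ => ?_) (fun t ht => ?_) ht
  · rw [div_mul_eq_mul_div, le_div_iff₀ (by linarith), mul_comm]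
    exact key
  · rw [← mul_pow]
    gcongr
    exact ContinuousLinearMap.le_opNorm _ _
  · have h1 := inner_incl_of_mem_Lap hb (hL t ht) (hG t ht)
    simp only [inner_sub_left, inner_smul_left, RCLike.conj_to_real,
      real_inner_self_eq_norm_sq] at h1
    have h2 : ‖radOp hb (F t)‖ ^ 2 ≤ ‖(radOp hb : HVec n β b →L[ℝ] HFun n β B)‖ ^ 2 * ‖F t‖ ^ 2 := by
      rw [← mul_pow]
      gcongr
      exact ContinuousLinearMap.le_opNorm _ _
    have h3 := real_inner_le_norm (radOp hb (F t)) (incl ℝ hb.le (f' t))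
    have h5 := mul_le_mul_of_nonneg_left h2 (by positivity : 0 ≤ 4 * B ^ 2)
    have h6 := mul_le_mul_of_nonneg_left h3 (by positivity : 0 ≤ 4 * B)
    nlinarith [sq_nonneg (‖incl ℝ hb.le (f' t)‖ - 2 * B * ‖radOp hb (F t)‖)]

/-- Interior regularity: at later times, and for a smaller weight, the gradient and the time
derivative are controlled by the function. -/
theorem exists_interior_estimate {b B : ℝ} (hb0 : 0 ≤ b) (hb : b < B) {s s' T : ℝ} (hs : s < s')
    (hT : s' ≤ T) :
    ∃ C : ℝ, 0 ≤ C ∧ ∀ (ε : ℝ) (f f' f'' : ℝ → HFun n β b) (F F' : ℝ → HVec n β b),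
      SolCurve n β ε b (Icc s T) f f' f'' F F' → ∀ t ∈ Icc s' T,
      ‖incl _ hb.le (F t)‖ ^ 2 ≤ C * ∫ r in s..T, ‖f r‖ ^ 2 ∧
      ‖incl ℝ hb.le (f' t)‖ ^ 2 ≤ C * ∫ r in s..T, ‖f r‖ ^ 2 := by
  obtain ⟨b₁, hb₁, hb₁'⟩ := exists_between hb
  obtain ⟨b₂, hb₂, hb₂'⟩ := exists_between hb₁'
  obtain ⟨s₁, hs₁, hs₁'⟩ := exists_between hs
  obtain ⟨s₂, hs₂, hs₂'⟩ := exists_between hs₁'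
  -- a Caccioppoli inequality for `f`, the energy inequality for `F`, and a Caccioppoli inequality
  -- for `f'`, with a loss of weight and of time in each of them
  obtain ⟨C₁, hC₁, H₁⟩ := exists_caccioppoli (n := n) (β := β) (by linarith) hb₁ hs₁
    (by linarith : s₁ ≤ T)
  obtain ⟨C₂, hC₂, H₂⟩ := exists_energy_grad (n := n) (β := β) (by linarith) hb₂ hs₂
    (by linarith : s₂ ≤ T)
  obtain ⟨C₃, hC₃, H₃⟩ := exists_caccioppoli (n := n) (β := β) (by linarith) hb₂' hs₂' hT
  set L := ‖(incl _ hb₂'.le : HVec n β b₂ →L[ℝ] HVec n β B)‖ ^ 2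
  refine ⟨max (L * (C₂ * C₁)) (C₃ * (C₂ * C₁)), le_max_of_le_left (by positivity),
    fun ε f f' f'' F F' h t ht => ?_⟩
  set X := ∫ r in s..T, ‖f r‖ ^ 2
  have hX : 0 ≤ X := intervalIntegral.integral_nonneg (by linarith) fun _ _ => by positivity
  have hsub₁ : Icc s₁ T ⊆ Icc s T := Icc_subset_Icc_left hs₁.le
  have hsub₂ : Icc s₂ T ⊆ Icc s T := Icc_subset_Icc_left (hs₁.trans hs₂).le
  have hF : ContinuousOn F (Icc s T) := fun r hr =>
    (h.deriv_grad r hr).continuousAt.continuousWithinAt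
  have hf' : ContinuousOn f' (Icc s T) := fun r hr =>
    (h.deriv' r hr).continuousAt.continuousWithinAt
  have a1 := H₁ ε f f' F h.deriv hf' hF h.mem_Gam h.mem_Lap T ⟨by linarith, le_rfl⟩
  have a1' : ∫ r in s₁..T, ‖incl _ hb₁.le (F r)‖ ^ 2 ≤ C₁ * X := by
    linarith [sq_nonneg ‖incl ℝ hb₁.le (f T)‖]
  have a2 := H₂ ε (fun t => incl ℝ hb₁.le (f' t)) (fun t => incl _ hb₁.le (F t))
    (fun t => incl _ hb₁.le (F' t)) (fun t ht => hasDerivAt_incl _ (h.deriv_grad t (hsub₁ ht)))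
    ((incl _ hb₁.le).continuous.comp_continuousOn (h.cont_grad.mono hsub₁))
    ((incl ℝ hb₁.le).continuous.comp_continuousOn (hf'.mono hsub₁))
    (fun t ht => incl_mem_Gam hb₁.le (h.mem_Gam' t (hsub₁ ht)))
    (fun t ht => incl_mem_Lap hb₁.le (h.mem_Lap t (hsub₁ ht)))
  have a2' : ∀ t ∈ Icc s₂ T, ‖incl _ (hb₁.trans hb₂).le (F t)‖ ^ 2 +
      ∫ r in s₂..t, ‖incl ℝ (hb₁.trans hb₂).le (f' r)‖ ^ 2 ≤ C₂ * C₁ * X := fun t ht => by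
    have := a2 t ht
    simp only [incl_incl] at this
    refine this.trans ?_
    rw [mul_assoc]
    gcongr
  have a3 := H₃ ε (fun t => incl ℝ (hb₁.trans hb₂).le (f' t))
    (fun t => incl ℝ (hb₁.trans hb₂).le (f'' t)) (fun t => incl _ (hb₁.trans hb₂).le (F' t))
    (fun t ht => hasDerivAt_incl _ (h.deriv' t (hsub₂ ht)))
    ((incl ℝ _).continuous.comp_continuousOn (h.cont.mono hsub₂))
    ((incl _ _).continuous.comp_continuousOn (h.cont_grad.mono hsub₂))
    (fun t ht => incl_mem_Gam _ (h.mem_Gam' t (hsub₂ ht)))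
    (fun t ht => incl_mem_Lap _ (h.mem_Lap' t (hsub₂ ht))) t ht
  simp only [incl_incl] at a3
  constructor
  · have e : incl _ hb.le (F t) = incl _ hb₂'.le (incl _ (hb₁.trans hb₂).le (F t)) := by simp
    have h1 := a2' t ⟨hs₂'.le.trans ht.1, ht.2⟩
    have h2 : 0 ≤ ∫ r in s₂..t, ‖incl ℝ (hb₁.trans hb₂).le (f' r)‖ ^ 2 :=
      intervalIntegral.integral_nonneg (hs₂'.le.trans ht.1) fun _ _ => by positivity
    calc ‖incl _ hb.le (F t)‖ ^ 2 ≤ L * ‖incl _ (hb₁.trans hb₂).le (F t)‖ ^ 2 := by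
          rw [e, ← mul_pow]
          gcongr
          exact ContinuousLinearMap.le_opNorm _ _
      _ ≤ L * (C₂ * C₁ * X) := by gcongr; linarith
      _ ≤ _ := by rw [← mul_assoc]; gcongr; exact le_max_left _ _
  · have h1 := a2' T ⟨by linarith, le_rfl⟩
    have h2 : 0 ≤ ∫ r in s'..t, ‖incl _ ((hb₁.trans hb₂).le.trans hb₂'.le) (F' r)‖ ^ 2 :=
      intervalIntegral.integral_nonneg ht.1 fun _ _ => by positivity
    calc ‖incl ℝ hb.le (f' t)‖ ^ 2
        ≤ C₃ * ∫ r in s₂..T, ‖incl ℝ (hb₁.trans hb₂).le (f' r)‖ ^ 2 := by linarith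
      _ ≤ C₃ * (C₂ * C₁ * X) := by
          gcongr
          linarith [sq_nonneg ‖incl _ (hb₁.trans hb₂).le (F T)‖]
      _ ≤ _ := by rw [← mul_assoc]; gcongr; exact le_max_right _ _

end

end

/-! ### Averages in time -/

section

variable {n : ℕ} {β : ℝ}

section Avg

variable {α γ E : Type*} [MeasurableSpace α] [MeasurableSpace γ] {ν : Measure α} {μ : Measure γ}
  [SFinite ν] [SFinite μ] [NormedAddCommGroup E] [InnerProductSpace ℝ E]

theorem eLpNorm_tensor {κ : α → ℝ} {h : γ → E} (hκ : AEStronglyMeasurable κ ν)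
    (hh : AEStronglyMeasurable h μ) :
    eLpNorm (fun z : α × γ => κ z.1 • h z.2) 2 (ν.prod μ) = eLpNorm κ 2 ν * eLpNorm h 2 μ := by
  rw [← (ENNReal.pow_right_strictMono two_ne_zero).injective.eq_iff, mul_pow, eLpNorm_two_sq,
    eLpNorm_two_sq, eLpNorm_two_sq,
    ← lintegral_prod_mul (hκ.enorm.pow_const 2) (hh.enorm.pow_const 2)]
  simp [enorm_smul, mul_pow]

theorem memLp_tensor {κ : α → ℝ} {h : γ → E} (hκ : MemLp κ 2 ν) (hh : MemLp h 2 μ) :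
    MemLp (fun z : α × γ => κ z.1 • h z.2) 2 (ν.prod μ) :=
  ⟨hκ.1.comp_fst.smul hh.1.comp_snd, by
    rw [eLpNorm_tensor hκ.1 hh.1]; exact ENNReal.mul_lt_top hκ.2 hh.2⟩

/-- The function `(t, x) ↦ κ(t) h(x)`. -/
def tensor (κ : Lp ℝ 2 ν) : Lp E 2 μ →L[ℝ] Lp E 2 (ν.prod μ) :=
  LinearMap.mkContinuous
    { toFun := fun h => (memLp_tensor (Lp.memLp κ) (Lp.memLp h)).toLp
      map_add' := fun f g => by
        rw [← MemLp.toLp_add]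
        refine MemLp.toLp_congr _ _ ?_
        filter_upwards [Measure.quasiMeasurePreserving_snd.ae (Lp.coeFn_add f g)] with z hz
        simp only [Pi.add_apply]
        rw [hz, Pi.add_apply, smul_add]
      map_smul' := fun c f => by
        rw [RingHom.id_apply, ← MemLp.toLp_const_smul]
        refine MemLp.toLp_congr _ _ ?_
        filter_upwards [Measure.quasiMeasurePreserving_snd.ae (Lp.coeFn_smul c f)] with z hz
        simp only [Pi.smul_apply]
        rw [hz, Pi.smul_apply, smul_comm] } ‖κ‖ fun h => by
    change ‖(memLp_tensor (Lp.memLp κ) (Lp.memLp h)).toLp‖ ≤ _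
    rw [Lp.norm_toLp, eLpNorm_tensor (Lp.aestronglyMeasurable κ) (Lp.aestronglyMeasurable h),
      ENNReal.toReal_mul]
    rfl

theorem coeFn_tensor (κ : Lp ℝ 2 ν) (h : Lp E 2 μ) :
    tensor κ h =ᵐ[ν.prod μ] fun z => κ z.1 • h z.2 :=
  MemLp.coeFn_toLp (memLp_tensor (Lp.memLp κ) (Lp.memLp h))

theorem tensor_add (κ κ' : Lp ℝ 2 ν) :
    (tensor (κ + κ') : Lp E 2 μ →L[ℝ] _) = tensor κ + tensor κ' := by
  ext1 h
  refine Lp.ext ?_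
  filter_upwards [coeFn_tensor (κ + κ') h, Lp.coeFn_add (tensor κ h) (tensor κ' h),
    coeFn_tensor κ h, coeFn_tensor κ' h,
    Measure.quasiMeasurePreserving_fst.ae (Lp.coeFn_add κ κ')] with z h1 h2 h3 h4 h5
  rw [h1, _root_.add_apply, h2, Pi.add_apply, h3, h4, h5, Pi.add_apply, add_smul]

theorem tensor_smul (c : ℝ) (κ : Lp ℝ 2 ν) :
    (tensor (c • κ) : Lp E 2 μ →L[ℝ] _) = c • tensor κ := by
  ext1 h
  refine Lp.ext ?_
  filter_upwards [coeFn_tensor (c • κ) h, Lp.coeFn_smul c (tensor κ h), coeFn_tensor κ h,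
    Measure.quasiMeasurePreserving_fst.ae (Lp.coeFn_smul c κ)] with z h1 h2 h3 h4
  rw [h1, _root_.smul_apply, h2, Pi.smul_apply, h3, h4, Pi.smul_apply, smul_assoc]

variable [CompleteSpace E]

/-- The average `∫ κ(t) G(t, ·) dt`, defined by duality. -/
def timeAvg (G : Lp E 2 (ν.prod μ)) : Lp ℝ 2 ν →L[ℝ] Lp E 2 μ :=
  LinearMap.mkContinuous
    { toFun := fun κ => ContinuousLinearMap.adjoint (tensor κ : Lp E 2 μ →L[ℝ] _) G
      map_add' := fun κ κ' => by rw [tensor_add, map_add, _root_.add_apply]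
      map_smul' := fun c κ => by
        refine ext_inner_right ℝ fun h => ?_
        rw [ContinuousLinearMap.adjoint_inner_left, tensor_smul, RingHom.id_apply,
          inner_smul_left, ContinuousLinearMap.adjoint_inner_left, _root_.smul_apply,
          inner_smul_right]
        simp } ‖G‖ fun κ => by
    refine (ContinuousLinearMap.le_opNorm (ContinuousLinearMap.adjoint
      (tensor κ : Lp E 2 μ →L[ℝ] _)) G).trans ?_
    rw [LinearIsometryEquiv.norm_map, mul_comm]
    gcongr
    exact LinearMap.mkContinuous_norm_le _ (norm_nonneg _) _

theorem inner_timeAvg (G : Lp E 2 (ν.prod μ)) (κ : Lp ℝ 2 ν) (h : Lp E 2 μ) :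
    inner ℝ (timeAvg G κ) h = inner ℝ G (tensor κ h) :=
  ContinuousLinearMap.adjoint_inner_left (tensor κ : Lp E 2 μ →L[ℝ] Lp E 2 (ν.prod μ)) h G

end Avg

section

variable [hn : Fact (2 ≤ n)] [hβ : Fact (0 < β)] {E : Type*} [NormedAddCommGroup E]
  [InnerProductSpace ℝ E]

theorem exists_coeFn_eq_inv_dens_smul (b : ℝ) {g : HornSpace n → E} (hg : Continuous g)
    (hc : HasCompactSupport g) (hs : tsupport g ⊆ {0}ᶜ) :
    ∃ G : Lp E 2 (wm n β b), G =ᵐ[volume] fun x => (dens n β b x)⁻¹ • g x := by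
  have h1 : ContinuousOn (fun x => (dens n β b x)⁻¹ • ContinuousLinearMap.id ℝ E) {0}ᶜ :=
    ((continuous_dens b).continuousOn.inv₀ fun x hx => (dens_pos b hx).ne').smul
      continuousOn_const
  have h4 := memLp_of_hasCompactSupport (β := β) b (continuous_fiber h1 hg hs)
    (hasCompactSupport_fiber (fun x => (dens n β b x)⁻¹ • ContinuousLinearMap.id ℝ E) hc)
  exact ⟨h4.toLp, ae_eq_wm.mp h4.coeFn_toLp⟩

theorem prod_wm (ν : Measure ℝ) [SFinite ν] (b : ℝ) :
    ν.prod (wm n β b) = (ν.prod volume).withDensity fun z => ENNReal.ofReal (dens n β b z.2) :=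
  prod_withDensity_right (measurable_dens b).ennreal_ofReal

theorem integral_prod_wm (ν : Measure ℝ) [SFinite ν] (b : ℝ) (f : ℝ × HornSpace n → ℝ) :
    ∫ z, f z ∂(ν.prod (wm n β b)) = ∫ z, dens n β b z.2 * f z ∂(ν.prod volume) := by
  rw [prod_wm, integral_withDensity_eq_integral_toReal_smul
    (by have := measurable_dens (n := n) (β := β) b; fun_prop) (by simp)]
  simp_rw [ENNReal.toReal_ofReal (dens_nonneg b _), smul_eq_mul]

theorem integrable_prod_wm (ν : Measure ℝ) [SFinite ν] (b : ℝ) {f : ℝ × HornSpace n → ℝ} :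
    Integrable f (ν.prod (wm n β b)) ↔
      Integrable (fun z => dens n β b z.2 * f z) (ν.prod volume) := by
  rw [prod_wm, integrable_withDensity_iff_integrable_smul'
    (by have := measurable_dens (n := n) (β := β) b; fun_prop) (by simp)]
  simp_rw [ENNReal.toReal_ofReal (dens_nonneg b _), smul_eq_mul]

theorem ae_prod_wm (ν : Measure ℝ) [SFinite ν] (b : ℝ) :
    ae (ν.prod (wm n β b)) = ae (ν.prod (volume : Measure (HornSpace n))) := by
  apply le_antisymm
  · exact (Measure.AbsolutelyContinuous.rfl.prod (withDensity_absolutelyContinuous _ _)).ae_le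
  · refine (Measure.AbsolutelyContinuous.rfl.prod ?_).ae_le
    exact Measure.ae_le_iff_absolutelyContinuous.mp (ae_wm b).ge

/-- Pairing of a time average with a function supported away from the tip. -/
theorem integral_inner_timeAvg [CompleteSpace E] {ν : Measure ℝ} [SFinite ν] {b : ℝ}
    (G : Lp E 2 (ν.prod (wm n β b))) (κ : Lp ℝ 2 ν) {g : HornSpace n → E} (hg : Continuous g)
    (hc : HasCompactSupport g) (hs : tsupport g ⊆ {0}ᶜ) :
    Integrable (fun z : ℝ × HornSpace n => κ z.1 * inner ℝ (G z) (g z.2)) (ν.prod volume) ∧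
    ∫ x, inner ℝ (timeAvg G κ x) (g x) =
      ∫ z, κ z.1 * inner ℝ (G z) (g z.2) ∂(ν.prod volume) := by
  obtain ⟨K, hK⟩ := exists_coeFn_eq_inv_dens_smul (β := β) b hg hc hs
  have hne : ∀ᵐ z ∂(ν.prod (volume : Measure (HornSpace n))), z.2 ≠ 0 :=
    Measure.quasiMeasurePreserving_snd.ae ae_ne_zero
  have e2 : (fun z : ℝ × HornSpace n => dens n β b z.2 * inner ℝ (G z) (tensor κ K z))
      =ᵐ[ν.prod volume] fun z => κ z.1 * inner ℝ (G z) (g z.2) := by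
    have h1 := coeFn_tensor κ K
    rw [Filter.EventuallyEq, ae_prod_wm] at h1
    filter_upwards [h1, Measure.quasiMeasurePreserving_snd.ae hK, hne] with z hz1 hz2 hz3
    rw [hz1, hz2, inner_smul_right, inner_smul_right]
    have := (dens_pos (n := n) (β := β) b hz3).ne'
    field_simp
  have e1 : inner ℝ (timeAvg G κ) K = ∫ x, inner ℝ (timeAvg G κ x) (g x) := by
    rw [L2.inner_def, integral_wm]
    refine integral_congr_ae ?_
    filter_upwards [hK, ae_ne_zero] with x hx hx0
    rw [hx]
    simp [inner_smul_right, mul_inv_cancel_left₀ (dens_pos b hx0).ne']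
  refine ⟨?_, ?_⟩
  · exact (integrable_congr e2).mp ((integrable_prod_wm ν b).mp (L2.integrable_inner _ _))
  · rw [← e1, inner_timeAvg, L2.inner_def, integral_prod_wm, integral_congr_ae e2]

/-- An element of a weighted `L²` space is determined by its integrals against test functions. -/
theorem lp_eq_of_forall_integral_eq {f g : HornSpace n → ℝ}
    (hf : LocallyIntegrableOn f {0}ᶜ) (hg : LocallyIntegrableOn g {0}ᶜ)
    (h : ∀ φ : HornSpace n → ℝ, IsTest φ → ∫ x, f x * φ x = ∫ x, g x * φ x) :
    f =ᵐ[volume] g := by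
  have key : ∀ᵐ x : HornSpace n, x ∈ ({0}ᶜ : Set (HornSpace n)) → f x - g x = 0 := by
    refine isOpen_compl_singleton.ae_eq_zero_of_integral_contDiff_smul_eq_zero
      (hf.sub hg) fun φ hφ hφc hφs => ?_
    have hi : ∀ {f : HornSpace n → ℝ}, LocallyIntegrableOn f {0}ᶜ →
        Integrable fun x => f x * φ x := fun {f} hf => by
      have h1 : IntegrableOn f (tsupport φ) := hf.integrableOn_compact_subset hφs hφc
      have h2 : IntegrableOn (fun x => f x * φ x) (tsupport φ) := by
        obtain ⟨C, hC⟩ := hφc.exists_bound_of_continuous hφ.continuous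
        exact h1.mul_bdd hφ.continuous.aestronglyMeasurable (ae_of_all _ hC)
      refine (integrableOn_iff_integrable_of_support_subset fun x hx => ?_).mp h2
      refine subset_tsupport _ fun h0 => hx ?_
      simp [h0]
    have h3 := h φ ⟨hφ, hφc, hφs⟩
    simp only [smul_eq_mul, mul_comm (φ _), sub_mul]
    rw [integral_sub (hi hf) (hi hg), h3, sub_self]
  filter_upwards [key, ae_ne_zero] with x hx hx0
  exact sub_eq_zero.mp (hx hx0)

end

end

/-! ### Time averages of a solution -/

section

variable {n : ℕ} {β : ℝ}

/-- Smooth functions of time with compact support in `(t₀, t₁)`. -/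
structure IsTimeTest (t₀ t₁ : ℝ) (κ : ℝ → ℝ) : Prop where
  smooth : ContDiff ℝ ∞ κ
  compact : HasCompactSupport κ
  supp : tsupport κ ⊆ Ioo t₀ t₁

theorem IsTimeTest.eq_zero {t₀ t₁ : ℝ} {κ : ℝ → ℝ} (h : IsTimeTest t₀ t₁ κ) {t : ℝ}
    (ht : t ∉ Ioo t₀ t₁) : κ t = 0 :=
  image_eq_zero_of_notMem_tsupport fun h' => ht (h.supp h')

protected theorem IsTimeTest.deriv {t₀ t₁ : ℝ} {κ : ℝ → ℝ} (h : IsTimeTest t₀ t₁ κ) :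
    IsTimeTest t₀ t₁ (deriv κ) where
  smooth := by
    have := h.smooth
    exact (contDiff_infty_iff_deriv.mp this).2
  compact := h.compact.deriv
  supp := (tsupport_deriv_subset (f := κ)).trans h.supp

/-- Lebesgue measure on `(t₀, t₁)`. -/
abbrev timeMeasure (t₀ t₁ : ℝ) : Measure ℝ := volume.restrict (Ioo t₀ t₁)

section Product

variable {t₀ t₁ : ℝ} {κ : ℝ → ℝ} {φ : HornSpace n → ℝ}

theorem tsupport_prod_subset (κ : ℝ → ℝ) (φ : HornSpace n → ℝ) :
    tsupport (fun z : ℝ × HornSpace n => κ z.1 * φ z.2) ⊆ tsupport κ ×ˢ tsupport φ := by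
  refine closure_minimal (fun z hz => ?_) ((isClosed_tsupport _).prod (isClosed_tsupport _))
  simp only [Function.mem_support, mul_ne_zero_iff] at hz
  exact ⟨subset_tsupport _ hz.1, subset_tsupport _ hz.2⟩

theorem contDiff_prod (hκ : IsTimeTest t₀ t₁ κ) (hφ : IsTest φ) :
    ContDiff ℝ ∞ fun z : ℝ × HornSpace n => κ z.1 * φ z.2 :=
  (hκ.smooth.comp contDiff_fst).mul (hφ.smooth.comp contDiff_snd)

theorem hasCompactSupport_prod (hκ : IsTimeTest t₀ t₁ κ) (hφ : IsTest φ) :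
    HasCompactSupport fun z : ℝ × HornSpace n => κ z.1 * φ z.2 :=
  (hκ.compact.prod hφ.compact).of_isClosed_subset (isClosed_tsupport _) (tsupport_prod_subset κ φ)

theorem tsupport_prod_subset' (hκ : IsTimeTest t₀ t₁ κ) (hφ : IsTest φ) :
    tsupport (fun z : ℝ × HornSpace n => κ z.1 * φ z.2) ⊆ Ioo t₀ t₁ ×ˢ {0}ᶜ :=
  (tsupport_prod_subset κ φ).trans (prod_mono hκ.supp hφ.supp)

theorem fderiv_prod_apply (hκ : IsTimeTest t₀ t₁ κ) (hφ : IsTest φ) (z : ℝ × HornSpace n) (s : ℝ)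
    (v : HornSpace n) :
    fderiv ℝ (fun z : ℝ × HornSpace n => κ z.1 * φ z.2) z (s, v) =
      κ z.1 * fderiv ℝ φ z.2 v + s * deriv κ z.1 * φ z.2 := by
  have h1 : HasFDerivAt (fun z : ℝ × HornSpace n => κ z.1)
      (deriv κ z.1 • ContinuousLinearMap.fst ℝ ℝ (HornSpace n)) z :=
    ((hκ.smooth.differentiable (by simp) z.1).hasDerivAt).comp_hasFDerivAt z
      (hasFDerivAt_fst (𝕜 := ℝ) (p := z))
  have h2 : HasFDerivAt (fun z : ℝ × HornSpace n => φ z.2)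
      ((fderiv ℝ φ z.2).comp (ContinuousLinearMap.snd ℝ ℝ (HornSpace n))) z :=
    (hφ.differentiableAt z.2).hasFDerivAt.comp z (hasFDerivAt_snd (𝕜 := ℝ) (p := z))
  rw [(h1.fun_mul h2).fderiv]
  simp; ring

end Product

section

variable [hn : Fact (2 ≤ n)] [hβ : Fact (0 < β)]

/-- Pairing of a time average with a function supported away from the tip. -/
theorem integral_inner_timeAvg_toLp {E : Type*} [NormedAddCommGroup E]
    [InnerProductSpace ℝ E] [CompleteSpace E] {b t₀ t₁ : ℝ} {f : ℝ × HornSpace n → E}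
    (hf : MemLp f 2 ((timeMeasure t₀ t₁).prod (wm n β b))) {k : Lp ℝ 2 (timeMeasure t₀ t₁)}
    {κ : ℝ → ℝ} (hκ : IsTimeTest t₀ t₁ κ) (hk : k =ᵐ[timeMeasure t₀ t₁] κ)
    {g : HornSpace n → E} (hg : Continuous g) (hc : HasCompactSupport g)
    (hs : tsupport g ⊆ {0}ᶜ) :
    Integrable (fun z : ℝ × HornSpace n => κ z.1 * inner ℝ (f z) (g z.2)) ∧
    ∫ x, inner ℝ (timeAvg hf.toLp k x) (g x) =
      ∫ z : ℝ × HornSpace n, κ z.1 * inner ℝ (f z) (g z.2) := by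
  obtain ⟨h1, h2⟩ := integral_inner_timeAvg hf.toLp k hg hc hs
  have e0 := hf.coeFn_toLp
  rw [Filter.EventuallyEq, ae_prod_wm] at e0
  have e : (fun z : ℝ × HornSpace n => k z.1 * inner ℝ (hf.toLp f z) (g z.2))
      =ᵐ[(timeMeasure t₀ t₁).prod volume] fun z => κ z.1 * inner ℝ (f z) (g z.2) := by
    filter_upwards [e0, Measure.quasiMeasurePreserving_fst.ae hk] with z hz1 hz2
    rw [hz1, hz2]
  have hν : (timeMeasure t₀ t₁).prod (volume : Measure (HornSpace n)) =
      volume.restrict (Ioo t₀ t₁ ×ˢ univ) := by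
    rw [timeMeasure, ← Measure.restrict_univ (μ := (volume : Measure (HornSpace n))),
      Measure.prod_restrict, Measure.volume_eq_prod]
  have h0 : ∀ z ∉ Ioo t₀ t₁ ×ˢ (univ : Set (HornSpace n)),
      κ z.1 * inner ℝ (f z) (g z.2) = 0 := fun z hz => by
    rw [hκ.eq_zero fun h => hz ⟨h, trivial⟩, zero_mul]
  have h1' := (integrable_congr e).mp h1
  rw [hν] at h1'
  refine ⟨(integrableOn_iff_integrable_of_support_subset fun z hz => ?_).mp h1', ?_⟩
  · by_contra h
    exact hz (h0 z h)
  · rw [h2, integral_congr_ae e, hν, setIntegral_eq_integral_of_forall_compl_eq_zero h0]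

/-- The equations satisfied by the time averages `Tu κ = ∫ κ(t) u(t) dt`, `TV κ` and `Tw κ` of a
solution of the heat equation, of its gradient and of its time derivative. -/
structure IsAvgSol (n : ℕ) (β ε b t₀ t₁ : ℝ) [Fact (2 ≤ n)] [Fact (0 < β)]
    (Tu : Lp ℝ 2 (timeMeasure t₀ t₁) →L[ℝ] HFun n β b)
    (TV : Lp ℝ 2 (timeMeasure t₀ t₁) →L[ℝ] HVec n β b)
    (Tw : Lp ℝ 2 (timeMeasure t₀ t₁) →L[ℝ] HFun n β b) : Prop where
  mem_Gam : ∀ (κ : ℝ → ℝ) (k : Lp ℝ 2 (timeMeasure t₀ t₁)), IsTimeTest t₀ t₁ κ → k =ᵐ[timeMeasure t₀ t₁] κ → (Tu k, TV k) ∈ Gam n β ε b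
  mem_Lap : ∀ (κ : ℝ → ℝ) (k : Lp ℝ 2 (timeMeasure t₀ t₁)), IsTimeTest t₀ t₁ κ → k =ᵐ[timeMeasure t₀ t₁] κ → (TV k, Tw k) ∈ Lap n β ε b
  protected deriv : ∀ (κ : ℝ → ℝ) (k k' : Lp ℝ 2 (timeMeasure t₀ t₁)), IsTimeTest t₀ t₁ κ → k =ᵐ[timeMeasure t₀ t₁] κ →
    k' =ᵐ[timeMeasure t₀ t₁] deriv κ → Tu k' = -Tw k

theorem hornMeasure_eq_wm {N ε η : ℝ} (hβ' : β = ε * (n - 1) + (N - n) * (1 - η)) :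
    hornMeasure n N ε η = wm n β 0 := by
  refine withDensity_congr_ae ?_
  filter_upwards [ae_ne_zero] with x hx
  have h0 : 0 < ‖x‖ := norm_pos_iff.mpr hx
  congr 1
  rw [dens, hβ', Real.rpow_add h0, div_pow, neg_zero, zero_mul,
    Real.exp_zero, mul_one]
  have : ((n : ℝ) - 1) = ((n - 1 : ℕ) : ℝ) := by
    have := hn.out
    push_cast [Nat.cast_sub (by omega : 1 ≤ n)]; ring
  rw [this, Real.rpow_mul_natCast h0.le, one_div, inv_pow]
  field_simp

section Sol

variable {N ε η a t₀ t₁ : ℝ} {u : ℝ → HornSpace n → ℝ} {V : ℝ → HornSpace n → HornSpace n}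
  {w : ℝ → HornSpace n → ℝ}

theorem aestronglyMeasurable_prod {E : Type*} [NormedAddCommGroup E]
    {f : ℝ × HornSpace n → E} (hf : LocallyIntegrableOn f (Ioo t₀ t₁ ×ˢ {0}ᶜ)) (b : ℝ) :
    AEStronglyMeasurable f ((timeMeasure t₀ t₁).prod (wm n β b)) := by
  have h1 := hf.aestronglyMeasurable
  rw [Measure.volume_eq_prod, ← Measure.prod_restrict] at h1
  refine h1.mono_ac (Measure.AbsolutelyContinuous.rfl.prod ?_)
  rw [Measure.restrict_eq_self_of_ae_mem (by simpa using ae_ne_zero)]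
  exact withDensity_absolutelyContinuous _ _

/-- A solution of less than Gaussian growth lies, with its derivatives, in weighted `L²` spaces. -/
theorem memLp_of_integrableOn (hm : hornMeasure n N ε η = wm n β 0)
    (hu : LocallyIntegrableOn (fun z : ℝ × HornSpace n => u z.1 z.2) (Ioo t₀ t₁ ×ˢ {0}ᶜ))
    (hV : LocallyIntegrableOn (fun z : ℝ × HornSpace n => V z.1 z.2) (Ioo t₀ t₁ ×ˢ {0}ᶜ))
    (hw : LocallyIntegrableOn (fun z : ℝ × HornSpace n => w z.1 z.2) (Ioo t₀ t₁ ×ˢ {0}ᶜ))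
    (hI : IntegrableOn (fun z : ℝ × HornSpace n =>
      (u z.1 z.2 ^ 2 + hornInner ε z.2 (V z.1 z.2) (V z.1 z.2) + w z.1 z.2 ^ 2) *
        Real.exp (-a * ‖z.2‖ ^ 2)) (Ioo t₀ t₁ ×ˢ univ) (hornSpaceTime n N ε η)) :
    MemLp (fun z : ℝ × HornSpace n => u z.1 z.2) 2 ((timeMeasure t₀ t₁).prod (wm n β a)) ∧
    MemLp (fun z : ℝ × HornSpace n => frame ε z.2 (V z.1 z.2)) 2
      ((timeMeasure t₀ t₁).prod (wm n β a)) ∧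
    MemLp (fun z : ℝ × HornSpace n => w z.1 z.2) 2 ((timeMeasure t₀ t₁).prod (wm n β a)) := by
  have h1 : Integrable (fun z : ℝ × HornSpace n =>
      u z.1 z.2 ^ 2 + hornInner ε z.2 (V z.1 z.2) (V z.1 z.2) + w z.1 z.2 ^ 2)
      ((timeMeasure t₀ t₁).prod (wm n β a)) := by
    rw [IntegrableOn, hornSpaceTime, hm, ← Measure.prod_restrict, Measure.restrict_univ,
      integrable_prod_wm] at hI
    rw [integrable_prod_wm]
    refine hI.congr (ae_of_all _ fun z => ?_)
    have := dens_mul_exp (n := n) (β := β) 0 a z.2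
    rw [zero_add] at this
    simp only [← this]
    ring
  have hne : ∀ᵐ z ∂((timeMeasure t₀ t₁).prod (wm n β a)), z.2 ≠ 0 :=
    Measure.quasiMeasurePreserving_snd.ae (ae_ne_zero_wm a)
  have m2 : AEStronglyMeasurable (fun z : ℝ × HornSpace n => frame ε z.2 (V z.1 z.2))
      ((timeMeasure t₀ t₁).prod (wm n β a)) :=
    ContinuousLinearMap.aestronglyMeasurable_comp₂
      (ContinuousLinearMap.id ℝ (HornSpace n →L[ℝ] HornSpace n))
      ((stronglyMeasurable_frame ε).comp_measurable measurable_snd).aestronglyMeasurable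
      (aestronglyMeasurable_prod hV a)
  have e : ∀ z : ℝ × HornSpace n, z.2 ≠ 0 → hornInner ε z.2 (V z.1 z.2) (V z.1 z.2) =
      ‖frame ε z.2 (V z.1 z.2)‖ ^ 2 := fun z hz => by
    rw [← inner_frame_frame ε hz, real_inner_self_eq_norm_sq]
  refine ⟨(memLp_two_iff_integrable_sq_norm (aestronglyMeasurable_prod hu a)).mpr ?_,
    (memLp_two_iff_integrable_sq_norm m2).mpr ?_,
    (memLp_two_iff_integrable_sq_norm (aestronglyMeasurable_prod hw a)).mpr ?_⟩
  · refine h1.mono' ((aestronglyMeasurable_prod hu a).norm.pow 2) ?_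
    filter_upwards [hne] with z hz
    rw [e z hz, Real.norm_of_nonneg (by positivity), Real.norm_eq_abs, sq_abs]
    linarith [sq_nonneg ‖frame ε z.2 (V z.1 z.2)‖, sq_nonneg (w z.1 z.2)]
  · refine h1.mono' (m2.norm.pow 2) ?_
    filter_upwards [hne] with z hz
    rw [e z hz, Real.norm_of_nonneg (by positivity)]
    linarith [sq_nonneg (u z.1 z.2), sq_nonneg (w z.1 z.2)]
  · refine h1.mono' ((aestronglyMeasurable_prod hw a).norm.pow 2) ?_
    filter_upwards [hne] with z hz
    rw [e z hz, Real.norm_of_nonneg (by positivity), Real.norm_eq_abs, sq_abs]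
    linarith [sq_nonneg ‖frame ε z.2 (V z.1 z.2)‖, sq_nonneg (u z.1 z.2)]

/-- Testing the weak equations of a solution with products `κ(t) φ(x)` gives the equations for its
time averages. -/
theorem isAvgSol (hm : hornMeasure n N ε η = wm n β 0) (hS : IsHornSolution n N ε η t₀ t₁ u V w)
    (hu : MemLp (fun z : ℝ × HornSpace n => u z.1 z.2) 2 ((timeMeasure t₀ t₁).prod (wm n β a)))
    (hV : MemLp (fun z : ℝ × HornSpace n => frame ε z.2 (V z.1 z.2)) 2
      ((timeMeasure t₀ t₁).prod (wm n β a)))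
    (hw : MemLp (fun z : ℝ × HornSpace n => w z.1 z.2) 2
      ((timeMeasure t₀ t₁).prod (wm n β a))) :
    IsAvgSol n β ε a t₀ t₁ (timeAvg hu.toLp) (timeAvg hV.toLp) (timeAvg hw.toLp) where
  mem_Gam κ k hκ hk := by
    have hne : ∀ᵐ z : ℝ × HornSpace n, z.2 ≠ 0 := by
      rw [Measure.volume_eq_prod]
      exact Measure.quasiMeasurePreserving_snd.ae ae_ne_zero
    have h : IsHornWeakGrad (timeAvg hu.toLp k : HornSpace n → ℝ)
        fun x => frameInv ε x (timeAvg hV.toLp k x) := by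
      refine ⟨locallyIntegrableOn_of_memLp (Lp.memLp _), locallyIntegrableOn_fiber
        (continuousOn_frameInv ε) (stronglyMeasurable_frameInv ε)
        (locallyIntegrableOn_of_memLp (Lp.memLp _)), fun φ hφ hφc hφs v => ?_⟩
      have hT : IsTest φ := ⟨hφ, hφc, hφs⟩
      have hd : Continuous fun x => fderiv ℝ φ x v :=
        (hφ.continuous_fderiv (by simp)).clm_apply continuous_const
      have e1 := (integral_inner_timeAvg_toLp hu hκ hk hd
        ((hφc.fderiv ℝ).mono fun x hx h0 => by
          simp only [Function.mem_support] at hx; exact hx (by simp [h0]))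
        ((tsupport_fderiv_apply_subset φ v).trans hφs)).2
      have hgs : tsupport (fun x => φ x • v) ⊆ tsupport φ := by
        refine closure_mono fun x hx h0 => ?_
        simp only [Function.mem_support] at hx
        exact hx (by simp [h0])
      have hgc : HasCompactSupport fun x => φ x • v :=
        hφc.of_isClosed_subset (isClosed_tsupport _) hgs
      have e2 := (integral_inner_timeAvg_toLp hV hκ hk
        (continuous_fiber (continuousOn_frameInv ε) (hφ.continuous.smul continuous_const)
          (hgs.trans hφs)) (hasCompactSupport_fiber (frameInv ε) hgc) (by
          refine (closure_mono fun x hx h0 => ?_).trans (hgs.trans hφs)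
          simp only [Function.mem_support] at hx
          exact hx (by simp [h0]))).2
      have key := hS.weak_grad _ (contDiff_prod hκ hT) (hasCompactSupport_prod hκ hT)
        (tsupport_prod_subset' hκ hT) v
      calc ∫ x, timeAvg hu.toLp k x * fderiv ℝ φ x v
          = ∫ x, inner ℝ (timeAvg hu.toLp k x) (fderiv ℝ φ x v) :=
            integral_congr_ae (ae_of_all _ fun x => by simp [mul_comm])
        _ = ∫ z : ℝ × HornSpace n, κ z.1 * inner ℝ (u z.1 z.2) (fderiv ℝ φ z.2 v) := e1
        _ = ∫ z : ℝ × HornSpace n, u z.1 z.2 *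
              fderiv ℝ (fun z : ℝ × HornSpace n => κ z.1 * φ z.2) z (0, v) := by
            refine integral_congr_ae (ae_of_all _ fun z => ?_)
            simp only [fderiv_prod_apply hκ hT]
            simp; ring
        _ = _ := key
        _ = -∫ z : ℝ × HornSpace n,
              κ z.1 * inner ℝ (frame ε z.2 (V z.1 z.2)) (frameInv ε z.2 (φ z.2 • v)) := by
            congr 1
            refine integral_congr_ae ?_
            filter_upwards [hne] with z hz
            rw [← inner_frameInv, frameInv_frame ε hz, inner_smul_right]
            ring
        _ = -∫ x, inner ℝ (timeAvg hV.toLp k x) (frameInv ε x (φ x • v)) := congrArg Neg.neg e2.symm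
        _ = _ := by
            congr 1
            refine integral_congr_ae (ae_of_all _ fun x => ?_)
            simp only [map_smul, inner_smul_right, inner_frameInv]
            ring
    have hV' : MemLp (fun x => frame ε x (frameInv ε x (timeAvg hV.toLp k x))) 2 (wm n β a) := by
      refine (Lp.memLp (timeAvg hV.toLp k)).ae_eq ?_
      filter_upwards [ae_ne_zero_wm a] with x hx
      rw [frame_frameInv ε hx]
    have h2 := h.mem_Gam (Lp.memLp _) hV'
    convert h2 using 2
    · exact (Lp.toLp_coeFn _ _).symm
    · refine Lp.ext ?_
      filter_upwards [hV'.coeFn_toLp, ae_ne_zero_wm a] with x hx hx0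
      rw [hx, frame_frameInv ε hx0]
  mem_Lap κ k hκ hk := by
    rw [mem_Lap]
    intro ψ hψ
    have hne : ∀ᵐ z : ℝ × HornSpace n, z.2 ≠ 0 := by
      rw [Measure.volume_eq_prod]
      exact Measure.quasiMeasurePreserving_snd.ae ae_ne_zero
    have c1 : Continuous fun x => dens n β 0 x • frame ε x (gradient ψ x) :=
      (continuous_dens 0).smul (hψ.continuous_frame_gradient ε)
    have t1 : tsupport (fun x => dens n β 0 x • frame ε x (gradient ψ x)) ⊆ tsupport ψ := by
      refine (closure_mono fun x hx h0 => ?_).trans (IsTest.tsupport_gradient (φ := ψ))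
      simp only [Function.mem_support] at hx
      exact hx (by simp [h0])
    have c2 : Continuous fun x => dens n β 0 x * ψ x :=
      (continuous_dens 0).mul hψ.smooth.continuous
    have t2 : tsupport (fun x => dens n β 0 x * ψ x) ⊆ tsupport ψ := by
      refine closure_mono fun x hx h0 => ?_
      simp only [Function.mem_support] at hx
      exact hx (by simp [h0])
    obtain ⟨i1, e1⟩ := integral_inner_timeAvg_toLp hV hκ hk c1
      (hψ.compact.of_isClosed_subset (isClosed_tsupport _) t1) (t1.trans hψ.supp)
    obtain ⟨i2, e2⟩ := integral_inner_timeAvg_toLp hw hκ hk c2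
      (hψ.compact.of_isClosed_subset (isClosed_tsupport _) t2) (t2.trans hψ.supp)
    have key := hS.heat_eq _ (contDiff_prod hκ hψ) (hasCompactSupport_prod hκ hψ)
      (tsupport_prod_subset' hκ hψ)
    rw [hornSpaceTime, hm, integral_prod_wm, ← Measure.volume_eq_prod] at key
    rw [integral_wm, integral_wm]
    calc (∫ x, dens n β 0 x • inner ℝ (timeAvg hV.toLp k x) (frame ε x (gradient ψ x))) +
          ∫ x, dens n β 0 x • (timeAvg hw.toLp k x * ψ x)
        = (∫ x, inner ℝ (timeAvg hV.toLp k x) (dens n β 0 x • frame ε x (gradient ψ x))) +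
          ∫ x, inner ℝ (timeAvg hw.toLp k x) (dens n β 0 x * ψ x) := by
          congr 1
          · simp [inner_smul_right]
          · refine integral_congr_ae (ae_of_all _ fun x => ?_)
            simp; ring
      _ = _ := by rw [e1, e2, ← integral_add i1 i2]
      _ = _ := by
          refine integral_congr_ae ?_
          filter_upwards [hne] with z hz
          have hg : gradient (fun y => κ z.1 * ψ y) z.2 = κ z.1 • gradient ψ z.2 :=
            hψ.gradient_const_mul _ _
          simp only [hg]
          rw [← inner_frame_frame ε hz, map_smul, inner_smul_right, inner_smul_right]
          simp; ring
      _ = 0 := key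
  deriv κ k k' hκ hk hk' := by
    refine lp_ext (lp_eq_of_forall_integral_eq (locallyIntegrableOn_of_memLp (Lp.memLp _))
      (locallyIntegrableOn_of_memLp (Lp.memLp _)) fun φ hφ => ?_)
    have e1 := (integral_inner_timeAvg_toLp hu hκ.deriv hk' hφ.smooth.continuous hφ.compact
      hφ.supp).2
    have e2 := (integral_inner_timeAvg_toLp hw hκ hk hφ.smooth.continuous hφ.compact
      hφ.supp).2
    have key := hS.weak_dt _ (contDiff_prod hκ hφ) (hasCompactSupport_prod hκ hφ)
      (tsupport_prod_subset' hκ hφ)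
    calc ∫ x, timeAvg hu.toLp k' x * φ x
        = ∫ x, inner ℝ (timeAvg hu.toLp k' x) (φ x) :=
          integral_congr_ae (ae_of_all _ fun x => by simp [mul_comm])
      _ = _ := e1
      _ = ∫ z : ℝ × HornSpace n, u z.1 z.2 *
            fderiv ℝ (fun z : ℝ × HornSpace n => κ z.1 * φ z.2) z (1, 0) := by
          refine integral_congr_ae (ae_of_all _ fun z => ?_)
          simp only [fderiv_prod_apply hκ hφ]
          simp; ring
      _ = _ := key
      _ = -∫ z : ℝ × HornSpace n, κ z.1 * inner ℝ (w z.1 z.2) (φ z.2) := by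
          congr 1
          refine integral_congr_ae (ae_of_all _ fun z => ?_)
          simp; ring
      _ = -∫ x, inner ℝ (timeAvg hw.toLp k x) (φ x) := by rw [e2]
      _ = _ := by
          rw [← integral_neg]
          refine integral_congr_ae ?_
          filter_upwards [ae_eq_wm.mp (Lp.coeFn_neg (timeAvg hw.toLp k))] with x hx
          rw [hx]
          simp; ring

end Sol

end

end

/-! ### Functions of time -/

section

variable {t₀ t₁ : ℝ}

theorem IsTimeTest.memLp {κ : ℝ → ℝ} (h : IsTimeTest t₀ t₁ κ) :
    MemLp κ 2 (timeMeasure t₀ t₁) :=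
  h.smooth.continuous.memLp_of_hasCompactSupport h.compact

theorem IsTimeTest.sub {κ κ' : ℝ → ℝ} (h : IsTimeTest t₀ t₁ κ) (h' : IsTimeTest t₀ t₁ κ') :
    IsTimeTest t₀ t₁ fun s => κ s - κ' s where
  smooth := h.smooth.sub h'.smooth
  compact := h.compact.sub h'.compact
  supp := (tsupport_sub κ κ').trans (union_subset h.supp h'.supp)

theorem IsTimeTest.const_mul {κ : ℝ → ℝ} (h : IsTimeTest t₀ t₁ κ) (c : ℝ) :
    IsTimeTest t₀ t₁ fun s => c * κ s where
  smooth := contDiff_const.mul h.smooth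
  compact := h.compact.mul_left
  supp := (closure_mono fun s hs => by
    simp only [Function.mem_support, mul_ne_zero_iff] at hs; exact hs.2).trans h.supp

theorem IsTimeTest.exists_Icc {κ : ℝ → ℝ} (h : IsTimeTest t₀ t₁ κ) (ht : t₀ < t₁) :
    ∃ p q, t₀ < p ∧ q < t₁ ∧ ∀ s ∉ Icc p q, κ s = 0 := by
  rcases (tsupport κ).eq_empty_or_nonempty with h0 | h0
  · obtain ⟨m, h1, h2⟩ := exists_between ht
    refine ⟨m, m, h1, h2, fun s _ => image_eq_zero_of_notMem_tsupport ?_⟩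
    rw [h0]; exact notMem_empty s
  · have hc : IsCompact (tsupport κ) := h.compact
    refine ⟨sInf (tsupport κ), sSup (tsupport κ), (h.supp (hc.sInf_mem h0)).1,
      (h.supp (hc.sSup_mem h0)).2, fun s hs => image_eq_zero_of_notMem_tsupport fun hs' => hs ?_⟩
    exact ⟨csInf_le hc.bddBelow hs', le_csSup hc.bddAbove hs'⟩

/-- A test function of mean zero is the derivative of a test function. -/
theorem IsTimeTest.exists_primitive {κ : ℝ → ℝ} (h : IsTimeTest t₀ t₁ κ) (ht : t₀ < t₁)
    (h0 : ∫ s, κ s = 0) : ∃ K, IsTimeTest t₀ t₁ K ∧ deriv K = κ := by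
  obtain ⟨p, q, hp, hq, hpq⟩ := h.exists_Icc ht
  have hc := h.smooth.continuous
  have hd : ∀ s, HasDerivAt (fun s => ∫ r in t₀..s, κ r) (κ s) s := fun s =>
    intervalIntegral.integral_hasDerivAt_right (hc.intervalIntegrable _ _)
      (hc.stronglyMeasurableAtFilter _ _) hc.continuousAt
  have hz : ∀ s ∉ Icc p q, ∫ r in t₀..s, κ r = 0 := by
    intro s hs
    rw [mem_Icc, not_and_or, not_le, not_le] at hs
    rcases hs with hs | hs
    · refine intervalIntegral.integral_zero_ae (ae_of_all _ fun r hr => hpq r fun h' => ?_)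
      rcases mem_uIoc.mp hr with h1 | h1
      · linarith [h'.1, h1.2]
      · linarith [h'.1, h1.2]
    · rw [← h0, intervalIntegral.integral_eq_integral_of_support_subset]
      intro r hr
      have := not_imp_comm.mp (hpq r) hr
      exact ⟨hp.trans_le this.1, this.2.trans hs.le⟩
  have hsub : tsupport (fun s => ∫ r in t₀..s, κ r) ⊆ Icc p q :=
    closure_minimal (fun s hs => by_contra fun h' => hs (hz s h')) isClosed_Icc
  have hdK : deriv (fun s => ∫ r in t₀..s, κ r) = κ := funext fun s => (hd s).deriv
  refine ⟨fun s => ∫ r in t₀..s, κ r, ⟨?_, isCompact_Icc.of_isClosed_subset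
    (isClosed_tsupport _) hsub, hsub.trans fun s hs => ⟨hp.trans_le hs.1, hs.2.trans_lt hq⟩⟩, hdK⟩
  rw [contDiff_infty_iff_deriv, hdK]
  exact ⟨fun s => (hd s).differentiableAt, h.smooth⟩

theorem exists_isTimeTest_integral_eq_one (ht : t₀ < t₁) :
    ∃ κ, IsTimeTest t₀ t₁ κ ∧ ∫ s, κ s = 1 := by
  let f : ContDiffBump ((t₀ + t₁) / 2) := ⟨(t₁ - t₀) / 8, (t₁ - t₀) / 4, by linarith, by linarith⟩
  refine ⟨f.normed volume, ⟨f.contDiff_normed, f.hasCompactSupport_normed, ?_⟩,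
    f.integral_normed⟩
  rw [f.tsupport_normed_eq, Real.closedBall_eq_Icc]
  intro s hs
  simp only [f, mem_Icc] at hs
  exact ⟨by linarith [hs.1], by linarith [hs.2]⟩

/-- The characteristic function of `(-∞, r]`. -/
def stepLp (t₀ t₁ r : ℝ) : Lp ℝ 2 (timeMeasure t₀ t₁) :=
  indicatorConstLp 2 (measurableSet_Iic (a := r)) (measure_ne_top _ _) (1 : ℝ)

theorem continuous_stepLp : Continuous (stepLp t₀ t₁) := by
  refine continuous_indicatorConstLp_set (by simp) fun r => ?_
  have hb : ∀ s, timeMeasure t₀ t₁ (symmDiff (Iic s) (Iic r)) ≤ ENNReal.ofReal |s - r| := by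
    intro s
    refine (Measure.restrict_apply_le _ _).trans ?_
    have hsub : symmDiff (Iic s) (Iic r) ⊆ uIcc s r := by
      intro x hx
      rw [mem_symmDiff, mem_Iic, mem_Iic, not_le, not_le] at hx
      rcases hx with hx | hx
      · exact mem_uIcc.mpr (Or.inr ⟨hx.2.le, hx.1⟩)
      · exact mem_uIcc.mpr (Or.inl ⟨hx.2.le, hx.1⟩)
    refine (measure_mono hsub).trans ?_
    rw [Real.volume_interval, abs_sub_comm]
  refine tendsto_of_tendsto_of_tendsto_of_le_of_le tendsto_const_nhds ?_ (fun _ => zero_le)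
    hb
  have : Tendsto (fun s => ENNReal.ofReal |s - r|) (𝓝 r) (𝓝 (ENNReal.ofReal |r - r|)) :=
    (ENNReal.continuous_ofReal.tendsto _).comp (Continuous.tendsto (by fun_prop) r)
  simpa using this

theorem IsTimeTest.integrable_smul {H : Type*} [NormedAddCommGroup H] [NormedSpace ℝ H]
    {κ : ℝ → ℝ} (h : IsTimeTest t₀ t₁ κ) {U : ℝ → H} (hU : Continuous U) :
    Integrable fun r => κ r • U r :=
  (h.smooth.continuous.smul hU).integrable_of_hasCompactSupport h.compact.smul_right

/-- A test function is the integral of the step functions against its derivative. -/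
theorem IsTimeTest.integral_deriv_smul_stepLp {κ : ℝ → ℝ} (h : IsTimeTest t₀ t₁ κ)
    {k : Lp ℝ 2 (timeMeasure t₀ t₁)} (hk : k =ᵐ[timeMeasure t₀ t₁] κ) :
    ∫ r, deriv κ r • stepLp t₀ t₁ r = -k := by
  have hi := h.deriv.integrable_smul (continuous_stepLp (t₀ := t₀) (t₁ := t₁))
  refine ext_inner_right ℝ fun θ => ?_
  have hθ : Integrable θ (timeMeasure t₀ t₁) := (Lp.memLp θ).integrable (by norm_num)
  have hc : Continuous (deriv κ) := h.deriv.smooth.continuous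
  have hd : ∀ s, ∫ r, (Iic r).indicator (fun _ => deriv κ r) s = -κ s := by
    intro s
    have : ∀ r, (Iic r).indicator (fun _ => deriv κ r) s = (Ici s).indicator (deriv κ) r := by
      intro r
      simp only [indicator, mem_Iic, mem_Ici]
    simp_rw [this]
    rw [integral_indicator measurableSet_Ici, integral_Ici_eq_integral_Ioi]
    exact h.compact.integral_Ioi_deriv_eq (h.smooth.of_le (by simp)) s
  calc inner ℝ (∫ r, deriv κ r • stepLp t₀ t₁ r) θ
      = ∫ r, inner ℝ (deriv κ r • stepLp t₀ t₁ r) θ := by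
        rw [real_inner_comm, ← integral_inner hi θ]
        exact integral_congr_ae (ae_of_all _ fun r => real_inner_comm _ _)
    _ = ∫ r, ∫ s, (Iic r).indicator (fun _ => deriv κ r) s * θ s ∂(timeMeasure t₀ t₁) := by
        refine integral_congr_ae (ae_of_all _ fun r => ?_)
        simp only [inner_smul_left, stepLp, L2.inner_indicatorConstLp_one, RCLike.conj_to_real]
        rw [← integral_indicator measurableSet_Iic, ← integral_const_mul]
        refine integral_congr_ae (ae_of_all _ fun s => ?_)
        by_cases hs : s ∈ Iic r <;> simp [hs]
    _ = ∫ s, ∫ r, (Iic r).indicator (fun _ => deriv κ r) s * θ s ∂volume ∂(timeMeasure t₀ t₁) := by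
        refine integral_integral_swap ?_
        have h1 : Integrable (fun z : ℝ × ℝ => deriv κ z.1 * θ z.2)
            (volume.prod (timeMeasure t₀ t₁)) :=
          (hc.integrable_of_hasCompactSupport h.deriv.compact).mul_prod hθ
        have h2 := h1.indicator (s := {z : ℝ × ℝ | z.2 ≤ z.1})
          (measurableSet_le measurable_snd measurable_fst)
        refine h2.congr (ae_of_all _ fun z => ?_)
        by_cases hz : z.2 ≤ z.1 <;> simp [hz, Function.uncurry]
    _ = ∫ s, -κ s * θ s ∂(timeMeasure t₀ t₁) := by
        simp_rw [integral_mul_const, hd]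
    _ = inner ℝ (-k) θ := by
        rw [L2.inner_def]
        refine integral_congr_ae ?_
        filter_upwards [hk, Lp.coeFn_neg k] with s hs hs'
        rw [hs', Pi.neg_apply, hs]
        simp; ring

/-- If the weak time derivative of `Tu` is represented by square integrable data `Tw`, then `Tu` is
represented by a continuous curve. -/
theorem exists_continuous_rep {H : Type*} [NormedAddCommGroup H] [InnerProductSpace ℝ H]
    [CompleteSpace H] (ht : t₀ < t₁) {Tu Tw : Lp ℝ 2 (timeMeasure t₀ t₁) →L[ℝ] H}
    (hT : ∀ (κ : ℝ → ℝ) (k k' : Lp ℝ 2 (timeMeasure t₀ t₁)), IsTimeTest t₀ t₁ κ →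
      k =ᵐ[timeMeasure t₀ t₁] κ → k' =ᵐ[timeMeasure t₀ t₁] deriv κ → Tu k' = -Tw k) :
    ∃ U : ℝ → H, Continuous U ∧ ∀ (κ : ℝ → ℝ) (k : Lp ℝ 2 (timeMeasure t₀ t₁)),
      IsTimeTest t₀ t₁ κ → k =ᵐ[timeMeasure t₀ t₁] κ → Tu k = ∫ r, κ r • U r := by
  set W : ℝ → H := fun r => Tw (stepLp t₀ t₁ r)
  have hW : Continuous W := Tw.continuous.comp continuous_stepLp
  have h1 : ∀ (κ : ℝ → ℝ) (k' : Lp ℝ 2 (timeMeasure t₀ t₁)), IsTimeTest t₀ t₁ κ →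
      k' =ᵐ[timeMeasure t₀ t₁] deriv κ → Tu k' = ∫ r, deriv κ r • W r := by
    intro κ k' hκ hk'
    rw [hT κ _ k' hκ hκ.memLp.coeFn_toLp hk', ← map_neg,
      ← hκ.integral_deriv_smul_stepLp hκ.memLp.coeFn_toLp,
      ← ContinuousLinearMap.integral_comp_comm Tw (hκ.deriv.integrable_smul continuous_stepLp)]
    simp only [map_smul, W]
  -- the constant of integration is fixed by a test function of integral one
  obtain ⟨μ, hμ, hμ1⟩ := exists_isTimeTest_integral_eq_one ht
  set c : H := Tu hμ.memLp.toLp - ∫ r, μ r • W r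
  refine ⟨fun r => W r + c, by fun_prop, fun κ k hκ hk => ?_⟩
  set m := ∫ r, κ r
  have hκ' : IsTimeTest t₀ t₁ fun s => κ s - m * μ s := hκ.sub (hμ.const_mul m)
  have iκ : Integrable κ := hκ.smooth.continuous.integrable_of_hasCompactSupport hκ.compact
  have iμ : Integrable μ := hμ.smooth.continuous.integrable_of_hasCompactSupport hμ.compact
  obtain ⟨K, hK, hKd⟩ := hκ'.exists_primitive ht (by
    rw [integral_sub iκ (iμ.const_mul m), integral_const_mul, hμ1, mul_one, sub_self])
  have h2 := h1 K (k - m • hμ.memLp.toLp) hK (by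
    rw [hKd]
    filter_upwards [Lp.coeFn_sub k (m • hμ.memLp.toLp), Lp.coeFn_smul m hμ.memLp.toLp, hk,
      hμ.memLp.coeFn_toLp] with s h1 h2 h3 h4
    rw [h1, Pi.sub_apply, h2, Pi.smul_apply, h3, h4, smul_eq_mul])
  rw [hKd] at h2
  simp only [sub_smul, mul_smul] at h2
  have hi : Integrable fun r => m • μ r • W r := (hμ.integrable_smul hW).smul m
  rw [integral_sub (hκ.integrable_smul hW) hi, integral_smul,
    map_sub, map_smul, sub_eq_iff_eq_add] at h2
  simp only [smul_add]
  rw [integral_add (hκ.integrable_smul hW) (hκ.integrable_smul continuous_const),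
    integral_smul_const, h2]
  simp only [c, m]
  module

/-- The function `s ↦ η (t - s)`. -/
def shiftLp (t₀ t₁ : ℝ) {η : ℝ → ℝ} (h : ContDiff ℝ ∞ η) (hc : HasCompactSupport η) (t : ℝ) :
    Lp ℝ 2 (timeMeasure t₀ t₁) :=
  MemLp.toLp (fun s => η (t - s)) ((h.continuous.comp (by fun_prop)).memLp_of_hasCompactSupport
    (hc.comp_homeomorph (Homeomorph.subLeft t)))

theorem coeFn_shiftLp {η : ℝ → ℝ} (h : ContDiff ℝ ∞ η) (hc : HasCompactSupport η) (t : ℝ) :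
    shiftLp t₀ t₁ h hc t =ᵐ[timeMeasure t₀ t₁] fun s => η (t - s) :=
  MemLp.coeFn_toLp _

theorem isTimeTest_shift {η : ℝ → ℝ} (h : ContDiff ℝ ∞ η) {δ : ℝ} (hδ : tsupport η ⊆ Icc (-δ) δ)
    {t : ℝ} (ht : t₀ + δ < t) (ht' : t < t₁ - δ) : IsTimeTest t₀ t₁ fun s => η (t - s) where
  smooth := h.comp (contDiff_const.sub contDiff_id)
  compact := HasCompactSupport.comp_homeomorph
    (isCompact_Icc.of_isClosed_subset (isClosed_tsupport _) hδ) (Homeomorph.subLeft t)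
  supp := by
    have hsub : tsupport (fun s => η (t - s)) ⊆ Icc (t - δ) (t + δ) := by
      refine closure_minimal (fun s hs => ?_) isClosed_Icc
      have := hδ (subset_tsupport _ hs)
      exact ⟨by linarith [this.2], by linarith [this.1]⟩
    exact hsub.trans fun s hs => ⟨by linarith [hs.1], by linarith [hs.2]⟩

/-- Translation in time of a smooth kernel is differentiable as a curve in `L²`, with the translates
of its derivative as derivative. -/
theorem hasDerivAt_shiftLp {η : ℝ → ℝ} (h : ContDiff ℝ ∞ η) (hc : HasCompactSupport η)
    (h' : ContDiff ℝ ∞ (deriv η)) (hc' : HasCompactSupport (deriv η)) (t : ℝ) :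
    HasDerivAt (shiftLp t₀ t₁ h hc) (shiftLp t₀ t₁ h' hc' t) t := by
  obtain ⟨C, hC⟩ := hc'.deriv.exists_bound_of_continuous
    (contDiff_infty_iff_deriv.mp h').2.continuous
  have hC0 : 0 ≤ C := (norm_nonneg _).trans (hC 0)
  have hd1 : ∀ r, HasDerivAt η (deriv η r) r := fun r =>
    (h.differentiable (by simp) r).hasDerivAt
  have hlip : ∀ p r : ℝ, ‖deriv η r - deriv η p‖ ≤ C * ‖r - p‖ := fun p r =>
    convex_univ.norm_image_sub_le_of_norm_deriv_le
      (fun x _ => h'.differentiable (by simp) x) (fun x _ => hC x) (mem_univ p) (mem_univ r)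
  have htay : ∀ p q : ℝ, ‖η q - η p - (q - p) * deriv η p‖ ≤ C * ‖q - p‖ ^ 2 := by
    intro p q
    have h1 : ∀ x ∈ uIcc p q, HasDerivWithinAt (fun r => η r - (r - p) * deriv η p)
        (deriv η x - deriv η p) (uIcc p q) x := fun x _ => by
      have := ((hd1 x).sub (((hasDerivAt_id x).sub_const p).mul_const (deriv η p)))
      refine (this.congr_deriv ?_).hasDerivWithinAt
      simp
    have h2 := (convex_uIcc p q).norm_image_sub_le_of_norm_hasDerivWithin_le h1
      (C := C * ‖q - p‖) (fun x hx => (hlip p x).trans (by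
        gcongr
        exact abs_sub_left_of_mem_uIcc hx)) left_mem_uIcc right_mem_uIcc
    calc ‖η q - η p - (q - p) * deriv η p‖
        = ‖η q - (q - p) * deriv η p - (η p - (p - p) * deriv η p)‖ := by congr 1; ring
      _ ≤ _ := h2
      _ = _ := by ring
  rw [hasDerivAt_iff_isLittleO]
  refine (Asymptotics.IsBigO.of_bound
    (measureUnivNNReal (timeMeasure t₀ t₁) ^ ((2 : ENNReal).toReal)⁻¹ * C)
    (Eventually.of_forall fun t' => ?_)).trans_isLittleO
    (Asymptotics.isLittleO_pow_sub_sub t (m := 2) (by norm_num))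
  rw [mul_assoc]
  refine Lp.norm_le_of_ae_bound (by positivity) ?_
  filter_upwards [Lp.coeFn_sub (shiftLp t₀ t₁ h hc t' - shiftLp t₀ t₁ h hc t)
    ((t' - t) • shiftLp t₀ t₁ h' hc' t), Lp.coeFn_sub (shiftLp t₀ t₁ h hc t')
    (shiftLp t₀ t₁ h hc t), Lp.coeFn_smul (t' - t) (shiftLp t₀ t₁ h' hc' t),
    coeFn_shiftLp (t₀ := t₀) (t₁ := t₁) h hc t', coeFn_shiftLp (t₀ := t₀) (t₁ := t₁) h hc t,
    coeFn_shiftLp (t₀ := t₀) (t₁ := t₁) h' hc' t] with s e1 e2 e3 e4 e5 e6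
  rw [e1, Pi.sub_apply, e2, Pi.sub_apply, e3, Pi.smul_apply, e4, e5, e6, smul_eq_mul]
  have := htay (t - s) (t' - s)
  rw [sub_sub_sub_cancel_right] at this
  rwa [norm_pow, norm_norm]

end

section

variable {n : ℕ} {β : ℝ}

section Young

variable {γ E : Type*} [MeasurableSpace γ] {μ : Measure γ} [SFinite μ] [NormedAddCommGroup E]
  [InnerProductSpace ℝ E] {t₀ t₁ : ℝ}

theorem norm_sq_eq_integral {α : Type*} [MeasurableSpace α] {ν : Measure α} (f : Lp E 2 ν) :
    Integrable (fun x => ‖f x‖ ^ 2) ν ∧ ‖f‖ ^ 2 = ∫ x, ‖f x‖ ^ 2 ∂ν := by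
  rw [← real_inner_self_eq_norm_sq, L2.inner_def]
  simp_rw [← real_inner_self_eq_norm_sq (f _)]
  exact ⟨L2.integrable_inner f f, trivial⟩

theorem integrable_mul_norm_sq {κ : ℝ → ℝ} (hκ : Continuous κ) (hκc : HasCompactSupport κ)
    (G : Lp E 2 ((timeMeasure t₀ t₁).prod μ)) :
    Integrable (fun z => κ z.1 * ‖G z‖ ^ 2) ((timeMeasure t₀ t₁).prod μ) := by
  obtain ⟨C, hC⟩ := hκc.exists_bound_of_continuous hκ
  exact (norm_sq_eq_integral G).1.bdd_mul
    (hκ.measurable.comp measurable_fst).aestronglyMeasurable (ae_of_all _ fun z => hC z.1)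

variable [CompleteSpace E]

/-- Jensen's inequality for time averages with weights of mass at most one. -/
theorem norm_timeAvg_sq_le {κ : ℝ → ℝ} (hκ : Continuous κ) (hκc : HasCompactSupport κ)
    (hκ0 : ∀ s, 0 ≤ κ s) (hκ1 : ∫ s, κ s = 1) {k : Lp ℝ 2 (timeMeasure t₀ t₁)}
    (hk : k =ᵐ[timeMeasure t₀ t₁] κ) (G : Lp E 2 ((timeMeasure t₀ t₁).prod μ)) :
    ‖timeAvg G k‖ ^ 2 ≤ ∫ z, κ z.1 * ‖G z‖ ^ 2 ∂((timeMeasure t₀ t₁).prod μ) := by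
  set h := timeAvg G k
  obtain ⟨hi, hn⟩ := norm_sq_eq_integral h
  have iκ : Integrable κ := hκ.integrable_of_hasCompactSupport hκc
  have hm : ∫ s, κ s ∂(timeMeasure t₀ t₁) ≤ 1 := by
    rw [← hκ1]
    exact setIntegral_le_integral iκ (ae_of_all _ hκ0)
  have i1 := integrable_mul_norm_sq hκ hκc G
  have i2 : Integrable (fun z : ℝ × γ => κ z.1 * ‖h z.2‖ ^ 2) ((timeMeasure t₀ t₁).prod μ) :=
    (iκ.mono_measure Measure.restrict_le_self).mul_prod hi
  have e2 : ∫ z, κ z.1 * ‖h z.2‖ ^ 2 ∂((timeMeasure t₀ t₁).prod μ) ≤ ‖h‖ ^ 2 := by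
    rw [integral_prod_mul κ fun x => ‖h x‖ ^ 2, ← hn]
    exact mul_le_of_le_one_left (by positivity) hm
  have e1 : ‖h‖ ^ 2 ≤ ∫ z, (1 / 2 * (κ z.1 * ‖G z‖ ^ 2) + 1 / 2 * (κ z.1 * ‖h z.2‖ ^ 2))
      ∂((timeMeasure t₀ t₁).prod μ) := by
    rw [← real_inner_self_eq_norm_sq, inner_timeAvg, L2.inner_def]
    refine integral_mono_ae (L2.integrable_inner _ _)
      ((i1.const_mul _).add (i2.const_mul _)) ?_
    filter_upwards [coeFn_tensor k h, Measure.quasiMeasurePreserving_fst.ae hk] with z hz hz'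
    rw [hz, hz', inner_smul_right]
    have h1 := real_inner_le_norm (G z) (h z.2)
    have h2 := mul_le_mul_of_nonneg_left h1 (hκ0 z.1)
    have h3 := mul_nonneg (hκ0 z.1) (sq_nonneg (‖G z‖ - ‖h z.2‖))
    linarith
  rw [integral_add (i1.const_mul _) (i2.const_mul _), integral_const_mul, integral_const_mul] at e1
  linarith

/-- Young's inequality: mollification in time does not increase the `L²` norm in space-time. -/
theorem integral_norm_timeAvg_shift_sq_le {η : ℝ → ℝ} (hη : ContDiff ℝ ∞ η)
    (hηc : HasCompactSupport η) (h0 : ∀ s, 0 ≤ η s) (h1 : ∫ s, η s = 1)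
    (G : Lp E 2 ((timeMeasure t₀ t₁).prod μ)) {s T : ℝ} (hsT : s ≤ T) :
    ∫ t in s..T, ‖timeAvg G (shiftLp t₀ t₁ hη hηc t)‖ ^ 2 ≤ ‖G‖ ^ 2 := by
  obtain ⟨hi, hn⟩ := norm_sq_eq_integral G
  have hη' : ContDiff ℝ ∞ (deriv η) := (contDiff_infty_iff_deriv.mp hη).2
  have hc : Continuous (shiftLp t₀ t₁ hη hηc) := continuous_iff_continuousAt.mpr fun t =>
    (hasDerivAt_shiftLp hη hηc hη' hηc.deriv t).continuousAt
  have iη : Integrable η := hη.continuous.integrable_of_hasCompactSupport hηc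
  have hcs : ∀ t, HasCompactSupport fun s => η (t - s) := fun t =>
    hηc.comp_homeomorph (Homeomorph.subLeft t)
  have hp : Integrable (fun y : ℝ × (ℝ × γ) => η (y.1 - y.2.1) * ‖G y.2‖ ^ 2)
      ((volume.restrict (Ioc s T)).prod ((timeMeasure t₀ t₁).prod μ)) := by
    obtain ⟨C, hC⟩ := hηc.exists_bound_of_continuous hη.continuous
    have : Integrable (fun y : ℝ × (ℝ × γ) => (1 : ℝ) * ‖G y.2‖ ^ 2)
        ((volume.restrict (Ioc s T)).prod ((timeMeasure t₀ t₁).prod μ)) :=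
      (integrable_const (1 : ℝ)).mul_prod hi
    simp only [one_mul] at this
    refine this.bdd_mul (Measurable.aestronglyMeasurable ?_) (ae_of_all _ fun y => hC _)
    have := hη.continuous.measurable
    fun_prop
  rw [intervalIntegral.integral_of_le hsT]
  calc ∫ t in Ioc s T, ‖timeAvg G (shiftLp t₀ t₁ hη hηc t)‖ ^ 2
      ≤ ∫ t in Ioc s T, ∫ z, η (t - z.1) * ‖G z‖ ^ 2 ∂((timeMeasure t₀ t₁).prod μ) := by
        refine integral_mono ?_ hp.integral_prod_left fun t => ?_
        · have : Continuous fun t => ‖timeAvg G (shiftLp t₀ t₁ hη hηc t)‖ ^ 2 := by fun_prop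
          exact (this.integrableOn_Icc (a := s) (b := T)).mono_set Ioc_subset_Icc_self
        · refine norm_timeAvg_sq_le (κ := fun s => η (t - s)) (hη.continuous.comp (by fun_prop))
            (hcs t) (fun s => h0 _) ?_ (coeFn_shiftLp hη hηc t) G
          rw [integral_sub_left_eq_self, h1]
    _ = ∫ z, (∫ t in Ioc s T, η (t - z.1) * ‖G z‖ ^ 2) ∂((timeMeasure t₀ t₁).prod μ) :=
        integral_integral_swap hp
    _ ≤ ∫ z, ‖G z‖ ^ 2 ∂((timeMeasure t₀ t₁).prod μ) := by
        refine integral_mono hp.integral_prod_right hi fun z => ?_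
        simp only [integral_mul_const]
        refine mul_le_of_le_one_left (by positivity) ?_
        have h2 : ∫ t, η (t - z.1) = 1 := by rw [integral_sub_right_eq_self, h1]
        rw [← h2]
        exact setIntegral_le_integral (iη.comp_sub_right _) (ae_of_all _ fun t => h0 _)
    _ = ‖G‖ ^ 2 := hn.symm

end Young

section

variable [hn : Fact (2 ≤ n)] [hβ : Fact (0 < β)]

variable {N ε η a t₀ t₁ : ℝ} {u : ℝ → HornSpace n → ℝ} {V : ℝ → HornSpace n → HornSpace n}
  {w : ℝ → HornSpace n → ℝ}

/-- Every time slice of a solution is locally square integrable. -/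
theorem memLp_slice (hm : hornMeasure n N ε η = wm n β 0) (hS : IsHornSolution n N ε η t₀ t₁ u V w)
    (ht : t₀ < t₁) {s : ℝ} (hs : s ∈ Icc t₀ t₁) (ρ : ℝ) :
    MemLp (u s) 2 ((wm n β 0).restrict (Metric.ball 0 ρ)) := by
  set μb := (wm n β 0).restrict (Metric.ball 0 ρ)
  have hmeas : ∀ t ∈ Icc t₀ t₁, AEStronglyMeasurable (u t) μb := fun t ht => by
    have := hS.slice_meas t ht
    rw [hm] at this
    exact this.restrict
  have hgood : ∀ᵐ t ∂(timeMeasure t₀ t₁), MemLp (u t) 2 μb := by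
    have h1 := hS.loc_energy ρ
    rw [IntegrableOn, hornSpaceTime, hm, ← Measure.prod_restrict] at h1
    filter_upwards [h1.prod_right_ae, ae_restrict_mem measurableSet_Ioo] with t h2 ht
    have hmt := hmeas t (Ioo_subset_Icc_self ht)
    rw [memLp_two_iff_integrable_sq hmt]
    refine h2.mono' (hmt.pow 2) ?_
    filter_upwards [ae_restrict_of_ae (ae_ne_zero_wm 0)] with x hx
    rw [Real.norm_of_nonneg (by positivity), ← inner_frame_frame ε hx, real_inner_self_eq_norm_sq]
    linarith [sq_nonneg ‖frame ε x (V t x)‖, sq_nonneg (w t x)]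
  have hev := (hS.slice_cont s hs ρ).eventually (gt_mem_nhds zero_lt_one)
  rw [hm] at hev
  obtain ⟨O, hO, hsO, hOs⟩ := mem_nhdsWithin.mp hev
  obtain ⟨t, ht, htg⟩ : ∃ t ∈ O ∩ Ioo t₀ t₁, MemLp (u t) 2 μb := by
    by_contra hcon
    push Not at hcon
    have hne : (O ∩ Ioo t₀ t₁).Nonempty := by
      rw [← closure_Ioo ht.ne] at hs
      exact mem_closure_iff.mp hs O hO hsO
    have hpos := (hO.inter isOpen_Ioo).measure_pos volume hne
    have h0 : volume (O ∩ Ioo t₀ t₁) = 0 := by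
      rw [ae_iff, Measure.restrict_apply' measurableSet_Ioo] at hgood
      exact measure_mono_null (fun t ht => mem_inter (hcon t ht) ht.2) hgood
    exact hpos.ne' h0
  have htI := Ioo_subset_Icc_self ht.2
  have hlt : eLpNorm (fun x => u t x - u s x) 2 μb < 1 := hOs ⟨ht.1, htI⟩
  have hd : MemLp (fun x => u t x - u s x) 2 μb :=
    ⟨(hmeas t htI).sub (hmeas s hs), hlt.trans ENNReal.one_lt_top⟩
  have := htg.sub hd
  refine this.ae_eq (ae_of_all _ fun x => ?_)
  simp

theorem locallyIntegrableOn_slice (hm : hornMeasure n N ε η = wm n β 0)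
    (hS : IsHornSolution n N ε η t₀ t₁ u V w) (ht : t₀ < t₁) {s : ℝ} (hs : s ∈ Icc t₀ t₁) :
    LocallyIntegrableOn (u s) {0}ᶜ := by
  rw [locallyIntegrableOn_iff isOpen_compl_singleton.isLocallyClosed]
  intro K hK0 hK
  obtain ⟨ρ, hρ⟩ := hK.isBounded.subset_ball 0
  have h1 : MemLp ((Metric.ball 0 ρ).indicator (u s)) 2 (wm n β 0) :=
    (memLp_indicator_iff_restrict measurableSet_ball).mpr (memLp_slice hm hS ht hs ρ)
  refine (integrableOn_of_memLp h1 hK hK0).congr_fun (fun x hx => ?_) hK.measurableSet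
  exact indicator_of_mem (hρ hx) _

/-- The pairing of a solution with a test function is continuous in time. -/
theorem continuousOn_integral_slice (hm : hornMeasure n N ε η = wm n β 0)
    (hS : IsHornSolution n N ε η t₀ t₁ u V w) (ht : t₀ < t₁) {φ : HornSpace n → ℝ}
    (hφ : IsTest φ) : ContinuousOn (fun t => ∫ x, u t x * φ x) (Icc t₀ t₁) := by
  obtain ⟨ρ, hρ⟩ := hφ.compact.isCompact.isBounded.subset_ball 0
  set μb := (wm n β 0).restrict (Metric.ball 0 ρ)
  obtain ⟨K, hK⟩ := exists_coeFn_eq_inv_dens_smul (β := β) 0 hφ.smooth.continuous hφ.compact hφ.supp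
  have hKm : MemLp K 2 μb := (Lp.memLp K).restrict _
  classical
  let ub : ℝ → Lp ℝ 2 μb := fun t => if h : MemLp (u t) 2 μb then h.toLp else 0
  have hub : ∀ (t) (h : MemLp (u t) 2 μb), ub t = h.toLp := fun t h => dif_pos h
  have hcont : ContinuousOn ub (Icc t₀ t₁) := by
    intro s hs
    rw [ContinuousWithinAt, tendsto_iff_edist_tendsto_0]
    have h1 := hS.slice_cont s hs ρ
    rw [hm] at h1
    refine h1.congr' ?_
    filter_upwards [self_mem_nhdsWithin] with t htI
    rw [hub t (memLp_slice hm hS ht htI ρ), hub s (memLp_slice hm hS ht hs ρ),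
      Lp.edist_toLp_toLp]
    rfl
  have h2 : ContinuousOn (fun t => inner ℝ (ub t) hKm.toLp) (Icc t₀ t₁) := by fun_prop
  refine h2.congr fun t htI => ?_
  have hmt := memLp_slice (β := β) hm hS ht htI ρ
  change _ = inner ℝ (ub t) hKm.toLp
  rw [hub t hmt, L2.inner_def]
  have h3 : ∫ x, inner ℝ (hmt.toLp (u t) x) (hKm.toLp K x) ∂μb = ∫ x, u t x * K x ∂μb := by
    refine integral_congr_ae ?_
    filter_upwards [hmt.coeFn_toLp, hKm.coeFn_toLp] with x h1 h2
    rw [h1, h2]; simp [mul_comm]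
  have h4 : ∫ x, u t x * K x ∂μb = ∫ x, u t x * K x ∂(wm n β 0) := by
    have hz : ∀ᵐ x ∂(wm n β 0), x ∉ Metric.ball 0 ρ → u t x * K x = 0 := by
      filter_upwards [ae_eq_wm.mpr hK] with x hx hxb
      rw [hx, image_eq_zero_of_notMem_tsupport fun h => hxb (hρ h)]
      simp
    exact setIntegral_eq_integral_of_ae_compl_eq_zero hz
  rw [h3, h4, integral_wm]
  refine integral_congr_ae ?_
  filter_upwards [hK, ae_ne_zero] with x hx hx0
  rw [hx]
  have := (dens_pos (n := n) (β := β) 0 hx0).ne'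
  simp only [smul_eq_mul]
  field_simp

/-- The continuous representative of the time averages is the solution itself. -/
theorem ae_eq_of_rep (hm : hornMeasure n N ε η = wm n β 0)
    (hS : IsHornSolution n N ε η t₀ t₁ u V w) (ht : t₀ < t₁)
    (hu : MemLp (fun z : ℝ × HornSpace n => u z.1 z.2) 2 ((timeMeasure t₀ t₁).prod (wm n β a)))
    {U : ℝ → HFun n β a} (hU : Continuous U)
    (hrep : ∀ (κ : ℝ → ℝ) (k : Lp ℝ 2 (timeMeasure t₀ t₁)), IsTimeTest t₀ t₁ κ →
      k =ᵐ[timeMeasure t₀ t₁] κ → timeAvg hu.toLp k = ∫ r, κ r • U r)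
    {t : ℝ} (htI : t ∈ Icc t₀ t₁) : U t =ᵐ[volume] u t := by
  refine lp_eq_of_forall_integral_eq (locallyIntegrableOn_of_memLp (Lp.memLp _))
    (locallyIntegrableOn_slice (β := β) hm hS ht htI) fun φ hφ => ?_
  obtain ⟨K, hK⟩ := exists_inner_eq_integral (β := β) a hφ.smooth.continuous hφ.compact hφ.supp
  have hKU : ∀ f : HFun n β a, ∫ x, f x * φ x = inner ℝ f K := fun f => by
    rw [(hK f).2]
    exact integral_congr_ae (ae_of_all _ fun x => by simp [mul_comm])
  have hcm := continuousOn_integral_slice (β := β) hm hS ht hφ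
  have hcU : Continuous fun t => inner ℝ (U t) K := by fun_prop
  suffices h : EqOn (fun t => inner ℝ (U t) K) (fun t => ∫ x, u t x * φ x) (Icc t₀ t₁) by
    rw [hKU]; exact h htI
  refine EqOn.of_subset_closure (s := Ioo t₀ t₁) ?_ hcU.continuousOn hcm Ioo_subset_Icc_self
    (closure_Ioo ht.ne).ge
  refine Measure.eqOn_open_of_ae_eq (μ := volume) ?_ isOpen_Ioo hcU.continuousOn
    (hcm.mono Ioo_subset_Icc_self)
  have hcd : ContinuousOn (fun t => inner ℝ (U t) K - ∫ x, u t x * φ x) (Ioo t₀ t₁) :=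
    hcU.continuousOn.sub (hcm.mono Ioo_subset_Icc_self)
  have key : ∀ᵐ t : ℝ, t ∈ Ioo t₀ t₁ → inner ℝ (U t) K - ∫ x, u t x * φ x = 0 := by
    refine isOpen_Ioo.ae_eq_zero_of_integral_contDiff_smul_eq_zero
      (hcd.locallyIntegrableOn measurableSet_Ioo) fun κ hκ hκc hκs => ?_
    have hκt : IsTimeTest t₀ t₁ κ := ⟨hκ, hκc, hκs⟩
    obtain ⟨i1, e1⟩ := integral_inner_timeAvg_toLp hu hκt hκt.memLp.coeFn_toLp
      hφ.smooth.continuous hφ.compact hφ.supp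
    rw [hrep κ _ hκt hκt.memLp.coeFn_toLp, ← (hK _).2] at e1
    rw [real_inner_comm, ← integral_inner (hκt.integrable_smul hU)] at e1
    have i1' := i1
    rw [Measure.volume_eq_prod] at i1 e1
    rw [integral_prod _ i1] at e1
    have e3 : ∀ r, κ r * ∫ x, u r x * φ x = ∫ x, κ r * inner ℝ (u r x) (φ x) := fun r => by
      rw [← integral_const_mul]
      exact integral_congr_ae (ae_of_all _ fun x => by simp [mul_comm])
    simp only [smul_eq_mul, mul_sub, e3]
    rw [integral_sub _ i1.integral_prod_left, ← e1, sub_eq_zero]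
    · refine integral_congr_ae (ae_of_all _ fun r => ?_)
      simp only [inner_smul_right]
      rw [real_inner_comm]
    · have := (hκt.integrable_smul hU).inner_const (𝕜 := ℝ) K
      refine this.congr (ae_of_all _ fun r => ?_)
      simp [inner_smul_left]
  rw [Filter.EventuallyEq, ae_restrict_iff' measurableSet_Ioo]
  filter_upwards [key] with t ht h1
  exact sub_eq_zero.mp (ht h1)

end

end

/-! ### Regularity in time -/

section

variable {n : ℕ} {β : ℝ}

/-- A smooth bump function of mass one supported in `[-1/(k+1), 1/(k+1)]`. -/
def timeBump (k : ℕ) : ContDiffBump (0 : ℝ) :=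
  ⟨1 / (k + 1) / 2, 1 / (k + 1), by positivity, half_lt_self (by positivity)⟩

theorem tsupport_timeBump (k : ℕ) :
    tsupport ((timeBump k).normed volume) ⊆ Icc (-(1 / ((k : ℝ) + 1))) (1 / ((k : ℝ) + 1)) := by
  rw [(timeBump k).tsupport_normed_eq, Real.closedBall_eq_Icc, zero_sub, zero_add]
  rfl

theorem eventually_timeBump {d : ℝ} (hd : 0 < d) : ∀ᶠ k : ℕ in atTop, 1 / ((k : ℝ) + 1) < d :=
  tendsto_one_div_add_atTop_nhds_zero_nat.eventually (gt_mem_nhds hd)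

/-- Mollifications of a continuous curve converge locally uniformly. -/
theorem tendstoUniformlyOn_mollify {H : Type*} [NormedAddCommGroup H] [NormedSpace ℝ H]
    [CompleteSpace H] {U : ℝ → H} (hU : Continuous U) (s T : ℝ) :
    TendstoUniformlyOn (fun k t => ∫ r, (timeBump k).normed volume (t - r) • U r) U atTop
      (Icc s T) := by
  rw [Metric.tendstoUniformlyOn_iff]
  intro e he
  have huc := (isCompact_Icc (a := s - 1) (b := T + 1)).uniformContinuousOn_of_continuous
    hU.continuousOn
  rw [Metric.uniformContinuousOn_iff] at huc
  obtain ⟨d, hd, h⟩ := huc (e / 2) (half_pos he)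
  filter_upwards [eventually_timeBump hd, eventually_timeBump one_pos] with k hk hk1 t ht
  have h1 := (timeBump k).dist_normed_convolution_le (μ := volume) (g := U) (x₀ := t) (ε := e / 2)
    hU.aestronglyMeasurable (fun r hr => by
      have hr' : dist r t < 1 / ((k : ℝ) + 1) := hr
      have hr2 := abs_lt.mp (Real.dist_eq r t ▸ hr'.trans hk1)
      exact (h r ⟨by linarith [ht.1, hr2.1], by linarith [ht.2, hr2.2]⟩ t
        ⟨by linarith [ht.1], by linarith [ht.2]⟩ (hr'.trans hk)).le)
  rw [convolution_eq_swap] at h1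
  rw [dist_comm]
  exact h1.trans_lt (half_lt_self he)

section

variable [hn : Fact (2 ≤ n)] [hβ : Fact (0 < β)] {ε a b t₀ t₁ : ℝ}
  {Tu Tw : Lp ℝ 2 (timeMeasure t₀ t₁) →L[ℝ] HFun n β a}
  {TV : Lp ℝ 2 (timeMeasure t₀ t₁) →L[ℝ] HVec n β a}

/-- The mollification in time of a solution is a smooth curve of solutions. It is defined at distance
more than `δ` from the ends of the time interval. -/
theorem IsAvgSol.solCurve (h : IsAvgSol n β ε a t₀ t₁ Tu TV Tw) {η : ℝ → ℝ}
    (hη : ContDiff ℝ ∞ η) (hc : HasCompactSupport η) (hη' : ContDiff ℝ ∞ (deriv η))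
    (hc' : HasCompactSupport (deriv η)) {δ : ℝ} (hδ : tsupport η ⊆ Icc (-δ) δ) {s T : ℝ}
    (hs : t₀ + δ < s) (hT : T < t₁ - δ) :
    SolCurve n β ε a (Icc s T) (fun t => Tu (shiftLp t₀ t₁ hη hc t))
      (fun t => Tw (shiftLp t₀ t₁ hη hc t)) (fun t => Tw (shiftLp t₀ t₁ hη' hc' t))
      (fun t => TV (shiftLp t₀ t₁ hη hc t)) (fun t => TV (shiftLp t₀ t₁ hη' hc' t)) := by
  have hδ' : tsupport (deriv η) ⊆ Icc (-δ) δ := (tsupport_deriv_subset (f := η)).trans hδ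
  have hη'' : ContDiff ℝ ∞ (deriv (deriv η)) := (contDiff_infty_iff_deriv.mp hη').2
  have hd : ∀ t, HasDerivAt (shiftLp t₀ t₁ hη hc) (shiftLp t₀ t₁ hη' hc' t) t :=
    hasDerivAt_shiftLp hη hc hη' hc'
  have hcont : Continuous (shiftLp t₀ t₁ hη' hc') := continuous_iff_continuousAt.mpr fun t =>
    (hasDerivAt_shiftLp hη' hc' hη'' hc'.deriv t).continuousAt
  have ht : ∀ t ∈ Icc s T, IsTimeTest t₀ t₁ fun s => η (t - s) := fun t ht =>
    isTimeTest_shift hη hδ (hs.trans_le ht.1) (ht.2.trans_lt hT)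
  have ht' : ∀ t ∈ Icc s T, IsTimeTest t₀ t₁ fun s => deriv η (t - s) := fun t ht =>
    isTimeTest_shift hη' hδ' (hs.trans_le ht.1) (ht.2.trans_lt hT)
  have hTu : ∀ t ∈ Icc s T, Tu (shiftLp t₀ t₁ hη' hc' t) = Tw (shiftLp t₀ t₁ hη hc t) := by
    intro t htI
    have h1 := h.deriv _ _ (-shiftLp t₀ t₁ hη' hc' t) (ht t htI) (coeFn_shiftLp hη hc t) (by
      filter_upwards [Lp.coeFn_neg (shiftLp t₀ t₁ hη' hc' t),
        coeFn_shiftLp (t₀ := t₀) (t₁ := t₁) hη' hc' t] with r h1 h2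
      have h3 := (hη.differentiable (by simp) (t - r)).hasDerivAt.comp_const_sub t r
      rw [h1, Pi.neg_apply, h2, h3.deriv])
    rw [map_neg, neg_inj] at h1
    exact h1
  have hk := coeFn_shiftLp (t₀ := t₀) (t₁ := t₁) hη hc
  have hk' := coeFn_shiftLp (t₀ := t₀) (t₁ := t₁) hη' hc'
  exact
    { deriv := fun t htI => by
        rw [← hTu t htI]
        exact Tu.hasFDerivAt.comp_hasDerivAt t (hd t)
      deriv' := fun t _ => Tw.hasFDerivAt.comp_hasDerivAt t (hd t)
      deriv_grad := fun t _ => TV.hasFDerivAt.comp_hasDerivAt t (hd t)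
      cont := (Tw.continuous.comp hcont).continuousOn
      cont_grad := (TV.continuous.comp hcont).continuousOn
      mem_Gam := fun t htI => h.mem_Gam _ _ (ht t htI) (hk t)
      mem_Gam' := fun t htI => by
        rw [← hTu t htI]
        exact h.mem_Gam _ _ (ht' t htI) (hk' t)
      mem_Lap := fun t htI => h.mem_Lap _ _ (ht t htI) (hk t)
      mem_Lap' := fun t htI => h.mem_Lap _ _ (ht' t htI) (hk' t) }

/-- A solution of the heat equation that is regular in the open time interval, and continuous up to
the end points: `f` is the function, `F` its gradient, `g` its time derivative. -/
structure IsRegSol (n : ℕ) (β ε b t₀ t₁ : ℝ) [Fact (2 ≤ n)] [Fact (0 < β)] (f : ℝ → HFun n β b)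
    (F : ℝ → HVec n β b) (g : ℝ → HFun n β b) : Prop where
  cont : Continuous f
  cont_grad : ContinuousOn F (Ioo t₀ t₁)
  cont_deriv : ContinuousOn g (Ioo t₀ t₁)
  deriv : ∀ t ∈ Ioo t₀ t₁, HasDerivAt f (g t) t
  mem_Gam : ∀ t ∈ Ioo t₀ t₁, (f t, F t) ∈ Gam n β ε b
  mem_Lap : ∀ t ∈ Ioo t₀ t₁, (F t, g t) ∈ Lap n β ε b
  bdd : ∀ T ∈ Ioo t₀ t₁, ∃ M : ℝ, ∀ t ∈ Ioc t₀ T, ‖F t‖ ≤ M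

/-- A sequence of curves controlled by a uniformly convergent sequence converges. -/
theorem exists_tendstoUniformlyOn {H X : Type*} [NormedAddCommGroup H] [CompleteSpace H]
    [NormedAddCommGroup X] {f : ℕ → ℝ → X} {U : ℝ → X} {y : ℕ → ℝ → H}
    (hf : ∀ s T, t₀ < s → T < t₁ → TendstoUniformlyOn f U atTop (Icc s T))
    (hy : ∀ s T, t₀ < s → s ≤ T → T < t₁ → ∃ s₀ C, t₀ < s₀ ∧ s₀ ≤ s ∧ 0 ≤ C ∧
      ∀ᶠ K in atTop, ∀ k ≥ K, ∀ l ≥ K, ∀ t ∈ Icc s T, ∀ e : ℝ, 0 ≤ e →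
        (∀ r ∈ Icc s₀ T, ‖f k r - f l r‖ ≤ e) → ‖y k t - y l t‖ ≤ C * e) :
    ∃ Y : ℝ → H, ∀ s T, t₀ < s → T < t₁ → TendstoUniformlyOn y Y atTop (Icc s T) := by
  have hcau : ∀ s T, t₀ < s → s ≤ T → T < t₁ → UniformCauchySeqOn y atTop (Icc s T) := by
    intro s T hs hsT hT
    obtain ⟨s₀, C, hs₀, hs₀', hC, hK⟩ := hy s T hs hsT hT
    rw [Metric.uniformCauchySeqOn_iff]
    intro e he
    have hC1 : 0 < C + 1 := by linarith
    obtain ⟨K₁, hK₁⟩ := eventually_atTop.mp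
      (Metric.tendstoUniformlyOn_iff.mp (hf s₀ T hs₀ hT) (e / (2 * (C + 1))) (by positivity))
    obtain ⟨K₂, hK₂⟩ := hK.exists
    refine ⟨max K₁ K₂, fun k hk l hl t ht => ?_⟩
    rw [dist_eq_norm]
    have h1 := hK₂ k (le_of_max_le_right hk) l (le_of_max_le_right hl) t ht (e / (C + 1))
      (by positivity) fun r hr => by
        have a1 := hK₁ k (le_of_max_le_left hk) r hr
        have a2 := hK₁ l (le_of_max_le_left hl) r hr
        rw [← dist_eq_norm]
        have a3 := dist_triangle_left (f k r) (f l r) (U r)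
        have a4 : e / (2 * (C + 1)) + e / (2 * (C + 1)) = e / (C + 1) := by field_simp; ring
        linarith
    refine h1.trans_lt ?_
    rw [← mul_div_assoc, div_lt_iff₀ hC1]
    nlinarith
  have hlim : ∀ t, ∃ z, t ∈ Ioo t₀ t₁ → Tendsto (fun k => y k t) atTop (𝓝 z) := by
    intro t
    by_cases ht : t ∈ Ioo t₀ t₁
    · obtain ⟨z, hz⟩ := cauchySeq_tendsto_of_complete
        ((hcau t t ht.1 le_rfl ht.2).cauchySeq (left_mem_Icc.mpr le_rfl))
      exact ⟨z, fun _ => hz⟩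
    · exact ⟨0, fun h => absurd h ht⟩
  choose Y hY using hlim
  refine ⟨Y, fun s T hs hT => ?_⟩
  rcases le_or_gt s T with hsT | hsT
  · exact (hcau s T hs hsT hT).tendstoUniformlyOn_of_tendsto fun t ht =>
      hY t ⟨hs.trans_le ht.1, ht.2.trans_lt hT⟩
  · rw [Icc_eq_empty hsT.not_ge]
    exact tendstoUniformlyOn_empty

/-- Interior regularity of solutions in weighted spaces. The mollifications in time are smooth curves
of solutions that converge locally uniformly, hence by the interior estimate so do their gradients
and time derivatives. The bound for the gradient up to the initial time comes from the square
integrability of the gradient and of the time derivative in space-time. -/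
theorem IsAvgSol.exists_isRegSol (h : IsAvgSol n β ε a t₀ t₁ Tu TV Tw) (ha : 0 ≤ a) (hab : a < b)
    {U : ℝ → HFun n β a} (hU : Continuous U)
    (hrep : ∀ (κ : ℝ → ℝ) (k : Lp ℝ 2 (timeMeasure t₀ t₁)), IsTimeTest t₀ t₁ κ →
      k =ᵐ[timeMeasure t₀ t₁] κ → Tu k = ∫ r, κ r • U r) {M : ℝ}
    (hV : ∀ (η : ℝ → ℝ) (hη : ContDiff ℝ ∞ η) (hc : HasCompactSupport η), (∀ s, 0 ≤ η s) →
      ∫ s, η s = 1 → ∀ s T, s ≤ T → ∫ t in s..T, ‖TV (shiftLp t₀ t₁ hη hc t)‖ ^ 2 ≤ M)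
    (hw : ∀ (η : ℝ → ℝ) (hη : ContDiff ℝ ∞ η) (hc : HasCompactSupport η), (∀ s, 0 ≤ η s) →
      ∫ s, η s = 1 → ∀ s T, s ≤ T → ∫ t in s..T, ‖Tw (shiftLp t₀ t₁ hη hc t)‖ ^ 2 ≤ M) :
    ∃ F g, IsRegSol n β ε b t₀ t₁ (fun t => incl ℝ hab.le (U t)) F g := by
  have hb0 : 0 ≤ b := ha.trans hab.le
  set η : ℕ → ℝ → ℝ := fun k => (timeBump k).normed volume
  have hη : ∀ k, ContDiff ℝ ∞ (η k) := fun k => (timeBump k).contDiff_normed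
  have hc : ∀ k, HasCompactSupport (η k) := fun k => (timeBump k).hasCompactSupport_normed
  have hη' : ∀ k, ContDiff ℝ ∞ (deriv (η k)) := fun k => (contDiff_infty_iff_deriv.mp (hη k)).2
  set σ : ℕ → ℝ → Lp ℝ 2 (timeMeasure t₀ t₁) := fun k => shiftLp t₀ t₁ (hη k) (hc k)
  set σ' : ℕ → ℝ → Lp ℝ 2 (timeMeasure t₀ t₁) := fun k => shiftLp t₀ t₁ (hη' k) (hc k).deriv
  have hev : ∀ s T, t₀ < s → T < t₁ →
      ∀ᶠ k : ℕ in atTop, t₀ + 1 / ((k : ℝ) + 1) < s ∧ T < t₁ - 1 / ((k : ℝ) + 1) := by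
    intro s T hs hT
    filter_upwards [eventually_timeBump (sub_pos.mpr hs), eventually_timeBump (sub_pos.mpr hT)]
      with k h1 h2
    constructor <;> linarith
  have hsol : ∀ s T, t₀ < s → T < t₁ → ∀ᶠ k : ℕ in atTop, SolCurve n β ε a (Icc s T)
      (fun t => Tu (σ k t)) (fun t => Tw (σ k t)) (fun t => Tw (σ' k t))
      (fun t => TV (σ k t)) (fun t => TV (σ' k t)) := by
    intro s T hs hT
    filter_upwards [hev s T hs hT] with k hk
    exact h.solCurve (hη k) (hc k) (hη' k) (hc k).deriv (tsupport_timeBump k) hk.1 hk.2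
  have hf : ∀ s T, t₀ < s → T < t₁ →
      TendstoUniformlyOn (fun k t => Tu (σ k t)) U atTop (Icc s T) := by
    intro s T hs hT
    refine (tendstoUniformlyOn_mollify hU s T).congr ?_
    filter_upwards [hev s T hs hT] with k hk t ht
    exact (hrep _ _ (isTimeTest_shift (hη k) (tsupport_timeBump k) (hk.1.trans_le ht.1)
      (ht.2.trans_lt hk.2)) (coeFn_shiftLp (hη k) (hc k) t)).symm
  -- the interior estimate for the difference of two mollifications
  have hest : ∀ s T, t₀ < s → s ≤ T → T < t₁ → ∃ s₀ C, t₀ < s₀ ∧ s₀ ≤ s ∧ 0 ≤ C ∧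
      ∀ᶠ K in atTop, ∀ k ≥ K, ∀ l ≥ K, ∀ t ∈ Icc s T, ∀ e : ℝ, 0 ≤ e →
        (∀ r ∈ Icc s₀ T, ‖Tu (σ k r) - Tu (σ l r)‖ ≤ e) →
          ‖incl _ hab.le (TV (σ k t)) - incl _ hab.le (TV (σ l t))‖ ≤ C * e ∧
          ‖incl ℝ hab.le (Tw (σ k t)) - incl ℝ hab.le (Tw (σ l t))‖ ≤ C * e := by
    intro s T hs hsT hT
    obtain ⟨s₀, hs₀, hs₀'⟩ := exists_between hs
    obtain ⟨C, hC, hE⟩ := exists_interior_estimate (n := n) (β := β) ha hab hs₀' hsT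
    obtain ⟨K, hK⟩ := eventually_atTop.mp (hsol s₀ T hs₀ hT)
    refine ⟨s₀, √(C * (T - s₀)), hs₀, hs₀'.le, Real.sqrt_nonneg _,
      (eventually_ge_atTop K).mono fun K' hK' k hk l hl t ht e he hr => ?_⟩
    have hcur := (hK k (hK'.trans hk)).sub (hK l (hK'.trans hl))
    obtain ⟨h1, h2⟩ := hE _ _ _ _ _ _ hcur t ht
    have hle : s₀ ≤ T := hs₀'.le.trans hsT
    have hint : ∫ r in s₀..T, ‖((fun t => Tu (σ k t)) - fun t => Tu (σ l t)) r‖ ^ 2 ≤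
        (T - s₀) * e ^ 2 := by
      have h3 : ∫ r in s₀..T, ‖((fun t => Tu (σ k t)) - fun t => Tu (σ l t)) r‖ ^ 2 ≤
          ∫ r in s₀..T, e ^ 2 := by
        refine intervalIntegral.integral_mono_on hle ?_ (by simp) fun r hr' => ?_
        · refine ContinuousOn.intervalIntegrable_of_Icc hle ?_
          have : ContinuousOn ((fun t => Tu (σ k t)) - fun t => Tu (σ l t)) (Icc s₀ T) :=
            fun r hr => (hcur.deriv r hr).continuousAt.continuousWithinAt
          fun_prop
        · have := hr r hr'
          simp only [Pi.sub_apply]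
          gcongr
      simpa using h3
    have hb : ∀ z : ℝ, 0 ≤ z → z ^ 2 ≤ C * ∫ r in s₀..T,
        ‖((fun t => Tu (σ k t)) - fun t => Tu (σ l t)) r‖ ^ 2 → z ≤ √(C * (T - s₀)) * e := by
      intro z hz hz2
      refine le_of_sq_le_sq ?_ (by positivity)
      rw [mul_pow, Real.sq_sqrt (mul_nonneg hC (sub_nonneg.mpr hle)), mul_assoc]
      exact hz2.trans (by gcongr)
    rw [← (incl (HornSpace n) hab.le).map_sub, ← (incl ℝ hab.le).map_sub]
    exact ⟨hb _ (norm_nonneg _) h1, hb _ (norm_nonneg _) h2⟩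
  obtain ⟨F, hF⟩ := exists_tendstoUniformlyOn (y := fun k t => incl _ hab.le (TV (σ k t))) hf
    (fun s T hs hsT hT => by
      obtain ⟨s₀, C, h1, h2, h3, h4⟩ := hest s T hs hsT hT
      exact ⟨s₀, C, h1, h2, h3, h4.mono fun K hK k hk l hl t ht e he hr =>
        (hK k hk l hl t ht e he hr).1⟩)
  obtain ⟨g, hg⟩ := exists_tendstoUniformlyOn (y := fun k t => incl ℝ hab.le (Tw (σ k t))) hf
    (fun s T hs hsT hT => by
      obtain ⟨s₀, C, h1, h2, h3, h4⟩ := hest s T hs hsT hT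
      exact ⟨s₀, C, h1, h2, h3, h4.mono fun K hK k hk l hl t ht e he hr =>
        (hK k hk l hl t ht e he hr).2⟩)
  have hcσ : ∀ k, Continuous (σ k) := fun k => continuous_iff_continuousAt.mpr fun t =>
    (hasDerivAt_shiftLp (hη k) (hc k) (hη' k) (hc k).deriv t).continuousAt
  have hcont : ∀ {X : Type _} [NormedAddCommGroup X] {y : ℕ → ℝ → X} {Y : ℝ → X},
      (∀ s T, t₀ < s → T < t₁ → TendstoUniformlyOn y Y atTop (Icc s T)) →
      (∀ k, Continuous (y k)) → ContinuousOn Y (Ioo t₀ t₁) := by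
    intro X _ y Y hy hc t ht
    obtain ⟨s, hs, hs'⟩ := exists_between ht.1
    obtain ⟨T, hT, hT'⟩ := exists_between ht.2
    have := (hy s T hs hT').continuousOn (Frequently.of_forall fun k => (hc k).continuousOn)
    exact (this.continuousAt (Icc_mem_nhds hs' hT)).continuousWithinAt
  have hpt : ∀ {X : Type _} [NormedAddCommGroup X] {y : ℕ → ℝ → X} {Y : ℝ → X},
      (∀ s T, t₀ < s → T < t₁ → TendstoUniformlyOn y Y atTop (Icc s T)) →
      ∀ t ∈ Ioo t₀ t₁, Tendsto (fun k => y k t) atTop (𝓝 (Y t)) := fun hy t ht =>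
    (hy t t ht.1 ht.2).tendsto_at (left_mem_Icc.mpr le_rfl)
  have hfi : ∀ t ∈ Ioo t₀ t₁, Tendsto (fun k => incl ℝ hab.le (Tu (σ k t))) atTop
      (𝓝 (incl ℝ hab.le (U t))) := fun t ht =>
    ((incl ℝ hab.le).continuous.tendsto _).comp (hpt hf t ht)
  refine ⟨F, g, by fun_prop, hcont hF fun k => by fun_prop, hcont hg fun k => by fun_prop,
    fun t ht => ?_, fun t ht => ?_, fun t ht => ?_, fun T hT => ?_⟩
  -- the derivatives converge uniformly, so the limit is differentiable
  · obtain ⟨s, hs, hs'⟩ := exists_between ht.1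
    obtain ⟨T, hT, hT'⟩ := exists_between ht.2
    refine hasDerivAt_of_tendstoUniformlyOn (l := atTop) isOpen_Ioo
      (f := fun k t => incl ℝ hab.le (Tu (σ k t)))
      ((hg s T hs hT').mono Ioo_subset_Icc_self) ?_
      (fun r hr => hfi r ⟨hs.trans hr.1, hr.2.trans hT'⟩) ⟨hs', hT⟩
    filter_upwards [hsol s T hs hT'] with k hk r hr
    exact hasDerivAt_incl _ (hk.deriv r (Ioo_subset_Icc_self hr))
  · refine (isClosed_Gam ε b).mem_of_tendsto ((hfi t ht).prodMk_nhds (hpt hF t ht)) ?_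
    filter_upwards [hsol t t ht.1 ht.2] with k hk
    exact incl_mem_Gam hab.le (hk.mem_Gam t (left_mem_Icc.mpr le_rfl))
  · refine (isClosed_Lap ε b).mem_of_tendsto ((hpt hF t ht).prodMk_nhds (hpt hg t ht)) ?_
    filter_upwards [hsol t t ht.1 ht.2] with k hk
    exact incl_mem_Lap hab.le (hk.mem_Lap t (left_mem_Icc.mpr le_rfl))
  -- the bound up to the initial time: the derivative of `‖F‖²` is controlled by space-time integrals
  · set K₁ := ‖(incl ℝ hab.le : HFun n β a →L[ℝ] HFun n β b)‖ ^ 2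
    set K₂ := ‖(radOp hab : HVec n β a →L[ℝ] HFun n β b)‖ ^ 2
    set K := (2 + 2 * b) * K₁ + 2 * b * K₂
    refine ⟨√(‖F T‖ ^ 2 + K * (M + M)), fun t ht => Real.le_sqrt_of_sq_le ?_⟩
    refine le_of_tendsto_of_tendsto ((hpt hF t ⟨ht.1, ht.2.trans_lt hT.2⟩).norm.pow 2)
      (((hpt hF T hT).norm.pow 2).add_const _) ?_
    filter_upwards [hsol t T ht.1 hT.2] with k hk
    have hcw : Continuous fun r => ‖Tw (σ k r)‖ ^ 2 := by fun_prop
    have hcV : Continuous fun r => ‖TV (σ k r)‖ ^ 2 := by fun_prop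
    have hcd : ContinuousOn (fun r => 2 * inner ℝ (incl _ hab.le (TV (σ k r)))
        (incl _ hab.le (TV (σ' k r)))) (Icc t T) := by
      have h1 : Continuous fun r => incl _ hab.le (TV (σ k r)) := by fun_prop
      have h2 := (incl (HornSpace n) hab.le : HVec n β a →L[ℝ] HVec n β b).continuous.comp_continuousOn
        hk.cont_grad
      exact continuousOn_const.mul (h1.continuousOn.inner h2)
    have e1 := intervalIntegral.integral_eq_sub_of_hasDerivAt
      (f := fun r => ‖incl _ hab.le (TV (σ k r))‖ ^ 2)
      (fun r hr => (hasDerivAt_incl hab.le (hk.deriv_grad r (uIcc_of_le ht.2 ▸ hr))).norm_sq)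
      (hcd.intervalIntegrable_of_Icc ht.2)
    have e2 : -∫ r in t..T, 2 * inner ℝ (incl _ hab.le (TV (σ k r)))
        (incl _ hab.le (TV (σ' k r))) ≤ ∫ r in t..T, K * (‖Tw (σ k r)‖ ^ 2 + ‖TV (σ k r)‖ ^ 2) := by
      rw [← intervalIntegral.integral_neg]
      refine intervalIntegral.integral_mono_on ht.2 (hcd.intervalIntegrable_of_Icc ht.2).neg
        (Continuous.intervalIntegrable (by fun_prop) _ _) fun r hr => ?_
      have h1 := inner_incl_of_mem_Lap hab (hk.mem_Lap r hr) (hk.mem_Gam' r hr)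
      simp only [inner_sub_left, inner_smul_left, RCLike.conj_to_real,
        real_inner_self_eq_norm_sq] at h1
      have h2 : ‖radOp hab (TV (σ k r))‖ ^ 2 ≤ K₂ * ‖TV (σ k r)‖ ^ 2 := by
        rw [← mul_pow]; gcongr; exact ContinuousLinearMap.le_opNorm _ _
      have h3 : ‖incl ℝ hab.le (Tw (σ k r))‖ ^ 2 ≤ K₁ * ‖Tw (σ k r)‖ ^ 2 := by
        rw [← mul_pow]; gcongr; exact ContinuousLinearMap.le_opNorm _ _
      have h4 := neg_le_of_abs_le (abs_real_inner_le_norm (radOp hab (TV (σ k r)))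
        (incl ℝ hab.le (Tw (σ k r))))
      have h5 := mul_le_mul_of_nonneg_left h2 (by positivity : 0 ≤ 2 * b)
      have h6 := mul_le_mul_of_nonneg_left h3 (by positivity : 0 ≤ 2 + 2 * b)
      have h7 := mul_le_mul_of_nonneg_left h4 (by positivity : 0 ≤ 4 * b)
      have h8 := mul_nonneg hb0 (sq_nonneg (‖radOp hab (TV (σ k r))‖ -
        ‖incl ℝ hab.le (Tw (σ k r))‖))
      have h9 : 0 ≤ 2 * b * K₂ * ‖Tw (σ k r)‖ ^ 2 := by positivity
      have h10 : 0 ≤ (2 + 2 * b) * K₁ * ‖TV (σ k r)‖ ^ 2 := by positivity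
      simp only [K]
      nlinarith
    rw [intervalIntegral.integral_const_mul K, intervalIntegral.integral_add
      (hcw.intervalIntegrable _ _) (hcV.intervalIntegrable _ _)] at e2
    have m1 := hw (η k) (hη k) (hc k) (fun s => (timeBump k).nonneg_normed s)
      (timeBump k).integral_normed t T ht.2
    have m2 := hV (η k) (hη k) (hc k) (fun s => (timeBump k).nonneg_normed s)
      (timeBump k).integral_normed t T ht.2
    have hK0 : 0 ≤ K := by positivity
    have := mul_le_mul_of_nonneg_left (add_le_add m1 m2) hK0
    simp only [σ] at e1 e2 ⊢
    linarith

/-- Solutions of less than Gaussian growth are regular. -/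
theorem exists_isRegSol {N η : ℝ} {u : ℝ → HornSpace n → ℝ} {V : ℝ → HornSpace n → HornSpace n}
    {w : ℝ → HornSpace n → ℝ} (hm : hornMeasure n N ε η = wm n β 0)
    (hS : IsHornSolution n N ε η t₀ t₁ u V w) (ht : t₀ < t₁)
    (hI : IntegrableOn (fun z : ℝ × HornSpace n =>
      (u z.1 z.2 ^ 2 + hornInner ε z.2 (V z.1 z.2) (V z.1 z.2) + w z.1 z.2 ^ 2) *
        Real.exp (-a * ‖z.2‖ ^ 2)) (Ioo t₀ t₁ ×ˢ univ) (hornSpaceTime n N ε η))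
    (hab : a < b) (hb : 0 < b) :
    ∃ f F g, IsRegSol n β ε b t₀ t₁ f F g ∧ ∀ t ∈ Icc t₀ t₁, f t =ᵐ[volume] u t := by
  obtain ⟨c, hc, hcb⟩ := exists_between (max_lt hab hb)
  have hac : a ≤ c := (le_max_left _ _).trans hc.le
  have hc0 : 0 ≤ c := (le_max_right _ _).trans hc.le
  have hI' : IntegrableOn (fun z : ℝ × HornSpace n =>
      (u z.1 z.2 ^ 2 + hornInner ε z.2 (V z.1 z.2) (V z.1 z.2) + w z.1 z.2 ^ 2) *
        Real.exp (-c * ‖z.2‖ ^ 2)) (Ioo t₀ t₁ ×ˢ univ) (hornSpaceTime n N ε η) := by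
    have h1 : Measurable fun z : ℝ × HornSpace n => Real.exp (-(c - a) * ‖z.2‖ ^ 2) := by fun_prop
    have h2 := Integrable.bdd_mul (c := 1) hI h1.aestronglyMeasurable (ae_of_all _ fun z => by
      rw [Real.norm_of_nonneg (Real.exp_pos _).le, Real.exp_le_one_iff]
      have : 0 ≤ (c - a) * ‖z.2‖ ^ 2 := mul_nonneg (by linarith) (by positivity)
      linarith)
    refine h2.congr (ae_of_all _ fun z => ?_)
    have : Real.exp (-c * ‖z.2‖ ^ 2) = Real.exp (-(c - a) * ‖z.2‖ ^ 2) *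
        Real.exp (-a * ‖z.2‖ ^ 2) := by rw [← Real.exp_add]; ring_nf
    simp only [this]
    ring
  obtain ⟨hu, hV, hw⟩ := memLp_of_integrableOn hm hS.locInt hS.locInt_grad hS.locInt_dt hI'
  have hA := isAvgSol hm hS hu hV hw
  obtain ⟨U, hU, hrep⟩ := exists_continuous_rep ht hA.deriv
  obtain ⟨F, g, hR⟩ := hA.exists_isRegSol hc0 hcb hU hrep
    (M := ‖hV.toLp‖ ^ 2 + ‖hw.toLp‖ ^ 2)
    (fun η hη hc h0 h1 s T hsT => (integral_norm_timeAvg_shift_sq_le hη hc h0 h1 _ hsT).trans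
      (by linarith [sq_nonneg ‖hw.toLp‖]))
    (fun η hη hc h0 h1 s T hsT => (integral_norm_timeAvg_shift_sq_le hη hc h0 h1 _ hsT).trans
      (by linarith [sq_nonneg ‖hV.toLp‖]))
  exact ⟨_, F, g, hR, fun t htI => (coeFn_incl _ _).trans (ae_eq_of_rep hm hS ht hu hU hrep htI)⟩

end

end

/-! ### Weak limits in closed subspaces -/

section

variable {n : ℕ} {β : ℝ}

/-- If the first components of pairs in a closed subspace converge and the second components stay
bounded, then the limit is the first component of a pair in the subspace. -/
theorem exists_mem_of_bounded {H J α : Type*} [NormedAddCommGroup H] [NormedSpace ℝ H]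
    [NormedAddCommGroup J] [InnerProductSpace ℝ J] [CompleteSpace J] {S : Submodule ℝ (H × J)}
    (hS : IsClosed (S : Set (H × J))) {l : Filter α} [l.NeBot] {f : α → H} {F : α → J} {f₀ : H}
    {M : ℝ} (hf : Tendsto f l (𝓝 f₀)) (hF : ∀ᶠ i in l, ‖F i‖ ≤ M) (hm : ∀ᶠ i in l, (f i, F i) ∈ S) :
    ∃ F₀, (f₀, F₀) ∈ S := by
  have hle := Ultrafilter.of_le l
  -- weak limits exist along an ultrafilter, by compactness of bounded intervals
  have hlim : ∀ h : J, ∃ z, Tendsto (fun i => inner ℝ (F i) h) (Ultrafilter.of l) (𝓝 z) ∧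
      |z| ≤ M * ‖h‖ := by
    intro h
    obtain ⟨z, hz, hz'⟩ := (isCompact_Icc (a := -(M * ‖h‖)) (b := M * ‖h‖)).ultrafilter_le_nhds
      ((Ultrafilter.of l).map fun i => inner ℝ (F i) h) (by
        refine tendsto_principal.mpr ?_
        refine hle (hF.mono fun i hi => ?_)
        exact abs_le.mp ((abs_real_inner_le_norm _ _).trans (by gcongr)))
    exact ⟨z, hz', abs_le.mpr hz⟩
  choose L hL hLM using hlim
  let T : StrongDual ℝ J := LinearMap.mkContinuous
    { toFun := L
      map_add' := fun h k => tendsto_nhds_unique (hL (h + k)) (by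
        simpa only [inner_add_right] using (hL h).add (hL k))
      map_smul' := fun c h => tendsto_nhds_unique (hL (c • h)) (by
        simpa only [inner_smul_right, smul_eq_mul, RingHom.id_apply] using (hL h).const_mul c) } M hLM
  refine ⟨(InnerProductSpace.toDual ℝ J).symm T, ?_⟩
  by_contra hnot
  obtain ⟨A, v, hA, hv⟩ := geometric_hahn_banach_closed_point S.convex hS hnot
  -- a functional bounded above on a subspace vanishes there
  have hA0 : ∀ p ∈ S, A p = 0 := by
    intro p hp
    by_contra h0
    have := hA (((v + 1) / A p) • p) (S.smul_mem _ hp)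
    rw [map_smul, smul_eq_mul, div_mul_cancel₀ _ h0] at this
    linarith
  have hv0 : 0 < v := by simpa using hA 0 S.zero_mem
  set A₂ : StrongDual ℝ J := A.comp (ContinuousLinearMap.inr ℝ H J)
  have hsplit : ∀ p : H × J, A p = A (p.1, 0) +
      inner ℝ p.2 ((InnerProductSpace.toDual ℝ J).symm A₂) := by
    intro p
    rw [real_inner_comm, InnerProductSpace.toDual_symm_apply]
    change _ = _ + A (0, p.2)
    rw [← map_add, Prod.mk_add_mk, add_zero, zero_add]
  have h1 : Tendsto (fun i => A (f i, F i)) (Ultrafilter.of l)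
      (𝓝 (A (f₀, (InnerProductSpace.toDual ℝ J).symm T))) := by
    rw [hsplit (f₀, _)]
    refine (Tendsto.add ?_ ?_).congr fun i => (hsplit (f i, F i)).symm
    · exact (A.continuous.tendsto _).comp ((hf.mono_left hle).prodMk_nhds tendsto_const_nhds)
    · rw [InnerProductSpace.toDual_symm_apply]
      exact hL _
  have h2 : Tendsto (fun i => A (f i, F i)) (Ultrafilter.of l) (𝓝 0) :=
    tendsto_const_nhds.congr' (hle (hm.mono fun i hi => (hA0 _ hi).symm))
  have h3 := tendsto_nhds_unique h1 h2
  linarith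

section

variable [hn : Fact (2 ≤ n)] [hβ : Fact (0 < β)] {ε a b t₀ t₁ : ℝ}

/-- A regular solution has a weak gradient at the initial time. -/
theorem IsRegSol.exists_mem_Gam {f : ℝ → HFun n β b} {F : ℝ → HVec n β b} {g : ℝ → HFun n β b}
    (h : IsRegSol n β ε b t₀ t₁ f F g) (ht : t₀ < t₁) :
    ∃ F₀, (f t₀, F₀) ∈ Gam n β ε b := by
  obtain ⟨T, hT⟩ := exists_between ht
  obtain ⟨M, hM⟩ := h.bdd T hT
  have hI : Ioc t₀ T ∈ 𝓝[>] t₀ := Ioc_mem_nhdsGT hT.1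
  exact exists_mem_of_bounded (isClosed_Gam ε b) (l := 𝓝[>] t₀)
    (h.cont.continuousAt.mono_left nhdsWithin_le_nhds) (mem_of_superset hI hM)
    (mem_of_superset hI fun t ht => h.mem_Gam t ⟨ht.1, ht.2.trans_lt hT.2⟩)

/-! ### Gaussian multipliers -/

/-- The function `r^{2k} e^{-c r²}`, for `c > 0`. -/
def gauss (k : ℕ) (c : ℝ) (x : HornSpace n) : ℝ :=
  if 0 < c then (‖x‖ ^ 2) ^ k * Real.exp (-c * ‖x‖ ^ 2) else 0

theorem gauss_of_pos (k : ℕ) {c : ℝ} (hc : 0 < c) (x : HornSpace n) :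
    gauss k c x = (‖x‖ ^ 2) ^ k * Real.exp (-c * ‖x‖ ^ 2) := if_pos hc

theorem measurable_gauss (k : ℕ) (c : ℝ) : Measurable (gauss k c : HornSpace n → ℝ) := by
  unfold gauss
  split_ifs <;> fun_prop

theorem exists_abs_gauss_le (k : ℕ) (c : ℝ) : ∃ C : ℝ, ∀ x : HornSpace n, |gauss k c x| ≤ C := by
  by_cases hc : 0 < c
  · obtain ⟨C, -, h⟩ := exists_pow_mul_exp_le (2 * k) hc
    refine ⟨C, fun x => ?_⟩
    rw [gauss_of_pos k hc, abs_of_nonneg (by positivity), ← pow_mul]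
    exact h _ (norm_nonneg x)
  · exact ⟨0, fun x => by simp [gauss, hc]⟩

/-- Multiplication by `r^{2k} e^{-c r²}`, for `c > 0`. -/
def gaussOp (E : Type*) [NormedAddCommGroup E] [NormedSpace ℝ E] (β b : ℝ) (k : ℕ) (c : ℝ) :
    Lp E 2 (wm n β b) →L[ℝ] Lp E 2 (wm n β b) :=
  mulOp E b (gauss k c) (measurable_gauss k c) (exists_abs_gauss_le k c)

theorem coeFn_gaussOp {E : Type*} [NormedAddCommGroup E] [NormedSpace ℝ E] (k : ℕ) (c : ℝ)
    (f : Lp E 2 (wm n β b)) : gaussOp E β b k c f =ᵐ[volume] fun x => gauss k c x • f x :=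
  coeFn_mulOp _ _ _ _ _

theorem inner_gaussOp {E : Type*} [NormedAddCommGroup E] [InnerProductSpace ℝ E] (k : ℕ) {c : ℝ}
    (hc : 0 < c) (f h : Lp E 2 (wm n β b)) :
    inner ℝ f (gaussOp E β b k c h) =
      ∫ x, (‖x‖ ^ 2) ^ k * inner ℝ (f x) (h x) ∂(wm n β (b + c)) := by
  rw [inner_eq_integral (Filter.EventuallyEq.refl _ _) (coeFn_gaussOp k c h), integral_wm_add]
  refine integral_congr_ae (ae_of_all _ fun x => ?_)
  simp only [gauss_of_pos k hc, inner_smul_right, smul_eq_mul]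
  ring

theorem abs_exp_sub_sub_le {c h y : ℝ} (hy : 0 ≤ y) (hh : |h| ≤ c / 2) :
    |Real.exp (-(c + h) * y) - Real.exp (-c * y) + h * (y * Real.exp (-c * y))| ≤
      h ^ 2 * (y ^ 2 * Real.exp (-(c / 2) * y)) := by
  have h1 := Complex.norm_exp_sub_sum_le_norm_mul_exp ((-(h * y) : ℝ) : ℂ) 2
  have h2 : Complex.exp ((-(h * y) : ℝ) : ℂ) - ∑ m ∈ Finset.range 2,
      ((-(h * y) : ℝ) : ℂ) ^ m / (m.factorial : ℂ) =
      ((Real.exp (-(h * y)) - (1 + -(h * y)) : ℝ) : ℂ) := by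
    simp [Finset.sum_range_succ]
  rw [h2, Complex.norm_real, Complex.norm_real, Real.norm_eq_abs, Real.norm_eq_abs, abs_neg,
    abs_mul, abs_of_nonneg hy] at h1
  have h3 : Real.exp (-(c + h) * y) - Real.exp (-c * y) + h * (y * Real.exp (-c * y)) =
      Real.exp (-c * y) * (Real.exp (-(h * y)) - (1 + -(h * y))) := by
    have : Real.exp (-(c + h) * y) = Real.exp (-c * y) * Real.exp (-(h * y)) := by
      rw [← Real.exp_add]; ring_nf
    rw [this]; ring
  rw [h3, abs_mul, abs_of_pos (Real.exp_pos _)]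
  have h4 : Real.exp (-c * y) * Real.exp (|h| * y) ≤ Real.exp (-(c / 2) * y) := by
    rw [← Real.exp_add]
    apply Real.exp_le_exp.mpr
    nlinarith
  calc Real.exp (-c * y) * |Real.exp (-(h * y)) - (1 + -(h * y))|
      ≤ Real.exp (-c * y) * ((|h| * y) ^ 2 * Real.exp (|h| * y)) := by gcongr
    _ = (|h| * y) ^ 2 * (Real.exp (-c * y) * Real.exp (|h| * y)) := by ring
    _ ≤ (|h| * y) ^ 2 * Real.exp (-(c / 2) * y) := by gcongr
    _ = _ := by rw [mul_pow, sq_abs]; ring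

theorem norm_lp_le_of_ae {E : Type*} [NormedAddCommGroup E] {C : ℝ}
    {f h : Lp E 2 (wm n β b)} (hfh : ∀ᵐ x, ‖f x‖ ≤ C * ‖h x‖) : ‖f‖ ≤ C * ‖h‖ :=
  Lp.norm_le_mul_norm_of_ae_le_mul ((ae_wm_iff (b := b)).mpr hfh)

/-- The operators of multiplication by `r^{2k} e^{-c r²}` depend differentiably on `c`. -/
theorem hasDerivAt_gaussOp (E : Type*) [NormedAddCommGroup E] [NormedSpace ℝ E] (β b : ℝ)
    [Fact (0 < β)] (k : ℕ) {c : ℝ} (hc : 0 < c) :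
    HasDerivAt (gaussOp (n := n) E β b k) (-gaussOp E β b (k + 1) c) c := by
  obtain ⟨K, hK, hKr⟩ := exists_pow_mul_exp_le (2 * (k + 2)) (half_pos hc)
  refine HasDerivAt.of_isLittleO ?_
  have hO : (fun c' => gaussOp (n := n) E β b k c' - gaussOp E β b k c -
      (c' - c) • -gaussOp E β b (k + 1) c) =O[𝓝 c] fun c' => (c' - c) ^ 2 := by
    refine Asymptotics.IsBigO.of_bound K ?_
    filter_upwards [Metric.ball_mem_nhds c (half_pos hc)] with c' hc'
    rw [Metric.mem_ball, Real.dist_eq] at hc'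
    have hc'0 : 0 < c' := by have := (abs_lt.mp hc').1; linarith
    refine ContinuousLinearMap.opNorm_le_bound _ (by positivity) fun f => ?_
    refine norm_lp_le_of_ae ?_
    have e : (gaussOp (n := n) E β b k c' - gaussOp (n := n) E β b k c -
        (c' - c) • -gaussOp (n := n) E β b (k + 1) c : Lp E 2 (wm n β b) →L[ℝ] Lp E 2 (wm n β b)) f = gaussOp E β b k c' f - gaussOp E β b k c f +
        (c' - c) • gaussOp E β b (k + 1) c f := by simp
    rw [e]
    filter_upwards [ae_eq_wm.mp (Lp.coeFn_add (gaussOp E β b k c' f - gaussOp E β b k c f)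
        ((c' - c) • gaussOp E β b (k + 1) c f)),
      ae_eq_wm.mp (Lp.coeFn_sub (gaussOp E β b k c' f) (gaussOp E β b k c f)),
      ae_eq_wm.mp (Lp.coeFn_smul (c' - c) (gaussOp E β b (k + 1) c f)),
      coeFn_gaussOp k c' f, coeFn_gaussOp k c f, coeFn_gaussOp (k + 1) c f] with x h1 h2 h3 h4 h5 h6
    rw [h1, Pi.add_apply, h2, Pi.sub_apply, h3, Pi.smul_apply, h4, h5, h6, smul_smul, ← sub_smul,
      ← add_smul, norm_smul, gauss_of_pos k hc'0, gauss_of_pos k hc, gauss_of_pos (k + 1) hc]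
    gcongr
    have h7 := abs_exp_sub_sub_le (c := c) (h := c' - c) (y := ‖x‖ ^ 2) (by positivity) hc'.le
    rw [add_sub_cancel] at h7
    have h8 : (‖x‖ ^ 2) ^ k * Real.exp (-c' * ‖x‖ ^ 2) - (‖x‖ ^ 2) ^ k * Real.exp (-c * ‖x‖ ^ 2) +
        (c' - c) * ((‖x‖ ^ 2) ^ (k + 1) * Real.exp (-c * ‖x‖ ^ 2)) = (‖x‖ ^ 2) ^ k *
        (Real.exp (-c' * ‖x‖ ^ 2) - Real.exp (-c * ‖x‖ ^ 2) +
          (c' - c) * (‖x‖ ^ 2 * Real.exp (-c * ‖x‖ ^ 2))) := by ring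
    rw [h8, norm_mul, Real.norm_of_nonneg (by positivity : 0 ≤ (‖x‖ ^ 2) ^ k), Real.norm_eq_abs,
      Real.norm_of_nonneg (by positivity : 0 ≤ (c' - c) ^ 2)]
    calc (‖x‖ ^ 2) ^ k * _ ≤ (‖x‖ ^ 2) ^ k *
          ((c' - c) ^ 2 * ((‖x‖ ^ 2) ^ 2 * Real.exp (-(c / 2) * ‖x‖ ^ 2))) := by gcongr
      _ = (‖x‖ ^ (2 * (k + 2)) * Real.exp (-(c / 2) * ‖x‖ ^ 2)) * (c' - c) ^ 2 := by ring
      _ ≤ K * (c' - c) ^ 2 := by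
          gcongr
          exact hKr _ (norm_nonneg x)
  refine hO.trans_isLittleO ?_
  have h2 : (fun c' : ℝ => (c' - c) ^ 2) =o[𝓝 c] fun c' => c' - c := by
    have h3 : Tendsto (fun c' : ℝ => c' - c) (𝓝 c) (𝓝 0) := by
      simpa using (tendsto_id (x := 𝓝 c)).sub_const c
    exact (Asymptotics.isLittleO_pow_id one_lt_two).comp_tendsto h3
  exact h2

theorem inner_incl_incl {E : Type*} [NormedAddCommGroup E] [InnerProductSpace ℝ E] {B : ℝ}
    (hb : b < B) (f h : Lp E 2 (wm n β b)) :
    inner ℝ (incl E hb.le f) (incl E hb.le h) = inner ℝ f (gaussOp E β b 0 (B - b) h) := by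
  rw [inner_gaussOp 0 (sub_pos.mpr hb), inner_eq_integral (coeFn_incl _ _) (coeFn_incl _ _)]
  simp

theorem inner_posOp_posOp {B : ℝ} (hb : b < B) (f h : HFun n β b) :
    inner ℝ (posOp hb f) (posOp hb h) = inner ℝ f (gaussOp ℝ β b 1 (B - b) h) := by
  rw [inner_gaussOp 1 (sub_pos.mpr hb), inner_posOp, add_sub_cancel]
  refine integral_congr_ae (ae_of_all _ fun x => ?_)
  simp [mul_comm]

end

end

/-! ### Dilations -/

section

variable {n : ℕ} {β : ℝ}

section

variable [hn : Fact (2 ≤ n)] [hβ : Fact (0 < β)] {ε b B l : ℝ}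

theorem norm_le_mul_exp_of_le {E : Type*} [SeminormedAddCommGroup E] {L : HornSpace n → E} {C : ℝ}
    (hC : 0 ≤ C) (hL : ∀ x, ‖L x‖ ≤ C) (h : b * l ^ 2 ≤ B) :
    ∃ C : ℝ, ∀ x, ‖L x‖ ≤ C * Real.exp ((B - b * l ^ 2) / 2 * ‖x‖ ^ 2) :=
  ⟨C, fun x => (hL x).trans (le_mul_of_one_le_right hC (Real.one_le_exp (by
    have : 0 ≤ B - b * l ^ 2 := sub_nonneg.mpr h
    positivity)))⟩

/-- The dilation `f ↦ (x ↦ f (l x))`. -/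
def dil (hl : 0 < l) (h : b * l ^ 2 ≤ B) : HFun n β b →L[ℝ] HFun n β B :=
  fiberMap b B hl (fun _ => ContinuousLinearMap.id ℝ ℝ) stronglyMeasurable_const
    (norm_le_mul_exp_of_le zero_le_one (fun _ => ContinuousLinearMap.norm_id_le) h)

theorem coeFn_dil (hl : 0 < l) (h : b * l ^ 2 ≤ B) (f : HFun n β b) :
    dil hl h f =ᵐ[volume] fun x => f (l • x) :=
  (coeFn_fiberMap hl _ _ _ _).trans (ae_of_all _ fun x => by simp)

/-- The map taking the gradient of `f` at `l x` to the gradient of the dilated function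
`x ↦ f (l x)` at `x`, in terms of the orthonormal frame. -/
def dilFrame (ε l : ℝ) (x : HornSpace n) : HornSpace n →L[ℝ] HornSpace n :=
  l • radProj x + l ^ (1 + ε) • (1 - radProj x)

theorem norm_dilFrame_le (ε : ℝ) (hl : 0 < l) (x : HornSpace n) :
    ‖dilFrame ε l x‖ ≤ l + l ^ (1 + ε) := by
  have h0 : 0 ≤ l ^ (1 + ε) := by positivity
  refine (norm_add_le _ _).trans (add_le_add ?_ ?_)
  · rw [norm_smul, Real.norm_of_nonneg hl.le]
    exact mul_le_of_le_one_right hl.le (norm_radProj_le x)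
  · rw [norm_smul, Real.norm_of_nonneg h0]
    exact mul_le_of_le_one_right h0 (norm_one_sub_radProj_le x)

theorem stronglyMeasurable_dilFrame (ε l : ℝ) :
    StronglyMeasurable (dilFrame ε l : HornSpace n → _) :=
  (stronglyMeasurable_radProj.const_smul l).add
    ((stronglyMeasurable_const (b := l ^ (1 + ε))).smul
      (stronglyMeasurable_const.sub stronglyMeasurable_radProj))

theorem radProj_smul (hl : 0 < l) (x : HornSpace n) : radProj (l • x) = radProj x := by
  ext1 v
  rw [radProj_apply, radProj_apply, norm_smul, inner_smul_left, smul_smul]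
  rcases eq_or_ne x 0 with rfl | hx
  · simp
  have := norm_ne_zero_iff.mpr hx
  congr 1
  simp only [Real.norm_of_nonneg hl.le, RCLike.conj_to_real]
  field_simp

theorem dilFrame_frame (ε : ℝ) (hl : 0 < l) (x v : HornSpace n) :
    dilFrame ε l x (frame ε (l • x) v) = l • frame ε x v := by
  have h1 : l ^ (1 + ε) * (l * ‖x‖) ^ (-ε) = l * ‖x‖ ^ (-ε) := by
    rw [Real.mul_rpow hl.le (norm_nonneg _), ← mul_assoc, ← Real.rpow_add hl]
    simp
  have h2 : l ^ (1 + ε) * (2 * (l * ‖x‖) ^ (-ε)) = l * (2 * ‖x‖ ^ (-ε)) := by linarith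
  have h3 : dilFrame ε l x (frame ε (l • x) v) = l • radProj x v +
      (l ^ (1 + ε) * (2 * (l * ‖x‖) ^ (-ε))) • (v - radProj x v) := by
    simp only [dilFrame, frame_apply, radProj_smul hl, norm_smul, Real.norm_of_nonneg hl.le,
      add_apply, smul_apply, sub_apply, one_apply_eq_self, map_add, map_sub, map_smul,
      radProj_radProj]
    module
  rw [h3, h2, frame_apply]
  module

/-- The action of a dilation on gradients. -/
def dilVec (ε : ℝ) (hl : 0 < l) (h : b * l ^ 2 ≤ B) : HVec n β b →L[ℝ] HVec n β B :=
  fiberMap b B hl (dilFrame ε l) (stronglyMeasurable_dilFrame ε l)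
    (norm_le_mul_exp_of_le (by positivity) (norm_dilFrame_le ε hl) h)

theorem coeFn_dilVec (hl : 0 < l) (h : b * l ^ 2 ≤ B) (F : HVec n β b) :
    dilVec ε hl h F =ᵐ[volume] fun x => dilFrame ε l x (F (l • x)) :=
  coeFn_fiberMap hl _ _ _ _

theorem dil_mem_Gam (hl : 0 < l) (h : b * l ^ 2 ≤ B) {p : HFun n β b × HVec n β b}
    (hp : p ∈ Gam n β ε b) : (dil hl h p.1, dilVec ε hl h p.2) ∈ Gam n β ε B := by
  obtain ⟨T, hT⟩ : ∃ T : (HFun n β b × HVec n β b) →L[ℝ] HFun n β B × HVec n β B,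
      ∀ f F, T (f, F) = (dil hl h f, dilVec ε hl h F) :=
    ⟨(dil hl h).prodMap (dilVec ε hl h), fun f F => by rw [ContinuousLinearMap.coe_prodMap']; rfl⟩
  have key := Gam_induction ((isClosed_Gam ε B).preimage T.continuous) (fun φ hφ => by
    have hq : ∀ {p : HornSpace n → Prop}, (∀ᵐ x, p x) → ∀ᵐ x : HornSpace n, p (l • x) := fun h =>
      (quasiMeasurePreserving_smul (n := n) hl).ae h
    have h1 : dil hl h (hφ.lp β b) = (hφ.comp_smul hl).lp β B := by
      refine lp_ext ?_
      filter_upwards [coeFn_dil hl h (hφ.lp β b), hq (hφ.coeFn_lp (β := β) b),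
        (hφ.comp_smul hl).coeFn_lp (β := β) B] with x h1 h2 h3
      rw [h1, h2, h3]
    have h2 : dilVec ε hl h (hφ.lpGrad β ε b) = (hφ.comp_smul hl).lpGrad β ε B := by
      refine lp_ext ?_
      filter_upwards [coeFn_dilVec (ε := ε) hl h (hφ.lpGrad β ε b),
        hq (hφ.coeFn_lpGrad (β := β) ε b),
        (hφ.comp_smul hl).coeFn_lpGrad (β := β) ε B] with x h1 h2 h3
      rw [h1, h2, h3, dilFrame_frame ε hl, hφ.gradient_comp_smul, map_smul]
    rw [mem_preimage, hT, h1, h2]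
    exact (hφ.comp_smul hl).mem_Gam ε B) p hp
  rwa [mem_preimage, ← Prod.mk.eta (p := p), hT] at key

theorem inner_dil (hl : 0 < l) (h : b * l ^ 2 ≤ B) (P : HFun n β B) {f : HFun n β b}
    {f' : HornSpace n → ℝ} (hf : f =ᵐ[volume] f') :
    inner ℝ P (dil hl h f) = ∫ x, P x * f' (l • x) ∂(wm n β B) := by
  rw [inner_eq_integral (Filter.EventuallyEq.refl _ _) (coeFn_dil hl h f)]
  refine integral_congr_ae (ae_eq_wm.mpr ?_)
  filter_upwards [(quasiMeasurePreserving_smul (n := n) hl).ae hf] with x hx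
  rw [hx]; simp [mul_comm]

/-- The square norm of a dilated gradient. -/
theorem inner_dilVec_self (hl : 0 < l) (h : b * l ^ 2 < B) (F : HVec n β b) :
    inner ℝ (dilVec ε hl h.le F) (dilVec ε hl h.le F) = l ^ (-hdim n β) *
      inner ℝ (l • radPartOp b F + l ^ (1 + ε) • (F - radPartOp b F))
        (gaussOp _ β b 0 (B / l ^ 2 - b)
          (l • radPartOp b F + l ^ (1 + ε) • (F - radPartOp b F))) := by
  set X := l • radPartOp b F + l ^ (1 + ε) • (F - radPartOp b F)
  have hX : X =ᵐ[volume] fun x => dilFrame ε l x (F x) := by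
    filter_upwards [ae_eq_wm.mp (Lp.coeFn_add (l • radPartOp b F) (l ^ (1 + ε) • (F - radPartOp b F))),
      ae_eq_wm.mp (Lp.coeFn_smul l (radPartOp b F)),
      ae_eq_wm.mp (Lp.coeFn_smul (l ^ (1 + ε)) (F - radPartOp b F)),
      ae_eq_wm.mp (Lp.coeFn_sub F (radPartOp b F)), coeFn_radPartOp b F] with x h1 h2 h3 h4 h5
    rw [h1, Pi.add_apply, h2, h3, Pi.smul_apply, Pi.smul_apply, h4, Pi.sub_apply, h5]
    simp [dilFrame]
  have hb : b < B / l ^ 2 := by rwa [lt_div_iff₀ (by positivity)]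
  have e := integral_wm_smul (n := n) (β := β) (B / l ^ 2) hl fun x => inner ℝ (X x) (X x)
  rw [div_mul_cancel₀ _ (by positivity), smul_eq_mul] at e
  rw [inner_gaussOp 0 (sub_pos.mpr hb), add_sub_cancel]
  simp only [pow_zero, one_mul]
  rw [← e, inner_eq_integral (coeFn_dilVec hl h.le F) (coeFn_dilVec hl h.le F)]
  refine integral_congr_ae (ae_eq_wm.mpr ?_)
  filter_upwards [(quasiMeasurePreserving_smul (n := n) hl).ae hX] with x hx
  rw [hx]
  simp [dilFrame, radProj_smul hl]

theorem norm_incl_le_norm {E : Type*} [NormedAddCommGroup E] [InnerProductSpace ℝ E] (h : b ≤ B)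
    (f : Lp E 2 (wm n β b)) : ‖incl E h f‖ ≤ ‖f‖ := by
  refine le_of_sq_le_sq ?_ (norm_nonneg _)
  rw [← real_inner_self_eq_norm_sq, ← real_inner_self_eq_norm_sq,
    inner_eq_integral (coeFn_incl h f) (coeFn_incl h f),
    inner_eq_integral (Filter.EventuallyEq.refl _ f) (Filter.EventuallyEq.refl _ f)]
  obtain ⟨c, rfl⟩ : ∃ c, B = b + c := ⟨B - b, by ring⟩
  rw [integral_wm_add]
  refine integral_mono_of_nonneg (ae_of_all _ fun x => ?_) (L2.integrable_inner f f)
    (ae_of_all _ fun x => ?_)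
  · exact smul_nonneg (Real.exp_pos _).le real_inner_self_nonneg
  · refine mul_le_of_le_one_left real_inner_self_nonneg (Real.exp_le_one_iff.mpr ?_)
    have : 0 ≤ c := by linarith
    have := mul_nonneg this (sq_nonneg ‖x‖)
    linarith

theorem norm_dil_le (hl : 0 < l) (h : b * l ^ 2 ≤ B) (f : HFun n β b) :
    ‖dil hl h f‖ ≤ √(l ^ (-hdim n β)) * ‖f‖ := by
  have hb : b ≤ B / l ^ 2 := by rwa [le_div_iff₀ (by positivity)]
  have h1 : ‖dil hl h f‖ ^ 2 = l ^ (-hdim n β) * ‖incl ℝ hb f‖ ^ 2 := by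
    have e := integral_wm_smul (n := n) (β := β) (B / l ^ 2) hl fun x => inner ℝ (f x) (f x)
    rw [div_mul_cancel₀ _ (by positivity), smul_eq_mul] at e
    rw [← real_inner_self_eq_norm_sq, ← real_inner_self_eq_norm_sq,
      inner_eq_integral (coeFn_dil hl h f) (coeFn_dil hl h f),
      inner_eq_integral (coeFn_incl hb f) (coeFn_incl hb f), e]
  have h2 := norm_incl_le_norm hb f
  refine le_of_sq_le_sq ?_ (by positivity)
  rw [h1, mul_pow, Real.sq_sqrt (by positivity)]
  gcongr

theorem IsTest.exists_abs_fderiv_self_le {φ : HornSpace n → ℝ} (h : IsTest φ) :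
    ∃ C : ℝ, ∀ x, |fderiv ℝ φ x x| ≤ C := by
  have h1 : Continuous fun x => fderiv ℝ φ x x := by
    have := h.smooth.continuous_fderiv (by simp); fun_prop
  have h2 : HasCompactSupport fun x => fderiv ℝ φ x x :=
    (h.compact.fderiv ℝ).mono fun x hx h0 => hx (by simp [h0])
  obtain ⟨C, hC⟩ := h1.bounded_above_of_compact_support h2
  exact ⟨C, hC⟩

/-- For test functions the derivative in `l` of the dilations `φ (l x)` is pointwise. -/
theorem IsTest.hasDerivAt_integral_comp_smul {φ : HornSpace n → ℝ} (hφ : IsTest φ) (hB : 0 < B)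
    (P : HFun n β B) (hl : 0 < l) :
    HasDerivAt (fun l => ∫ x, P x * φ (l • x) ∂(wm n β B))
      (l⁻¹ * ∫ x, P x * fderiv ℝ φ (l • x) (l • x) ∂(wm n β B)) l := by
  have := isFiniteMeasure_wm (n := n) (β := β) hB
  obtain ⟨C, hC⟩ := hφ.exists_abs_fderiv_self_le
  have hP : Integrable P (wm n β B) := (Lp.memLp P).integrable (by norm_num)
  have hφc := hφ.smooth.continuous
  obtain ⟨C', hC'⟩ := hφc.bounded_above_of_compact_support hφ.compact
  have hdc : Continuous fun x => fderiv ℝ φ (l • x) (l • x) := by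
    have := hφ.smooth.continuous_fderiv (by simp); fun_prop
  have h := hasDerivAt_integral_of_dominated_loc_of_deriv_le (μ := wm n β B) (𝕜 := ℝ)
    (F := fun r x => P x * φ (r • x)) (F' := fun r x => P x * (r⁻¹ * fderiv ℝ φ (r • x) (r • x)))
    (bound := fun x => ‖P x‖ * (2 / l * C)) (x₀ := l) (Ioi_mem_nhds (half_lt_self hl))
    (Eventually.of_forall fun r => hP.aestronglyMeasurable.mul
      (hφc.comp (continuous_const_smul r)).aestronglyMeasurable)
    (hP.mul_bdd (hφc.comp (continuous_const_smul l)).aestronglyMeasurable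
      (ae_of_all _ fun x => hC' _))
    (hP.aestronglyMeasurable.mul (continuous_const.mul hdc).aestronglyMeasurable)
    (ae_of_all _ fun x r hr => ?_) (hP.norm.mul_const _) (ae_of_all _ fun x r hr => ?_)
  · have e : l⁻¹ * ∫ x, P x * fderiv ℝ φ (l • x) (l • x) ∂(wm n β B) =
        ∫ x, P x * (l⁻¹ * fderiv ℝ φ (l • x) (l • x)) ∂(wm n β B) := by
      rw [← integral_const_mul]
      refine integral_congr_ae (ae_of_all _ fun x => ?_)
      ring
    rw [e]
    exact h.2
  · have hr0 : 0 < r := (half_pos hl).trans hr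
    have h1 : r⁻¹ ≤ 2 / l := by
      rw [inv_le_comm₀ hr0 (by positivity), inv_div]
      exact (mem_Ioi.mp hr).le
    rw [norm_mul, norm_mul, Real.norm_of_nonneg (inv_pos.mpr hr0).le]
    gcongr
    exact hC _
  · have hr0 : 0 < r := (half_pos hl).trans hr
    have h1 : HasDerivAt (fun r : ℝ => r • x) x r := by
      simpa using (hasDerivAt_id r).smul_const x
    have h2 := (hφ.differentiableAt (r • x)).hasFDerivAt.comp_hasDerivAt r h1
    have h3 : fderiv ℝ φ (r • x) x = r⁻¹ * fderiv ℝ φ (r • x) (r • x) := by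
      rw [map_smul, smul_eq_mul, inv_mul_cancel_left₀ hr0.ne']
    rw [← h3]
    exact h2.const_mul _

/-- The derivative of the dilated functions `x ↦ f (l x)` at `l = 1` is the radial derivative
`r ∂_r f`, in the weak sense. -/
theorem hasDerivAt_integral_comp_smul (hb : b < B) (hB : 0 < B) (P : HFun n β B)
    {p : HFun n β b × HVec n β b} (hp : p ∈ Gam n β ε b) :
    HasDerivAt (fun l : ℝ => ∫ x, P x * p.1 (l • x) ∂(wm n β B)) (inner ℝ P (radOp hb p.2)) 1 := by
  obtain ⟨B₁, hB₁, hB₁'⟩ := exists_between hb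
  obtain ⟨q, hq, hqp⟩ := mem_closure_iff_seq_limit.mp hp
  choose φ hφ hqφ using hq
  set s : Set ℝ := {l | 1 / 2 < l ∧ B₁ * l ^ 2 < B}
  have hs : IsOpen s := (isOpen_lt continuous_const continuous_id).inter
    (isOpen_lt (f := fun l : ℝ => B₁ * l ^ 2) (by fun_prop) continuous_const)
  have hs0 : ∀ l ∈ s, 0 < l := fun l hl => (by norm_num : (0 : ℝ) < 1 / 2).trans hl.1
  have hsB : ∀ l ∈ s, b * l ^ 2 ≤ B := fun l hl =>
    (mul_le_mul_of_nonneg_right hB₁.le (sq_nonneg l)).trans hl.2.le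
  have hrad : ∀ k, (radOp hB₁ (q k).2 : HFun n β B₁) =ᵐ[volume] fun x => fderiv ℝ (φ k) x x := by
    intro k
    rw [hqφ]
    exact (hφ k).radOp_lpGrad ε hB₁
  set G : ℝ → HFun n β B₁ → ℝ := fun l h => l⁻¹ * ∫ x, P x * h (l • x) ∂(wm n β B)
  have hG : ∀ l (hl : l ∈ s) h, G l h = l⁻¹ * inner ℝ P (dil (hs0 l hl) hl.2.le h) := by
    intro l hl h
    rw [inner_dil _ _ _ (Filter.EventuallyEq.refl _ _)]
  set K : ℝ := 2 * (‖P‖ * √((1 / 2) ^ (-hdim n β)))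
  have hd : 0 ≤ hdim n β := by
    have := hβ.out
    unfold hdim
    positivity
  have hGb : ∀ l ∈ s, ∀ h k, |G l h - G l k| ≤ K * ‖h - k‖ := by
    intro l hl h k
    have hl0 := hs0 l hl
    rw [hG l hl, hG l hl, ← mul_sub, ← inner_sub_right, ← map_sub, abs_mul,
      abs_of_pos (inv_pos.mpr hl0)]
    have h1 : l⁻¹ ≤ 2 := by
      rw [inv_le_comm₀ hl0 two_pos]
      have := hl.1
      norm_num at this ⊢
      exact this.le
    have h2 : l ^ (-hdim n β) ≤ (1 / 2) ^ (-hdim n β) :=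
      Real.rpow_le_rpow_of_nonpos (by norm_num) hl.1.le (by linarith)
    calc l⁻¹ * |inner ℝ P (dil hl0 hl.2.le (h - k))|
        ≤ 2 * (‖P‖ * (√((1 / 2) ^ (-hdim n β)) * ‖h - k‖)) := by
          gcongr
          refine (abs_real_inner_le_norm _ _).trans ?_
          gcongr
          refine (norm_dil_le _ _ _).trans ?_
          gcongr
      _ = K * ‖h - k‖ := by simp only [K]; ring
  have hconv : Tendsto (fun k => (radOp hB₁ (q k).2 : HFun n β B₁)) atTop (𝓝 (radOp hB₁ p.2)) :=
    ((radOp hB₁).continuous.tendsto _).comp ((continuous_snd.tendsto p).comp hqp)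
  have hunif : TendstoUniformlyOn (fun k l => G l (radOp hB₁ (q k).2))
      (fun l => G l (radOp hB₁ p.2)) atTop s := by
    rw [Metric.tendstoUniformlyOn_iff]
    intro e he
    have h1 : Tendsto (fun k => K * ‖radOp hB₁ p.2 - (radOp hB₁ (q k).2 : HFun n β B₁)‖) atTop
        (𝓝 0) := by
      have := ((tendsto_const_nhds (x := (radOp hB₁ p.2 : HFun n β B₁))).sub hconv).norm.const_mul K
      simpa using this
    filter_upwards [h1.eventually (gt_mem_nhds he)] with k hk l hl
    rw [Real.dist_eq]
    exact (hGb l hl _ _).trans_lt hk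
  have h1s : (1 : ℝ) ∈ s := ⟨by norm_num, by simpa using hB₁'⟩
  have key := hasDerivAt_of_tendstoUniformlyOn hs hunif
    (f := fun k l => ∫ x, P x * φ k (l • x) ∂(wm n β B))
    (g := fun l : ℝ => ∫ x, P x * p.1 (l • x) ∂(wm n β B))
    (Eventually.of_forall fun k l hl => ?_) (fun l hl => ?_) h1s
  · have e : inner ℝ P (radOp hb p.2) = G 1 (radOp hB₁ p.2) := by
      rw [inner_eq_integral (Filter.EventuallyEq.refl _ P)
        ((coeFn_radOp hb p.2).trans (coeFn_radOp hB₁ p.2).symm)]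
      simp [G, mul_comm]
    rw [e]
    exact key
  · have hl0 := hs0 l hl
    have h1 := (hφ k).hasDerivAt_integral_comp_smul hB P hl0
    rw [← inner_dil hl0 hl.2.le P (hrad k)] at h1
    rw [hG l hl]
    exact h1
  · have hl0 := hs0 l hl
    rw [← inner_dil hl0 (hsB l hl) P (Filter.EventuallyEq.refl _ (p.1 : HornSpace n → ℝ))]
    have h1 : ∀ k, ∫ x, P x * φ k (l • x) ∂(wm n β B) =
        inner ℝ P (dil hl0 (hsB l hl) (q k).1) := fun k => by
      rw [hqφ]
      exact (inner_dil _ _ _ ((hφ k).coeFn_lp b)).symm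
    simp only [h1]
    exact Tendsto.inner tendsto_const_nhds (((dil hl0 (hsB l hl)).continuous.tendsto _).comp
      ((continuous_fst.tendsto p).comp hqp))

/-- The weak equation `div F = g` with weight `e^{-B r²}`, tested with the full Sobolev space. -/
theorem inner_of_mem_Lap (hb : b < B) {p : HVec n β b × HFun n β b}
    (hp : p ∈ Lap n β ε b) {q : HFun n β B × HVec n β B} (hq : q ∈ Gam n β ε B) :
    inner ℝ (incl _ hb.le p.1) q.2 =
      -inner ℝ (incl ℝ hb.le p.2 - (2 * B) • radOp hb p.1) q.1 := by
  have key : q ∈ {q : HFun n β B × HVec n β B |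
      inner ℝ (incl _ hb.le p.1) q.2 =
      -inner ℝ (incl ℝ hb.le p.2 - (2 * B) • radOp hb p.1) q.1} := by
    refine Gam_induction (isClosed_eq (by fun_prop) (by fun_prop)) (fun φ hφ => ?_) q hq
    have h := inner_incl_of_mem_Lap hb hp (hφ.mem_Gam ε b)
    rwa [hφ.incl_lp, hφ.incl_lpGrad] at h
  exact key

theorem inner_sub_radPartOp_radPartOp (hb : b < B) (F : HVec n β b) :
    inner ℝ (F - radPartOp b F) (gaussOp _ β b 0 (B - b) (radPartOp b F)) = 0 := by
  rw [inner_gaussOp 0 (sub_pos.mpr hb)]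
  refine integral_eq_zero_of_ae (ae_eq_wm.mpr ?_)
  filter_upwards [ae_eq_wm.mp (Lp.coeFn_sub F (radPartOp b F)), coeFn_radPartOp b F] with x h1 h2
  rw [h1, Pi.sub_apply, h2, inner_sub_left, inner_radProj_right, inner_radProj_right,
    radProj_radProj]
  simp

/-- The square norm of the tangential part of a gradient field. -/
def tangSq (hb : b < B) (F : HVec n β b) : ℝ :=
  inner ℝ (incl _ hb.le (F - radPartOp b F)) (incl _ hb.le F)

theorem tangSq_le (hb : b < B) (F : HVec n β b) :
    tangSq hb F ≤ inner ℝ (incl _ hb.le F) (incl _ hb.le F) := by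
  have h1 := inner_sub_radPartOp_radPartOp hb F
  rw [← inner_incl_incl hb, map_sub, inner_sub_left] at h1
  rw [tangSq, map_sub, inner_sub_left]
  have h2 : 0 ≤ inner ℝ (incl _ hb.le (radPartOp b F)) (incl _ hb.le (radPartOp b F)) :=
    real_inner_self_nonneg
  have h3 := real_inner_comm (incl _ hb.le F) (incl _ hb.le (radPartOp b F))
  linarith

/-- The Pohozaev identity for the horn with Gaussian weight `e^{-B r²}`. It is the first variation of
the energy under dilations. By the weak equation, `l ↦ ‖∇f_l‖² + 2 ∫ P f_l`, with `f_l = f(l ·)` and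
`P` the source `g - 2 B r ∂_r f`, is minimal at `l = 1`; its first term is explicit in `l` and its
second term is differentiable. No second derivatives of `f` are needed. -/
theorem pohozaev (hb : b < B) (hB : 0 < B) {f g : HFun n β b} {F : HVec n β b}
    (hf : (f, F) ∈ Gam n β ε b) (hF : (F, g) ∈ Lap n β ε b) :
    -2 * inner ℝ (incl ℝ hb.le g - (2 * B) • radOp hb F) (radOp hb F) =
      (2 - hdim n β) * inner ℝ (incl _ hb.le F) (incl _ hb.le F) + 2 * ε * tangSq hb F +
        2 * B * inner ℝ F (gaussOp _ β b 1 (B - b) F) := by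
  set P := incl ℝ hb.le g - (2 * B) • radOp hb F
  set X : ℝ → HVec n β b := fun l => l • radPartOp b F + l ^ (1 + ε) • (F - radPartOp b F)
  set φ : ℝ → ℝ := fun l => l ^ (-hdim n β) * inner ℝ (X l) (gaussOp _ β b 0 (B / l ^ 2 - b) (X l))
  set ψ : ℝ → ℝ := fun l => φ l + 2 * ∫ x, P x * f (l • x) ∂(wm n β B)
  have hX1 : X 1 = F := by simp [X]
  have hX : HasDerivAt X (F + ε • (F - radPartOp b F)) 1 := by
    have h1 := ((hasDerivAt_id (1 : ℝ)).smul_const (radPartOp b F)).add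
      ((Real.hasDerivAt_rpow_const (p := 1 + ε) (Or.inl one_ne_zero)).smul_const (F - radPartOp b F))
    have e : F + ε • (F - radPartOp b F) = (1 : ℝ) • radPartOp b F +
        ((1 + ε) * 1 ^ (1 + ε - 1)) • (F - radPartOp b F) := by
      rw [Real.one_rpow]
      module
    rw [e]
    exact h1
  have hc : HasDerivAt (fun l : ℝ => B / l ^ 2 - b) (-2 * B) 1 := by
    have h1 := ((hasDerivAt_const (1 : ℝ) B).div (hasDerivAt_pow 2 (1 : ℝ)) (by norm_num)).sub_const b
    have e : -2 * B = (0 * 1 ^ 2 - B * (((2 : ℕ) : ℝ) * 1 ^ (2 - 1))) / (1 ^ 2) ^ 2 := by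
      norm_num
      ring
    rw [e]
    exact h1
  have hS : HasDerivAt (fun l : ℝ => gaussOp (n := n) (HornSpace n) β b 0 (B / l ^ 2 - b))
      ((-2 * B) • -gaussOp (n := n) (HornSpace n) β b 1 (B - b)) 1 := by
    have h1 : HasDerivAt (gaussOp (n := n) (HornSpace n) β b 0)
        (-gaussOp (n := n) (HornSpace n) β b 1 (B - b)) (B / 1 ^ 2 - b) := by
      rw [one_pow, div_one]
      exact hasDerivAt_gaussOp (n := n) (HornSpace n) β b 0 (sub_pos.mpr hb)
    exact h1.scomp 1 hc
  have hφ : HasDerivAt φ ((2 - hdim n β) * inner ℝ (incl _ hb.le F) (incl _ hb.le F) +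
      2 * ε * tangSq hb F + 2 * B * inner ℝ F (gaussOp _ β b 1 (B - b) F)) 1 := by
    have h1 := (Real.hasDerivAt_rpow_const (p := -hdim n β) (Or.inl (one_ne_zero (α := ℝ)))).mul
      (hX.inner ℝ (hS.clm_apply hX))
    refine h1.congr_deriv ?_
    simp only [hX1, Real.one_rpow, one_pow, div_one, mul_one, one_mul, neg_apply, smul_apply,
      map_add, map_smul, inner_add_left, inner_add_right, inner_smul_left, inner_smul_right,
      inner_neg_right, smul_neg, RCLike.conj_to_real]
    have hsym : inner ℝ F (gaussOp _ β b 0 (B - b) (F - radPartOp b F)) =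
        inner ℝ (F - radPartOp b F) (gaussOp _ β b 0 (B - b) F) := by
      rw [← inner_incl_incl hb, ← inner_incl_incl hb, real_inner_comm]
    rw [tangSq, inner_incl_incl hb, inner_incl_incl hb]
    simp only [map_sub, inner_sub_left, inner_sub_right] at hsym ⊢
    linear_combination ε * hsym
  have hψ : HasDerivAt ψ _ 1 := hφ.add ((hasDerivAt_integral_comp_smul hb hB P hf).const_mul 2)
  -- the difference to the value at `l = 1` is the square norm of `∇f_l - ∇f`
  have hmin : IsLocalMin ψ 1 := by
    have hev : ∀ᶠ l : ℝ in 𝓝 1, 0 < l ∧ b * l ^ 2 < B :=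
      ((isOpen_lt continuous_const continuous_id).inter
        (isOpen_lt (f := fun l : ℝ => b * l ^ 2) (by fun_prop) continuous_const)).mem_nhds
        ⟨one_pos (α := ℝ), by simpa using hb⟩
    have hval : ∀ l (h : 0 < l ∧ b * l ^ 2 < B), ψ l =
        inner ℝ (dilVec ε h.1 h.2.le F) (dilVec ε h.1 h.2.le F) +
          2 * inner ℝ P (dil h.1 h.2.le f) := by
      intro l h
      rw [inner_dilVec_self h.1 h.2, inner_dil h.1 h.2.le P (Filter.EventuallyEq.refl _ _)]
    have hval1 : ψ 1 = inner ℝ (incl _ hb.le F) (incl _ hb.le F) + 2 * inner ℝ P (incl ℝ hb.le f) := by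
      simp only [ψ, φ, hX1]
      rw [inner_incl_incl hb, inner_eq_integral (Filter.EventuallyEq.refl _ P) (coeFn_incl hb.le f)]
      simp [mul_comm]
    filter_upwards [hev] with l hl
    rw [hval l hl, hval1]
    have h1 := inner_of_mem_Lap hb hF (dil_mem_Gam hl.1 hl.2.le hf)
    have h2 := inner_of_mem_Lap hb hF (incl_mem_Gam hb.le hf)
    simp only at h1 h2
    have h3 : 0 ≤ inner ℝ (dilVec ε hl.1 hl.2.le F - incl _ hb.le F)
      (dilVec ε hl.1 hl.2.le F - incl _ hb.le F) := real_inner_self_nonneg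
    rw [inner_sub_left, inner_sub_right, inner_sub_right,
      real_inner_comm (incl _ hb.le F) (dilVec ε hl.1 hl.2.le F), h1, h2] at h3
    change 0 ≤ _ - -inner ℝ P _ - (-inner ℝ P _ - _) at h3
    linarith
  have := hmin.hasDerivAt_eq_zero hψ
  linarith

end

end

/-! ### Evolution of height and energy -/

section

variable {n : ℕ} {β : ℝ}

/-- The coefficient of `-r²` in the exponent of the backward heat kernel with pole at time `θ`. -/
def gaussCoeff (θ t : ℝ) : ℝ := 1 / (4 * (θ - t))

theorem hasDerivAt_gaussCoeff {θ t : ℝ} (h : t < θ) :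
    HasDerivAt (gaussCoeff θ) (4 * gaussCoeff θ t ^ 2) t := by
  have h0 : θ - t ≠ 0 := (sub_pos.mpr h).ne'
  have h1 := (((hasDerivAt_id t).const_sub θ).const_mul 4).inv (by simpa using h0)
  have h2 : gaussCoeff θ = fun t => (4 * (θ - id t))⁻¹ := by ext t; simp [gaussCoeff]
  rw [h2]
  refine h1.congr_deriv ?_
  simp only [id]
  field_simp

theorem lt_gaussCoeff {θ t₀ t b : ℝ} (hb : b < gaussCoeff θ t₀) (ht : t₀ ≤ t) (hθ : t < θ) :
    b < gaussCoeff θ t := by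
  refine hb.trans_le ?_
  unfold gaussCoeff
  have : 0 < θ - t := sub_pos.mpr hθ
  gcongr

theorem gaussCoeff_pos {θ t : ℝ} (h : t < θ) : 0 < gaussCoeff θ t := by
  have : 0 < θ - t := sub_pos.mpr h
  unfold gaussCoeff
  positivity

/-- The product rule where one factor vanishes and the other factors are only continuous. -/
theorem hasDerivAt_inner_of_eq_zero {H : Type*} [NormedAddCommGroup H] [InnerProductSpace ℝ H]
    {X Y : ℝ → H} {S : ℝ → H →L[ℝ] H} {y : H} {t : ℝ} (hX : ContinuousAt X t)
    (hS : ContinuousAt S t) (hY : HasDerivAt Y y t) (h0 : Y t = 0) :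
    HasDerivAt (fun s => inner ℝ (X s) (S s (Y s))) (inner ℝ (X t) (S t y)) t := by
  rw [hasDerivAt_iff_tendsto_slope] at hY ⊢
  have h1 : slope (fun s => inner ℝ (X s) (S s (Y s))) t =
      fun s => inner ℝ (X s) (S s (slope Y t s)) := by
    ext s
    simp [slope_def_module, h0, inner_smul_right]
  rw [h1]
  have hX' : Tendsto X (𝓝[≠] t) (𝓝 (X t)) := hX.mono_left nhdsWithin_le_nhds
  have hS' : Tendsto S (𝓝[≠] t) (𝓝 (S t)) := hS.mono_left nhdsWithin_le_nhds
  exact hX'.inner (((isBoundedBilinearMap_apply (𝕜 := ℝ) (E := H) (F := H)).continuous.tendsto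
    (S t, y)).comp (hS'.prodMk_nhds hY))

section

variable [hn : Fact (2 ≤ n)] [hβ : Fact (0 < β)] {ε b θ t₀ t₁ : ℝ}

theorem hasDerivAt_gaussOp_gaussCoeff (E : Type*) [NormedAddCommGroup E] [NormedSpace ℝ E] (k : ℕ)
    {t : ℝ} (ht : t < θ) (hb : b < gaussCoeff θ t) :
    HasDerivAt (fun t => gaussOp (n := n) E β b k (gaussCoeff θ t - b))
      (-(4 * gaussCoeff θ t ^ 2) • gaussOp (n := n) E β b (k + 1) (gaussCoeff θ t - b)) t := by
  have h := (hasDerivAt_gaussOp (n := n) E β b k (sub_pos.mpr hb)).scomp t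
    ((hasDerivAt_gaussCoeff ht).sub_const b)
  rw [neg_smul, ← smul_neg]
  exact h

variable (b θ) in
/-- The square norm of `X t` with the Gaussian weight at time `t`. -/
def gaussSq {E : Type*} [NormedAddCommGroup E] [InnerProductSpace ℝ E]
    (X : ℝ → Lp E 2 (wm n β b)) (t : ℝ) : ℝ :=
  inner ℝ (X t) (gaussOp E β b 0 (gaussCoeff θ t - b) (X t))

theorem gaussSq_eq {E : Type*} [NormedAddCommGroup E] [InnerProductSpace ℝ E]
    (X : ℝ → Lp E 2 (wm n β b)) {t : ℝ} (hb : b < gaussCoeff θ t) :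
    gaussSq b θ X t = ‖incl E hb.le (X t)‖ ^ 2 := by
  rw [gaussSq, ← inner_incl_incl hb, real_inner_self_eq_norm_sq]

theorem gaussSq_eq_integral {E : Type*} [NormedAddCommGroup E] [InnerProductSpace ℝ E]
    (X : ℝ → Lp E 2 (wm n β b)) {t : ℝ} (hb : b < gaussCoeff θ t) :
    gaussSq b θ X t = ∫ x, inner ℝ (X t x) (X t x) ∂(wm n β (gaussCoeff θ t)) := by
  rw [gaussSq, inner_gaussOp 0 (sub_pos.mpr hb), add_sub_cancel]
  simp

variable {f : ℝ → HFun n β b} {F : ℝ → HVec n β b} {g : ℝ → HFun n β b}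

theorem IsRegSol.continuousAt_gaussSq (h : IsRegSol n β ε b t₀ t₁ f F g) {t : ℝ} (ht : t < θ)
    (hb : b < gaussCoeff θ t) : ContinuousAt (gaussSq b θ f) t := by
  have h1 := h.cont.continuousAt (x := t)
  exact h1.inner ((hasDerivAt_gaussOp_gaussCoeff ℝ 0 ht hb).continuousAt.clm_apply h1)

/-- The derivative of the weighted `L²` norm of a solution. -/
theorem IsRegSol.hasDerivAt_gaussSq (h : IsRegSol n β ε b t₀ t₁ f F g) {t : ℝ}
    (htI : t ∈ Ioo t₀ t₁) (ht : t < θ) (hb : b < gaussCoeff θ t) :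
    HasDerivAt (gaussSq b θ f)
      (-2 * gaussSq b θ F t - 2 * hdim n β * gaussCoeff θ t * gaussSq b θ f t) t := by
  have h1 := h.deriv t htI
  refine (HasDerivAt.inner ℝ h1
    ((hasDerivAt_gaussOp_gaussCoeff ℝ 0 ht hb).clm_apply h1)).congr_deriv ?_
  have h2 := inner_incl_of_mem_Lap hb (h.mem_Lap t htI) (h.mem_Gam t htI)
  have h3 := two_inner_radOp_self hb (h.mem_Gam t htI)
  have h4 : inner ℝ (f t) (gaussOp ℝ β b 0 (gaussCoeff θ t - b) (g t)) =
      inner ℝ (g t) (gaussOp ℝ β b 0 (gaussCoeff θ t - b) (f t)) := by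
    rw [← inner_incl_incl hb, ← inner_incl_incl hb, real_inner_comm]
  simp only [inner_sub_left, inner_smul_left, RCLike.conj_to_real] at h2 h3
  rw [inner_incl_incl hb, inner_incl_incl hb] at h2
  rw [inner_incl_incl hb, inner_posOp_posOp hb] at h3
  simp only [smul_apply, inner_add_right, inner_smul_right, gaussSq, h4]
  linear_combination 2 * h2 + 2 * gaussCoeff θ t * h3

/-- The function `P = g - 2 B r ∂_r f` is the time derivative of `f` corrected by the scaling
field. -/
def scalingDefect (hb : b < gaussCoeff θ t₀) (F : HVec n β b) (g : HFun n β b) :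
    HFun n β (gaussCoeff θ t₀) :=
  incl ℝ hb.le g - (2 * gaussCoeff θ t₀) • radOp hb F

/-- The derivative of the weighted Dirichlet energy of a solution. -/
theorem IsRegSol.hasDerivAt_gaussSq_grad (h : IsRegSol n β ε b t₀ t₁ f F g) {t : ℝ}
    (htI : t ∈ Ioo t₀ t₁) (ht : t < θ) (hb : b < gaussCoeff θ t) :
    HasDerivAt (gaussSq b θ F)
      (-2 * ‖scalingDefect hb (F t) (g t)‖ ^ 2 +
        2 * gaussCoeff θ t * (2 - hdim n β) * gaussSq b θ F t +
        4 * gaussCoeff θ t * ε * tangSq hb (F t)) t := by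
  have hB := gaussCoeff_pos ht
  obtain ⟨b₁, hb₁, hb₁'⟩ := exists_between hb
  have hcB := (hasDerivAt_gaussCoeff ht).continuousAt
  set Q : ℝ → HFun n β b₁ := fun s => incl ℝ hb₁.le (g s + g t) -
    (2 * gaussCoeff θ s) • radOp hb₁ (F s + F t)
  set S : ℝ → HFun n β b₁ →L[ℝ] HFun n β b₁ :=
    fun s => gaussOp ℝ β b₁ 0 (gaussCoeff θ s - b₁)
  set Y : ℝ → HFun n β b₁ := fun s => incl ℝ hb₁.le (f s - f t)
  have hgt := h.cont_deriv.continuousAt (isOpen_Ioo.mem_nhds htI)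
  have hFt := h.cont_grad.continuousAt (isOpen_Ioo.mem_nhds htI)
  have hQ : ContinuousAt Q t := by fun_prop
  have hY : HasDerivAt Y (incl ℝ hb₁.le (g t)) t :=
    hasDerivAt_incl hb₁.le ((h.deriv t htI).sub_const (f t))
  have h1 := (hasDerivAt_inner_of_eq_zero hQ
    (hasDerivAt_gaussOp_gaussCoeff ℝ 0 ht hb₁').continuousAt hY (by simp [Y])).neg
  have h2 : HasDerivAt (fun s => inner ℝ (F t) (gaussOp _ β b 0 (gaussCoeff θ s - b) (F t)))
      (inner ℝ (F t) ((-(4 * gaussCoeff θ t ^ 2) •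
        gaussOp (HornSpace n) β b 1 (gaussCoeff θ t - b)) (F t))) t := by
    have e1 := (hasDerivAt_gaussOp_gaussCoeff (β := β) (HornSpace n) 0 ht hb).clm_apply
      (hasDerivAt_const t (F t))
    have e2 := HasDerivAt.inner ℝ (hasDerivAt_const t (F t)) e1
    simpa using e2
  -- the difference of the energies is a product of a sum and a difference
  have hev : ∀ᶠ s in 𝓝 t, gaussSq b θ F s = -inner ℝ (Q s) (S s (Y s)) +
      inner ℝ (F t) (gaussOp _ β b 0 (gaussCoeff θ s - b) (F t)) := by
    filter_upwards [isOpen_Ioo.mem_nhds htI, hcB.eventually (lt_mem_nhds hb₁')] with s hs hs1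
    have hsb : b < gaussCoeff θ s := hb₁.trans hs1
    have e1 := inner_incl_of_mem_Lap hsb (add_mem (h.mem_Lap s hs) (h.mem_Lap t htI))
      (sub_mem (h.mem_Gam s hs) (h.mem_Gam t htI))
    simp only [Prod.mk_add_mk, Prod.mk_sub_mk] at e1
    have e2 : incl ℝ hsb.le (g s + g t) - (2 * gaussCoeff θ s) • radOp hsb (F s + F t) =
        incl ℝ hs1.le (Q s) := by
      simp only [Q, map_sub, map_smul, incl_incl, incl_radOp]
    have e3 : incl ℝ hsb.le (f s - f t) = incl ℝ hs1.le (Y s) := by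
      simp only [Y, incl_incl]
    rw [e2, e3, inner_incl_incl hs1, inner_incl_incl hsb] at e1
    have e4 : inner ℝ (F t) (gaussOp _ β b 0 (gaussCoeff θ s - b) (F s)) =
        inner ℝ (F s) (gaussOp _ β b 0 (gaussCoeff θ s - b) (F t)) := by
      rw [← inner_incl_incl hsb, ← inner_incl_incl hsb, real_inner_comm]
    simp only [map_sub, inner_add_left, inner_sub_right] at e1
    simp only [gaussSq, S, Y, map_sub, inner_sub_right] at e1 ⊢
    linarith
  refine ((h1.add h2).congr_of_eventuallyEq hev).congr_deriv ?_
  have hQt : incl ℝ hb₁'.le (Q t) = (2 : ℝ) • scalingDefect hb (F t) (g t) := by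
    simp only [Q, scalingDefect, map_sub, map_smul, incl_incl, incl_radOp, map_add]
    module
  have hP := pohozaev hb hB (h.mem_Gam t htI) (h.mem_Lap t htI)
  have e5 : inner ℝ (Q t) (S t (incl ℝ hb₁.le (g t))) =
      2 * inner ℝ (scalingDefect hb (F t) (g t)) (incl ℝ hb.le (g t)) := by
    simp only [S]
    rw [← inner_incl_incl hb₁', hQt, inner_smul_left, incl_incl]
    simp
  have e6 : incl ℝ hb.le (g t) = scalingDefect hb (F t) (g t) +
      (2 * gaussCoeff θ t) • radOp hb (F t) := by simp [scalingDefect]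
  rw [e5]
  nth_rewrite 1 [e6]
  rw [inner_add_right, inner_smul_right, real_inner_self_eq_norm_sq, smul_apply, inner_smul_right]
  rw [inner_incl_incl hb] at hP
  simp only [gaussSq, scalingDefect] at hP ⊢
  linear_combination (2 * gaussCoeff θ t) * hP

/-- The energy is minus the product of the solution with its scaling defect. -/
theorem IsRegSol.gaussSq_grad_eq (h : IsRegSol n β ε b t₀ t₁ f F g) {t : ℝ}
    (htI : t ∈ Ioo t₀ t₁) (hb : b < gaussCoeff θ t) :
    gaussSq b θ F t = -inner ℝ (scalingDefect hb (F t) (g t)) (incl ℝ hb.le (f t)) := by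
  have h2 := inner_incl_of_mem_Lap hb (h.mem_Lap t htI) (h.mem_Gam t htI)
  rwa [inner_incl_incl hb] at h2

/-- The weighted mean of a solution is constant in time, up to the normalisation of the kernel. -/
theorem IsRegSol.hasDerivAt_inner_one (h : IsRegSol n β ε b t₀ t₁ f F g) {t : ℝ}
    (htI : t ∈ Ioo t₀ t₁) (ht : t < θ) (hb : b < gaussCoeff θ t) {e : HFun n β b}
    (he : (e, 0) ∈ Gam n β ε b) :
    HasDerivAt (fun t => inner ℝ (f t) (gaussOp ℝ β b 0 (gaussCoeff θ t - b) e))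
      (-2 * hdim n β * gaussCoeff θ t *
        inner ℝ (f t) (gaussOp ℝ β b 0 (gaussCoeff θ t - b) e)) t := by
  have h1 := h.deriv t htI
  have h0 := (hasDerivAt_gaussOp_gaussCoeff (n := n) (β := β) ℝ 0 ht hb).clm_apply
    (hasDerivAt_const t e)
  refine (HasDerivAt.inner ℝ h1 h0).congr_deriv ?_
  have h2 := inner_incl_of_mem_Lap hb (h.mem_Lap t htI) he
  have h3 := inner_radOp_add hb (h.mem_Gam t htI) he
  simp only [map_zero, inner_zero_right, inner_zero_left, add_zero, inner_sub_left,
    inner_smul_left, RCLike.conj_to_real] at h2 h3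
  rw [h3, inner_incl_incl hb, inner_incl_incl hb, inner_posOp_posOp hb] at h2
  simp only [smul_apply, map_zero, add_zero, zero_add, inner_smul_right]
  linear_combination h2

end

end

/-! ### The differential inequality for the frequency -/

/-- The differential (in)equalities satisfied by the height `D` and the energy `E` of a solution
with respect to the backward heat kernel with pole at time `θ`. The frequency is
`(θ - t) E t / D t`. The first inequality for `E'` is the one of the frequency, multiplied out so that
it makes sense where `D` vanishes; the second bounds the growth of `E` alone. -/
structure IsFreqPair (ε t₀ θ : ℝ) (D E : ℝ → ℝ) : Prop where
  height_nonneg : ∀ t ∈ Ico t₀ θ, 0 ≤ D t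
  energy_nonneg : ∀ t ∈ Ioo t₀ θ, 0 ≤ E t
  deriv_height : ∀ t ∈ Ioo t₀ θ, HasDerivAt D (-2 * E t) t
  deriv_energy : ∀ t ∈ Ioo t₀ θ, ∃ e, HasDerivAt E e t ∧
    (θ - t) * (e * D t) ≤ -2 * (θ - t) * E t ^ 2 + (1 + ε) * (E t * D t) ∧
    (θ - t) * e ≤ (1 + ε) * E t
  cont : ContinuousOn D (Ico t₀ θ)
  bdd : ∀ T ∈ Ioo t₀ θ, ∃ M : ℝ, ∀ t ∈ Ioc t₀ T, E t ≤ M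

namespace IsFreqPair

variable {ε t₀ θ : ℝ} {D E : ℝ → ℝ}

theorem antitoneOn_height (h : IsFreqPair ε t₀ θ D E) : AntitoneOn D (Ico t₀ θ) := by
  refine antitoneOn_of_deriv_nonpos (convex_Ico _ _) h.cont ?_ ?_
  · rw [interior_Ico]
    exact fun t ht => (h.deriv_height t ht).differentiableAt.differentiableWithinAt
  · rw [interior_Ico]
    intro t ht
    rw [(h.deriv_height t ht).deriv]
    linarith [h.energy_nonneg t ht]

/-- The frequency inequality, for the frequency with the height increased by `δ ≥ 0`. -/
theorem exists_deriv (h : IsFreqPair ε t₀ θ D E) {t δ : ℝ} (ht : t ∈ Ioo t₀ θ) (hδ : 0 ≤ δ)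
    (hD : 0 < D t + δ) :
    ∃ e, HasDerivAt (fun t => (θ - t) * E t / (D t + δ)) e t ∧ e ≤ ε * E t / (D t + δ) := by
  obtain ⟨e, he, h1, h2⟩ := h.deriv_energy t ht
  refine ⟨_, (((hasDerivAt_id t).const_sub θ).mul he).div ((h.deriv_height t ht).add_const δ)
    hD.ne', ?_⟩
  rw [div_le_div_iff₀ (by positivity) hD]
  simp only [id, Pi.mul_apply]
  have h3 := mul_le_mul_of_nonneg_right h2 hδ
  have h4 : (-1 * E t + (θ - t) * e) * (D t + δ) - (θ - t) * E t * (-2 * E t) ≤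
      ε * E t * (D t + δ) := by linarith
  nlinarith [mul_le_mul_of_nonneg_right h4 hD.le]

/-- The frequency times `(θ - t)^ε` is nonincreasing in time. -/
theorem antitoneOn_freq (h : IsFreqPair ε t₀ θ D E) {δ : ℝ} (hδ : 0 ≤ δ)
    (hD : ∀ t ∈ Ioo t₀ θ, 0 < D t + δ) :
    AntitoneOn (fun t => (θ - t) * E t / (D t + δ) * (θ - t) ^ ε) (Ioo t₀ θ) := by
  have hd : ∀ t ∈ Ioo t₀ θ, ∃ e, HasDerivAt
      (fun t => (θ - t) * E t / (D t + δ) * (θ - t) ^ ε) e t ∧ e ≤ 0 := by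
    intro t ht
    obtain ⟨e, he, hle⟩ := h.exists_deriv ht hδ (hD t ht)
    have hτ : 0 < θ - t := sub_pos.mpr ht.2
    have h1 := ((hasDerivAt_id t).const_sub θ).rpow_const (p := ε) (Or.inl hτ.ne')
    refine ⟨_, he.mul h1, ?_⟩
    simp only [id]
    have h2 : (θ - t) * (θ - t) ^ (ε - 1) = (θ - t) ^ ε := by
      rw [mul_comm, ← Real.rpow_add_one hτ.ne', sub_add_cancel]
    have h3 : (θ - t) * E t / (D t + δ) * (-1 * ε * (θ - t) ^ (ε - 1)) =
        -(ε * E t / (D t + δ)) * ((θ - t) * (θ - t) ^ (ε - 1)) := by ring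
    rw [h3, h2, ← add_mul]
    exact mul_nonpos_of_nonpos_of_nonneg (by linarith) (by positivity)
  choose! e he hle using hd
  refine antitoneOn_of_deriv_nonpos (convex_Ioo _ _)
    (fun t ht => (he t ht).continuousAt.continuousWithinAt) ?_ ?_
  · rw [interior_Ioo]
    exact fun t ht => (he t ht).differentiableAt.differentiableWithinAt
  · rw [interior_Ioo]
    intro t ht
    rw [(he t ht).deriv]
    exact hle t ht

/-- Quantitative backward uniqueness: a positive height stays positive. The logarithmic derivative of
the height is minus twice the frequency over `θ - t`, and the frequency is bounded by its
monotonicity. -/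
theorem le_height (h : IsFreqPair ε t₀ θ D E) (hε : 0 < ε) {s t : ℝ} (hs : s ∈ Ioo t₀ θ)
    (hst : s ≤ t) (ht : t < θ) (hD : 0 < D s) :
    D s * Real.exp (-(2 * ((θ - s) * E s / D s * (θ - s) ^ ε) / ε) * (θ - t) ^ (-ε)) ≤ D t := by
  set A := (θ - s) * E s / D s * (θ - s) ^ ε
  have hsub : Icc s t ⊆ Ioo t₀ θ := fun r hr => ⟨hs.1.trans_le hr.1, hr.2.trans_lt ht⟩
  have hτs : 0 < θ - s := sub_pos.mpr hs.2
  have hA : 0 ≤ A := by have := h.energy_nonneg s hs; positivity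
  -- `D` might vanish, so the frequency is regularised by adding `δ` to the height
  refine le_of_forall_pos_le_add fun δ hδ => ?_
  have hpos : ∀ r ∈ Ioo t₀ θ, 0 < D r + δ := fun r hr => by
    linarith [h.height_nonneg r ⟨hr.1.le, hr.2⟩]
  have hN : ∀ r ∈ Icc s t, (θ - r) * E r / (D r + δ) * (θ - r) ^ ε ≤ A := by
    intro r hr
    refine (h.antitoneOn_freq hδ.le hpos hs (hsub hr) hr.1).trans ?_
    have := h.energy_nonneg s hs
    simp only [A]
    gcongr
    linarith
  have hd : ∀ r ∈ Icc s t, HasDerivAt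
      (fun r => Real.log (D r + δ) + 2 * A / ε * (θ - r) ^ (-ε))
      (-2 * E r / (D r + δ) + 2 * A / ε * (-1 * (-ε) * (θ - r) ^ (-ε - 1))) r := by
    intro r hr
    have hτ : 0 < θ - r := sub_pos.mpr (hsub hr).2
    exact (((h.deriv_height r (hsub hr)).add_const δ).log (hpos r (hsub hr)).ne').add
      ((((hasDerivAt_id r).const_sub θ).rpow_const (p := -ε) (Or.inl hτ.ne')).const_mul _)
  -- `(log (D + δ))' = -2 E / (D + δ) ≥ -2 A (θ - r)^{-1-ε}`
  have hmono : MonotoneOn (fun r => Real.log (D r + δ) + 2 * A / ε * (θ - r) ^ (-ε)) (Icc s t) := by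
    refine monotoneOn_of_deriv_nonneg (convex_Icc _ _)
      (fun r hr => (hd r hr).continuousAt.continuousWithinAt)
      (fun r hr => (hd r (interior_subset hr)).differentiableAt.differentiableWithinAt)
      fun r hr => ?_
    have hr' := interior_subset hr
    rw [(hd r hr').deriv]
    have hτ : 0 < θ - r := sub_pos.mpr (hsub hr').2
    have h1 := hN r hr'
    have h2 : (θ - r) * (θ - r) ^ ε * (θ - r) ^ (-ε - 1) = 1 := by
      rw [mul_comm (θ - r), ← Real.rpow_add_one hτ.ne', ← Real.rpow_add hτ]
      simp
    have h3 := mul_le_mul_of_nonneg_right h1 (by positivity : 0 ≤ (θ - r) ^ (-ε - 1))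
    have h4 : (θ - r) * E r / (D r + δ) * (θ - r) ^ ε * (θ - r) ^ (-ε - 1) = E r / (D r + δ) := by
      calc _ = E r / (D r + δ) * ((θ - r) * (θ - r) ^ ε * (θ - r) ^ (-ε - 1)) := by ring
        _ = _ := by rw [h2, mul_one]
    rw [h4] at h3
    have h5 : 2 * A / ε * (-1 * (-ε) * (θ - r) ^ (-ε - 1)) = 2 * (A * (θ - r) ^ (-ε - 1)) := by
      field_simp
    rw [h5, mul_div_assoc]
    linarith
  have key := hmono (left_mem_Icc.mpr hst) (right_mem_Icc.mpr hst) hst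
  simp only at key
  have h6 : 0 ≤ 2 * A / ε * (θ - s) ^ (-ε) := by positivity
  have h7 : Real.log (D s) ≤ Real.log (D s + δ) := Real.log_le_log hD (by linarith)
  have hDt := hpos t (hsub (right_mem_Icc.mpr hst))
  rw [← Real.log_le_log_iff (by positivity) hDt, Real.log_mul hD.ne' (Real.exp_pos _).ne',
    Real.log_exp]
  linarith

theorem height_pos (h : IsFreqPair ε t₀ θ D E) (hε : 0 < ε) {s t : ℝ} (hs : s ∈ Ioo t₀ θ)
    (hD : 0 < D s) (ht : t ∈ Ico t₀ θ) : 0 < D t := by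
  rcases le_total s t with hst | hst
  · exact lt_of_lt_of_le (by positivity) (h.le_height hε hs hst ht.2 hD)
  · exact hD.trans_le (h.antitoneOn_height ht ⟨hs.1.le, hs.2⟩ hst)

/-- After time `s` this is the quantitative backward uniqueness; before it, the height is at least
`D s`. -/
theorem exists_le_height (h : IsFreqPair ε t₀ θ D E) (hε : 0 < ε) {s : ℝ} (hs : s ∈ Ioo t₀ θ)
    (hD : 0 < D s) : ∃ c C : ℝ, 0 < c ∧ 0 < C ∧
      ∀ t ∈ Ico t₀ θ, c * Real.exp (-C * (θ - t) ^ (-ε)) ≤ D t := by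
  set C := 2 * ((θ - s) * E s / D s * (θ - s) ^ ε) / ε
  have hτs : 0 < θ - s := sub_pos.mpr hs.2
  have hC : 0 ≤ C := by have := h.energy_nonneg s hs; positivity
  refine ⟨D s, C + 1, hD, by positivity, fun t ht => ?_⟩
  have hτ : 0 < θ - t := sub_pos.mpr ht.2
  have hp : 0 < (θ - t) ^ (-ε) := by positivity
  rcases le_total s t with hst | hst
  · refine le_trans ?_ (h.le_height hε hs hst ht.2 hD)
    gcongr
    linarith
  · refine le_trans ?_ (h.antitoneOn_height ht ⟨hs.1.le, hs.2⟩ hst)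
    refine mul_le_of_le_one_right hD.le (Real.exp_le_one_iff.mpr ?_)
    nlinarith

/-- After time `s` the bound is the monotonicity of `N (θ - t)^ε`. Before it, `E` is bounded and the
height is at least `D s`. -/
theorem exists_freq_le (h : IsFreqPair ε t₀ θ D E) (hε : 0 < ε) {s : ℝ} (hs : s ∈ Ioo t₀ θ)
    (hD : 0 < D s) : ∃ C : ℝ, 0 < C ∧
      ∀ t ∈ Ioo t₀ θ, (θ - t) * E t / D t ≤ C * (θ - t) ^ (-ε) := by
  obtain ⟨M, hM⟩ := h.bdd s hs
  have hpos : ∀ t ∈ Ioo t₀ θ, 0 < D t := fun t ht => h.height_pos hε hs hD ⟨ht.1.le, ht.2⟩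
  have hτ₀ : 0 < θ - t₀ := sub_pos.mpr (hs.1.trans hs.2)
  have hτs : 0 < θ - s := sub_pos.mpr hs.2
  have hEs := h.energy_nonneg s hs
  have hM0 : 0 ≤ M := hEs.trans (hM s ⟨hs.1, le_rfl⟩)
  refine ⟨(θ - s) * E s / D s * (θ - s) ^ ε + (θ - t₀) * M / D s * (θ - t₀) ^ ε + 1,
    by positivity, fun t ht => ?_⟩
  have hτ : 0 < θ - t := sub_pos.mpr ht.2
  have hEt := h.energy_nonneg t ht
  rw [Real.rpow_neg hτ.le, ← div_eq_mul_inv, le_div_iff₀ (by positivity)]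
  have p1 : 0 ≤ (θ - s) * E s / D s * (θ - s) ^ ε := by positivity
  have p2 : 0 ≤ (θ - t₀) * M / D s * (θ - t₀) ^ ε := by positivity
  rcases le_total s t with hst | hst
  · have h1 := h.antitoneOn_freq le_rfl (by simpa using hpos) hs ht hst
    simp only [add_zero] at h1
    linarith
  · have h1 : (θ - t) * E t / D t * (θ - t) ^ ε ≤ (θ - t₀) * M / D s * (θ - t₀) ^ ε := by
      have h2 := h.antitoneOn_height ⟨ht.1.le, ht.2⟩ ⟨hs.1.le, hs.2⟩ hst
      have h3 := hM t ⟨ht.1, hst⟩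
      have h4 := ht.1.le
      gcongr
    linarith

end IsFreqPair

section

variable {n : ℕ} {β : ℝ} [hn : Fact (2 ≤ n)] [hβ : Fact (0 < β)] {ε b θ t₀ : ℝ}
  {f : ℝ → HFun n β b} {F : ℝ → HVec n β b} {g : ℝ → HFun n β b}

theorem hasDerivAt_rpow_sub {t : ℝ} (ht : t < θ) :
    HasDerivAt (fun t => (θ - t) ^ (-hdim n β / 2))
      (2 * hdim n β * gaussCoeff θ t * (θ - t) ^ (-hdim n β / 2)) t := by
  have hτ : 0 < θ - t := sub_pos.mpr ht
  refine (((hasDerivAt_id t).const_sub θ).rpow_const (p := -hdim n β / 2)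
    (Or.inl hτ.ne')).congr_deriv ?_
  simp only [id]
  rw [Real.rpow_sub_one hτ.ne', gaussCoeff]
  field_simp
  norm_num

/-- The height and energy of a solution with respect to the backward heat kernel. -/
theorem IsRegSol.isFreqPair (h : IsRegSol n β ε b t₀ θ f F g) (hε : 0 < ε)
    (hb : b < gaussCoeff θ t₀) :
    IsFreqPair ε t₀ θ (fun t => (θ - t) ^ (-hdim n β / 2) * gaussSq b θ f t)
      (fun t => (θ - t) ^ (-hdim n β / 2) * gaussSq b θ F t) := by
  have hlt : ∀ t ∈ Ico t₀ θ, b < gaussCoeff θ t := fun t ht => lt_gaussCoeff hb ht.1 ht.2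
  have hlt' : ∀ t ∈ Ioo t₀ θ, b < gaussCoeff θ t := fun t ht => hlt t ⟨ht.1.le, ht.2⟩
  have hρ : ∀ t < θ, HasDerivAt (fun t => (θ - t) ^ (-hdim n β / 2))
      (2 * hdim n β * gaussCoeff θ t * (θ - t) ^ (-hdim n β / 2)) t := fun t ht =>
    hasDerivAt_rpow_sub ht
  have hnn : ∀ t ∈ Ico t₀ θ, 0 ≤ (θ - t) ^ (-hdim n β / 2) * gaussSq b θ f t := fun t ht => by
    have hτ : 0 < θ - t := sub_pos.mpr ht.2
    rw [gaussSq_eq f (hlt t ht)]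
    positivity
  have hnn' : ∀ t ∈ Ioo t₀ θ, 0 ≤ (θ - t) ^ (-hdim n β / 2) * gaussSq b θ F t := fun t ht => by
    have hτ : 0 < θ - t := sub_pos.mpr ht.2
    rw [gaussSq_eq F (hlt' t ht)]
    positivity
  refine ⟨hnn, hnn', fun t ht => ?_, fun t ht => ?_, fun t ht => ?_, fun T hT => ?_⟩
  · refine ((hρ t ht.2).mul (h.hasDerivAt_gaussSq ht ht.2 (hlt' t ht))).congr_deriv ?_
    ring
  · have hb' := hlt' t ht
    have hτ : 0 < θ - t := sub_pos.mpr ht.2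
    refine ⟨_, (hρ t ht.2).mul (h.hasDerivAt_gaussSq_grad ht ht.2 hb'), ?_⟩
    set ρ := (θ - t) ^ (-hdim n β / 2)
    have hρ0 : 0 < ρ := by positivity
    set P := scalingDefect hb' (F t) (g t)
    have hτB : (θ - t) * gaussCoeff θ t = 1 / 4 := by unfold gaussCoeff; field_simp
    have hT : tangSq hb' (F t) ≤ gaussSq b θ F t := by
      rw [gaussSq, ← inner_incl_incl hb']
      exact tangSq_le hb' (F t)
    have hCS : gaussSq b θ F t ^ 2 ≤ ‖P‖ ^ 2 * gaussSq b θ f t := by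
      rw [h.gaussSq_grad_eq ht hb', gaussSq_eq f hb', neg_sq, ← mul_pow]
      exact sq_le_sq' (by linarith [neg_le_of_abs_le (abs_real_inner_le_norm P (incl ℝ hb'.le (f t)))])
        (real_inner_le_norm _ _)
    set q := gaussSq b θ F t
    set D := gaussSq b θ f t
    set qT := tangSq hb' (F t)
    have hD0 : 0 ≤ D := by rw [show D = _ from gaussSq_eq f hb']; positivity
    have e1 : (θ - t) * (2 * hdim n β * gaussCoeff θ t * ρ * q + ρ * (-2 * ‖P‖ ^ 2 +
        2 * gaussCoeff θ t * (2 - hdim n β) * q + 4 * gaussCoeff θ t * ε * qT)) =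
        ρ * (-2 * (θ - t) * ‖P‖ ^ 2 + q + ε * qT) := by
      linear_combination (4 * ρ * (q + ε * qT)) * hτB
    have e2 : ρ * (-2 * (θ - t) * ‖P‖ ^ 2 + q + ε * qT) ≤
        ρ * (-2 * (θ - t) * ‖P‖ ^ 2 + (1 + ε) * q) := by
      refine mul_le_mul_of_nonneg_left ?_ hρ0.le
      nlinarith
    constructor
    · rw [← mul_assoc, e1]
      calc _ ≤ ρ * (-2 * (θ - t) * ‖P‖ ^ 2 + (1 + ε) * q) * (ρ * D) := by gcongr
        _ = ρ ^ 2 * (-2 * (θ - t) * (‖P‖ ^ 2 * D) + (1 + ε) * (q * D)) := by ring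
        _ ≤ ρ ^ 2 * (-2 * (θ - t) * q ^ 2 + (1 + ε) * (q * D)) := by
            gcongr ρ ^ 2 * (?_ + _)
            nlinarith
        _ = _ := by ring
    · rw [e1]
      refine e2.trans ?_
      have : 0 ≤ ρ * ((θ - t) * ‖P‖ ^ 2) := by positivity
      linarith
  · exact ((hρ t ht.2).continuousAt.mul
      (h.continuousAt_gaussSq ht.2 (hlt t ht))).continuousWithinAt
  · obtain ⟨M, hM⟩ := h.bdd T hT
    refine ⟨(θ - T) ^ (-hdim n β / 2) * M ^ 2, fun t ht => ?_⟩
    have hτ : 0 < θ - T := sub_pos.mpr hT.2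
    have hd : 0 ≤ hdim n β := by
      have := hβ.out
      unfold hdim
      positivity
    have hb' := hlt' t ⟨ht.1, ht.2.trans_lt hT.2⟩
    rw [gaussSq_eq F hb']
    have h1 : (θ - t) ^ (-hdim n β / 2) ≤ (θ - T) ^ (-hdim n β / 2) :=
      Real.rpow_le_rpow_of_nonpos hτ (by linarith [ht.2]) (by linarith)
    have h2 := (norm_incl_le_norm hb'.le (F t)).trans (hM t ht)
    gcongr

end

/-! ### The kernel with pole at the tip -/

section

variable {n : ℕ} {β : ℝ}

/-- The total mass of the measure with weight `e^{-r²/4}`. -/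
def kernMass (n : ℕ) (β : ℝ) : ℝ := ∫ y, Real.exp (-‖y‖ ^ 2 / 4) ∂(wm n β 0)

/-- The heat kernel with pole at the tip. -/
def kern (n : ℕ) (β τ : ℝ) (x : HornSpace n) : ℝ :=
  (kernMass n β)⁻¹ * τ ^ (-hdim n β / 2) * Real.exp (-‖x‖ ^ 2 / (4 * τ))

variable [hn : Fact (2 ≤ n)] [hβ : Fact (0 < β)]

theorem exp_eq_gauss {τ : ℝ} (hτ : 0 < τ) (x : HornSpace n) :
    Real.exp (-‖x‖ ^ 2 / (4 * τ)) = gauss 0 (1 / (4 * τ)) x := by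
  rw [gauss_of_pos 0 (by positivity), pow_zero, one_mul]
  congr 1
  ring

theorem integral_exp_mul {τ : ℝ} (f : HornSpace n → ℝ) :
    ∫ x, Real.exp (-‖x‖ ^ 2 / (4 * τ)) * f x ∂(wm n β 0) = ∫ x, f x ∂(wm n β (1 / (4 * τ))) := by
  have h := integral_wm_add (n := n) (β := β) 0 (1 / (4 * τ)) f
  rw [zero_add] at h
  rw [h]
  refine integral_congr_ae (ae_of_all _ fun x => ?_)
  simp only [smul_eq_mul]
  congr 2
  ring

theorem kernMass_eq : kernMass n β = (wm n β (1 / 4)).real univ := by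
  have h := integral_exp_mul (n := n) (β := β) (τ := 1) fun _ => 1
  simp only [mul_one, integral_const, smul_eq_mul] at h
  exact h

theorem kernMass_pos : 0 < kernMass n β := by
  have h1 := isFiniteMeasure_wm (n := n) (β := β) (b := 1 / 4) (by norm_num)
  rw [kernMass_eq, measureReal_def, ENNReal.toReal_pos_iff]
  refine ⟨?_, measure_lt_top _ _⟩
  rw [pos_iff_ne_zero, Ne, Measure.measure_univ_eq_zero]
  intro h0
  have h2 : ∀ᵐ x ∂(wm n β (1 / 4)), False := by rw [h0]; simp
  have h3 : ∀ᵐ x : HornSpace n, False := ae_wm_iff.mp h2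
  rw [eventually_false_iff_eq_bot, ae_eq_bot] at h3
  exact NeZero.ne (volume : Measure (HornSpace n)) h3

theorem integral_wm_one {τ : ℝ} (hτ : 0 < τ) :
    ∫ _, (1 : ℝ) ∂(wm n β (1 / (4 * τ))) = τ ^ (hdim n β / 2) * kernMass n β := by
  have hs : 0 < √τ := Real.sqrt_pos.mpr hτ
  have h := integral_wm_smul (n := n) (β := β) (1 / (4 * τ)) hs fun _ => (1 : ℝ)
  rw [Real.sq_sqrt hτ.le, show 1 / (4 * τ) * τ = 1 / 4 by field_simp, smul_eq_mul] at h
  have h2 : kernMass n β = ∫ _, (1 : ℝ) ∂(wm n β (1 / 4)) := by simp [kernMass_eq]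
  rw [h2, h, ← mul_assoc, Real.sqrt_eq_rpow, ← Real.rpow_mul hτ.le, ← Real.rpow_add hτ]
  ring_nf
  simp

theorem kern_nonneg {τ : ℝ} (hτ : 0 ≤ τ) (x : HornSpace n) : 0 ≤ kern n β τ x := by
  have := kernMass_pos (n := n) (β := β)
  unfold kern
  positivity

/-- Integrals against the kernel are integrals against the Gaussian weight. -/
theorem integral_kern_mul {τ : ℝ} (f : HornSpace n → ℝ) :
    ∫ x, kern n β τ x * f x ∂(wm n β 0) =
      (kernMass n β)⁻¹ * τ ^ (-hdim n β / 2) * ∫ x, f x ∂(wm n β (1 / (4 * τ))) := by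
  rw [← integral_exp_mul, ← integral_const_mul]
  refine integral_congr_ae (ae_of_all _ fun x => ?_)
  simp only [kern]
  ring

theorem integral_kern {τ : ℝ} (hτ : 0 < τ) : ∫ x, kern n β τ x ∂(wm n β 0) = 1 := by
  have h := integral_kern_mul (n := n) (β := β) (τ := τ) fun _ => 1
  simp only [mul_one] at h
  rw [h, integral_wm_one hτ, neg_div, Real.rpow_neg hτ.le]
  have := kernMass_pos (n := n) (β := β)
  field_simp

theorem integrable_gauss (k : ℕ) {c : ℝ} (hc : 0 < c) : Integrable (gauss k c) (wm n β 0) := by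
  have := isFiniteMeasure_wm (n := n) (β := β) (half_pos hc)
  obtain ⟨C, hC⟩ := exists_abs_gauss_le (n := n) k (c / 2)
  have h1 : Integrable (gauss k (c / 2)) (wm n β (c / 2)) :=
    Integrable.of_bound (measurable_gauss k _).aestronglyMeasurable C (ae_of_all _ hC)
  have h2 := (integrable_wm_add (n := n) (β := β) 0 (c / 2)).mp (by rwa [zero_add])
  refine h2.congr (ae_of_all _ fun x => ?_)
  simp only [gauss_of_pos k hc, gauss_of_pos k (half_pos hc), smul_eq_mul]
  have : Real.exp (-c * ‖x‖ ^ 2) = Real.exp (-(c / 2) * ‖x‖ ^ 2) * Real.exp (-(c / 2) * ‖x‖ ^ 2) := by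
    rw [← Real.exp_add]; ring_nf
  rw [this]
  ring

theorem gauss_zero_sq {c : ℝ} (hc : 0 < c) (x : HornSpace n) :
    gauss 0 c x ^ 2 = gauss 0 (2 * c) x := by
  rw [gauss_of_pos 0 hc, gauss_of_pos 0 (by positivity), mul_pow, ← Real.exp_nat_mul]
  simp only [pow_zero, one_pow, one_mul]
  congr 1
  push_cast
  ring

theorem memLp_gauss {c : ℝ} (hc : 0 < c) : MemLp (gauss 0 c) 2 (wm n β 0) := by
  rw [memLp_two_iff_integrable_sq (measurable_gauss 0 c).aestronglyMeasurable]
  refine (integrable_gauss 0 (c := 2 * c) (by positivity)).congr (ae_of_all _ fun x => ?_)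
  exact (gauss_zero_sq hc x).symm

theorem kern_eq {τ : ℝ} (hτ : 0 < τ) :
    kern n β τ = ((kernMass n β)⁻¹ * τ ^ (-hdim n β / 2)) • gauss 0 (1 / (4 * τ)) := by
  ext x
  rw [kern, exp_eq_gauss hτ]
  rfl

theorem memLp_kern {τ : ℝ} (hτ : 0 < τ) : MemLp (kern n β τ) 2 (wm n β 0) := by
  rw [kern_eq hτ]
  exact (memLp_gauss (by positivity)).const_smul _

theorem integrable_kern {τ : ℝ} (hτ : 0 < τ) : Integrable (kern n β τ) (wm n β 0) := by
  rw [kern_eq hτ]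
  exact (integrable_gauss 0 (by positivity)).smul _

variable (n β) in
/-- The kernel as an element of `L²`. -/
def kernLp (τ : ℝ) : HFun n β 0 := if h : 0 < τ then (memLp_kern h).toLp else 0

theorem coeFn_kernLp {τ : ℝ} (hτ : 0 < τ) : kernLp n β τ =ᵐ[volume] kern n β τ := by
  rw [kernLp, dif_pos hτ]
  exact ae_eq_wm.mp (memLp_kern hτ).coeFn_toLp

/-- Near `τ` the kernels are a fixed Gaussian multiplied by Gaussian multipliers that depend
differentiably on the time. -/
theorem continuousAt_kernLp {τ : ℝ} (hτ : 0 < τ) : ContinuousAt (kernLp n β) τ := by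
  set c := 1 / (8 * τ)
  have hc : 0 < c := by positivity
  set G : HFun n β 0 := (memLp_gauss hc).toLp
  have hG : G =ᵐ[volume] gauss 0 c := ae_eq_wm.mp (memLp_gauss hc).coeFn_toLp
  have h1 : ContinuousAt (fun r : ℝ => 1 / (4 * r) - c) τ := by
    have : (4 : ℝ) * τ ≠ 0 := by positivity
    fun_prop (disch := assumption)
  have hpos : 0 < 1 / (4 * τ) - c := by
    simp only [c]; rw [sub_pos]; gcongr; norm_num
  have h2 : ContinuousAt (fun r : ℝ => ((kernMass n β)⁻¹ * r ^ (-hdim n β / 2)) •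
      gaussOp ℝ β 0 0 (1 / (4 * r) - c) G) τ := by
    refine ContinuousAt.smul (continuousAt_const.mul
      (Real.continuousAt_rpow_const _ _ (Or.inl hτ.ne'))) ?_
    have h3 : ContinuousAt (gaussOp (n := n) ℝ β 0 0) (1 / (4 * τ) - c) :=
      (hasDerivAt_gaussOp ℝ β 0 0 hpos).continuousAt
    have h4 : ContinuousAt (fun r : ℝ => gaussOp (n := n) ℝ β 0 0 (1 / (4 * r) - c)) τ :=
      ContinuousAt.comp (f := fun r : ℝ => 1 / (4 * r) - c) h3 h1
    exact h4.clm_apply continuousAt_const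
  refine h2.congr ?_
  filter_upwards [h1.eventually (lt_mem_nhds hpos), lt_mem_nhds hτ] with r hr hr0
  refine lp_ext ?_
  filter_upwards [ae_eq_wm.mp (Lp.coeFn_smul ((kernMass n β)⁻¹ * r ^ (-hdim n β / 2))
      (gaussOp ℝ β 0 0 (1 / (4 * r) - c) G)), coeFn_gaussOp 0 (1 / (4 * r) - c) G, hG,
    coeFn_kernLp (n := n) (β := β) hr0] with x e1 e2 e3 e4
  rw [e1, Pi.smul_apply, e2, e3, e4, kern_eq hr0, Pi.smul_apply, gauss_of_pos 0 hr,
    gauss_of_pos 0 hc, gauss_of_pos 0 (by positivity)]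
  simp only [smul_eq_mul, pow_zero, one_mul]
  rw [← Real.exp_add]
  congr 2
  ring

/-! ### The kernel as an approximate identity -/

/-- The kernels converge to the Dirac measure at the tip, tested against functions continuous at the
tip and integrable with respect to a Gaussian weight. -/
theorem tendsto_integral_kern {c : ℝ} (hc : 0 < c) {f : HornSpace n → ℝ}
    (hf : Integrable f (wm n β c)) (hf0 : ContinuousAt f 0) :
    Tendsto (fun τ => ∫ x, kern n β τ x * f x ∂(wm n β 0)) (𝓝[>] 0) (𝓝 (f 0)) := by
  have hfin := isFiniteMeasure_wm (n := n) (β := β) hc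
  have hZ := kernMass_pos (n := n) (β := β)
  have hpos : ∀ᶠ τ : ℝ in 𝓝[>] 0, 0 < τ := self_mem_nhdsWithin
  -- relative to the weight `e^{-c r²}` the kernel still concentrates at the tip
  set φ : ℝ → HornSpace n → ℝ := fun τ x => Real.exp (c * ‖x‖ ^ 2) * kern n β τ x
  have hφ : ∀ (τ : ℝ) (h : HornSpace n → ℝ),
      ∫ x, φ τ x • h x ∂(wm n β c) = ∫ x, kern n β τ x * h x ∂(wm n β 0) := by
    intro τ h
    have h1 := integral_wm_add (n := n) (β := β) 0 c fun x => φ τ x • h x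
    rw [zero_add] at h1
    rw [h1]
    refine integral_congr_ae (ae_of_all _ fun x => ?_)
    simp only [φ, smul_eq_mul]
    rw [← mul_assoc, ← mul_assoc, ← Real.exp_add]
    simp
  have key := tendsto_integral_peak_smul_of_integrable_of_tendsto (μ := wm n β c) (g := f)
    (l := 𝓝[>] (0 : ℝ)) (x₀ := 0) (φ := φ) (a := f 0) MeasurableSet.univ univ_mem
    (measure_ne_top _ _) (hpos.mono fun τ hτ x => mul_nonneg (Real.exp_pos _).le
      (kern_nonneg hτ.le x)) ?_ ?_ (Eventually.of_forall fun τ => ?_) hf hf0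
  · exact key.congr fun τ => hφ τ f
  · intro u hu h0
    obtain ⟨ρ, hρ, hball⟩ := Metric.isOpen_iff.mp hu 0 h0
    rw [Metric.tendstoUniformlyOn_iff]
    intro e he
    have hlim : Tendsto (fun τ : ℝ => (kernMass n β)⁻¹ *
        ((1 / τ) ^ (hdim n β / 2) * Real.exp (-(ρ ^ 2 / 8) * (1 / τ)))) (𝓝[>] 0) (𝓝 0) := by
      have h1 := ((tendsto_rpow_mul_exp_neg_mul_atTop_nhds_zero (hdim n β / 2) (ρ ^ 2 / 8)
        (by positivity)).comp tendsto_inv_nhdsGT_zero).const_mul (kernMass n β)⁻¹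
      simpa [Function.comp_def] using h1
    filter_upwards [hpos, hlim.eventually (gt_mem_nhds he),
      (tendsto_inv_nhdsGT_zero (𝕜 := ℝ)).eventually (eventually_ge_atTop (8 * c))] with τ hτ h1 h2 x hx
    have hxρ : ρ ≤ ‖x‖ := by
      by_contra hlt
      exact hx (hball (by simpa using not_le.mp hlt))
    rw [Pi.zero_apply, dist_zero_left, Real.norm_of_nonneg (mul_nonneg (Real.exp_pos _).le
      (kern_nonneg hτ.le x))]
    refine lt_of_le_of_lt ?_ h1
    have h3 : c * ‖x‖ ^ 2 + -‖x‖ ^ 2 / (4 * τ) ≤ -(ρ ^ 2 / 8) * (1 / τ) := by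
      have e1 : -‖x‖ ^ 2 / (4 * τ) = -(‖x‖ ^ 2 / 4 * τ⁻¹) := by field_simp
      rw [e1, one_div]
      have e2 : ρ ^ 2 ≤ ‖x‖ ^ 2 := by gcongr
      have e3 := mul_le_mul_of_nonneg_right h2 (by positivity : 0 ≤ ‖x‖ ^ 2 / 8)
      have e4 := mul_le_mul_of_nonneg_right e2 (by positivity : 0 ≤ τ⁻¹ / 8)
      nlinarith
    simp only [kern]
    calc Real.exp (c * ‖x‖ ^ 2) * ((kernMass n β)⁻¹ * τ ^ (-hdim n β / 2) *
          Real.exp (-‖x‖ ^ 2 / (4 * τ)))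
        = (kernMass n β)⁻¹ * (τ ^ (-hdim n β / 2) *
          Real.exp (c * ‖x‖ ^ 2 + -‖x‖ ^ 2 / (4 * τ))) := by rw [Real.exp_add]; ring
      _ ≤ (kernMass n β)⁻¹ * (τ ^ (-hdim n β / 2) * Real.exp (-(ρ ^ 2 / 8) * (1 / τ))) := by
          gcongr
      _ = _ := by
          rw [neg_div, Real.rpow_neg hτ.le, one_div, Real.inv_rpow hτ.le]
  · simp only [Measure.restrict_univ]
    refine tendsto_const_nhds.congr' (hpos.mono fun τ hτ => ?_)
    have h1 := hφ τ fun _ => 1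
    simp only [smul_eq_mul, mul_one] at h1
    exact (h1.trans (integral_kern hτ)).symm
  · have : Continuous (φ τ) := by unfold φ kern; fun_prop
    exact this.aestronglyMeasurable

end

/-! ### The kernel is a heat flow -/

section

variable {n : ℕ} {β : ℝ} [hn : Fact (2 ≤ n)] [hβ : Fact (0 < β)]

/-- Integration by parts against a test function supported where `u` is smooth. -/
theorem integral_mul_fderiv_of_hasFDerivAt {E : Type*} [NormedAddCommGroup E] [NormedSpace ℝ E]
    [MeasurableSpace E] [BorelSpace E] [FiniteDimensional ℝ E] {μ : Measure E} [μ.IsAddHaarMeasure]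
    {u : E → ℝ} {L : E → E →L[ℝ] ℝ} {Ω : Set E} (hΩ : IsOpen Ω)
    (hu : ∀ z ∈ Ω, HasFDerivAt u (L z) z) {v : E} (hL : ContinuousOn (fun z => L z v) Ω)
    {φ : E → ℝ} (hφ : ContDiff ℝ ∞ φ) (hc : HasCompactSupport φ) (hs : tsupport φ ⊆ Ω) :
    ∫ z, u z * fderiv ℝ φ z v ∂μ = -∫ z, L z v * φ z ∂μ := by
  have hcu : ContinuousOn u Ω := fun z hz => (hu z hz).continuousAt.continuousWithinAt
  have hd : Continuous fun z => fderiv ℝ φ z v :=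
    (hφ.continuous_fderiv (by simp)).clm_apply continuous_const
  have hds : tsupport (fun z => fderiv ℝ φ z v) ⊆ tsupport φ :=
    closure_minimal (fun z hz => by
      by_contra h0
      have h1 : fderiv ℝ φ z = 0 :=
        image_eq_zero_of_notMem_tsupport fun h => h0 (tsupport_fderiv_subset ℝ (f := φ) h)
      exact hz (by simp [h1])) (isClosed_tsupport φ)
  have hdc : HasCompactSupport fun z => fderiv ℝ φ z v := hc.of_isClosed_subset
    (isClosed_tsupport _) hds
  have hint : ∀ {p q : E → ℝ}, ContinuousOn p Ω → Continuous q → HasCompactSupport q →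
      tsupport q ⊆ Ω → Integrable (fun z => p z * q z) μ := by
    intro p q hp hq hqc hqs
    have hsub : tsupport (fun z => p z * q z) ⊆ tsupport q :=
      closure_mono fun z hz h0 => hz (by simp [h0])
    exact (ContinuousOn.continuous_of_tsupport_subset (hp.mul hq.continuousOn) hΩ
      (hsub.trans hqs)).integrable_of_hasCompactSupport
      (hqc.of_isClosed_subset (isClosed_tsupport _) hsub)
  have e : ∀ z, fderiv ℝ u z v * φ z = L z v * φ z := by
    intro z
    by_cases hz : z ∈ tsupport φ
    · rw [(hu z (hs hz)).fderiv]
    · rw [image_eq_zero_of_notMem_tsupport hz, mul_zero, mul_zero]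
  rw [← integral_congr_ae (ae_of_all μ e)]
  refine integral_mul_fderiv_eq_neg_fderiv_mul_of_integrable ?_ (hint hcu hd hdc (hds.trans hs))
    (hint hcu hφ.continuous hc hs) (fun z hz => (hu z (hs hz)).differentiableAt)
    (fun z _ => hφ.differentiable (by simp) z)
  simp_rw [e]
  exact hint hL hφ.continuous hc hs

variable (n β) in
/-- The Cartesian gradient of the kernel. -/
def kernGrad (τ : ℝ) (x : HornSpace n) : HornSpace n := (-(kern n β τ x / (2 * τ))) • x

variable (n β) in
/-- The time derivative of the kernel. -/
def kernDeriv (τ : ℝ) (x : HornSpace n) : ℝ :=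
  kern n β τ x * (‖x‖ ^ 2 / (4 * τ ^ 2) - hdim n β / (2 * τ))

variable (n β) in
/-- The derivative of the kernel in space-time. -/
def kernFDeriv (s : ℝ) (z : ℝ × HornSpace n) : ℝ × HornSpace n →L[ℝ] ℝ :=
  kernDeriv n β (s + z.1) z.2 • ContinuousLinearMap.fst ℝ ℝ (HornSpace n) +
    (innerSL ℝ (kernGrad n β (s + z.1) z.2)).comp (ContinuousLinearMap.snd ℝ ℝ (HornSpace n))

theorem hasFDerivAt_kern {s : ℝ} {z : ℝ × HornSpace n} (hz : 0 < s + z.1) :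
    HasFDerivAt (fun z : ℝ × HornSpace n => kern n β (s + z.1) z.2) (kernFDeriv n β s z) z := by
  have hs : HasFDerivAt (fun z : ℝ × HornSpace n => s + z.1)
      (ContinuousLinearMap.fst ℝ ℝ (HornSpace n)) z := hasFDerivAt_fst.const_add s
  have h4 : 4 * (s + z.1) ≠ 0 := by positivity
  have hA := ((Real.hasDerivAt_rpow_const (p := -hdim n β / 2) (Or.inl hz.ne')).comp_hasFDerivAt z
    hs).const_mul (kernMass n β)⁻¹
  have hB := ((hasDerivAt_inv hz.ne').comp_hasFDerivAt z hs)
  have hq := (((hasFDerivAt_snd (𝕜 := ℝ) (p := z)).norm_sq).mul hB).const_mul (-(1 / 4))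
  have h := hA.mul hq.exp
  have hfac : ∀ r τ : ℝ, -r / (4 * τ) = -(1 / 4) * (r * τ⁻¹) := fun r τ => by
    rw [neg_div, div_eq_mul_inv, mul_inv]; ring
  have e : (fun z : ℝ × HornSpace n => kern n β (s + z.1) z.2) = fun z : ℝ × HornSpace n =>
      ((kernMass n β)⁻¹ * ((fun τ : ℝ => τ ^ (-hdim n β / 2)) ∘ fun z : ℝ × HornSpace n => s + z.1) z) *
      Real.exp (-(1 / 4) * (‖z.2‖ ^ 2 * (Inv.inv ∘ fun z : ℝ × HornSpace n => s + z.1) z)) := by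
    ext z
    simp only [kern, Function.comp]
    rw [hfac]
  rw [e]
  refine h.congr_fderiv ?_
  refine ContinuousLinearMap.ext fun p => ?_
  have hexp : Real.exp (-(1 / 4) * (‖z.2‖ ^ 2 * (s + z.1)⁻¹)) =
      Real.exp (-‖z.2‖ ^ 2 / (4 * (s + z.1))) := by
    rw [hfac]
  simp only [Function.comp, Pi.mul_apply, hexp, kernFDeriv, kernGrad, kernDeriv, kern, add_apply,
    smul_apply, ContinuousLinearMap.comp_apply, innerSL_apply_apply, ContinuousLinearMap.coe_fst',
    ContinuousLinearMap.coe_snd', smul_eq_mul, inner_smul_left, RCLike.conj_to_real,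
    Real.rpow_sub_one hz.ne', nsmul_eq_mul]
  field_simp
  ring

theorem isOpen_timeDomain (s : ℝ) : IsOpen {z : ℝ × HornSpace n | 0 < s + z.1} :=
  isOpen_lt continuous_const (by fun_prop)

theorem continuousOn_kern (s : ℝ) : ContinuousOn
    (fun z : ℝ × HornSpace n => kern n β (s + z.1) z.2) {z | 0 < s + z.1} := fun _ hz =>
  (hasFDerivAt_kern hz).continuousAt.continuousWithinAt

theorem continuousOn_kernGrad (s : ℝ) : ContinuousOn
    (fun z : ℝ × HornSpace n => kernGrad n β (s + z.1) z.2) {z | 0 < s + z.1} := by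
  have h : ContinuousOn (fun z : ℝ × HornSpace n => 2 * (s + z.1)) {z | 0 < s + z.1} := by fun_prop
  exact ((continuousOn_kern s).div h fun z hz => by
    have : 0 < s + z.1 := hz
    positivity).neg.smul continuousOn_snd

theorem continuousOn_kernDeriv (s : ℝ) : ContinuousOn
    (fun z : ℝ × HornSpace n => kernDeriv n β (s + z.1) z.2) {z | 0 < s + z.1} := by
  have h0 : ∀ z ∈ {z : ℝ × HornSpace n | 0 < s + z.1}, 2 * (s + z.1) ≠ 0 := fun z hz => by
    have : 0 < s + z.1 := hz
    positivity
  have h1 : ∀ z ∈ {z : ℝ × HornSpace n | 0 < s + z.1}, 4 * (s + z.1) ^ 2 ≠ 0 := fun z hz => by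
    have : 0 < s + z.1 := hz
    positivity
  have h2 : ContinuousOn (fun z : ℝ × HornSpace n => ‖z.2‖ ^ 2 / (4 * (s + z.1) ^ 2) -
      hdim n β / (2 * (s + z.1))) {z | 0 < s + z.1} := by
    fun_prop (disch := assumption)
  exact (continuousOn_kern s).mul h2

theorem hornInner_smul_left (ε c : ℝ) (x W : HornSpace n) :
    hornInner ε x (c • x) W = c * inner ℝ x W := by
  rcases eq_or_ne x 0 with rfl | hx
  · simp [hornInner, radialPart]
  · rw [← inner_frame_frame ε hx, map_smul, frame_self, inner_smul_left, inner_self_frame]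
    simp

theorem inner_kernGrad (ε τ : ℝ) (x W : HornSpace n) : hornInner ε x (kernGrad n β τ x) W =
    -(kern n β τ x / (2 * τ)) * inner ℝ x W := hornInner_smul_left _ _ _ _

/-- A slice in time of a test function. -/
theorem isTest_slice {φ : ℝ × HornSpace n → ℝ} {I : Set ℝ} (hφ : ContDiff ℝ ∞ φ)
    (hc : HasCompactSupport φ) (hs : tsupport φ ⊆ I ×ˢ {0}ᶜ) (t : ℝ) :
    IsTest fun x => φ (t, x) where
  smooth := hφ.comp (contDiff_const.prodMk contDiff_id)
  compact := by
    refine HasCompactSupport.intro (hc.image continuous_snd) fun x hx => ?_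
    by_contra h0
    exact hx ⟨(t, x), subset_tsupport φ h0, rfl⟩
  supp := by
    have h1 : tsupport (fun x => φ (t, x)) ⊆ (fun x => (t, x)) ⁻¹' tsupport φ :=
      closure_minimal (fun x hx => subset_tsupport φ hx)
        ((isClosed_tsupport φ).preimage (by fun_prop))
    exact fun x hx => (hs (h1 hx)).2

theorem fderiv_slice {φ : ℝ × HornSpace n → ℝ} (hφ : ContDiff ℝ ∞ φ) (t : ℝ) (x v : HornSpace n) :
    fderiv ℝ (fun x => φ (t, x)) x v = fderiv ℝ φ (t, x) (0, v) := by
  have h1 := (hφ.differentiable (by simp) (t, x)).hasFDerivAt.comp x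
    ((hasFDerivAt_const t x).prodMk (hasFDerivAt_id x))
  have h2 : fderiv ℝ (fun x => φ (t, x)) x = _ := h1.fderiv
  rw [h2]
  simp

/-- The weak heat equation for the kernel, at a fixed time. -/
theorem integral_kern_slice {ψ : HornSpace n → ℝ} (hψ : IsTest ψ) {τ : ℝ} (hτ : 0 < τ) :
    ∫ x, (-(kern n β τ x / (2 * τ)) * fderiv ℝ ψ x x + ψ x * kernDeriv n β τ x) ∂(wm n β 0) = 0 := by
  have e : ∀ x, -(kern n β τ x / (2 * τ)) * fderiv ℝ ψ x x + ψ x * kernDeriv n β τ x =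
      kern n β τ x * (-(1 / (2 * τ)) * (fderiv ℝ ψ x x +
        ψ x * (hdim n β - 2 * (1 / (4 * τ)) * ‖x‖ ^ 2))) := by
    intro x
    simp only [kernDeriv]
    field_simp
    ring
  simp_rw [e]
  rw [integral_kern_mul, integral_const_mul]
  have h1 : Continuous fun x => fderiv ℝ ψ x x := by
    have := hψ.smooth.continuous_fderiv (by simp); fun_prop
  have h2 : HasCompactSupport fun x => fderiv ℝ ψ x x :=
    (hψ.compact.fderiv ℝ).mono fun x hx h0 => hx (by simp [h0])
  have h3 := hψ.smooth.continuous
  rw [integral_add (h1.integrable_of_hasCompactSupport h2)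
    ((by fun_prop : Continuous fun x => ψ x * (hdim n β - 2 * (1 / (4 * τ)) * ‖x‖ ^ 2))
      |>.integrable_of_hasCompactSupport hψ.compact.mul_right), hψ.integral_fderiv_self]
  simp

theorem eLpNorm_kern_sub {τ σ : ℝ} (hτ : 0 < τ) (hσ : 0 < σ) :
    eLpNorm (fun x => kern n β τ x - kern n β σ x) 2 (wm n β 0) =
      edist (kernLp n β τ) (kernLp n β σ) := by
  rw [kernLp, kernLp, dif_pos hτ, dif_pos hσ, Lp.edist_toLp_toLp]
  rfl

theorem tendsto_eLpNorm_kern {s t : ℝ} (ht : 0 < s + t) :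
    Tendsto (fun r => eLpNorm (fun x => kern n β (s + r) x - kern n β (s + t) x) 2 (wm n β 0))
      (𝓝 t) (𝓝 0) := by
  have h1 : ContinuousAt (fun r => kernLp n β (s + r)) t :=
    ContinuousAt.comp (f := fun r => s + r) (continuousAt_kernLp ht) (by fun_prop)
  have h2 := tendsto_iff_edist_tendsto_0.mp h1
  refine h2.congr' ?_
  have h3 : ∀ᶠ r in 𝓝 t, 0 < s + r :=
    (by fun_prop : ContinuousAt (fun r => s + r) t).eventually (lt_mem_nhds ht)
  filter_upwards [h3] with r hr
  exact (eLpNorm_kern_sub hr ht).symm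

theorem continuous_kern (τ : ℝ) : Continuous (kern n β τ) := by
  unfold kern
  fun_prop

variable {N ε η : ℝ}

/-- For times between two positive bounds the energy density of the kernel is dominated by a fixed
Gaussian. -/
theorem integrableOn_energy_kern (hm : hornMeasure n N ε η = wm n β 0) {s t₀ t₁ : ℝ}
    (hs : 0 < s + t₀) (ht : t₀ < t₁) : IntegrableOn (fun z : ℝ × HornSpace n =>
      kern n β (s + z.1) z.2 ^ 2 + hornInner ε z.2 (kernGrad n β (s + z.1) z.2)
        (kernGrad n β (s + z.1) z.2) + kernDeriv n β (s + z.1) z.2 ^ 2)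
      (Ioo t₀ t₁ ×ˢ univ) (hornSpaceTime n N ε η) := by
  set α := s + t₀
  set A := s + t₁
  have hA : 0 < A := by simp only [A]; linarith
  have hd : 0 ≤ hdim n β := by
    have := hβ.out
    unfold hdim
    positivity
  have hZ := kernMass_pos (n := n) (β := β)
  set C := (kernMass n β)⁻¹ * α ^ (-hdim n β / 2)
  set c := 1 / (4 * A)
  have hc : 0 < c := by positivity
  set bound : HornSpace n → ℝ := fun x => C ^ 2 * ((1 + 2 * (hdim n β / (2 * α)) ^ 2) *
    gauss 0 (2 * c) x + 1 / (2 * α) ^ 2 * gauss 1 (2 * c) x + 2 * (1 / (4 * α ^ 2)) ^ 2 *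
      gauss 2 (2 * c) x)
  have hb : Integrable bound (wm n β 0) :=
    ((((integrable_gauss 0 (by positivity)).const_mul _).add
      ((integrable_gauss 1 (by positivity)).const_mul _)).add
      ((integrable_gauss 2 (by positivity)).const_mul _)).const_mul _
  have hbz : Integrable (fun z : ℝ × HornSpace n => (1 : ℝ) * bound z.2)
      ((volume.restrict (Ioo t₀ t₁)).prod (wm n β 0)) := Integrable.mul_prod (f := fun _ => (1 : ℝ))
        (integrable_const _) hb
  have hmeas : (hornSpaceTime n N ε η).restrict (Ioo t₀ t₁ ×ˢ univ) =
      (volume.restrict (Ioo t₀ t₁)).prod (wm n β 0) := by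
    rw [hornSpaceTime, hm, ← Measure.prod_restrict, Measure.restrict_univ]
  have hdom : ∀ z ∈ Ioo t₀ t₁ ×ˢ (univ : Set (HornSpace n)), 0 < s + z.1 := fun z hz => by
    have := hz.1.1
    simp only [α] at hs
    linarith
  have hform : ∀ z : ℝ × HornSpace n, hornInner ε z.2 (kernGrad n β (s + z.1) z.2)
      (kernGrad n β (s + z.1) z.2) = (kern n β (s + z.1) z.2 / (2 * (s + z.1))) ^ 2 * ‖z.2‖ ^ 2 := by
    intro z
    rw [inner_kernGrad, kernGrad, inner_smul_right, real_inner_self_eq_norm_sq]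
    ring
  simp_rw [hform]
  have hcont : ContinuousOn (fun z : ℝ × HornSpace n => kern n β (s + z.1) z.2 ^ 2 +
      (kern n β (s + z.1) z.2 / (2 * (s + z.1))) ^ 2 * ‖z.2‖ ^ 2 +
      kernDeriv n β (s + z.1) z.2 ^ 2) (Ioo t₀ t₁ ×ˢ univ) := by
    have h1 := (continuousOn_kern (n := n) (β := β) s).mono hdom
    have h2 := (continuousOn_kernDeriv (n := n) (β := β) s).mono hdom
    have h3 : ∀ z ∈ Ioo t₀ t₁ ×ˢ (univ : Set (HornSpace n)), 2 * (s + z.1) ≠ 0 := fun z hz => by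
      have := hdom z hz
      positivity
    fun_prop (disch := assumption)
  have hO : MeasurableSet (Ioo t₀ t₁ ×ˢ (univ : Set (HornSpace n))) :=
    measurableSet_Ioo.prod MeasurableSet.univ
  unfold IntegrableOn
  refine Integrable.mono' (hmeas ▸ hbz) (hcont.aestronglyMeasurable hO) ?_
  refine (ae_restrict_iff' hO).mpr (ae_of_all _ fun z hz => ?_)
  have hτ := hdom z hz
  have hατ : α ≤ s + z.1 := by simp only [α]; linarith [hz.1.1]
  have hτA : s + z.1 ≤ A := by simp only [A]; linarith [hz.1.2]
  set τ := s + z.1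
  have hk0 := kern_nonneg (n := n) (β := β) hτ.le z.2
  have hk : kern n β τ z.2 ≤ C * gauss 0 c z.2 := by
    rw [kern, exp_eq_gauss hτ, gauss_of_pos 0 (by positivity), gauss_of_pos 0 hc]
    have h1 : τ ^ (-hdim n β / 2) ≤ α ^ (-hdim n β / 2) :=
      Real.rpow_le_rpow_of_nonpos hs hατ (by linarith)
    simp only [C, c]
    gcongr
  have hk2 : kern n β τ z.2 ^ 2 ≤ C ^ 2 * gauss 0 (2 * c) z.2 := by
    rw [← gauss_zero_sq hc, ← mul_pow]
    gcongr
  have hw : (‖z.2‖ ^ 2 / (4 * τ ^ 2) - hdim n β / (2 * τ)) ^ 2 ≤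
      2 * (1 / (4 * α ^ 2)) ^ 2 * (‖z.2‖ ^ 2) ^ 2 + 2 * (hdim n β / (2 * α)) ^ 2 := by
    have h1 : ‖z.2‖ ^ 2 / (4 * τ ^ 2) ≤ 1 / (4 * α ^ 2) * ‖z.2‖ ^ 2 := by
      rw [one_div, ← div_eq_inv_mul]
      gcongr
    have h2 : hdim n β / (2 * τ) ≤ hdim n β / (2 * α) := by gcongr
    have h3 : 0 ≤ ‖z.2‖ ^ 2 / (4 * τ ^ 2) := by positivity
    have h4 : 0 ≤ hdim n β / (2 * τ) := by positivity
    have h5 := pow_le_pow_left₀ h3 h1 2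
    have h6 := pow_le_pow_left₀ h4 h2 2
    nlinarith [sq_nonneg (‖z.2‖ ^ 2 / (4 * τ ^ 2) + hdim n β / (2 * τ))]
  have hv : (1 / (2 * τ)) ^ 2 ≤ 1 / (2 * α) ^ 2 := by
    rw [one_div_pow]
    gcongr
  rw [one_mul, Real.norm_of_nonneg (by positivity)]
  have h2c : 0 < 2 * c := by positivity
  have hg1 : gauss 1 (2 * c) z.2 = ‖z.2‖ ^ 2 * gauss 0 (2 * c) z.2 := by
    simp [gauss_of_pos _ h2c]
  have hg2 : gauss 2 (2 * c) z.2 = (‖z.2‖ ^ 2) ^ 2 * gauss 0 (2 * c) z.2 := by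
    simp [gauss_of_pos _ h2c]
  have hg0 : 0 ≤ gauss 0 (2 * c) z.2 := by
    rw [gauss_of_pos _ h2c]
    positivity
  simp only [bound, hg1, hg2, kernDeriv]
  calc kern n β τ z.2 ^ 2 + (kern n β τ z.2 / (2 * τ)) ^ 2 * ‖z.2‖ ^ 2 +
        (kern n β τ z.2 * (‖z.2‖ ^ 2 / (4 * τ ^ 2) - hdim n β / (2 * τ))) ^ 2
      = kern n β τ z.2 ^ 2 * (1 + (1 / (2 * τ)) ^ 2 * ‖z.2‖ ^ 2 +
        (‖z.2‖ ^ 2 / (4 * τ ^ 2) - hdim n β / (2 * τ)) ^ 2) := by ring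
    _ ≤ (C ^ 2 * gauss 0 (2 * c) z.2) * (1 + 1 / (2 * α) ^ 2 * ‖z.2‖ ^ 2 +
        (2 * (1 / (4 * α ^ 2)) ^ 2 * (‖z.2‖ ^ 2) ^ 2 + 2 * (hdim n β / (2 * α)) ^ 2)) := by
        gcongr
    _ = _ := by ring

/-- The kernel is a weak solution of the heat equation. -/
theorem isHornSolution_kern (hm : hornMeasure n N ε η = wm n β 0) {s t₀ t₁ : ℝ}
    (hs : 0 < s + t₀) (ht : t₀ < t₁) :
    IsHornSolution n N ε η t₀ t₁ (fun t => kern n β (s + t)) (fun t => kernGrad n β (s + t))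
      (fun t => kernDeriv n β (s + t)) := by
  have hsub : Ioo t₀ t₁ ×ˢ ({0}ᶜ : Set (HornSpace n)) ⊆ {z | 0 < s + z.1} := fun z hz => by
    have := hz.1.1
    rw [mem_ofPred_eq]
    linarith
  have hmeas : MeasurableSet (Ioo t₀ t₁ ×ˢ ({0}ᶜ : Set (HornSpace n))) :=
    measurableSet_Ioo.prod (measurableSet_singleton 0).compl
  have hHaar : (volume : Measure (ℝ × HornSpace n)).IsAddHaarMeasure := by
    rw [Measure.volume_eq_prod]
    infer_instance
  refine ⟨((continuousOn_kern s).mono hsub).locallyIntegrableOn hmeas,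
    ((continuousOn_kernGrad s).mono hsub).locallyIntegrableOn hmeas,
    ((continuousOn_kernDeriv s).mono hsub).locallyIntegrableOn hmeas,
    fun φ hφ hc hφs v => ?_, fun φ hφ hc hφs => ?_, fun ρ => ?_, fun φ hφ hc hφs => ?_,
    fun t _ => (continuous_kern _).aestronglyMeasurable, fun t htI ρ => ?_⟩
  · have h := integral_mul_fderiv_of_hasFDerivAt (μ := (volume : Measure (ℝ × HornSpace n)))
      (isOpen_timeDomain s) (fun z hz => hasFDerivAt_kern (n := n) (β := β) hz) (v := (0, v))
      (((continuousOn_kernGrad (n := n) (β := β) s).inner continuousOn_const).congr fun z hz => by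
        simp [kernFDeriv]; rfl) hφ hc (hφs.trans hsub)
    rw [h]
    congr 1
    refine integral_congr_ae (ae_of_all _ fun z => ?_)
    simp [kernFDeriv]
  · have h := integral_mul_fderiv_of_hasFDerivAt (μ := (volume : Measure (ℝ × HornSpace n)))
      (isOpen_timeDomain s) (fun z hz => hasFDerivAt_kern (n := n) (β := β) hz) (v := (1, 0))
      ((continuousOn_kernDeriv (n := n) (β := β) s).congr fun z hz => by simp [kernFDeriv]) hφ hc (hφs.trans hsub)
    rw [h]
    congr 1
    refine integral_congr_ae (ae_of_all _ fun z => ?_)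
    simp [kernFDeriv]
  · exact (integrableOn_energy_kern hm hs ht).mono_set (prod_mono_right (subset_univ _))
  · set Φ : ℝ × HornSpace n → ℝ := fun z => -(kern n β (s + z.1) z.2 / (2 * (s + z.1))) *
      fderiv ℝ (fun y => φ (z.1, y)) z.2 z.2 + φ z * kernDeriv n β (s + z.1) z.2
    have e : ∀ z : ℝ × HornSpace n, hornInner ε z.2 (kernGrad n β (s + z.1) z.2)
        (gradient (fun y => φ (z.1, y)) z.2) + φ z * kernDeriv n β (s + z.1) z.2 = Φ z := by
      intro z
      rw [inner_kernGrad, real_inner_comm, inner_gradient_apply]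
    have hzero : ∀ z ∉ tsupport φ, Φ z = 0 := by
      intro z hz
      have h1 : fderiv ℝ φ z = 0 :=
        image_eq_zero_of_notMem_tsupport fun h => hz (tsupport_fderiv_subset ℝ (f := φ) h)
      simp only [Φ]
      rw [fderiv_slice hφ, image_eq_zero_of_notMem_tsupport hz, Prod.mk.eta, h1]
      simp
    have hsupp : tsupport Φ ⊆ tsupport φ := closure_minimal (fun z hz => by
      by_contra h0
      exact hz (hzero z h0)) (isClosed_tsupport φ)
    have hcont : Continuous Φ := by
      refine ContinuousOn.continuous_of_tsupport_subset ?_ (isOpen_timeDomain s)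
        (hsupp.trans (hφs.trans hsub))
      have h1 := continuousOn_kern (n := n) (β := β) s
      have h2 := continuousOn_kernDeriv (n := n) (β := β) s
      have h3 : ∀ z ∈ {z : ℝ × HornSpace n | 0 < s + z.1}, 2 * (s + z.1) ≠ 0 := fun z hz => by
        have : 0 < s + z.1 := hz
        positivity
      have h4 : Continuous fun z : ℝ × HornSpace n => fderiv ℝ φ z (0, z.2) :=
        (hφ.continuous_fderiv (by simp)).clm_apply (by fun_prop)
      have h5 := hφ.continuous
      simp only [Φ, fderiv_slice hφ, Prod.mk.eta]
      exact ((h1.div (by fun_prop) h3).neg.mul h4.continuousOn).add (h5.continuousOn.mul h2)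
    have hint : Integrable Φ (volume.prod (wm n β 0)) :=
      hcont.integrable_of_hasCompactSupport (hc.of_isClosed_subset (isClosed_tsupport _) hsupp)
    simp_rw [e]
    rw [hornSpaceTime, hm, integral_prod _ hint]
    refine integral_eq_zero_of_ae (ae_of_all _ fun t => ?_)
    rw [Pi.zero_apply]
    by_cases htI : t ∈ Ioo t₀ t₁
    · exact integral_kern_slice (τ := s + t) (isTest_slice hφ hc hφs t) (by have := htI.1; linarith)
    · refine integral_eq_zero_of_ae (ae_of_all _ fun x => hzero _ fun h => htI (hφs h).1)
  · refine tendsto_of_tendsto_of_tendsto_of_le_of_le tendsto_const_nhds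
      ((tendsto_eLpNorm_kern (n := n) (β := β) (s := s) (t := t) (by linarith [htI.1])).mono_left
        nhdsWithin_le_nhds) (fun _ => bot_le) fun r => ?_
    rw [hm]
    exact eLpNorm_mono_measure _ Measure.restrict_le_self

theorem isHornHeatFlow_kern (hm : hornMeasure n N ε η = wm n β 0) {s : ℝ} (hs : 0 < s) :
    IsHornHeatFlow n N ε η (fun t => kern n β (s + t)) (fun t => kernGrad n β (s + t))
      (fun t => kernDeriv n β (s + t)) where
  memLp t ht := hm ▸ memLp_kern (by positivity)
  solution r T hr hrT := isHornSolution_kern hm (by positivity) hrT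
  energy r T hr hrT := integrableOn_energy_kern hm (by positivity) hrT
  initial := by
    rw [hm]
    exact (tendsto_eLpNorm_kern (by simpa using hs)).mono_left nhdsWithin_le_nhds

end

/-! ### The reproducing property -/

section

variable {n : ℕ} {β : ℝ} [hn : Fact (2 ≤ n)] [hβ : Fact (0 < β)] {N ε η : ℝ}
  {v : ℝ → HornSpace n → ℝ} {V : ℝ → HornSpace n → HornSpace n} {w : ℝ → HornSpace n → ℝ}

theorem inner_kernLp {τ : ℝ} (hτ : 0 < τ) {h : HFun n β 0} {h' : HornSpace n → ℝ}
    (hh : h =ᵐ[volume] h') : inner ℝ (kernLp n β τ) h = ∫ x, kern n β τ x * h' x ∂(wm n β 0) := by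
  rw [inner_eq_integral (coeFn_kernLp hτ) hh]
  simp [mul_comm]

/-- Integrals of a heat flow against the backward kernel are constant in time. -/
theorem integral_kern_mul_eq (hm : hornMeasure n N ε η = wm n β 0)
    (hv : IsHornHeatFlow n N ε η v V w) {s t δ : ℝ} (hs : 0 < s) (hst : s < t) (hδ : 0 < δ) :
    ∫ x, kern n β (δ + t - s) x * v s x ∂(wm n β 0) = ∫ x, kern n β δ x * v t x ∂(wm n β 0) := by
  set θ := δ + t
  set b := gaussCoeff θ 0 / 2
  have hθ : 0 < θ := by simp only [θ]; linarith
  have hb0 : 0 < b := half_pos (gaussCoeff_pos hθ)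
  have hb : b < gaussCoeff θ 0 := half_lt_self (gaussCoeff_pos hθ)
  set T := t + δ / 2
  have hsT : s < T := by simp only [T]; linarith
  obtain ⟨f, F, g, hf, hfv⟩ := exists_isRegSol (a := 0) (b := b) hm (hv.solution s T hs hsT) hsT
    (by simpa using hv.energy s T hs hsT) hb0 hb0
  obtain ⟨e, he, heG⟩ := exists_one_mem_Gam (n := n) (β := β) ε hb0
  set m : ℝ → ℝ := fun r => (θ - r) ^ (-hdim n β / 2) *
    inner ℝ (f r) (gaussOp ℝ β b 0 (gaussCoeff θ r - b) e)
  have hθr : ∀ r ∈ Icc s t, r < θ := fun r hr => by simp only [θ]; linarith [hr.2]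
  have hbr : ∀ r ∈ Icc s t, b < gaussCoeff θ r := fun r hr =>
    lt_gaussCoeff hb (hs.le.trans hr.1) (hθr r hr)
  have hm1 : ∀ r ∈ Icc s t, (kernMass n β)⁻¹ * m r =
      ∫ x, kern n β (θ - r) x * v r x ∂(wm n β 0) := by
    intro r hr
    rw [integral_kern_mul, ← mul_assoc]
    congr 1
    rw [inner_gaussOp 0 (sub_pos.mpr (hbr r hr)), add_sub_cancel]
    refine integral_congr_ae (ae_eq_wm.mpr ?_)
    filter_upwards [he, hfv r ⟨hr.1, hr.2.trans (by simp only [T]; linarith)⟩] with x h1 h2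
    simp [h1, h2]
  have hρ : ∀ r < θ, HasDerivAt (fun r => (θ - r) ^ (-hdim n β / 2))
      (2 * hdim n β * gaussCoeff θ r * (θ - r) ^ (-hdim n β / 2)) r := fun r hr =>
    hasDerivAt_rpow_sub hr
  have hcont : ContinuousOn m (Icc s t) := fun r hr => by
    refine ((hρ r (hθr r hr)).continuousAt.mul ?_).continuousWithinAt
    exact hf.cont.continuousAt.inner ((hasDerivAt_gaussOp_gaussCoeff ℝ 0 (hθr r hr)
      (hbr r hr)).continuousAt.clm_apply continuousAt_const)
  have hd : ∀ r ∈ Ioo s t, HasDerivAt m 0 r := fun r hr => by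
    have hr' := Ioo_subset_Icc_self hr
    refine ((hρ r (hθr r hr')).mul (hf.hasDerivAt_inner_one ⟨hr.1, hr.2.trans (by
      simp only [T]; linarith)⟩ (hθr r hr') (hbr r hr') heG)).congr_deriv ?_
    ring
  obtain ⟨c, -, hc⟩ := exists_hasDerivAt_eq_slope m (fun _ => 0) hst hcont hd
  have hmst : m t = m s := by
    have : t - s ≠ 0 := (sub_pos.mpr hst).ne'
    field_simp at hc
    linarith
  have h1 := hm1 s (left_mem_Icc.mpr hst.le)
  have h2 := hm1 t (right_mem_Icc.mpr hst.le)
  rw [show θ - t = δ by simp only [θ]; ring] at h2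
  rw [← h1, ← h2, hmst]

/-- The initial time is reached by continuity of the heat flow and of the kernel in `L²`. -/
theorem integral_kern_mul_zero (hm : hornMeasure n N ε η = wm n β 0)
    (hv : IsHornHeatFlow n N ε η v V w) {t δ : ℝ} (ht : 0 < t) (hδ : 0 < δ) :
    ∫ x, kern n β (δ + t) x * v 0 x ∂(wm n β 0) = ∫ x, kern n β δ x * v t x ∂(wm n β 0) := by
  have hmem : ∀ r, 0 ≤ r → MemLp (v r) 2 (wm n β 0) := fun r hr => hm ▸ hv.memLp r hr
  set vL : ℝ → HFun n β 0 := fun r => if h : 0 ≤ r then (hmem r h).toLp else 0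
  have hvL : ∀ r (hr : 0 ≤ r), vL r = (hmem r hr).toLp := fun r hr => dif_pos hr
  have hvLc : ∀ r, 0 ≤ r → vL r =ᵐ[volume] v r := fun r hr => by
    rw [hvL r hr]
    exact ae_eq_wm.mp (hmem r hr).coeFn_toLp
  have h1 : Tendsto vL (𝓝[>] 0) (𝓝 (vL 0)) := by
    rw [tendsto_iff_edist_tendsto_0]
    refine (hm ▸ hv.initial).congr' ?_
    filter_upwards [self_mem_nhdsWithin] with r hr
    rw [hvL r (le_of_lt hr), hvL 0 le_rfl, Lp.edist_toLp_toLp]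
    rfl
  have h2 : Tendsto (fun s => kernLp n β (δ + t - s)) (𝓝[>] 0) (𝓝 (kernLp n β (δ + t))) := by
    have h3 : ContinuousAt (kernLp n β) (δ + t - 0) := continuousAt_kernLp (by linarith)
    have h4 : ContinuousAt (fun s => kernLp n β (δ + t - s)) 0 :=
      ContinuousAt.comp (f := fun s => δ + t - s) h3 (by fun_prop)
    have h5 := h4.tendsto.mono_left (nhdsWithin_le_nhds (s := Ioi 0))
    rwa [sub_zero] at h5
  have h3 := Tendsto.inner (𝕜 := ℝ) h2 h1
  rw [inner_kernLp (by linarith) (hvLc 0 le_rfl)] at h3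
  refine tendsto_nhds_unique h3 (tendsto_const_nhds.congr' ?_)
  filter_upwards [Ioo_mem_nhdsGT ht] with s hs
  rw [inner_kernLp (by linarith [hs.2]) (hvLc s hs.1.le), integral_kern_mul_eq hm hv hs.1 hs.2 hδ]

theorem integrable_wm_of_memLp {f : HornSpace n → ℝ} (hf : MemLp f 2 (wm n β 0)) :
    Integrable f (wm n β 1) := by
  have h := isFiniteMeasure_wm (n := n) (β := β) one_pos
  have h1 : MemLp (incl ℝ zero_le_one (hf.toLp : HFun n β 0)) 2 (wm n β 1) := Lp.memLp _
  refine (h1.integrable (by norm_num)).congr (ae_eq_wm.mpr ?_)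
  exact (coeFn_incl _ _).trans (ae_eq_wm.mp hf.coeFn_toLp)

/-- The kernel is the heat kernel with pole at the tip. -/
theorem isTipHeatKernel_kern (hm : hornMeasure n N ε η = wm n β 0) :
    IsTipHeatKernel n N ε η (kern n β) where
  continuousOn := by
    refine ((continuousOn_kern (n := n) (β := β) 0).mono fun z hz => ?_).congr fun z _ => ?_
    · simpa using hz.1
    · simp
  nonneg t x ht := kern_nonneg ht.le x
  heat_flow s hs := ⟨_, _, isHornHeatFlow_kern hm hs⟩
  mass_one t ht := hm ▸ ⟨integrable_kern ht, integral_kern ht⟩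
  dirac f hf hb := by
    rw [hm]
    have h := isFiniteMeasure_wm (n := n) (β := β) one_pos
    obtain ⟨B, hB⟩ := hb
    exact tendsto_integral_kern one_pos
      (Integrable.of_bound hf.aestronglyMeasurable B (ae_of_all _ hB)) hf.continuousAt
  reproducing v V w hv t ht hc := by
    have hmem : ∀ r, 0 ≤ r → MemLp (v r) 2 (wm n β 0) := fun r hr => hm ▸ hv.memLp r hr
    have hv0 : (hmem 0 le_rfl).toLp =ᵐ[volume] v 0 := ae_eq_wm.mp (hmem 0 le_rfl).coeFn_toLp
    rw [hm]
    refine ⟨(memLp_kern ht).integrable_mul (hmem 0 le_rfl), ?_⟩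
    have h1 := tendsto_integral_kern one_pos (integrable_wm_of_memLp (hmem t ht.le)) hc
    have h2 : Tendsto (fun δ => inner ℝ (kernLp n β (δ + t)) (hmem 0 le_rfl).toLp) (𝓝[>] 0)
        (𝓝 (inner ℝ (kernLp n β t) (hmem 0 le_rfl).toLp)) := by
      have h3 : ContinuousAt (kernLp n β) (0 + t) := continuousAt_kernLp (by linarith)
      have h4 : ContinuousAt (fun δ => kernLp n β (δ + t)) 0 :=
        ContinuousAt.comp (f := fun δ => δ + t) h3 (by fun_prop)
      have h5 := h4.tendsto.mono_left (nhdsWithin_le_nhds (s := Ioi 0))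
      rw [zero_add] at h5
      exact Tendsto.inner (𝕜 := ℝ) h5 tendsto_const_nhds
    rw [inner_kernLp ht hv0] at h2
    refine tendsto_nhds_unique h1 (h2.congr' ?_)
    filter_upwards [self_mem_nhdsWithin] with δ hδ
    have hδ0 : 0 < δ := hδ
    rw [inner_kernLp (by linarith) hv0, integral_kern_mul_zero hm hv ht hδ0]

end

/-! ### The frequency function of a solution -/

section

variable {n : ℕ} {β : ℝ} [hn : Fact (2 ≤ n)] [hβ : Fact (0 < β)] {N ε η b : ℝ}

theorem tipHeatKernel_eq_kern (hm : hornMeasure n N ε η = wm n β 0)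
    (hβ' : β = ε * (n - 1) + (N - n) * (1 - η)) : tipHeatKernel n N ε η = kern n β := by
  funext t x
  rw [tipHeatKernel, kern, kernMass, hm, hdim, hβ']
  congr 3
  ring

theorem integrable_mul_kern {τ : ℝ} {f : HornSpace n → ℝ}
    (hf : Integrable f (wm n β (1 / (4 * τ)))) :
    Integrable (fun x => f x * kern n β τ x) (wm n β 0) := by
  rw [← zero_add (1 / (4 * τ)), integrable_wm_add] at hf
  refine (hf.const_mul ((kernMass n β)⁻¹ * τ ^ (-hdim n β / 2))).congr (ae_of_all _ fun x => ?_)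
  have e : -(1 / (4 * τ)) * ‖x‖ ^ 2 = -‖x‖ ^ 2 / (4 * τ) := by ring
  simp only [kern, smul_eq_mul, e]
  ring

/-- An integral against the kernel, of a function given almost everywhere by the square of an
element of a weighted `L²` space. -/
theorem integrable_and_integral_mul_kern {E : Type*} [NormedAddCommGroup E]
    [InnerProductSpace ℝ E] {τ : ℝ} (X : ℝ → Lp E 2 (wm n β b))
    (hb : b < gaussCoeff 0 (-τ)) {h : HornSpace n → ℝ}
    (hh : h =ᵐ[volume] fun x => inner ℝ (X (-τ) x) (X (-τ) x)) :
    Integrable (fun x => h x * kern n β τ x) (wm n β 0) ∧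
      ∫ x, h x * kern n β τ x ∂(wm n β 0) =
        (kernMass n β)⁻¹ * (τ ^ (-hdim n β / 2) * gaussSq b 0 X (-τ)) := by
  have e : gaussCoeff 0 (-τ) = 1 / (4 * τ) := by rw [gaussCoeff, zero_sub, neg_neg]
  constructor
  · refine integrable_mul_kern ?_
    rw [← e]
    refine (L2.integrable_inner (𝕜 := ℝ) (incl E hb.le (X (-τ)))
      (incl E hb.le (X (-τ)))).congr (ae_eq_wm.mpr ?_)
    filter_upwards [coeFn_incl hb.le (X (-τ)), hh] with x h1 h2
    rw [h1, h2]
  · rw [gaussSq_eq_integral X hb, e, ← mul_assoc, ← integral_congr_ae (ae_eq_wm.mpr hh),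
      ← integral_kern_mul]
    exact integral_congr_ae (ae_of_all _ fun x => mul_comm _ _)

theorem hornGradSq_ae_eq {p : HFun n β b × HVec n β b} (hp : p ∈ Gam n β ε b)
    {u : HornSpace n → ℝ} (hu : p.1 =ᵐ[volume] u) :
    hornGradSq ε u =ᵐ[volume] fun x => inner ℝ (p.2 x) (p.2 x) := by
  have h1 := (isHornWeakGrad_of_mem_Gam hp).congr hu
  have h2 : ∃ W, IsHornWeakGrad u W := ⟨_, h1⟩
  have h3 : IsHornWeakGrad u (hornWeakGrad u) := by
    rw [hornWeakGrad, dif_pos h2]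
    exact h2.choose_spec
  filter_upwards [h3.ae_eq h1 EventuallyEq.rfl, ae_ne_zero] with x hx hx0
  rw [hornGradSq, hx, ← inner_frame_frame ε hx0, frame_frameInv ε hx0]

/-- A solution vanishing at almost every point of almost every time slice vanishes. -/
theorem ae_eq_zero_of_slices {t₀ t₁ : ℝ} (hm : hornMeasure n N ε η = wm n β 0)
    {u : ℝ → HornSpace n → ℝ}
    (hu : LocallyIntegrableOn (fun z : ℝ × HornSpace n => u z.1 z.2) (Ioo t₀ t₁ ×ˢ {0}ᶜ))
    (h0 : ∀ t ∈ Ioo t₀ t₁, u t =ᵐ[volume] 0) :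
    ∀ᵐ z ∂((hornSpaceTime n N ε η).restrict (Ioo t₀ t₁ ×ˢ univ)), u z.1 z.2 = 0 := by
  rw [hornSpaceTime, hm, ← Measure.prod_restrict, Measure.restrict_univ]
  have h1 := aestronglyMeasurable_prod (β := β) hu 0
  have h2 : ∫⁻ z, ‖u z.1 z.2‖ₑ ∂((timeMeasure t₀ t₁).prod (wm n β 0)) = 0 := by
    rw [lintegral_prod _ h1.enorm]
    refine (setLIntegral_congr_fun measurableSet_Ioo (g := fun _ => 0) fun t ht => ?_).trans (by simp)
    rw [lintegral_eq_zero_of_ae_eq_zero]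
    filter_upwards [ae_eq_wm.mpr (h0 t ht)] with x hx
    simp [hx]
  rw [lintegral_eq_zero_iff' h1.enorm] at h2
  filter_upwards [h2] with z hz
  simpa using hz

theorem neg_sq_mem_Ico {R R₀ : ℝ} (hR : R ∈ Ioc 0 R₀) : -R ^ 2 ∈ Ico (-R₀ ^ 2) 0 := by
  constructor
  · have := pow_le_pow_left₀ hR.1.le hR.2 2
    linarith
  · have := pow_pos hR.1 2
    linarith

theorem neg_sq_mem_Ioo {R R₀ : ℝ} (hR : R ∈ Ioo 0 R₀) : -R ^ 2 ∈ Ioo (-R₀ ^ 2) 0 := by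
  constructor
  · have := pow_lt_pow_left₀ hR.2 hR.1.le two_ne_zero
    linarith
  · have := pow_pos hR.1 2
    linarith

variable {R₀ a : ℝ} {u : ℝ → HornSpace n → ℝ} {V : ℝ → HornSpace n → HornSpace n}
  {w : ℝ → HornSpace n → ℝ}

/-- In the time variable `t = -R²`, the height and the energy of a nonzero solution are, up to the
total mass of the Gaussian, a pair of functions as in `IsFreqPair`. -/
theorem exists_isFreqPair (hm : hornMeasure n N ε η = wm n β 0)
    (hβ' : β = ε * (n - 1) + (N - n) * (1 - η)) (hε : 0 < ε) (hR₀ : 0 < R₀)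
    (ha : a < 1 / (4 * R₀ ^ 2)) (hS : IsHornSolution n N ε η (-R₀ ^ 2) 0 u V w)
    (hI : IntegrableOn (fun z : ℝ × HornSpace n =>
      (u z.1 z.2 ^ 2 + hornInner ε z.2 (V z.1 z.2) (V z.1 z.2) + w z.1 z.2 ^ 2) *
        Real.exp (-a * ‖z.2‖ ^ 2)) (Ioo (-R₀ ^ 2) 0 ×ˢ univ) (hornSpaceTime n N ε η))
    (hne : ¬ (∀ᵐ z ∂((hornSpaceTime n N ε η).restrict (Ioo (-R₀ ^ 2) 0 ×ˢ univ)),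
      u z.1 z.2 = 0)) :
    ∃ D E : ℝ → ℝ, IsFreqPair ε (-R₀ ^ 2) 0 D E ∧ (∃ s ∈ Ioo (-R₀ ^ 2) 0, 0 < D s) ∧
      (∀ R ∈ Ioc 0 R₀, (∃ W, IsHornWeakGrad (u (-R ^ 2)) W) ∧
        Integrable (fun x => u (-R ^ 2) x ^ 2 * backwardKernel n N ε η x (-R ^ 2))
          (hornMeasure n N ε η) ∧
        Integrable (fun x => hornGradSq ε (u (-R ^ 2)) x * backwardKernel n N ε η x (-R ^ 2))
          (hornMeasure n N ε η) ∧
        freqD n N ε η u R = (kernMass n β)⁻¹ * D (-R ^ 2)) ∧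
      ∀ R ∈ Ioo 0 R₀, freqI n N ε η u R = R ^ 2 * ((kernMass n β)⁻¹ * E (-R ^ 2)) := by
  have hG₀ : gaussCoeff 0 (-R₀ ^ 2) = 1 / (4 * R₀ ^ 2) := by rw [gaussCoeff, zero_sub, neg_neg]
  obtain ⟨b, hb1, hb2⟩ := exists_between
    (max_lt ha (by positivity) : max a 0 < 1 / (4 * R₀ ^ 2))
  have hb0 : 0 < b := (le_max_right _ _).trans_lt hb1
  have hab : a < b := (le_max_left _ _).trans_lt hb1
  rw [← hG₀] at hb2
  have ht : -R₀ ^ 2 < 0 := by linarith [pow_pos hR₀ 2]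
  obtain ⟨f, F, g, hf, hfu⟩ := exists_isRegSol hm hS ht hI hab hb0
  obtain ⟨F₀, hF₀⟩ := hf.exists_mem_Gam ht
  have hbt : ∀ t ∈ Ico (-R₀ ^ 2) 0, b < gaussCoeff 0 t := fun t ht' =>
    lt_gaussCoeff hb2 ht'.1 ht'.2
  have hker : ∀ (R : ℝ) x, backwardKernel n N ε η x (-R ^ 2) = kern n β (R ^ 2) x :=
    fun R x => by rw [backwardKernel, neg_neg, tipHeatKernel_eq_kern hm hβ']
  have hfin : ∀ t ∈ Ico (-R₀ ^ 2) 0, u t =ᵐ[volume] f t := fun t ht' =>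
    (hfu t (Ico_subset_Icc_self ht')).symm
  refine ⟨_, _, hf.isFreqPair hε hb2, ?_, fun R hR => ?_, fun R hR => ?_⟩
  · by_contra! hcon
    refine hne (ae_eq_zero_of_slices hm hS.locInt fun t ht' => ?_)
    have hbt' := hbt t (Ioo_subset_Ico_self ht')
    have h1 : gaussSq b 0 f t ≤ 0 := by
      have h2 : 0 < (0 - t) ^ (-hdim n β / 2) := Real.rpow_pos_of_pos (by linarith [ht'.2]) _
      exact nonpos_of_mul_nonpos_right (hcon t ht') h2
    rw [gaussSq_eq f hbt'] at h1
    have h3 : incl ℝ hbt'.le (f t) = 0 := by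
      rw [← norm_eq_zero]
      nlinarith [norm_nonneg (incl ℝ hbt'.le (f t))]
    have h4 : f t = 0 := incl_injective hbt'.le (by rw [h3, map_zero])
    refine (hfin t (Ioo_subset_Ico_self ht')).trans ?_
    rw [h4]
    exact ae_eq_wm.mp (Lp.coeFn_zero _ _ _)
  · have ht' := neg_sq_mem_Ico hR
    have hbt' := hbt _ ht'
    -- the weak gradient at the initial time has to be added to `F`
    obtain ⟨G, hG⟩ : ∃ G, (f (-R ^ 2), G) ∈ Gam n β ε b := by
      rcases eq_or_lt_of_le ht'.1 with h | h
      · rw [← h]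
        exact ⟨F₀, hF₀⟩
      · exact ⟨_, hf.mem_Gam _ ⟨h, ht'.2⟩⟩
    have hu := hfin _ ht'
    have h1 := integrable_and_integral_mul_kern f hbt'
      (h := fun x => u (-R ^ 2) x ^ 2) (by
        filter_upwards [hu] with x hx
        rw [hx, real_inner_self_eq_norm_sq, Real.norm_eq_abs, sq_abs])
    have h2 := integrable_and_integral_mul_kern (fun _ => G) hbt'
      (hornGradSq_ae_eq hG hu.symm)
    refine ⟨⟨_, (isHornWeakGrad_of_mem_Gam hG).congr hu.symm⟩, ?_, ?_, ?_⟩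
    · simpa only [hker, hm] using h1.1
    · simpa only [hker, hm] using h2.1
    · simp only [freqD, hker, hm, h1.2, zero_sub, neg_neg]
  · have ht' := neg_sq_mem_Ioo hR
    have h2 := integrable_and_integral_mul_kern F (hbt _ (Ioo_subset_Ico_self ht'))
      (hornGradSq_ae_eq (hf.mem_Gam _ ht') (hfin _ (Ioo_subset_Ico_self ht')).symm)
    simp only [freqI, hker, hm, h2.2, zero_sub, neg_neg]

/-- The constant in front of an exponential can be made equal to the one in the exponent. -/
theorem exists_mul_exp_le {c C x₀ : ℝ} (hc : 0 < c) (hC : 0 < C) (hx₀ : 0 < x₀) :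
    ∃ C', 0 < C' ∧ ∀ x, x₀ ≤ x → C' * Real.exp (-C' * x) ≤ c * Real.exp (-C * x) := by
  have h1 := Real.tendsto_pow_mul_exp_neg_atTop_nhds_zero 1
  have h2 : Tendsto (fun k : ℝ => k * x₀) atTop atTop := tendsto_id.atTop_mul_const hx₀
  have h3 := (h1.comp h2).eventually (gt_mem_nhds (show 0 < c * x₀ / 2 by positivity))
  obtain ⟨k, hk, hkC⟩ := (h3.and (eventually_ge_atTop C)).exists
  simp only [Function.comp, pow_one] at hk
  have hk0 : 0 < k := hC.trans_le hkC
  refine ⟨C + k, by positivity, fun x hx => ?_⟩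
  have e : -(C + k) * x = -(k * x) + -C * x := by ring
  rw [e, Real.exp_add, ← mul_assoc]
  refine mul_le_mul_of_nonneg_right ?_ (Real.exp_pos _).le
  have h5 : Real.exp (-(k * x)) ≤ Real.exp (-(k * x₀)) :=
    Real.exp_le_exp.mpr (neg_le_neg (mul_le_mul_of_nonneg_left hx hk0.le))
  have h6 : k * Real.exp (-(k * x₀)) ≤ c / 2 := by
    have : (k * Real.exp (-(k * x₀))) * x₀ < c / 2 * x₀ := by linarith
    exact (lt_of_mul_lt_mul_right this hx₀.le).le
  calc (C + k) * Real.exp (-(k * x)) ≤ (2 * k) * Real.exp (-(k * x₀)) := by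
        gcongr
        linarith
    _ ≤ c := by linarith

theorem sq_rpow_neg {R : ℝ} (hR : 0 < R) (ε : ℝ) : (R ^ 2) ^ (-ε) = R ^ (-(2 * ε)) := by
  rw [← Real.rpow_natCast R 2, ← Real.rpow_mul hR.le]
  congr 1
  push_cast
  ring

end

end Horn

end

theorem mainTheorem5 (n : ℕ) (N ε η : ℝ) (hn : 2 ≤ n) (hN : (n : ℝ) ≤ N) (hε : 0 < ε)
    (hη : η ≤ 1) :
    -- the kernel in the frequency is the heat kernel with pole at the tip
    IsTipHeatKernel n N ε η (tipHeatKernel n N ε η) ∧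
    ∀ (R₀ a : ℝ), 0 < R₀ → a < 1 / (4 * R₀ ^ 2) →
    ∀ (u : ℝ → HornSpace n → ℝ) (V : ℝ → HornSpace n → HornSpace n) (w : ℝ → HornSpace n → ℝ),
    -- a solution on `X × [-R₀², 0]` of less than the critical Gaussian growth, not zero
    IsHornSolution n N ε η (-R₀ ^ 2) 0 u V w →
    IntegrableOn (fun z : ℝ × HornSpace n =>
      (u z.1 z.2 ^ 2 + hornInner ε z.2 (V z.1 z.2) (V z.1 z.2) + w z.1 z.2 ^ 2) *
        Real.exp (-a * ‖z.2‖ ^ 2)) (Ioo (-R₀ ^ 2) 0 ×ˢ univ) (hornSpaceTime n N ε η) →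
    ¬ (∀ᵐ z ∂((hornSpaceTime n N ε η).restrict (Ioo (-R₀ ^ 2) 0 ×ˢ univ)), u z.1 z.2 = 0) →
    -- the integrals defining `D` and `I` converge, and `D > 0`
    (∀ R ∈ Ioc 0 R₀,
      (∃ W, IsHornWeakGrad (u (-R ^ 2)) W) ∧
      Integrable (fun x => u (-R ^ 2) x ^ 2 * backwardKernel n N ε η x (-R ^ 2))
        (hornMeasure n N ε η) ∧
      Integrable (fun x => hornGradSq ε (u (-R ^ 2)) x * backwardKernel n N ε η x (-R ^ 2))
        (hornMeasure n N ε η) ∧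
      0 < freqD n N ε η u R) ∧
    -- `(log N)'(R) ≥ -2ε / R` wherever `N(R) > 0`
    (∀ R ∈ Ioo 0 R₀, DifferentiableAt ℝ (freqN n N ε η u) R ∧
      (0 < freqN n N ε η u R →
        ∃ l : ℝ, HasDerivAt (fun s => Real.log (freqN n N ε η u s)) l R ∧ -(2 * ε) / R ≤ l)) ∧
    -- `N(R) ≤ C R^{-2ε}`
    (∃ C : ℝ, 0 < C ∧ ∀ R ∈ Ioc 0 R₀, freqN n N ε η u R ≤ C * R ^ (-(2 * ε))) ∧
    -- `D(R) ≥ C e^{-C R^{-2ε}}`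
    (∃ C : ℝ, 0 < C ∧ ∀ R ∈ Ioc 0 R₀,
      C * Real.exp (-C * R ^ (-(2 * ε))) ≤ freqD n N ε η u R) := by
  have hn1 : (1 : ℝ) < n := by exact_mod_cast hn
  obtain ⟨β, hβ'⟩ : ∃ β, β = ε * (n - 1) + (N - n) * (1 - η) := ⟨_, rfl⟩
  have hβ : 0 < β := by
    rw [hβ']
    have h1 : 0 < ε * ((n : ℝ) - 1) := mul_pos hε (by linarith)
    have h2 : 0 ≤ (N - n) * (1 - η) := mul_nonneg (by linarith) (by linarith)
    linarith
  have : Fact (2 ≤ n) := ⟨hn⟩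
  have : Fact (0 < β) := ⟨hβ⟩
  have hm : hornMeasure n N ε η = Horn.wm n β 0 := Horn.hornMeasure_eq_wm hβ'
  refine ⟨Horn.tipHeatKernel_eq_kern hm hβ' ▸ Horn.isTipHeatKernel_kern hm, ?_⟩
  intro R₀ a hR₀ ha u V w hS hI hne
  obtain ⟨D, E, hDE, ⟨s, hs, hDs⟩, hD, hE⟩ :=
    Horn.exists_isFreqPair hm hβ' hε hR₀ ha hS hI hne
  have hk : 0 < (Horn.kernMass n β)⁻¹ := inv_pos.mpr Horn.kernMass_pos
  have hpos : ∀ t ∈ Ico (-R₀ ^ 2) 0, 0 < D t := fun t ht => hDE.height_pos hε hs hDs ht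
  have hfreq : ∀ R ∈ Ioo 0 R₀, freqN n N ε η u R =
      (0 - -R ^ 2) * E (-R ^ 2) / (D (-R ^ 2) + 0) := fun R hR => by
    rw [freqN, hE R hR, (hD R (Ioo_subset_Ioc_self hR)).2.2.2, mul_left_comm,
      mul_div_mul_left _ _ hk.ne', zero_sub, neg_neg, add_zero]
  refine ⟨fun R hR => ?_, fun R hR => ?_, ?_, ?_⟩
  · obtain ⟨h1, h2, h3, h4⟩ := hD R hR
    exact ⟨h1, h2, h3, h4 ▸ mul_pos hk (hpos _ (Horn.neg_sq_mem_Ico hR))⟩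
  · have ht := Horn.neg_sq_mem_Ioo hR
    have hDR := hpos _ (Ioo_subset_Ico_self ht)
    obtain ⟨e, he, hle⟩ := hDE.exists_deriv ht le_rfl (by rwa [add_zero])
    have h1 : HasDerivAt (fun s : ℝ => -s ^ 2) (-(2 * R)) R := by
      simpa using (hasDerivAt_pow 2 R).fun_neg
    have h2 : HasDerivAt (freqN n N ε η u) (e * -(2 * R)) R :=
      (HasDerivAt.comp R (h := fun s : ℝ => -s ^ 2) he h1).congr_of_eventuallyEq (by
        filter_upwards [Ioo_mem_nhds hR.1 hR.2] with r hr using hfreq r hr)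
    refine ⟨h2.differentiableAt, fun hpR => ⟨_, h2.log hpR.ne', ?_⟩⟩
    -- the derivative in `t` of the frequency is at most `ε / R²` times the frequency
    have h3 : e ≤ ε / R ^ 2 * freqN n N ε η u R := by
      refine hle.trans_eq ?_
      rw [hfreq R hR]
      have := hR.1.ne'
      field_simp
      ring
    rw [le_div_iff₀ hpR]
    have h4 := mul_le_mul_of_nonneg_right h3 (by linarith [hR.1] : 0 ≤ 2 * R)
    have h5 : ε / R ^ 2 * freqN n N ε η u R * (2 * R) =
        2 * ε / R * freqN n N ε η u R := by
      have := hR.1.ne'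
      field_simp
    rw [h5] at h4
    have h6 : -(2 * ε) / R * freqN n N ε η u R = -(2 * ε / R * freqN n N ε η u R) := by ring
    rw [h6]
    linarith
  · obtain ⟨C, hC, hCle⟩ := hDE.exists_freq_le hε hs hDs
    have hp : 0 < R₀ ^ (-(2 * ε)) := Real.rpow_pos_of_pos hR₀ _
    refine ⟨C + |freqN n N ε η u R₀| / R₀ ^ (-(2 * ε)), by positivity, fun R hR => ?_⟩
    rcases eq_or_lt_of_le hR.2 with h | h
    · rw [h, add_mul, div_mul_cancel₀ _ hp.ne']
      have := le_abs_self (freqN n N ε η u R₀)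
      have : 0 ≤ C * R₀ ^ (-(2 * ε)) := by positivity
      linarith
    · have h1 := hCle _ (Horn.neg_sq_mem_Ioo ⟨hR.1, h⟩)
      have hpR : 0 < R ^ (-(2 * ε)) := Real.rpow_pos_of_pos hR.1 _
      rw [hfreq R ⟨hR.1, h⟩, add_zero]
      refine h1.trans ?_
      rw [zero_sub, neg_neg, Horn.sq_rpow_neg hR.1]
      gcongr
      exact le_add_of_nonneg_right (by positivity)
  · obtain ⟨c, C, hc, hC, hle⟩ := hDE.exists_le_height hε hs hDs
    obtain ⟨C', hC', hle'⟩ := Horn.exists_mul_exp_le (mul_pos hk hc) hC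
      (Real.rpow_pos_of_pos hR₀ (-(2 * ε)))
    refine ⟨C', hC', fun R hR => (hle' _ ?_).trans ?_⟩
    · exact Real.rpow_le_rpow_of_nonpos hR.1 hR.2 (by linarith)
    · rw [(hD R hR).2.2.2, mul_assoc]
      refine mul_le_mul_of_nonneg_left ?_ hk.le
      have h1 := hle _ (Horn.neg_sq_mem_Ico hR)
      rwa [zero_sub, neg_neg, Horn.sq_rpow_neg hR.1] at h1
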